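/- \textbf{Conventions.} A \emph{complex} $\mathcal{C}$ in $\mathbb{R}^d$ is a finite abstract simplicial complex whose vertices are points of $\mathbb{R}^d$, such that the vertex set of every simplex $\Delta$ is affinely independent and any two simplices $\Delta,\Psi$ with a common vertex satisfy $\mathrm{rel}(\Delta)\cap\mathrm{rel}(\Psi)=\mathrm{rel}(\Delta\cap\Psi)$, where $\mathrm{rel}(\Delta)$ is the convex hull of $\Delta$ (simplices without a common vertex may intersect). $|\mathcal{C}|$ is the number of (nonempty) simplices. Two simplices are \emph{adjacent} if one is a face of the other. A \emph{simplicial path} is a map $\varphi$ from $[0,1]$ to the simplices of $\mathcal{C}$ such that each $\varphi^{-1}(\Delta)$ is a finite union of open intervals and points, and such that whenever $\varphi$ takes exactly two values on an interval $[x,y]$, these two simplices are adjacent. A \emph{curve in} $\mathcal{C}$ is a continuous $\pi:[0,1]\to\mathbb{R}^d$ for which there is a simplicial path $\varphi$ such that, for all $t$, $\pi(t)$ lies in $\mathrm{rel}(\varphi(t))$ but in no proper face of it. A \emph{reparameterization} is a continuous map $\rho:[0,1]\to[0,1]$ with $\rho(0)=0$, $\rho(1)=1$. A \emph{cell} of $\mathcal{C}_1\times\dots\times\mathcal{C}_k$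 is a product $\mathrm{rel}(\Delta_1)\times\dots\times\mathrm{rel}(\Delta_k)\subseteq\mathbb{R}^{kd}$ with $\Delta_i\in\mathcal{C}_i$. \textbf{Model.} Time is counted on a real RAM (unit-cost addition, subtraction and comparison of integers, unit-cost arithmetic and comparison of reals, indirect addressing, subroutine calls). The complexes are given combinatorially: the simplices of each $\mathcal{C}_i$ are numbered, and for each simplex the list of its proper faces is given, together with the numbers of the start and end vertices. The function $f$ is given by an oracle which, for any cell, returns in unit time a point of the cell at which $f$ attains its minimum over the cell, and the value of $f$ there; in particular these minima are assumed to exist. \textbf{Theorem.} There is a single program with the following property. Let $k\ge 1$ and $d\ge 0$. Let $\mathcal{C}_1,\dots,\mathcal{C}_k$ be complexes in $\mathbb{R}^d$, let $n=\max_i|\mathcal{C}_i|$, let $s_i,t_i$ be vertices of $\mathcal{C}_i$ in the same connected component of $\mathcal{C}_i$ for $i=1,\dots,k$ (for instance, let every $\mathcal{C}_i$ be connected), and let $f$ be a real function that is convex on every cell of $\mathcal{C}_1\times\dots\times\mathcal{C}_k$ and attains its minimum on every cell. Then, given this input in the above form, the program halts after at most $K n^k$ steps, where $K$ depends only on $k$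 and $d$, and outputs (as lists of breakpoints) polygonal curves $\pi_1,\dots,\pi_k$, where $\pi_i$ is a curve in $\mathcal{C}_i$ from $s_i$ to $t_i$, and injective piecewise linear reparameterizations $\rho_1,\dots,\rho_k$, such that the maximum \[ M=\max_{u\in[0,1]} f\bigl(\pi_1(\rho_1(u)),\dots,\pi_k(\rho_k(u))\bigr) \] exists and is smallest possible: for all curves $\pi'_i$ in $\mathcal{C}_i$ from $s_i$ to $t_i$ and all (not necessarily injective) reparameterizations $\rho'_i$, $i=1,\dots,k$, there is a $u\in[0,1]$ with $f\bigl(\pi'_1(\rho'_1(u)),\dots,\pi'_k(\rho'_k(u))\bigr)\ge M$. -/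

import Mathlib

/-! ## Complexes and curves in complexes -/

/-- The ambient space `ℝ^d`. -/
abbrev Pt (d : ℕ) : Type := EuclideanSpace ℝ (Fin d)

/-- The realization of a simplex: the convex hull of its vertices. -/
def realize {d : ℕ} (Δ : Finset (Pt d)) : Set (Pt d) := convexHull ℝ (Δ : Set (Pt d))

/-- A finite simplicial complex with vertices in `ℝ^d`, together with its realization: an abstract
simplicial complex (a downward closed family of nonempty finite sets of points) such that every
simplex is affinely independent, and two simplices that share a vertex meet exactly in the
realization of their common face. Simplices without a common vertex may intersect, so that a
self-intersecting polygonal curve is a complex. -/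
structure GeoComplex (d : ℕ) extends PreAbstractSimplicialComplex (Pt d) where
  finite_faces : faces.Finite
  affineIndependent : ∀ Δ ∈ faces, AffineIndependent ℝ ((↑) : Δ → Pt d)
  locally_consistent : ∀ Δ ∈ faces, ∀ Ψ ∈ faces, ((Δ : Set (Pt d)) ∩ Ψ).Nonempty →
    realize Δ ∩ realize Ψ = convexHull ℝ ((Δ : Set (Pt d)) ∩ Ψ)

/-- Two simplices are adjacent if one of them is a face of the other. -/
def SimplexAdj {d : ℕ} (Δ Ψ : Finset (Pt d)) : Prop := Δ ⊆ Ψ ∨ Ψ ⊆ Δ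

namespace GeoComplex

variable {d : ℕ}

/-- The number `|C|` of simplices of the complex. -/
noncomputable def size (C : GeoComplex d) : ℕ := C.faces.ncard

/-- The point `p` is a vertex of the complex. -/
def IsVertex (C : GeoComplex d) (p : Pt d) : Prop := {p} ∈ C.faces

/-- The points `p` and `q` are vertices in the same connected component of `C`: they are joined by
a chain of simplices of `C` in which consecutive simplices are adjacent. -/
def SameComponent (C : GeoComplex d) (p q : Pt d) : Prop :=
  Relation.ReflTransGen (fun Δ Ψ => Δ ∈ C.faces ∧ Ψ ∈ C.faces ∧ SimplexAdj Δ Ψ) {p} {q}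

/-- A simplicial path: a map `φ` from `[0,1]` to the simplices such that each `φ⁻¹(Δ)` is a finite
union of open intervals and points, and such that, if `φ` takes exactly two values on some
`[x,y]`, then these two simplices are adjacent. -/
structure IsSimplicialPath (C : GeoComplex d) (φ : unitInterval → Finset (Pt d)) : Prop where
  mem : ∀ t, φ t ∈ C.faces
  finite_union : ∀ Δ ∈ C.faces,
    ∃ (S : Finset (unitInterval × unitInterval)) (Q : Finset unitInterval),
      φ ⁻¹' {Δ} = (⋃ p ∈ S, Set.Ioo p.1 p.2) ∪ Q
  adj : ∀ x y : unitInterval, x ≤ y → ∀ Δ Ψ : Finset (Pt d), Δ ≠ Ψ →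
    φ '' Set.Icc x y = {Δ, Ψ} → SimplexAdj Δ Ψ

/-- The curve `γ` is a realization of the simplicial path `φ`: at every time `t` the point `γ t`
lies in `φ t`, and in no proper face of `φ t`. -/
structure Realizes (C : GeoComplex d) (γ : unitInterval → Pt d)
    (φ : unitInterval → Finset (Pt d)) : Prop where
  isSimplicialPath : C.IsSimplicialPath φ
  mem : ∀ t, γ t ∈ realize (φ t)
  lowest : ∀ t, ∀ Ψ ∈ C.faces, Ψ ⊂ φ t → γ t ∉ realize Ψ

/-- The (continuous) curve `γ` is a curve in the complex `C`. -/
def HasCurve (C : GeoComplex d) {p q : Pt d} (γ : Path p q) : Prop := ∃ φ, C.Realizes γ φ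

end GeoComplex

/-- A choice of one simplex from each complex is a cell of the product complex. -/
def IsProductCell {k d : ℕ} (C : Fin k → GeoComplex d) (Δ : Fin k → Finset (Pt d)) : Prop :=
  ∀ i, Δ i ∈ (C i).faces

/-- The realization of a product cell, a subset of `(ℝ^d)^k`. -/
def realizeCell {k d : ℕ} (Δ : Fin k → Finset (Pt d)) : Set (Fin k → Pt d) :=
  Set.univ.pi fun i => realize (Δ i)

/-- The curve `γ` is polygonal with the vertices `q 0, …, q m` at the times `0, 1/m, …, 1`, and
linear in between. -/
def IsPolygonal {V : Type*} [AddCommGroup V] [Module ℝ V]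
    (γ : unitInterval → V) (m : ℕ) (q : ℕ → V) : Prop :=
  0 < m ∧ ∀ j < m, ∀ t : unitInterval, (j : ℝ) ≤ m * t → m * (t : ℝ) ≤ j + 1 →
    γ t = AffineMap.lineMap (q j) (q (j + 1)) (m * (t : ℝ) - j)

/-! ## The machine: a real RAM with an oracle

A program is a finite list of commands that may call one another. The memory holds integer
variables, integer arrays and real arrays; every elementary operation (addition and subtraction of
integers, field operations on reals, comparison, indirect access to an array cell, constants,
assignment, branching, call) and every oracle call costs one time unit. -/

/-- The contents of the memory. -/
structure Mem where
  /-- integer variables -/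
  var : ℕ → ℕ
  /-- `arr A i` is the `i`-th entry of the integer array `A` -/
  arr : ℕ → ℕ → ℕ
  /-- `real R i` is the `i`-th entry of the real array `R` -/
  real : ℕ → ℕ → ℝ

/-- Integer expressions; `sub` is truncated subtraction and `get A e` is array access. -/
inductive IExp where
  | const (c : ℕ)
  | var (x : ℕ)
  | get (A : ℕ) (e : IExp)
  | add (e₁ e₂ : IExp)
  | sub (e₁ e₂ : IExp)

def IExp.eval (μ : Mem) : IExp → ℕ
  | const c => c
  | var x => μ.var x
  | get A e => μ.arr A (e.eval μ)
  | add e₁ e₂ => e₁.eval μ + e₂.eval μ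
  | sub e₁ e₂ => e₁.eval μ - e₂.eval μ

/-- The number of operations in the expression. -/
def IExp.cost : IExp → ℕ
  | const _ => 1
  | var _ => 1
  | get _ e => e.cost + 1
  | add e₁ e₂ => e₁.cost + e₂.cost + 1
  | sub e₁ e₂ => e₁.cost + e₂.cost + 1

/-- Real expressions. -/
inductive RExp where
  | const (c : ℚ)
  | get (R : ℕ) (e : IExp)
  | add (e₁ e₂ : RExp)
  | sub (e₁ e₂ : RExp)
  | mul (e₁ e₂ : RExp)
  | div (e₁ e₂ : RExp)

noncomputable def RExp.eval (μ : Mem) : RExp → ℝ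
  | const c => (c : ℝ)
  | get R e => μ.real R (e.eval μ)
  | add e₁ e₂ => e₁.eval μ + e₂.eval μ
  | sub e₁ e₂ => e₁.eval μ - e₂.eval μ
  | mul e₁ e₂ => e₁.eval μ * e₂.eval μ
  | div e₁ e₂ => e₁.eval μ / e₂.eval μ

/-- The number of operations in the expression. -/
def RExp.cost : RExp → ℕ
  | const _ => 1
  | get _ e => e.cost + 1
  | add e₁ e₂ => e₁.cost + e₂.cost + 1
  | sub e₁ e₂ => e₁.cost + e₂.cost + 1
  | mul e₁ e₂ => e₁.cost + e₂.cost + 1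
  | div e₁ e₂ => e₁.cost + e₂.cost + 1

/-- Tests: comparisons of integers or of reals, and their Boolean combinations. -/
inductive Test where
  | le (e₁ e₂ : IExp)
  | rle (e₁ e₂ : RExp)
  | neg (b : Test)
  | both (b₁ b₂ : Test)

def Test.Holds (μ : Mem) : Test → Prop
  | le e₁ e₂ => e₁.eval μ ≤ e₂.eval μ
  | rle e₁ e₂ => e₁.eval μ ≤ e₂.eval μ
  | neg b => ¬ b.Holds μ
  | both b₁ b₂ => b₁.Holds μ ∧ b₂.Holds μ

/-- The number of operations in the test. -/
def Test.cost : Test → ℕ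
  | le e₁ e₂ => e₁.cost + e₂.cost + 1
  | rle e₁ e₂ => e₁.cost + e₂.cost + 1
  | neg b => b.cost + 1
  | both b₁ b₂ => b₁.cost + b₂.cost + 1

/-- Commands. `query A R` hands the integer array `A` to the oracle and receives its answer in the
real array `R`; `call p` runs the `p`-th command of the program. -/
inductive Cmd where
  | skip
  | setVar (x : ℕ) (e : IExp)
  | setArr (A : ℕ) (i e : IExp)
  | setReal (R : ℕ) (i : IExp) (e : RExp)
  | query (A R : ℕ)
  | seq (c₁ c₂ : Cmd)
  | ite (b : Test) (c₁ c₂ : Cmd)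
  | loop (b : Test) (c : Cmd)
  | call (p : ℕ)

/-- A program: a finite list of commands, of which the first one is the main command. -/
abbrev Program : Type := List Cmd

/-- An oracle maps the contents of an integer array to the contents of a real array. -/
abbrev Oracle : Type := (ℕ → ℕ) → ℕ → ℝ

open Function in
/-- `Exec P O c μ μ' T`: the command `c`, started with the memory `μ`, halts after `T` steps with
the memory `μ'`; here `P` is the program that resolves calls, and `O` answers the queries. -/
inductive Exec (P : Program) (O : Oracle) : Cmd → Mem → Mem → ℕ → Prop
  | skip (μ : Mem) : Exec P O .skip μ μ 1
  | setVar (μ : Mem) (x : ℕ) (e : IExp) :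
      Exec P O (.setVar x e) μ { μ with var := update μ.var x (e.eval μ) } (e.cost + 1)
  | setArr (μ : Mem) (A : ℕ) (i e : IExp) :
      Exec P O (.setArr A i e) μ
        { μ with arr := update μ.arr A (update (μ.arr A) (i.eval μ) (e.eval μ)) }
        (i.cost + e.cost + 1)
  | setReal (μ : Mem) (R : ℕ) (i : IExp) (e : RExp) :
      Exec P O (.setReal R i e) μ
        { μ with real := update μ.real R (update (μ.real R) (i.eval μ) (e.eval μ)) }
        (i.cost + e.cost + 1)
  | query (μ : Mem) (A R : ℕ) :
      Exec P O (.query A R) μ { μ with real := update μ.real R (O (μ.arr A)) } 1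
  | seq {c₁ c₂ : Cmd} {μ₁ μ₂ μ₃ : Mem} {T₁ T₂ : ℕ} :
      Exec P O c₁ μ₁ μ₂ T₁ → Exec P O c₂ μ₂ μ₃ T₂ → Exec P O (.seq c₁ c₂) μ₁ μ₃ (T₁ + T₂)
  | ite_true {b : Test} {c₁ c₂ : Cmd} {μ μ' : Mem} {T : ℕ} :
      b.Holds μ → Exec P O c₁ μ μ' T → Exec P O (.ite b c₁ c₂) μ μ' (b.cost + T)
  | ite_false {b : Test} {c₁ c₂ : Cmd} {μ μ' : Mem} {T : ℕ} :
      ¬ b.Holds μ → Exec P O c₂ μ μ' T → Exec P O (.ite b c₁ c₂) μ μ' (b.cost + T)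
  | loop_done {b : Test} {c : Cmd} {μ : Mem} :
      ¬ b.Holds μ → Exec P O (.loop b c) μ μ b.cost
  | loop_step {b : Test} {c : Cmd} {μ₁ μ₂ μ₃ : Mem} {T₁ T₂ : ℕ} :
      b.Holds μ₁ → Exec P O c μ₁ μ₂ T₁ → Exec P O (.loop b c) μ₂ μ₃ T₂ →
        Exec P O (.loop b c) μ₁ μ₃ (b.cost + T₁ + T₂)
  | call {p : ℕ} {μ μ' : Mem} {T : ℕ} :
      Exec P O (P.getD p .skip) μ μ' T → Exec P O (.call p) μ μ' (T + 1)

/-- The program `P` with the oracle `O`, started with the memory `μ`, halts after `T` steps with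
the memory `μ'`. -/
def Program.Runs (P : Program) (O : Oracle) (μ μ' : Mem) (T : ℕ) : Prop :=
  Exec P O (P.getD 0 .skip) μ μ' T

/-! ## Input and output -/

/-- `num a`, for `a < |C|`, lists the simplices of `C` without repetition. -/
def IsNumbering {d : ℕ} (C : GeoComplex d) (num : ℕ → Finset (Pt d)) : Prop :=
  Set.BijOn num (Set.Iio C.size) C.faces

/-- The memory `μ` holds the combinatorial description of the complexes `C i`, whose simplices are
numbered by `num i`, and of the start vertices `s i` and end vertices `t i`:
* the variables `0` and `1` hold `k` and `d`;
* the entries `i < k` of the arrays `0`, `1` and `2` hold the number of simplices of `C i` and the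
  numbers of the vertices `s i` and `t i`;
* the proper faces of the simplex number `a` of `C i` are given, without repetition, by a list of
  numbers in array `5`, preceded by its length; array `4` at `h i + a` points to this list, where
  `h i` is the entry `i` of array `3`.

The rest of the memory is arbitrary. -/
structure EncodesInput {k d : ℕ} (C : Fin k → GeoComplex d) (s t : Fin k → Pt d)
    (num : Fin k → ℕ → Finset (Pt d)) (μ : Mem) : Prop where
  var_zero : μ.var 0 = k
  var_one : μ.var 1 = d
  size : ∀ i : Fin k, μ.arr 0 i = (C i).size
  start_lt : ∀ i : Fin k, μ.arr 1 i < (C i).size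
  start : ∀ i : Fin k, num i (μ.arr 1 i) = {s i}
  end_lt : ∀ i : Fin k, μ.arr 2 i < (C i).size
  ends : ∀ i : Fin k, num i (μ.arr 2 i) = {t i}
  faces : ∀ i : Fin k, ∀ a < (C i).size,
    Set.BijOn (fun j => μ.arr 5 (μ.arr 4 (μ.arr 3 i + a) + 1 + j))
      (Set.Iio (μ.arr 5 (μ.arr 4 (μ.arr 3 i + a))))
      {b | b < (C i).size ∧ num i b ⊂ num i a}

/-- The oracle minimizes `f` over cells: given the numbers `a 0, …, a (k - 1)` of one simplex from
each complex, it returns the `k * d` coordinates of a point of the product cell at which `f` is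
minimal over this cell, followed by the value of `f` there. -/
def IsMinOracle {k d : ℕ} (C : Fin k → GeoComplex d) (f : (Fin k → Pt d) → ℝ)
    (num : Fin k → ℕ → Finset (Pt d)) (O : Oracle) : Prop :=
  ∀ a : ℕ → ℕ, (∀ i : Fin k, a i < (C i).size) →
    ∃ x ∈ realizeCell fun i => num i (a i),
      IsMinOn f (realizeCell fun i => num i (a i)) x ∧
      (∀ (i : Fin k) (c : Fin d), O a (i * d + c) = x i c) ∧
      O a (k * d) = f x

/-- The memory `μ` holds the polygonal curves `π i` in `ℝ^d` and the piecewise linear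
reparameterizations `ρ i`: with `m` the value of the variable `0`, the coordinates of the points
`π 0 (j/m), …, π (k-1) (j/m)`, for `j = 0, …, m`, stand consecutively in the real array `0`, and
the values `ρ 0 (j/m), …, ρ (k-1) (j/m)` stand consecutively in the real array `1`. -/
def EncodesOutput {k d : ℕ} {s t : Fin k → Pt d} (μ : Mem) (π : ∀ i, Path (s i) (t i))
    (ρ : Fin k → Path (0 : unitInterval) 1) : Prop :=
  ∀ i : Fin k,
    IsPolygonal (π i) (μ.var 0)
      (fun j => WithLp.toLp 2 fun c : Fin d => μ.real 0 (j * (k * d) + (i * d + c))) ∧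
    IsPolygonal (fun u => (ρ i u : ℝ)) (μ.var 0) (fun j => μ.real 1 (j * k + i))

/-! Curves with reparameterizations describe a point moving through the product of the complexes,
and only the cells that it visits matter. Consider the graph whose nodes are the product cells and
two extra nodes for the points `s` and `t`. A cell is joined to every cell that arises from it by
enlarging one component, and the weight of this arc is the minimum of `f` over the smaller cell. The
extra nodes are joined to all cells containing the point `s` or `t`, with weight `f s` or `f t`. Let
`B` be the bottleneck value of the extra nodes, that is, the least possible maximal weight on a path
between them. Then `B` is the optimum.

Lower bound (`conn_of_curves`). Close to any time a simplicial path visits only cofaces of the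
current simplex (`eventually_subset`), since it is constant on either side, its values are adjacent,
and each simplex carries its point minimally. So the cell at a time `u` is a face of the cells at
nearby times. If `f` stays below `B`, then all cells between these two contain a point of value less
than `B`, and the arcs joining them are lighter than `B` (`conn_of_subset`). The set of times whose
cell is reachable from `s` by such arcs is therefore clopen, hence everything, and `t` is reachable
too, contradicting the choice of `B`.

Upper bound (`exists_curves`). On a path with weights at most `B`, assign to each cell a point where
`f` is minimal. Two consecutive points lie in the larger cell and have values at most the weight of
the arc, so convexity bounds `f` on the segment between them. The resulting polygons are curves in
the complexes, because the interior points of a segment are carried by the union of the carriers of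
its ends (`InRel.lineMap`, `hasCurve_polygonPath`). All polygons are traversed simultaneously, so
identical reparameterizations suffice.

Running time. A simplex has at most `d + 1` vertices, hence boundedly many faces, so the graph has
`O(n ^ k)` arcs and each cell needs constant work. Simplices without a common vertex may cross, so a
curve may start at the point `s i` inside a simplex that does not have `s i` as a vertex; which
cells contain `s` is thus a geometric question. It is settled by orthogonalization of vectors of
vertex coordinates, which the oracle provides (`IsOrtho.mem_realize_iff`).

The bottleneck value is found in linear time by pruning. Let `p` be an approximate median of the
weights (`run_pivot`). If the arcs lighter than `p` join the two nodes, the other arcs are useless.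
If not, but the arcs of weight at most `p` do, then `p` is the answer. Otherwise the components of
the latter arcs are contracted (`conn_contract`), and only the heavier arcs remain. Each
inconclusive round removes a fixed fraction of the arcs, so the costs form a geometric series. A
final search from `t` along arcs of weight at most `B` provides the path. -/

/-! ## Total correctness with time bounds -/

/-- Started with the memory `μ`, the command `c` halts within `t` steps with a memory in `Q`. -/
def Run (P : Program) (O : Oracle) (c : Cmd) (μ : Mem) (t : ℕ) (Q : Mem → Prop) : Prop :=
  ∃ μ' T, Exec P O c μ μ' T ∧ T ≤ t ∧ Q μ'

namespace Cmd

/-- Sequential composition. -/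
infixr:60 " ;; " => Cmd.seq

/-- The integer variables that the command may change. -/
def wv : Cmd → List ℕ
  | setVar x _ => [x]
  | seq c₁ c₂ => c₁.wv ++ c₂.wv
  | ite _ c₁ c₂ => c₁.wv ++ c₂.wv
  | loop _ c => c.wv
  | _ => []

/-- The integer arrays that the command may change. -/
def wa : Cmd → List ℕ
  | setArr A _ _ => [A]
  | seq c₁ c₂ => c₁.wa ++ c₂.wa
  | ite _ c₁ c₂ => c₁.wa ++ c₂.wa
  | loop _ c => c.wa
  | _ => []

/-- The real arrays that the command may change. -/
def wr : Cmd → List ℕ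
  | setReal R _ _ => [R]
  | query _ R => [R]
  | seq c₁ c₂ => c₁.wr ++ c₂.wr
  | ite _ c₁ c₂ => c₁.wr ++ c₂.wr
  | loop _ c => c.wr
  | _ => []

/-- The command contains no calls. -/
def callFree : Cmd → Bool
  | seq c₁ c₂ => c₁.callFree && c₂.callFree
  | ite _ c₁ c₂ => c₁.callFree && c₂.callFree
  | loop _ c => c.callFree
  | call _ => false
  | _ => true

/-- The command contains neither loops nor calls. -/
def simple : Cmd → Bool
  | seq c₁ c₂ => c₁.simple && c₂.simple
  | ite _ c₁ c₂ => c₁.simple && c₂.simple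
  | loop _ _ => false
  | call _ => false
  | _ => true

/-- An upper bound for the running time of a command without loops and calls. -/
def ub : Cmd → ℕ
  | setVar _ e => e.cost + 1
  | setArr _ i e => i.cost + e.cost + 1
  | setReal _ i e => i.cost + e.cost + 1
  | seq c₁ c₂ => c₁.ub + c₂.ub
  | ite b c₁ c₂ => b.cost + max c₁.ub c₂.ub
  | _ => 1

open Function Classical in
/-- The effect of a command without loops and calls. -/
noncomputable def step (O : Oracle) : Cmd → Mem → Mem
  | setVar x e, μ => { μ with var := update μ.var x (e.eval μ) }
  | setArr A i e, μ =>
      { μ with arr := update μ.arr A (update (μ.arr A) (i.eval μ) (e.eval μ)) }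
  | setReal R i e, μ =>
      { μ with real := update μ.real R (update (μ.real R) (i.eval μ) (e.eval μ)) }
  | query A R, μ => { μ with real := update μ.real R (O (μ.arr A)) }
  | seq c₁ c₂, μ => c₂.step O (c₁.step O μ)
  | ite b c₁ c₂, μ => if b.Holds μ then c₁.step O μ else c₂.step O μ
  | _, μ => μ

/-- The memories `μ` and `μ'` agree outside of what the command may change. -/
structure Frame (c : Cmd) (μ μ' : Mem) : Prop where
  var : ∀ x, x ∉ c.wv → μ'.var x = μ.var x
  arr : ∀ A, A ∉ c.wa → μ'.arr A = μ.arr A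
  real : ∀ R, R ∉ c.wr → μ'.real R = μ.real R

end Cmd

theorem Test.cost_pos (b : Test) : 0 < b.cost := by cases b <;> simp [Test.cost]

/-- Each command can only write what it names syntactically, so the lists `wv`, `wa`, `wr` bound the
effect of any run. They are empty for a `call`, which is why calls are excluded. -/
theorem Exec.frame {P : Program} {O : Oracle} {c : Cmd} {μ μ' : Mem} {T : ℕ}
    (h : Exec P O c μ μ' T) (hc : c.callFree = true) : c.Frame μ μ' := by
  induction h with
  | skip => exact ⟨fun _ _ => rfl, fun _ _ => rfl, fun _ _ => rfl⟩
  | setVar μ x e =>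
    exact ⟨fun y hy => Function.update_of_ne (by simpa [Cmd.wv] using hy) _ _, fun _ _ => rfl,
      fun _ _ => rfl⟩
  | setArr μ A i e =>
    exact ⟨fun _ _ => rfl, fun y hy => Function.update_of_ne (by simpa [Cmd.wa] using hy) _ _,
      fun _ _ => rfl⟩
  | setReal μ A i e =>
    exact ⟨fun _ _ => rfl, fun _ _ => rfl,
      fun y hy => Function.update_of_ne (by simpa [Cmd.wr] using hy) _ _⟩
  | query μ A R =>
    exact ⟨fun _ _ => rfl, fun _ _ => rfl,
      fun y hy => Function.update_of_ne (by simpa [Cmd.wr] using hy) _ _⟩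
  | seq _ _ ih₁ ih₂ =>
    simp only [Cmd.callFree, Bool.and_eq_true] at hc
    obtain ⟨a, b, c⟩ := ih₁ hc.1
    obtain ⟨a', b', c'⟩ := ih₂ hc.2
    refine ⟨fun x hx => ?_, fun x hx => ?_, fun x hx => ?_⟩ <;>
      simp only [Cmd.wv, Cmd.wa, Cmd.wr, List.mem_append, not_or] at hx
    · rw [a' x hx.2, a x hx.1]
    · rw [b' x hx.2, b x hx.1]
    · rw [c' x hx.2, c x hx.1]
  | ite_true _ _ ih =>
    simp only [Cmd.callFree, Bool.and_eq_true] at hc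
    obtain ⟨a, b, c⟩ := ih hc.1
    refine ⟨fun x hx => ?_, fun x hx => ?_, fun x hx => ?_⟩ <;>
      simp only [Cmd.wv, Cmd.wa, Cmd.wr, List.mem_append, not_or] at hx
    exacts [a x hx.1, b x hx.1, c x hx.1]
  | ite_false _ _ ih =>
    simp only [Cmd.callFree, Bool.and_eq_true] at hc
    obtain ⟨a, b, c⟩ := ih hc.2
    refine ⟨fun x hx => ?_, fun x hx => ?_, fun x hx => ?_⟩ <;>
      simp only [Cmd.wv, Cmd.wa, Cmd.wr, List.mem_append, not_or] at hx
    exacts [a x hx.2, b x hx.2, c x hx.2]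
  | loop_done => exact ⟨fun _ _ => rfl, fun _ _ => rfl, fun _ _ => rfl⟩
  | loop_step _ _ _ ih₁ ih₂ =>
    obtain ⟨a, b, c⟩ := ih₁ hc
    obtain ⟨a', b', c'⟩ := ih₂ hc
    refine ⟨fun x hx => ?_, fun x hx => ?_, fun x hx => ?_⟩
    · rw [a' x hx, a x hx]
    · rw [b' x hx, b x hx]
    · rw [c' x hx, c x hx]
  | call => simp [Cmd.callFree] at hc

/-- Without loops and calls execution is a total function of the memory. With the definitions of
`step` and `eval` as simplification rules, straight-line code is then verified by `simp`. -/
theorem exec_step {P : Program} {O : Oracle} (c : Cmd) (hc : c.simple = true) (μ : Mem) :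
    ∃ T, Exec P O c μ (c.step O μ) T ∧ T ≤ c.ub := by
  induction c generalizing μ with
  | skip => exact ⟨_, .skip μ, le_rfl⟩
  | setVar => exact ⟨_, .setVar μ _ _, le_rfl⟩
  | setArr => exact ⟨_, .setArr μ _ _ _, le_rfl⟩
  | setReal => exact ⟨_, .setReal μ _ _ _, le_rfl⟩
  | query => exact ⟨_, .query μ _ _, le_rfl⟩
  | seq c₁ c₂ ih₁ ih₂ =>
    simp only [Cmd.simple, Bool.and_eq_true] at hc
    obtain ⟨T₁, h₁, h₁'⟩ := ih₁ hc.1 μ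
    obtain ⟨T₂, h₂, h₂'⟩ := ih₂ hc.2 (c₁.step O μ)
    exact ⟨_, .seq h₁ h₂, add_le_add h₁' h₂'⟩
  | ite b c₁ c₂ ih₁ ih₂ =>
    simp only [Cmd.simple, Bool.and_eq_true] at hc
    by_cases hb : b.Holds μ
    · obtain ⟨T, h, h'⟩ := ih₁ hc.1 μ
      refine ⟨_, by simpa [Cmd.step, hb] using Exec.ite_true hb h, ?_⟩
      exact Nat.add_le_add_left (h'.trans (le_max_left _ _)) _
    · obtain ⟨T, h, h'⟩ := ih₂ hc.2 μ
      refine ⟨_, by simpa [Cmd.step, hb] using Exec.ite_false hb h, ?_⟩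
      exact Nat.add_le_add_left (h'.trans (le_max_right _ _)) _
  | loop => simp [Cmd.simple] at hc
  | call => simp [Cmd.simple] at hc

namespace Run

variable {P : Program} {O : Oracle}

theorem mono {c : Cmd} {μ : Mem} {t t' : ℕ} {Q Q' : Mem → Prop} (h : Run P O c μ t Q)
    (ht : t ≤ t') (hQ : ∀ μ', Q μ' → Q' μ') : Run P O c μ t' Q' := by
  obtain ⟨μ', T, h₁, h₂, h₃⟩ := h
  exact ⟨μ', T, h₁, h₂.trans ht, hQ _ h₃⟩

theorem imp {c : Cmd} {μ : Mem} {t : ℕ} {Q Q' : Mem → Prop} (h : Run P O c μ t Q)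
    (hQ : ∀ μ', Q μ' → Q' μ') : Run P O c μ t Q' := h.mono le_rfl hQ

/-- What a command cannot change is preserved. -/
theorem withFrame {c : Cmd} {μ : Mem} {t : ℕ} {Q Q' : Mem → Prop} (h : Run P O c μ t Q)
    (hc : c.callFree = true) (hQ : ∀ μ', Q μ' → c.Frame μ μ' → Q' μ') : Run P O c μ t Q' := by
  obtain ⟨μ', T, h₁, h₂, h₃⟩ := h
  exact ⟨μ', T, h₁, h₂, hQ _ h₃ (h₁.frame hc)⟩

theorem seq {c₁ c₂ : Cmd} {μ : Mem} {t₁ t₂ : ℕ} {Q Q' : Mem → Prop} (h₁ : Run P O c₁ μ t₁ Q)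
    (h₂ : ∀ μ', Q μ' → Run P O c₂ μ' t₂ Q') : Run P O (c₁ ;; c₂) μ (t₁ + t₂) Q' := by
  obtain ⟨μ₁, T₁, h, h', hQ⟩ := h₁
  obtain ⟨μ₂, T₂, k, k', hQ'⟩ := h₂ _ hQ
  exact ⟨μ₂, _, .seq h k, add_le_add h' k', hQ'⟩

theorem simple {c : Cmd} {μ : Mem} {Q : Mem → Prop} (hc : c.simple = true)
    (hQ : Q (c.step O μ)) : Run P O c μ c.ub Q := by
  obtain ⟨T, h, h'⟩ := exec_step (P := P) (O := O) c hc μ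
  exact ⟨_, T, h, h', hQ⟩

theorem ite {b : Test} {c₁ c₂ : Cmd} {μ : Mem} {t : ℕ} {Q : Mem → Prop}
    (h₁ : b.Holds μ → Run P O c₁ μ t Q) (h₂ : ¬ b.Holds μ → Run P O c₂ μ t Q) :
    Run P O (.ite b c₁ c₂) μ (b.cost + t) Q := by
  by_cases hb : b.Holds μ
  · obtain ⟨μ', T, h, h', hQ⟩ := h₁ hb
    exact ⟨μ', _, .ite_true hb h, Nat.add_le_add_left h' _, hQ⟩
  · obtain ⟨μ', T, h, h', hQ⟩ := h₂ hb
    exact ⟨μ', _, .ite_false hb h, Nat.add_le_add_left h' _, hQ⟩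

/-- A loop whose running time is paid from the credit `n` in the invariant. -/
theorem loop {b : Test} {c : Cmd} (I : ℕ → Mem → Prop)
    (hstep : ∀ n μ, I n μ → b.Holds μ →
      ∃ t, Run P O c μ t fun μ' => ∃ n', I n' μ' ∧ b.cost + t + n' ≤ n)
    {n : ℕ} {μ : Mem} (h : I n μ) :
    Run P O (.loop b c) μ (n + b.cost) fun μ' => (∃ n', I n' μ') ∧ ¬ b.Holds μ' := by
  induction n using Nat.strong_induction_on generalizing μ with
  | _ n ih =>
    by_cases hb : b.Holds μ
    · obtain ⟨t, μ', T, h₁, h₂, n', h₃, h₄⟩ := hstep n μ h hb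
      -- The test alone costs a positive amount, so the credit strictly decreases and the loop
      -- terminates.
      have := b.cost_pos
      obtain ⟨μ'', T', k₁, k₂, k₃⟩ := ih n' (by omega) h₃
      exact ⟨μ'', _, .loop_step hb h₁ k₁, by omega, k₃⟩
    · exact ⟨μ, _, .loop_done hb, by omega, ⟨n, h⟩, hb⟩

/-- A loop with the rounds `i, …, m - 1`. -/
theorem for_range {b : Test} {c : Cmd} (I : ℕ → Mem → Prop) {i m t : ℕ} (him : i ≤ m)
    (hstep : ∀ j μ, i ≤ j → j < m → I j μ → b.Holds μ ∧ Run P O c μ t (I (j + 1)))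
    (hdone : ∀ μ, I m μ → ¬ b.Holds μ) {μ : Mem} (h : I i μ) :
    Run P O (.loop b c) μ ((m - i) * (b.cost + t) + b.cost) (I m) := by
  induction him using Nat.decreasingInduction generalizing μ with
  | self => exact ⟨μ, _, .loop_done (hdone μ h), by omega, h⟩
  | of_succ j hj ih =>
    obtain ⟨hb, μ', T, h₁, h₂, h₃⟩ := hstep j μ le_rfl hj h
    obtain ⟨μ'', T', k₁, k₂, k₃⟩ := ih (fun j' μ h h' => hstep j' μ (by omega) h') h₃
    refine ⟨μ'', _, .loop_step hb h₁ k₁, ?_, k₃⟩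
    obtain ⟨e, rfl⟩ := Nat.exists_eq_add_of_lt hj
    have : j + e + 1 - j = (j + e + 1 - (j + 1)) + 1 := by omega
    rw [this, Nat.add_mul]
    omega

end Run

/-- The successor of an integer expression. -/
abbrev IExp.succ (e : IExp) : IExp := .add e (.const 1)

/-- The test `e₁ < e₂`. -/
abbrev Test.lt (e₁ e₂ : IExp) : Test := .le e₁.succ e₂

/-- The test `e₁ = e₂`. -/
abbrev Test.eq (e₁ e₂ : IExp) : Test := .both (.le e₁ e₂) (.le e₂ e₁)

/-- The test `e₁ < e₂` for reals. -/
abbrev Test.rlt (e₁ e₂ : RExp) : Test := .neg (.rle e₂ e₁)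

attribute [simp] Cmd.step Test.Holds IExp.eval RExp.eval Cmd.ub IExp.cost RExp.cost Test.cost

theorem Run.exact {P : Program} {O : Oracle} {c : Cmd} {μ : Mem} (hc : c.simple = true) :
    Run P O c μ c.ub fun μ' => μ' = c.step O μ :=
  .simple hc rfl

/-! ## An approximate median in linear time -/

open Cmd in
/-- One comparison of `sortCmd`. -/
def sortStep : Cmd :=
  ite (.rlt (.get 6 (.var 33)) (.get 6 (.var 32)))
    (setReal 7 (.const 1) (.get 6 (.var 32)) ;;
     setReal 6 (.var 32) (.get 6 (.var 33)) ;;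
     setReal 6 (.var 33) (.get 7 (.const 1)))
    skip ;;
  setVar 33 (.succ (.var 33))

open Cmd in
/-- Sorts the entries `lo, …, hi - 1` of the real array `6`, where the variables `37` and `39` hold
`lo` and `hi`. -/
def sortCmd : Cmd :=
  setVar 32 (.var 37) ;;
  loop (.lt (.var 32) (.var 39))
    (setVar 33 (.succ (.var 32)) ;;
     loop (.lt (.var 33) (.var 39))
       sortStep ;;
     setVar 32 (.succ (.var 32)))

/-- The function `Z'` arises from `Z` by permuting the arguments in `[lo, hi)`. -/
def IsRearrangement (lo hi : ℕ) (Z Z' : ℕ → ℝ) : Prop :=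
  ∃ σ : Equiv.Perm ℕ, (∀ x, x ∉ Set.Ico lo hi → σ x = x) ∧ Z' = Z ∘ σ

theorem IsRearrangement.refl (lo hi : ℕ) (Z : ℕ → ℝ) : IsRearrangement lo hi Z Z :=
  ⟨1, fun _ _ => rfl, rfl⟩

theorem IsRearrangement.swap {lo hi : ℕ} {Z Z' : ℕ → ℝ} (h : IsRearrangement lo hi Z Z')
    {i j : ℕ} (hi' : i ∈ Set.Ico lo hi) (hj : j ∈ Set.Ico lo hi) :
    IsRearrangement lo hi Z (Function.update (Function.update Z' i (Z' j)) j (Z' i)) := by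
  obtain ⟨σ, h₁, rfl⟩ := h
  refine ⟨σ * Equiv.swap i j, fun x hx => ?_, ?_⟩
  · rw [Equiv.Perm.mul_apply, Equiv.swap_apply_of_ne_of_ne, h₁ x hx]
    · rintro rfl; exact hx hi'
    · rintro rfl; exact hx hj
  · ext x
    simp only [Function.comp, Equiv.Perm.mul_apply, Equiv.swap_apply_def, Function.update_apply]
    split_ifs <;> simp_all

section

variable {P : Program} {O : Oracle}

/-- An exchange sort: round `i` moves the smallest remaining entry to position `i`. Quadratic time
is affordable because the chunks are short compared with the total number of entries. The constant
precedes the quantifier over the oracle, here and in all later bounds. -/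
theorem run_sort : ∃ K, ∀ {O : Oracle}
    (μ : Mem) (lo hi : ℕ), μ.var 37 = lo → μ.var 39 = hi → lo ≤ hi →
    Run P O sortCmd μ (K * (hi - lo + 1) * (hi - lo + 1)) fun μ' =>
      IsRearrangement lo hi (μ.real 6) (μ'.real 6) ∧
      ∀ a b, lo ≤ a → a ≤ b → b < hi → μ'.real 6 a ≤ μ'.real 6 b := by
  refine ⟨100, fun {O} μ lo hi hlo hhi hle => ?_⟩
  -- Exchanging position `i` with a later position keeps earlier entries below all later ones, since
  -- both exchanged values were above them already.
  have inner : ∀ (i : ℕ) (μ₁ : Mem), lo ≤ i → i < hi → μ₁.var 32 = i → μ₁.var 33 = i + 1 →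
      μ₁.var 39 = hi → IsRearrangement lo hi (μ.real 6) (μ₁.real 6) →
      (∀ a b, lo ≤ a → a < i → a ≤ b → b < hi → μ₁.real 6 a ≤ μ₁.real 6 b) →
      Run P O (.loop (.lt (.var 33) (.var 39))
       sortStep) μ₁ (40 * (hi - lo + 1)) fun μ₂ =>
        μ₂.var 32 = i ∧ μ₂.var 39 = hi ∧ IsRearrangement lo hi (μ.real 6) (μ₂.real 6) ∧
        (∀ a b, lo ≤ a → a < i + 1 → a ≤ b → b < hi → μ₂.real 6 a ≤ μ₂.real 6 b) := by
    intro i μ₁ h1 h2 h3 h4 h5 h6 h7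
    refine (Run.for_range (i := i + 1) (m := hi) (t := sortStep.ub) (fun j μ₂ => μ₂.var 32 = i ∧ μ₂.var 33 = j ∧
      μ₂.var 39 = hi ∧ IsRearrangement lo hi (μ.real 6) (μ₂.real 6) ∧
      (∀ a b, lo ≤ a → a < i → a ≤ b → b < hi → μ₂.real 6 a ≤ μ₂.real 6 b) ∧
      ∀ b, i < b → b < j → μ₂.real 6 i ≤ μ₂.real 6 b) h2
      ?_ ?_ ⟨h3, h4, h5, h6, h7, fun b hb hb' => by omega⟩).mono ?_ ?_
    · rintro j μ₂ hj hj' ⟨k1, k2, k3, k4, k5, k6⟩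
      refine ⟨by simp [Test.Holds, IExp.eval, k2, k3]; omega, Run.simple rfl ?_⟩
      simp only [sortStep, Cmd.step, Test.Holds, RExp.eval, IExp.eval, k1, k2]
      by_cases hlt : μ₂.real 6 i ≤ μ₂.real 6 j
      · simp only [hlt, not_true_eq_false, if_false]
        refine ⟨by simp [k1], by simp [k2], by simp [k3], k4, k5, fun b hb hb' => ?_⟩
        rcases Nat.lt_succ_iff_lt_or_eq.1 hb' with h | rfl
        exacts [k6 b hb h, hlt]
      · simp only [hlt, not_false_eq_true, if_true]
        have hij : i ≠ j := by omega
        simp only [Function.update_self, ne_eq, Nat.reduceEqDiff,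
          not_false_eq_true, Function.update_of_ne, k1, k2, k3, true_and]
        refine ⟨k4.swap ⟨h1, by omega⟩ ⟨by omega, hj'⟩, ?_, ?_⟩
        · intro a b ha ha' hab hb
          have e1 : a ≠ i := by omega
          have e2 : a ≠ j := by omega
          rw [Function.update_of_ne e2, Function.update_of_ne e1]
          by_cases hbj : b = j
          · subst hbj; rw [Function.update_self]; exact k5 a i ha ha' ha'.le h2
          · rw [Function.update_of_ne hbj]
            by_cases hbi : b = i
            · subst hbi; rw [Function.update_self]; exact k5 a j ha ha' (by omega) hj'
            · rw [Function.update_of_ne hbi]; exact k5 a b ha ha' hab hb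
        · intro b hb hb'
          rw [Function.update_of_ne hij, Function.update_self]
          by_cases hbj : b = j
          · subst hbj; rw [Function.update_self]; exact (not_le.1 hlt).le
          · rw [Function.update_of_ne hbj, Function.update_of_ne (by omega)]
            exact (not_le.1 hlt).le.trans (k6 b hb (by omega))
    · rintro μ₂ ⟨-, k2, k3, -⟩
      simp [Test.Holds, IExp.eval, k2, k3]
    · simp [sortStep]
      omega
    · rintro μ₂ ⟨k1, k2, k3, k4, k5, k6⟩
      refine ⟨k1, k3, k4, fun a b ha ha' hab hb => ?_⟩
      rcases Nat.lt_succ_iff_lt_or_eq.1 ha' with h | rfl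
      · exact k5 a b ha h hab hb
      · rcases hab.eq_or_lt with rfl | h
        exacts [le_rfl, k6 b h hb]
  refine (Run.seq (Run.simple (Q := fun μ₁ => μ₁.var 32 = lo ∧ μ₁.var 39 = hi ∧
      IsRearrangement lo hi (μ.real 6) (μ₁.real 6) ∧
      (∀ a b, lo ≤ a → a < lo → a ≤ b → b < hi → μ₁.real 6 a ≤ μ₁.real 6 b)) rfl ?_)
    (fun μ₁ h => Run.for_range (i := lo) (m := hi) (t := 40 * (hi - lo + 1) + 20) (fun i μ₁ =>
      μ₁.var 32 = i ∧ μ₁.var 39 = hi ∧ IsRearrangement lo hi (μ.real 6) (μ₁.real 6) ∧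
      (∀ a b, lo ≤ a → a < i → a ≤ b → b < hi → μ₁.real 6 a ≤ μ₁.real 6 b)) hle
      ?_ ?_ h)).mono ?_ ?_
  · simp [Cmd.step, IExp.eval, hlo, hhi, IsRearrangement.refl]
    omega
  · rintro i μ₂ hi1 hi2 ⟨k1, k2, k3, k4⟩
    refine ⟨by simp [Test.Holds, IExp.eval, k1, k2]; omega, ?_⟩
    refine (Run.seq (Run.exact rfl) fun μ₃ h₃ => Run.seq (inner i μ₃ hi1 hi2
      ?_ ?_ ?_ ?_ ?_) fun μ₄ h₄ => Run.simple rfl ?_).mono (t := _) ?_ fun _ => id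
    · simp [h₃, Cmd.step, IExp.eval, k1]
    · simp [h₃, Cmd.step, IExp.eval, k1]
    · simp [h₃, Cmd.step, IExp.eval, k2]
    · simpa [h₃, Cmd.step, IExp.eval] using k3
    · simpa [h₃, Cmd.step, IExp.eval] using k4
    · simpa [Cmd.step, IExp.eval, h₄.1] using h₄.2
    · simp [Cmd.ub, IExp.cost]; omega
  · rintro μ₂ ⟨k1, k2, -⟩
    simp [Test.Holds, IExp.eval, k1, k2]
  · simp only [Cmd.ub, Test.cost, IExp.cost]
    obtain ⟨e, he⟩ : ∃ e, e = hi - lo := ⟨_, rfl⟩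
    rw [← he]
    nlinarith
  · rintro μ₂ ⟨-, -, k3, k4⟩
    exact ⟨k3, fun a b ha hab hb => k4 a b ha (by omega) hab hb⟩

end

/-! ### Counting values in lower sets -/

open Classical in
/-- The number of indices in `[a, b)` at which `Z` has a value in `D`. -/
noncomputable def cntIn (Z : ℕ → ℝ) (D : Set ℝ) (a b : ℕ) : ℕ :=
  ((Finset.Ico a b).filter fun i => Z i ∈ D).card

theorem cntIn_add {Z : ℕ → ℝ} {D : Set ℝ} {a b c : ℕ} (h : a ≤ b) (h' : b ≤ c) :
    cntIn Z D a b + cntIn Z D b c = cntIn Z D a c := by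
  classical
  rw [cntIn, cntIn, cntIn, ← Finset.Ico_union_Ico_eq_Ico h h', Finset.filter_union,
    Finset.card_union_of_disjoint]
  exact Finset.disjoint_filter_filter (Finset.Ico_disjoint_Ico_consecutive _ _ _)

theorem cntIn_le (Z : ℕ → ℝ) (D : Set ℝ) (a b : ℕ) : cntIn Z D a b ≤ b - a := by
  classical
  exact (Finset.card_filter_le _ _).trans (by simp)

theorem cntIn_congr {Z Z' : ℕ → ℝ} {D : Set ℝ} {a b : ℕ} (h : ∀ x, a ≤ x → x < b → Z x = Z' x) :
    cntIn Z D a b = cntIn Z' D a b := by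
  classical
  unfold cntIn
  congr 1
  refine Finset.filter_congr fun x hx => ?_
  rw [h x (Finset.mem_Ico.1 hx).1 (Finset.mem_Ico.1 hx).2]

theorem cntIn_of_forall {Z : ℕ → ℝ} {D : Set ℝ} {a b : ℕ} (h : ∀ x, a ≤ x → x < b → Z x ∈ D) :
    cntIn Z D a b = b - a := by
  classical
  rw [cntIn, Finset.filter_true_of_mem fun x hx => ?_, Nat.card_Ico]
  exact h x (Finset.mem_Ico.1 hx).1 (Finset.mem_Ico.1 hx).2

theorem cntIn_eq_zero {Z : ℕ → ℝ} {D : Set ℝ} {a b : ℕ} (h : ∀ x, a ≤ x → x < b → Z x ∉ D) :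
    cntIn Z D a b = 0 := by
  classical
  rw [cntIn, Finset.filter_false_of_mem fun x hx => ?_, Finset.card_empty]
  exact h x (Finset.mem_Ico.1 hx).1 (Finset.mem_Ico.1 hx).2

theorem IsRearrangement.maps {lo hi : ℕ} {σ : Equiv.Perm ℕ}
    (h : ∀ x, x ∉ Set.Ico lo hi → σ x = x) {x : ℕ} (hx : x ∈ Set.Ico lo hi) :
    σ x ∈ Set.Ico lo hi := by
  by_contra hc
  have := σ.injective (h _ hc)
  rw [this] at hc
  exact hc hx

theorem IsRearrangement.cntIn_eq {lo hi : ℕ} {Z Z' : ℕ → ℝ} (h : IsRearrangement lo hi Z Z')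
    (D : Set ℝ) : cntIn Z' D lo hi = cntIn Z D lo hi := by
  classical
  obtain ⟨σ, h, rfl⟩ := h
  refine Finset.card_bij (fun x _ => σ x) ?_ (fun _ _ _ _ h => σ.injective h) fun y hy => ?_
  · intro x hx
    simp only [Finset.mem_filter, Finset.mem_Ico] at hx ⊢
    exact ⟨IsRearrangement.maps h hx.1, hx.2⟩
  · simp only [Finset.mem_filter, Finset.mem_Ico] at hy
    refine ⟨σ.symm y, ?_, by simp⟩
    have : σ.symm y ∈ Set.Ico lo hi := by
      by_contra hc
      have := h _ hc
      simp only [Equiv.apply_symm_apply] at this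
      rw [← this] at hc
      exact hc hy.1
    simpa using ⟨this, hy.2⟩

/-- Keeping every fourth entry of a sorted sequence. -/
theorem cntIn_thin {S T : ℕ → ℝ} {D : Set ℝ} (hD : IsLowerSet D) {A L : ℕ}
    (hS : ∀ a b, 4 * A ≤ a → a ≤ b → b < 4 * (A + L) → S a ≤ S b)
    (hT : ∀ r, A ≤ r → r < A + L → T r = S (4 * r + 3)) :
    4 * cntIn T D A (A + L) ≤ cntIn S D (4 * A) (4 * (A + L)) ∧
      cntIn S D (4 * A) (4 * (A + L)) ≤ 4 * cntIn T D A (A + L) + 3 := by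
  induction L with
  | zero => simp [cntIn]
  | succ L ih =>
    have ih := ih (fun a b h h' h'' => hS a b h h' (by omega)) (fun r h h' => hT r h (by omega))
    have e₁ := cntIn_add (Z := T) (D := D) (a := A) (b := A + L) (c := A + (L + 1)) (by omega)
      (by omega)
    have e₂ := cntIn_add (Z := S) (D := D) (a := 4 * A) (b := 4 * (A + L))
      (c := 4 * (A + (L + 1))) (by omega) (by omega)
    have b₁ := cntIn_le T D (A + L) (A + (L + 1))
    have b₂ := cntIn_le S D (4 * (A + L)) (4 * (A + (L + 1)))
    -- The last group of four is compared with `D`. If its first entry lies outside, the group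
    -- contributes nothing to either count. If it lies inside, so do all earlier entries, and both
    -- earlier counts are full; then the last entry of the group decides whether the kept entry is
    -- counted, and at most three others go unnoticed.
    by_cases h₀ : S (4 * (A + L)) ∈ D
    · have f₂ : cntIn S D (4 * A) (4 * (A + L)) = 4 * (A + L) - 4 * A :=
        cntIn_of_forall fun x hx hx' => hD (hS _ _ hx hx'.le (by omega)) h₀
      have f₁ : cntIn T D A (A + L) = A + L - A := cntIn_of_forall fun x hx hx' => by
        rw [hT x hx (by omega)]
        exact hD (hS _ _ (by omega) (by omega) (by omega)) h₀
      by_cases h₁ : S (4 * (A + L) + 3) ∈ D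
      · have g₁ : cntIn T D (A + L) (A + (L + 1)) = A + (L + 1) - (A + L) :=
          cntIn_of_forall fun x hx hx' => by
            obtain rfl : x = A + L := by omega
            rw [hT _ (by omega) hx']; exact h₁
        have g₂ : cntIn S D (4 * (A + L)) (4 * (A + (L + 1))) =
            4 * (A + (L + 1)) - 4 * (A + L) :=
          cntIn_of_forall fun x hx hx' => hD (hS _ _ (by omega) (by omega) (by omega)) h₁
        omega
      · have g₁ : cntIn T D (A + L) (A + (L + 1)) = 0 := cntIn_eq_zero fun x hx hx' => by
          obtain rfl : x = A + L := by omega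
          rw [hT _ (by omega) hx']; exact h₁
        have g₂ := cntIn_add (Z := S) (D := D) (a := 4 * (A + L)) (b := 4 * (A + L) + 3)
          (c := 4 * (A + (L + 1))) (by omega) (by omega)
        have g₃ := cntIn_le S D (4 * (A + L)) (4 * (A + L) + 3)
        have g₄ : cntIn S D (4 * (A + L) + 3) (4 * (A + (L + 1))) = 0 :=
          cntIn_eq_zero fun x hx hx' => by
            obtain rfl : x = 4 * (A + L) + 3 := by omega
            exact h₁
        omega
    · have g₂ : cntIn S D (4 * (A + L)) (4 * (A + (L + 1))) = 0 :=
        cntIn_eq_zero fun x hx hx' h => h₀ (hD (hS _ _ (by omega) hx (by omega)) h)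
      have g₁ : cntIn T D (A + L) (A + (L + 1)) = 0 := cntIn_eq_zero fun x hx hx' h => by
        obtain rfl : x = A + L := by omega
        rw [hT _ (by omega) hx'] at h
        exact h₀ (hD (hS _ _ (by omega) (by omega) (by omega)) h)
      omega

open Cmd in
/-- Sorts one chunk of eight blocks. -/
def chunkStep : Cmd :=
  setVar 39 (.add (.var 37) (.var 36)) ;; sortCmd ;; setVar 37 (.var 39) ;;
  setVar 30 (.sub (.var 30) (.const 8)) ;; setVar 38 (.succ (.var 38))

open Cmd in
/-- One step of `thinCmd`. -/
def thinStep : Cmd :=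
  setReal 6 (.var 34) (.get 6 (.var 35)) ;; setVar 34 (.succ (.var 34)) ;;
  setVar 35 (.add (.var 35) (.const 4))

open Cmd in
/-- Replaces each eight blocks, of which variable `30` holds the number and `31` the size, by one
block of double size. -/
def levelCmd : Cmd :=
  (setVar 36 (.add (.var 31) (.var 31)) ;; setVar 36 (.add (.var 36) (.var 36)) ;;
    setVar 36 (.add (.var 36) (.var 36)) ;; setVar 37 (.const 0) ;; setVar 38 (.const 0)) ;;
  loop (.le (.const 8) (.var 30)) chunkStep ;;
  (setVar 31 (.add (.var 31) (.var 31)) ;; setVar 34 (.const 0) ;; setVar 35 (.const 3)) ;;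
  loop (.lt (.var 35) (.var 37)) thinStep ;;
  setVar 30 (.var 38)

section

variable {P : Program} {O : Oracle}

/-- Eight blocks of size `b` are sorted together, and every fourth of the `8 * b` entries is kept,
which leaves one sorted block of size `2 * b`. Sorting `q / 8` chunks of length `8 * b`
quadratically costs `O(b * b * q)`. Blocks after the last full group of eight are dropped. -/
theorem run_level : ∃ K, ∀ {O : Oracle}
    (μ : Mem) (q b : ℕ), μ.var 30 = q → μ.var 31 = b → 0 < b → 8 ≤ q →
    Run P O levelCmd μ (K * (b * b * q)) fun μ' => μ'.var 30 = q / 8 ∧ μ'.var 31 = 2 * b ∧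
      (∀ g < q / 8, ∀ D, IsLowerSet D →
        4 * cntIn (μ'.real 6) D (2 * b * g) (2 * b * (g + 1)) ≤
            cntIn (μ.real 6) D (8 * b * g) (8 * b * (g + 1)) ∧
          cntIn (μ.real 6) D (8 * b * g) (8 * b * (g + 1)) ≤
            4 * cntIn (μ'.real 6) D (2 * b * g) (2 * b * (g + 1)) + 3) ∧
      (∀ x y, x ≤ y → y < 2 * b → μ'.real 6 x ≤ μ'.real 6 y) ∧
      ∀ x < 2 * b * (q / 8), ∃ y < b * q, μ'.real 6 x = μ.real 6 y := by
  obtain ⟨K, hK⟩ := run_sort (P := P)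
  refine ⟨100 * K + 1000, fun {O} μ q b hq hb hb0 hq8 => ?_⟩
  set I : ℕ → Mem → Prop := fun j μ₁ => μ₁.var 30 = q - 8 * j ∧ μ₁.var 31 = b ∧
    μ₁.var 36 = 8 * b ∧ μ₁.var 37 = 8 * b * j ∧ μ₁.var 38 = j ∧
    (∀ g < j, ∀ D, cntIn (μ₁.real 6) D (8 * b * g) (8 * b * (g + 1)) =
      cntIn (μ.real 6) D (8 * b * g) (8 * b * (g + 1))) ∧
    (∀ g < j, ∀ x y, 8 * b * g ≤ x → x ≤ y → y < 8 * b * (g + 1) →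
      μ₁.real 6 x ≤ μ₁.real 6 y) ∧
    (∀ x, 8 * b * j ≤ x → μ₁.real 6 x = μ.real 6 x) ∧
    ∀ x < 8 * b * j, ∃ y < 8 * b * j, μ₁.real 6 x = μ.real 6 y with hI
  have h₁ : ∀ μ₁, I 0 μ₁ → Run P O (.loop (.le (.const 8) (.var 30)) chunkStep) μ₁
      ((q / 8 - 0) * (3 + (K * (8 * b + 1) * (8 * b + 1) + 20)) + 3) (I (q / 8)) := by
    intro μ₁ h
    refine Run.for_range I (Nat.zero_le _) ?_ ?_ h
    · rintro j μ₂ - hj ⟨k1, k2, k3, k4, k5, k6, k7, k8, k9⟩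
      refine ⟨by simp [k1]; omega, ?_⟩
      have hm : 8 * b * (j + 1) = 8 * b * j + 8 * b := by ring
      refine (Run.seq (Run.exact rfl) fun μ₃ h₃ => Run.seq ((hK μ₃ (8 * b * j)
        (8 * b * (j + 1)) ?_ ?_ ?_).withFrame rfl fun μ₄ h₄ f => And.intro h₄ f)
        fun μ₄ h₄ => Run.simple rfl ?_).mono (t := _) ?_ fun _ => id
      · simp [h₃, k4]
      · simp [h₃, k4, k3, hm]
      · omega
      · obtain ⟨⟨hr, hs⟩, f⟩ := h₄
        have e6 : μ₃.real 6 = μ₂.real 6 := by simp [h₃]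
        rw [e6] at hr
        have v30 := f.var 30 (by decide)
        have v31 := f.var 31 (by decide)
        have v36 := f.var 36 (by decide)
        have v38 := f.var 38 (by decide)
        have v39 := f.var 39 (by decide)
        simp [h₃, k1, k2, k3, k4, k5] at v30 v31 v36 v38 v39
        have hout : ∀ x, x ∉ Set.Ico (8 * b * j) (8 * b * (j + 1)) →
            μ₄.real 6 x = μ₂.real 6 x := by
          obtain ⟨σ, hσ, he⟩ := hr
          intro x hx
          rw [he, Function.comp, hσ x hx]
        have hlow : ∀ g < j, 8 * b * (g + 1) ≤ 8 * b * j := fun g hg => Nat.mul_le_mul_left _ hg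
        refine ⟨by simp [v30]; omega, by simp [v31], by simp [v36], by simp [v39, hm],
          by simp [v38], ?_, ?_, ?_, ?_⟩
        · intro g hg D
          simp only [Cmd.step]
          rcases Nat.lt_succ_iff_lt_or_eq.1 hg with h | rfl
          · rw [← k6 g h D]
            exact cntIn_congr fun x hx hx' => hout x fun hc => by
              have := hlow g h; have := hc.1; omega
          · rw [hr.cntIn_eq]
            exact cntIn_congr fun x hx hx' => k8 x hx
        · intro g hg x y hx hxy hy
          simp only [Cmd.step]
          rcases Nat.lt_succ_iff_lt_or_eq.1 hg with h | rfl
          · have := hlow g h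
            rw [hout x fun hc => by have := hc.1; omega, hout y fun hc => by have := hc.1; omega]
            exact k7 g h x y hx hxy hy
          · exact hs x y hx hxy hy
        · intro x hx
          simp only [Cmd.step]
          rw [hout x fun hc => by have := hc.2; omega]
          exact k8 x (by omega)
        · intro x hx
          simp only [Cmd.step]
          by_cases hxj : x < 8 * b * j
          · rw [hout x fun hc => by have := hc.1; omega]
            obtain ⟨y, hy, e⟩ := k9 x hxj
            exact ⟨y, by omega, e⟩
          · obtain ⟨σ, hσ, he⟩ := hr
            have hm' := IsRearrangement.maps hσ (x := x) ⟨by omega, hx⟩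
            exact ⟨σ x, hm'.2, by rw [he, Function.comp, k8 _ hm'.1]⟩
      · have : 8 * b * (j + 1) - 8 * b * j = 8 * b := by omega
        rw [this]
        simp
        omega
    · rintro μ₂ ⟨k1, -⟩
      simp [k1]; omega
  have h₂ : ∀ (S : ℕ → ℝ) μ₁, μ₁.var 37 = 8 * b * (q / 8) → μ₁.var 38 = q / 8 →
      μ₁.var 31 = 2 * b → μ₁.var 34 = 0 → μ₁.var 35 = 3 → μ₁.real 6 = S →
      Run P O (.loop (.lt (.var 35) (.var 37)) thinStep) μ₁
        ((2 * b * (q / 8) - 0) * (5 + thinStep.ub) + 5) fun μ₂ => μ₂.var 38 = q / 8 ∧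
          μ₂.var 31 = 2 * b ∧ ∀ r < 2 * b * (q / 8), μ₂.real 6 r = S (4 * r + 3) := by
    intro S μ₁ k1 k2 k3 k4 k5 k6
    have e : 8 * b * (q / 8) = 4 * (2 * b * (q / 8)) := by ring
    -- The thinning works in place: round `r` writes position `r` and reads position `4 * r + 3`,
    -- and everything from `r` on is still unchanged.
    refine (Run.for_range (i := 0) (m := 2 * b * (q / 8)) (t := thinStep.ub) (fun r μ₂ =>
      μ₂.var 37 = 8 * b * (q / 8) ∧ μ₂.var 38 = q / 8 ∧ μ₂.var 31 = 2 * b ∧ μ₂.var 34 = r ∧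
      μ₂.var 35 = 4 * r + 3 ∧ (∀ x < r, μ₂.real 6 x = S (4 * x + 3)) ∧
      ∀ x, r ≤ x → μ₂.real 6 x = S x) (Nat.zero_le _) ?_ ?_ ?_).mono (t := _) le_rfl ?_
    · rintro r μ₂ - hr ⟨l1, l2, l3, l4, l5, l6, l7⟩
      refine ⟨by simp [l1, l5]; omega, Run.simple rfl ?_⟩
      simp only [thinStep, Cmd.step, IExp.eval, RExp.eval, Function.update_self, ne_eq,
        Nat.reduceEqDiff, not_false_eq_true, Function.update_of_ne, l1, l2, l3, l4, l5, true_and]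
      refine ⟨by omega, fun x hx => ?_, fun x hx => ?_⟩
      · rcases Nat.lt_succ_iff_lt_or_eq.1 hx with h | rfl
        · rw [Function.update_of_ne h.ne]; exact l6 x h
        · rw [Function.update_self]; exact l7 _ (by omega)
      · rw [Function.update_of_ne (by omega)]; exact l7 x (by omega)
    · rintro μ₂ ⟨l1, l2, l3, l4, l5, l6, l7⟩
      simp [l1, l5]; omega
    · exact ⟨k1, k2, k3, k4, k5, by simp, fun x _ => by rw [k6]⟩
    · rintro μ₂ ⟨l1, l2, l3, l4, l5, l6, l7⟩
      exact ⟨l2, l3, l6⟩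
  refine (Run.seq (Run.exact rfl) fun μ₁ g₁ => Run.seq (h₁ μ₁ ?_) fun μ₂ g₂ =>
    Run.seq (Run.exact rfl) fun μ₃ g₃ => Run.seq (h₂ (μ₂.real 6) μ₃ ?_ ?_ ?_ ?_ ?_ ?_)
    fun μ₄ g₄ => Run.simple rfl ?_).mono (t := _) ?_ fun _ => id
  · refine ⟨?_, ?_, ?_, ?_, ?_, ?_, ?_, ?_, ?_⟩ <;> simp [g₁, hq, hb]
    omega
  · simp [g₃, g₂.2.2.2.1]
  · simp [g₃, g₂.2.2.2.2.1]
  · simp [g₃, g₂.2.1]; omega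
  · simp [g₃]
  · simp [g₃]
  · simp [g₃]
  · obtain ⟨-, k2, k3, k4, k5, k6, k7, k8, k9⟩ := g₂
    obtain ⟨l1, l2, l3⟩ := g₄
    have hg : ∀ g < q / 8, 2 * b * (g + 1) ≤ 2 * b * (q / 8) := fun g hg =>
      Nat.mul_le_mul_left _ hg
    refine ⟨by simp [l1], by simp [l2], fun g hgq D hD => ?_, fun x y hxy hy => ?_, fun x hx => ?_⟩
    · simp only [Cmd.step]
      have e₁ : 8 * b * g = 4 * (2 * b * g) := by ring
      have e₂ : 8 * b * (g + 1) = 4 * (2 * b * g + 2 * b) := by ring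
      have e₃ : 2 * b * (g + 1) = 2 * b * g + 2 * b := by ring
      have := hg g hgq
      rw [← k6 g hgq D, e₁, e₂, e₃]
      refine cntIn_thin hD (fun x y hx hxy hy => k7 g hgq x y ?_ hxy ?_)
        fun r hr hr' => l3 r ?_ <;> omega
    · simp only [Cmd.step]
      have h0 : 0 < q / 8 := by omega
      have := hg 0 h0
      rw [l3 x (by omega), l3 y (by omega)]
      exact k7 0 h0 _ _ (by omega) (by omega) (by omega)
    · simp only [Cmd.step]
      rw [l3 x hx]
      have e : 8 * b * (q / 8) = 4 * (2 * b * (q / 8)) := by ring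
      obtain ⟨y, hy, e'⟩ := k9 (4 * x + 3) (by omega)
      refine ⟨y, hy.trans_le ?_, e'⟩
      calc 8 * b * (q / 8) = b * (8 * (q / 8)) := by ring
        _ ≤ b * q := Nat.mul_le_mul_left _ (Nat.mul_div_le _ _)
  · have e1 : q / 8 * 8 ≤ q := Nat.div_mul_le_self _ _
    obtain ⟨p, hp⟩ : ∃ p, p = q / 8 := ⟨_, rfl⟩
    rw [← hp] at e1 ⊢
    simp [thinStep]
    have h1 : K * (8 * b + 1) * (8 * b + 1) ≤ K * (81 * (b * b)) := by
      rw [mul_assoc]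
      refine Nat.mul_le_mul_left _ ?_
      nlinarith
    have h2 : p * (K * (8 * b + 1) * (8 * b + 1)) ≤ p * (K * (81 * (b * b))) :=
      Nat.mul_le_mul_left _ h1
    have h3 : p * 8 * (K * (b * b)) ≤ q * (K * (b * b)) := Nat.mul_le_mul_right _ e1
    have h4 : p * 8 * (b * b) ≤ q * (b * b) := Nat.mul_le_mul_right _ e1
    have h5 : 1 ≤ b * b := Nat.mul_pos hb0 hb0
    have h6 : p ≤ p * (b * b) := Nat.le_mul_of_pos_right _ h5
    have h7 : b * p ≤ b * b * p := Nat.mul_le_mul_right _ (Nat.le_mul_of_pos_left _ hb0)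
    have h8 : 8 ≤ b * b * q := by nlinarith
    nlinarith

end

/-! ### The pivot -/

open Cmd in
/-- Puts an approximate median of the first entries of the real array `12`, of which variable `20`
holds the number, into the entry `0` of the real array `7`. -/
def pivotCmd : Cmd :=
  setVar 32 (.const 0) ;;
  loop (.lt (.var 32) (.var 20))
    (setReal 6 (.var 32) (.get 12 (.var 32)) ;; setVar 32 (.succ (.var 32))) ;;
  (setVar 30 (.var 20) ;; setVar 31 (.const 1)) ;;
  loop (.le (.const 8) (.var 30)) levelCmd ;;
  (setVar 34 (.const 0) ;; setVar 35 (.const 8)) ;;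
  loop (.le (.var 35) (.var 31))
    (setVar 34 (.succ (.var 34)) ;; setVar 35 (.add (.var 35) (.const 8))) ;;
  setReal 7 (.const 0) (.get 6 (.var 34))

/-- The blocks of size `2 ^ J` of `Z` represent the blocks of size `8 ^ J` of `W`. -/
def Represents (W Z : ℕ → ℝ) (J q : ℕ) : Prop :=
  ∀ g < q, ∀ D, IsLowerSet D →
    4 ^ J * cntIn Z D (2 ^ J * g) (2 ^ J * (g + 1)) ≤ cntIn W D (8 ^ J * g) (8 ^ J * (g + 1)) ∧
    4 * cntIn W D (8 ^ J * g) (8 ^ J * (g + 1)) + 3 * 4 ^ J ≤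
      4 * (4 ^ J * cntIn Z D (2 ^ J * g) (2 ^ J * (g + 1))) + 3 * 8 ^ J

/-- A count in the representatives, scaled by `4 ^ J`, underestimates the true count by at most `e J
= 3 / 4 * (8 ^ J - 4 ^ J)`. Joining eight blocks adds up eight errors, and the thinning loses up to
`3` representatives, each standing for `4 ^ J` entries. Indeed `8 * e J + 3 * 4 ^ J = e (J + 1)`. -/
theorem Represents.succ {W Z Z' : ℕ → ℝ} {J q : ℕ} (h : Represents W Z J q)
    (h' : ∀ g < q / 8, ∀ D, IsLowerSet D →
        4 * cntIn Z' D (2 * 2 ^ J * g) (2 * 2 ^ J * (g + 1)) ≤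
            cntIn Z D (8 * 2 ^ J * g) (8 * 2 ^ J * (g + 1)) ∧
          cntIn Z D (8 * 2 ^ J * g) (8 * 2 ^ J * (g + 1)) ≤
            4 * cntIn Z' D (2 * 2 ^ J * g) (2 * 2 ^ J * (g + 1)) + 3) :
    Represents W Z' (J + 1) (q / 8) := by
  intro g hg D hD
  have key : ∀ e ≤ 8, 4 ^ J * cntIn Z D (2 ^ J * (8 * g)) (2 ^ J * (8 * g + e)) ≤
      cntIn W D (8 ^ J * (8 * g)) (8 ^ J * (8 * g + e)) ∧
      4 * cntIn W D (8 ^ J * (8 * g)) (8 ^ J * (8 * g + e)) + e * (3 * 4 ^ J) ≤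
      4 * (4 ^ J * cntIn Z D (2 ^ J * (8 * g)) (2 ^ J * (8 * g + e))) + e * (3 * 8 ^ J) := by
    intro e he
    induction e with
    | zero => simp [cntIn]
    | succ e ih =>
      have ih := ih (by omega)
      have hb := h (8 * g + e) (by omega) D hD
      have e₁ := cntIn_add (Z := Z) (D := D) (a := 2 ^ J * (8 * g)) (b := 2 ^ J * (8 * g + e))
        (c := 2 ^ J * (8 * g + (e + 1))) (Nat.mul_le_mul_left _ (by omega))
        (Nat.mul_le_mul_left _ (by omega))
      have e₂ := cntIn_add (Z := W) (D := D) (a := 8 ^ J * (8 * g)) (b := 8 ^ J * (8 * g + e))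
        (c := 8 ^ J * (8 * g + (e + 1))) (Nat.mul_le_mul_left _ (by omega))
        (Nat.mul_le_mul_left _ (by omega))
      rw [← e₁, ← e₂]
      rw [add_assoc] at hb
      simp only [mul_add, add_mul, one_mul] at hb ih ⊢
      omega
  have k := key 8 le_rfl
  have t := h' g hg D hD
  have a₁ : 2 ^ J * (8 * g) = 8 * 2 ^ J * g := by ring
  have a₂ : 2 ^ J * (8 * g + 8) = 8 * 2 ^ J * (g + 1) := by ring
  have a₃ : 8 ^ J * (8 * g) = 8 ^ (J + 1) * g := by ring
  have a₄ : 8 ^ J * (8 * g + 8) = 8 ^ (J + 1) * (g + 1) := by ring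
  have a₅ : (2 : ℕ) ^ (J + 1) = 2 * 2 ^ J := by ring
  rw [a₁, a₂, a₃, a₄] at k
  rw [a₅]
  have m₁ := Nat.mul_le_mul_left (4 ^ J) t.1
  have m₂ := Nat.mul_le_mul_left (4 ^ J) t.2
  have b₁ : (4 : ℕ) ^ (J + 1) = 4 * 4 ^ J := by ring
  have b₂ : (8 : ℕ) ^ (J + 1) = 8 * 8 ^ J := by ring
  generalize cntIn W D _ _ = cW at *
  generalize cntIn Z D _ _ = cZ at *
  generalize cntIn Z' D _ _ = cZ' at *
  rw [b₁]
  simp only [b₂]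
  constructor <;> nlinarith

section

variable {P : Program} {O : Oracle}

/-- In the end fewer than eight blocks remain, so the first one represents `8 ^ J > M / 8` entries.
The pivot is its entry number `2 ^ J / 8`. At most an eighth of these `8 ^ J` entries is counted
below the pivot, and the error is at most three quarters, so at least an eighth of them is not below
it. At least an eighth is at most the pivot, as that estimate has no error. An eighth of `8 ^ J` is
more than `M / 64`. -/
theorem run_pivot : ∃ K, ∀ {O : Oracle} (μ : Mem) (M : ℕ), μ.var 20 = M → 0 < M →
    Run P O pivotCmd μ (K * M) fun μ' => (∃ a < M, μ'.real 7 0 = μ.real 12 a) ∧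
      64 * cntIn (μ.real 12) {x | x < μ'.real 7 0} 0 M ≤ 63 * M ∧
      M ≤ 64 * cntIn (μ.real 12) {x | x ≤ μ'.real 7 0} 0 M := by
  obtain ⟨K, hK⟩ := run_level (P := P)
  refine ⟨2 * K + 100, fun {O} μ M hM hM0 => ?_⟩
  set W := μ.real 12 with hW
  -- The next level costs a multiple of `4 ^ J * q`, because the blocks have size `2 ^ J`. Passing
  -- from `J`, `q` to `J + 1`, `q / 8` at least halves this quantity, so it serves as a credit, and
  -- all levels together take time linear in `M`.
  set I : ℕ → Mem → Prop := fun n μ₁ => ∃ J q, μ₁.var 30 = q ∧ μ₁.var 31 = 2 ^ J ∧ 0 < q ∧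
    8 ^ J * q ≤ M ∧ M < 8 ^ J * (q + 1) ∧ Represents W (μ₁.real 6) J q ∧
    (∀ x y, x ≤ y → y < 2 ^ J → μ₁.real 6 x ≤ μ₁.real 6 y) ∧
    (∀ x < 2 ^ J * q, ∃ a < M, μ₁.real 6 x = W a) ∧ (2 * K + 6) * (4 ^ J * q) = n with hI
  have h₁ : ∀ μ₁, μ₁.var 32 = 0 → μ₁.var 20 = M → μ₁.real 12 = W →
      Run P O (.loop (.lt (.var 32) (.var 20))
        (.setReal 6 (.var 32) (.get 12 (.var 32)) ;; .setVar 32 (.succ (.var 32)))) μ₁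
        ((M - 0) * (5 + 9) + 5)
        fun μ₂ => μ₂.var 20 = M ∧ ∀ x < M, μ₂.real 6 x = W x := by
    intro μ₁ k1 k2 k3
    refine (Run.for_range (i := 0) (m := M) (t := 9) (fun r μ₂ => μ₂.var 32 = r ∧
      μ₂.var 20 = M ∧ μ₂.real 12 = W ∧ ∀ x < r, μ₂.real 6 x = W x) (Nat.zero_le _)
      ?_ ?_ ⟨k1, k2, k3, by simp⟩).mono le_rfl ?_
    · rintro r μ₂ - hr ⟨l1, l2, l3, l4⟩
      refine ⟨by simp [l1, l2]; omega, (Run.simple rfl ?_).mono (t := _) (by simp) fun _ => id⟩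
      refine ⟨by simp [l1], by simp [l2], by simp [l3], fun x hx => ?_⟩
      simp only [Cmd.step, IExp.eval, RExp.eval, Function.update_self, l1, l3]
      rcases Nat.lt_succ_iff_lt_or_eq.1 hx with h | rfl
      · rw [Function.update_of_ne h.ne]; exact l4 x h
      · rw [Function.update_self]
    · rintro μ₂ ⟨l1, l2, -⟩
      simp [l1, l2]
    · rintro μ₂ ⟨-, l2, -, l4⟩
      exact ⟨l2, l4⟩
  have h₂ : ∀ μ₁, I ((2 * K + 6) * M) μ₁ → Run P O (.loop (.le (.const 8) (.var 30)) levelCmd) μ₁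
      ((2 * K + 6) * M + 3) fun μ' => (∃ n', I n' μ') ∧ ¬ 8 ≤ μ'.var 30 := by
    intro μ₁ h
    refine (Run.loop I ?_ h).mono le_rfl (by simp)
    rintro n μ₂ ⟨J, q, k1, k2, k3, k4, k5, k6, k7, k8, rfl⟩ hb
    simp only [Test.Holds, IExp.eval, k1] at hb
    refine ⟨_, (hK μ₂ q (2 ^ J) k1 k2 (by positivity) hb).imp fun μ₃ ⟨l1, l2, l3, l4, l5⟩ =>
      ⟨_, ⟨J + 1, q / 8, l1, by rw [l2]; ring, by omega, ?_, ?_, k6.succ l3, ?_, ?_, rfl⟩, ?_⟩⟩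
    · calc 8 ^ (J + 1) * (q / 8) = 8 ^ J * (8 * (q / 8)) := by ring
        _ ≤ 8 ^ J * q := Nat.mul_le_mul_left _ (Nat.mul_div_le _ _)
        _ ≤ M := k4
    · calc M < 8 ^ J * (q + 1) := k5
        _ ≤ 8 ^ J * (8 * (q / 8 + 1)) := Nat.mul_le_mul_left _ (by omega)
        _ = _ := by ring
    · intro x y hxy hy
      exact l4 x y hxy (by rw [← pow_succ']; exact hy)
    · intro x hx
      obtain ⟨y, hy, e⟩ := l5 x (by rw [← pow_succ']; exact hx)
      obtain ⟨a, ha, e'⟩ := k8 y hy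
      exact ⟨a, ha, e.trans e'⟩
    · have e1 : (2 : ℕ) ^ J * 2 ^ J = 4 ^ J := by rw [← mul_pow]; norm_num
      rw [e1]
      have e2 : (4 : ℕ) ^ (J + 1) * (q / 8) * 2 = 4 ^ J * (8 * (q / 8)) := by ring
      have e3 : 4 ^ J * (8 * (q / 8)) ≤ 4 ^ J * q := Nat.mul_le_mul_left _ (Nat.mul_div_le _ _)
      have e4 : 1 ≤ 4 ^ J * q := Nat.mul_pos (by positivity) k3
      simp
      nlinarith
  -- The index `b / 8` is found by counting in steps of eight, since division of integers is not an
  -- operation of the machine.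
  have h₃ : ∀ μ₁ b S, 0 < b → μ₁.var 34 = 0 → μ₁.var 35 = 8 → μ₁.var 31 = b → μ₁.real 6 = S →
      Run P O (.loop (.le (.var 35) (.var 31))
        (.setVar 34 (.succ (.var 34)) ;; .setVar 35 (.add (.var 35) (.const 8)))) μ₁
        ((b / 8 - 0) * (3 + 8) + 3) fun μ₂ => μ₂.var 34 = b / 8 ∧ μ₂.real 6 = S := by
    intro μ₁ b S hb k1 k2 k3 k4
    refine (Run.for_range (i := 0) (m := b / 8) (t := 8) (fun r μ₂ => μ₂.var 34 = r ∧
      μ₂.var 35 = 8 * r + 8 ∧ μ₂.var 31 = b ∧ μ₂.real 6 = S) (Nat.zero_le _)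
      ?_ ?_ ⟨k1, k2, k3, k4⟩).mono le_rfl ?_
    · rintro r μ₂ - hr ⟨l1, l2, l3, l4⟩
      refine ⟨by simp [l2, l3]; omega, (Run.simple rfl ?_).mono (t := _) (by simp) fun _ => id⟩
      simp [l1, l2, l3, l4]
      ring
    · rintro μ₂ ⟨l1, l2, l3, -⟩
      simp [l2, l3]; omega
    · rintro μ₂ ⟨l1, -, -, l4⟩
      exact ⟨l1, l4⟩
  refine (Run.seq (Run.exact rfl) fun μ₁ g₁ => Run.seq (h₁ μ₁ ?_ ?_ ?_) fun μ₂ g₂ =>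
    Run.seq (Run.exact rfl) fun μ₃ g₃ => Run.seq (h₂ μ₃ ?_) fun μ₄ ⟨⟨n, J, q, k⟩, hq8⟩ =>
    Run.seq (Run.exact rfl) fun μ₅ g₅ => Run.seq ((h₃ μ₅ (2 ^ J) (μ₄.real 6)
      (by positivity) ?_ ?_ ?_ ?_).mono (t' := 11 * M + 3) ?_ fun _ => id)
      fun μ₆ g₆ => Run.simple rfl ?_).mono (t := _) ?_ fun _ => id
  · simp [g₁]
  · simp [g₁, hM]
  · simp [g₁, hW]
  · refine ⟨0, M, ?_, ?_, hM0, ?_, ?_, ?_, ?_, ?_, ?_⟩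
    · simp [g₃, g₂.1]
    · simp [g₃]
    · simp
    · simp
    · intro g hg D hD
      have : cntIn (μ₃.real 6) D g (g + 1) = cntIn W D g (g + 1) :=
        cntIn_congr fun x hx hx' => by simpa [g₃] using g₂.2 x (by omega)
      simp [this]
    · intro x y hxy hy
      obtain rfl : x = y := by simp at hy; omega
      exact le_rfl
    · intro x hx
      exact ⟨x, by simpa using hx, by simpa [g₃] using g₂.2 x (by simpa using hx)⟩
    · simp
  · simp [g₅]
  · simp [g₅]
  · simp [g₅, k.2.1]
  · simp [g₅]
  · have : (2 : ℕ) ^ J ≤ 8 ^ J * q :=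
      (Nat.pow_le_pow_left (by norm_num) J).trans (Nat.le_mul_of_pos_right _ k.2.2.1)
    have := k.2.2.2.1
    omega
  · obtain ⟨k1, k2, k3, k4, k5, k6, k7, k8, -⟩ := k
    obtain ⟨b, hb⟩ : ∃ b, b = 2 ^ J := ⟨_, rfl⟩
    have hb0 : 0 < b := by rw [hb]; positivity
    have e8 : (8 : ℕ) ^ J = 4 ^ J * b := by rw [hb, ← mul_pow]; norm_num
    have hr : 2 ^ J / 8 < 2 ^ J := by rw [← hb]; omega
    have hp : (Cmd.step O (Cmd.setReal 7 (.const 0) (.get 6 (.var 34))) μ₆).real 7 0 =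
        μ₄.real 6 (2 ^ J / 8) := by simp [g₆.1, g₆.2]
    rw [hp]
    set p := μ₄.real 6 (2 ^ J / 8)
    have hqJ : 8 ^ J * 1 ≤ 8 ^ J * q := Nat.mul_le_mul_left _ k3
    have hq9 : 8 ^ J * (q + 1) ≤ 8 ^ J * 8 := Nat.mul_le_mul_left _ (by omega)
    refine ⟨k8 _ (hr.trans_le (Nat.le_mul_of_pos_right _ k3)), ?_, ?_⟩
    · have a := (k6 0 k3 {x | x < p} fun x y hxy hx => lt_of_le_of_lt hxy hx).2
      have a₁ := cntIn_add (Z := μ₄.real 6) (D := {x | x < p}) (a := 0) (b := 2 ^ J / 8)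
        (c := 2 ^ J) (Nat.zero_le _) hr.le
      have a₂ := cntIn_le (μ₄.real 6) {x | x < p} 0 (2 ^ J / 8)
      have a₃ : cntIn (μ₄.real 6) {x | x < p} (2 ^ J / 8) (2 ^ J) = 0 :=
        cntIn_eq_zero fun x hx hx' hc => absurd (k7 _ x hx hx') (not_le.2 hc)
      have a₄ := cntIn_add (Z := W) (D := {x | x < p}) (a := 0) (b := 8 ^ J)
        (c := M) (Nat.zero_le _) (by omega)
      have a₅ := cntIn_le W {x | x < p} (8 ^ J) M
      simp only [mul_zero, zero_add, mul_one] at a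
      have a₆ : 4 ^ J * cntIn (μ₄.real 6) {x | x < p} 0 (2 ^ J) ≤ 4 ^ J * (b / 8) :=
        Nat.mul_le_mul_left _ (by rw [hb]; omega)
      have a₇ : 8 * (4 ^ J * (b / 8)) ≤ 8 ^ J := by
        rw [e8]
        calc 8 * (4 ^ J * (b / 8)) = 4 ^ J * (8 * (b / 8)) := by ring
          _ ≤ _ := Nat.mul_le_mul_left _ (Nat.mul_div_le _ _)
      have a₈ : 0 < 4 ^ J := by positivity
      omega
    · have a := (k6 0 k3 {x | x ≤ p} fun x y hxy hx => le_trans hxy hx).1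
      have a₁ := cntIn_add (Z := μ₄.real 6) (D := {x | x ≤ p}) (a := 0) (b := 2 ^ J / 8 + 1)
        (c := 2 ^ J) (Nat.zero_le _) hr
      have a₂ : cntIn (μ₄.real 6) {x | x ≤ p} 0 (2 ^ J / 8 + 1) = 2 ^ J / 8 + 1 - 0 :=
        cntIn_of_forall fun x hx hx' => k7 x _ (by omega) hr
      have a₄ := cntIn_add (Z := W) (D := {x | x ≤ p}) (a := 0) (b := 8 ^ J)
        (c := M) (Nat.zero_le _) (by omega)
      simp only [mul_zero, zero_add, mul_one] at a
      have a₆ : 4 ^ J * (b / 8 + 1) ≤ 4 ^ J * cntIn (μ₄.real 6) {x | x ≤ p} 0 (2 ^ J) :=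
        Nat.mul_le_mul_left _ (by rw [hb]; omega)
      have a₇ : 8 ^ J ≤ 8 * (4 ^ J * (b / 8 + 1)) := by
        rw [e8]
        calc 4 ^ J * b ≤ 4 ^ J * (8 * (b / 8 + 1)) := Nat.mul_le_mul_left _ (by omega)
          _ = _ := by ring
      omega
  · simp
    nlinarith

end

/-! ## Components of a graph by breadth-first search -/

/-- `u` and `v` are joined by an arc with number `a < M` that satisfies `D`. -/
def ArcRel (M : ℕ) (F T : ℕ → ℕ) (D : ℕ → Prop) (u v : ℕ) : Prop :=
  ∃ a < M, D a ∧ F a = u ∧ T a = v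

/-- Every arc satisfying `D` has a reverse arc satisfying `D`. -/
def ArcSymm (M : ℕ) (F T : ℕ → ℕ) (D : ℕ → Prop) : Prop :=
  ∀ a < M, D a → ∃ a' < M, D a' ∧ F a' = T a ∧ T a' = F a

open Classical in
/-- One more than the number of the last arc from `x` before `a` that satisfies `D`, or `0`. -/
noncomputable def prevArc (F : ℕ → ℕ) (D : ℕ → Prop) (x : ℕ) : ℕ → ℕ
  | 0 => 0
  | a + 1 => if D a ∧ F a = x then a + 1 else prevArc F D x a

theorem prevArc_eq_zero {F : ℕ → ℕ} {D : ℕ → Prop} {x b : ℕ} (h : prevArc F D x b = 0) {a : ℕ}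
    (ha : a < b) (hD : D a) : F a ≠ x := by
  induction b with
  | zero => omega
  | succ b ih =>
    rw [prevArc] at h
    split_ifs at h with hc
    rcases Nat.lt_succ_iff_lt_or_eq.1 ha with h' | rfl
    · exact ih h h'
    · exact fun e => hc ⟨hD, e⟩

theorem prevArc_eq_succ {F : ℕ → ℕ} {D : ℕ → Prop} {x b c : ℕ} (h : prevArc F D x b = c + 1) :
    c < b ∧ D c ∧ F c = x ∧ ∀ a, c < a → a < b → D a → F a ≠ x := by
  induction b with
  | zero => simp [prevArc] at h
  | succ b ih =>
    rw [prevArc] at h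
    split_ifs at h with hc
    · obtain rfl : b = c := by omega
      exact ⟨by omega, hc.1, hc.2, fun a h h' => by omega⟩
    · obtain ⟨h₁, h₂, h₃, h₄⟩ := ih h
      refine ⟨by omega, h₂, h₃, fun a ha ha' hD e => ?_⟩
      rcases Nat.lt_succ_iff_lt_or_eq.1 ha' with h' | rfl
      · exact h₄ a ha h' hD e
      · exact hc ⟨hD, e⟩

/-- The invariant of the search. The queue `Q` holds `qt` nodes, of which `qh` have been taken out;
`C` holds the labels, `R` the parents; the last node taken out has been scanned down to the arc
`β`; the current component starts at the position `r` of the queue and has the label `l`. -/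
structure BfsInv (M : ℕ) (F T : ℕ → ℕ) (D : ℕ → Prop) (t : ℕ) (C R Q : ℕ → ℕ)
    (c qh qt l β r : ℕ) : Prop where
  cM : c ≤ M
  qle : qh ≤ qt
  rle : r ≤ qh
  rlt : r < qt
  β_le : β ≤ M
  touched : ∀ j < qt, Q j = t ∨ ∃ a < M, F a = Q j
  zero_iff : ∀ y, (y = t ∨ ∃ a < M, F a = y) → (C y = 0 ↔ ∀ j < qt, Q j ≠ y)
  reach : ∀ j < qt, ∃ r, C (Q j) = r + 1 ∧ Relation.ReflTransGen (ArcRel M F T D) r (Q j)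
  parent : ∀ j < qt, C (Q j) = Q j + 1 ∨
    ∃ j' < j, R (Q j) = Q j' ∧ C (Q j) = C (Q j') ∧ ArcRel M F T D (Q j') (Q j)
  inj : ∀ i < qt, ∀ j < qt, Q i = Q j → i = j
  scanned : ∀ j < qh, ∀ a < M, D a → F a = Q j → (j + 1 = qh → β ≤ a) → C (T a) = C (Q j)
  closed : ∀ j < r, ∀ a < M, D a → F a = Q j → C (T a) = C (Q j)
  label : ∀ j < qt, r ≤ j → C (Q j) = l + 1
  cand : ∀ a < c, ∃ j < qt, Q j = F a
  root : Q 0 = t ∧ C t = t + 1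

namespace BfsInv

variable {M : ℕ} {F T : ℕ → ℕ} {D : ℕ → Prop} {t : ℕ} {C R Q : ℕ → ℕ} {c qh qt l β r : ℕ}

open Classical in
/-- The number of arcs still to be scanned. -/
noncomputable def todo (M : ℕ) (F : ℕ → ℕ) (Q : ℕ → ℕ) (qh β : ℕ) : ℕ :=
  ((Finset.range M).filter fun a => ∀ j < qh, F a = Q j → j + 1 = qh ∧ a < β).card

theorem todo_le : todo M F Q qh β ≤ M := by
  classical
  exact (Finset.card_filter_le _ _).trans (by simp)

/-- The queue has no repetitions, so the scanned arc belonged to the current node only and was still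
counted; with the new bound it no longer is. -/
theorem todo_scan (h : BfsInv M F T D t C R Q c qh qt l β r) {a : ℕ} {Q' : ℕ → ℕ}
    (hqh : 0 < qh) (ha : a < β) (hF : F a = Q (qh - 1)) (hQ : ∀ j < qh, Q' j = Q j) :
    todo M F Q' qh a + 1 ≤ todo M F Q qh β := by
  classical
  refine Finset.card_lt_card ⟨fun x hx => ?_, fun hs => ?_⟩
  · simp only [Finset.mem_filter, Finset.mem_range] at hx ⊢
    refine ⟨hx.1, fun j hj hFj => ?_⟩
    have := hx.2 j hj (by rw [hQ j hj]; exact hFj)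
    exact ⟨this.1, this.2.trans ha⟩
  · have hm : a ∈ (Finset.range M).filter fun a => ∀ j < qh, F a = Q j → j + 1 = qh ∧ a < β := by
      simp only [Finset.mem_filter, Finset.mem_range]
      refine ⟨ha.trans_le h.β_le, fun j hj hFj => ?_⟩
      have := h.inj j (by have := h.qle; omega) (qh - 1) (by have := h.qle; omega)
        (hFj.symm.trans hF)
      exact ⟨by omega, ha⟩
    have := hs hm
    simp only [Finset.mem_filter, Finset.mem_range] at this
    exact absurd (this.2 (qh - 1) (by omega) (by rw [hQ _ (by omega)]; exact hF)).2 (lt_irrefl _)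

theorem todo_next : todo M F Q (qh + 1) M ≤ todo M F Q qh β := by
  classical
  refine Finset.card_le_card fun x hx => ?_
  simp only [Finset.mem_filter, Finset.mem_range] at hx ⊢
  refine ⟨hx.1, fun j hj hFj => ?_⟩
  have := (hx.2 j (by omega) hFj).1
  omega

/-- Adding the node `y` to the queue. -/
theorem push (h : BfsInv M F T D t C R Q c qh qt l β r) {y l' r' v : ℕ}
    (hy : ∃ a < M, F a = y) (hC : C y = 0) (hr : r' ≤ qh)
    (hcl : ∀ j < r', ∀ a < M, D a → F a = Q j → C (T a) = C (Q j))
    (hl : ∀ j < qt, r' ≤ j → C (Q j) = l' + 1) (hreach : Relation.ReflTransGen (ArcRel M F T D) l' y)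
    (hpar : l' = y ∨ ∃ j' < qt, v = Q j' ∧ C (Q j') = l' + 1 ∧ ArcRel M F T D (Q j') y) :
    BfsInv M F T D t (Function.update C y (l' + 1)) (Function.update R y v)
      (Function.update Q qt y) c qh (qt + 1) l' β r' := by
  have hny := (h.zero_iff y (Or.inr hy)).1 hC
  have hQ : ∀ j < qt, Function.update Q qt y j = Q j := fun j hj =>
    Function.update_of_ne hj.ne _ _
  have hQC : ∀ j < qt, Function.update C y (l' + 1) (Q j) = C (Q j) := fun j hj =>
    Function.update_of_ne (hny j hj) _ _
  have hq := h.qle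
  -- Queued nodes have nonzero labels, while the label of `y` is still `0`. So the end of an arc
  -- known to have the label of a queued node is not `y`, and labelling `y` does not disturb it.
  have hT : ∀ a, ∀ j < qt, C (T a) = C (Q j) → T a ≠ y := by
    intro a j hj he hty
    rw [hty, hC] at he
    obtain ⟨r, hr, -⟩ := h.reach j hj
    omega
  constructor
  · exact h.cM
  · omega
  · exact hr
  · omega
  · exact h.β_le
  · intro j hj
    rcases Nat.lt_succ_iff_lt_or_eq.1 hj with hj | rfl
    · rw [hQ j hj]; exact h.touched j hj
    · rw [Function.update_self]; exact Or.inr hy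
  · intro z hz
    by_cases hzy : z = y
    · subst hzy
      simp only [Function.update_self, Nat.add_eq_zero_iff, one_ne_zero, and_false, false_iff]
      exact fun hc => hc qt (by omega) (by simp)
    · rw [Function.update_of_ne hzy, h.zero_iff z hz]
      constructor
      · intro hc j hj
        rcases Nat.lt_succ_iff_lt_or_eq.1 hj with hj | rfl
        · rw [hQ j hj]; exact hc j hj
        · rw [Function.update_self]; exact fun e => hzy e.symm
      · intro hc j hj
        rw [← hQ j hj]; exact hc j (by omega)
  · intro j hj
    rcases Nat.lt_succ_iff_lt_or_eq.1 hj with hj | rfl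
    · rw [hQ j hj, hQC j hj]; exact h.reach j hj
    · rw [Function.update_self, Function.update_self]; exact ⟨l', rfl, hreach⟩
  · intro j hj
    rcases Nat.lt_succ_iff_lt_or_eq.1 hj with hj | rfl
    · rw [hQ j hj, hQC j hj]
      refine (h.parent j hj).imp_right ?_
      rintro ⟨j', hj', h₁, h₂, h₃⟩
      refine ⟨j', hj', ?_, ?_, ?_⟩
      · rw [Function.update_of_ne (hny j hj), hQ j' (by omega)]; exact h₁
      · rw [hQ j' (by omega), hQC j' (by omega)]; exact h₂
      · rw [hQ j' (by omega)]; exact h₃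
    · rw [Function.update_self, Function.update_self]
      refine hpar.imp (by rintro rfl; rfl) ?_
      rintro ⟨j', hj', h₁, h₂, h₃⟩
      refine ⟨j', hj', ?_, ?_, ?_⟩
      · rw [Function.update_self, hQ j' hj']; exact h₁
      · rw [hQ j' hj', hQC j' hj', h₂]
      · rw [hQ j' hj']; exact h₃
  · intro i hi j hj he
    rcases Nat.lt_succ_iff_lt_or_eq.1 hi with hi | rfl <;>
      rcases Nat.lt_succ_iff_lt_or_eq.1 hj with hj | rfl
    · rw [hQ i hi, hQ j hj] at he; exact h.inj i hi j hj he
    · rw [hQ i hi, Function.update_self] at he; exact absurd he (hny i hi)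
    · rw [hQ j hj, Function.update_self] at he; exact absurd he.symm (hny j hj)
    · rfl
  · intro j hj a ha hD hF hβ
    rw [hQ j (by omega)] at hF ⊢
    have := h.scanned j hj a ha hD hF hβ
    rw [hQC j (by omega), Function.update_of_ne (hT a j (by omega) this), this]
  · intro j hj a ha hD hF
    rw [hQ j (by omega)] at hF ⊢
    have := hcl j hj a ha hD hF
    rw [hQC j (by omega), Function.update_of_ne (hT a j (by omega) this), this]
  · intro j hj hrj
    rcases Nat.lt_succ_iff_lt_or_eq.1 hj with hj | rfl
    · rw [hQ j hj, hQC j hj]; exact hl j hj hrj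
    · rw [Function.update_self, Function.update_self]
  · intro a ha
    obtain ⟨j, hj, e⟩ := h.cand a ha
    exact ⟨j, by omega, by rw [hQ j hj]; exact e⟩
  · have h0 := h.rlt
    have := h.root
    refine ⟨by rw [hQ 0 (by omega)]; exact this.1, ?_⟩
    have hq0 := hQC 0 (by omega)
    rw [this.1] at hq0
    rw [hq0]; exact this.2

/-- Lowering the bound `β`. -/
theorem scan (h : BfsInv M F T D t C R Q c qh qt l β r) {b : ℕ} (hb : b < β) (hq : 0 < qh)
    (hbetween : ∀ a, b < a → a < β → D a → F a ≠ Q (qh - 1)) (hCb : C (T b) = C (Q (qh - 1))) :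
    BfsInv M F T D t C R Q c qh qt l b r where
  __ := h
  β_le := hb.le.trans h.β_le
  scanned j hj a ha hD hF hβ := by
    by_cases hjq : j + 1 = qh
    · obtain rfl : j = qh - 1 := by omega
      have hba := hβ hjq
      rcases hba.eq_or_lt with rfl | hba
      · exact hCb
      · refine h.scanned _ hj a ha hD hF fun _ => ?_
        by_contra hc
        exact hbetween a hba (not_le.1 hc) hD hF
    · exact h.scanned j hj a ha hD hF fun e => absurd e hjq

/-- When nothing is left to scan at the current node, everything taken out is scanned. -/
theorem scanned_all (h : BfsInv M F T D t C R Q c qh qt l β r)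
    (h0 : 0 < qh → prevArc F D (Q (qh - 1)) β = 0) : ∀ j < qh, ∀ a < M, D a → F a = Q j →
      C (T a) = C (Q j) := by
  intro j hj a ha hD hF
  refine h.scanned j hj a ha hD hF fun e => ?_
  by_contra hc
  refine prevArc_eq_zero (h0 (by omega)) (not_le.1 hc) hD ?_
  rw [hF]; congr 1; omega

/-- Taking out the next node. -/
theorem next (h : BfsInv M F T D t C R Q c qh qt l β r)
    (h0 : 0 < qh → prevArc F D (Q (qh - 1)) β = 0) (hq : qh < qt) :
    BfsInv M F T D t C R Q c (qh + 1) qt l M r where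
  __ := h
  qle := hq
  rle := by have := h.rle; omega
  β_le := le_rfl
  scanned j hj a ha hD hF hβ := by
    by_cases hjq : j = qh
    · have := hβ (by omega); omega
    · exact h.scanned_all h0 j (by omega) a ha hD hF

/-- Skipping a candidate that has been visited. -/
theorem skip (h : BfsInv M F T D t C R Q c qh qt l β r) (hc : c < M) (hC : C (F c) ≠ 0) :
    BfsInv M F T D t C R Q (c + 1) qh qt l β r where
  __ := h
  cM := hc
  cand a ha := by
    rcases Nat.lt_succ_iff_lt_or_eq.1 ha with ha | rfl
    · exact h.cand a ha
    · by_contra hn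
      push Not at hn
      exact hC ((h.zero_iff _ (Or.inr ⟨a, hc, rfl⟩)).2 hn)

end BfsInv

/-! ### The search in the machine -/

/-- The outcome of the search: labels `C` and parents `R` of the nodes, which were visited in the
order `Q 0, …, Q (m - 1)`, beginning with `t`. -/
structure SearchResult (M : ℕ) (F T : ℕ → ℕ) (D : ℕ → Prop) (t : ℕ) (C R Q : ℕ → ℕ) (m : ℕ) :
    Prop where
  arc : ∀ a < M, D a → C (T a) = C (F a)
  label : ∀ y, (y = t ∨ ∃ a < M, F a = y) →
    ∃ r, C y = r + 1 ∧ Relation.ReflTransGen (ArcRel M F T D) r y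
  visited : ∀ y, (y = t ∨ ∃ a < M, F a = y) → ∃ j < m, Q j = y
  parent : ∀ j < m, C (Q j) = Q j + 1 ∨
    ∃ j' < j, R (Q j) = Q j' ∧ C (Q j) = C (Q j') ∧ ArcRel M F T D (Q j') (Q j)
  inj : ∀ i < m, ∀ j < m, Q i = Q j → i = j
  root : C t = t + 1
  le : m ≤ M + 1

open Cmd in
/-- One step of the search. -/
def bfsStep : Cmd :=
  ite (.le (.const 1) (.var 44))
    (setVar 48 (.sub (.var 44) (.const 1)) ;;
     setVar 47 (.get 13 (.var 48)) ;;
     setVar 44 (.get 15 (.var 48)) ;;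
     ite (.le (.get 16 (.var 47)) (.const 0))
       (setArr 16 (.var 47) (.succ (.var 46)) ;;
        setArr 17 (.var 47) (.var 45) ;;
        setArr 18 (.var 43) (.var 47) ;;
        setVar 43 (.succ (.var 43)))
       skip)
    (ite (.lt (.var 42) (.var 43))
      (setVar 45 (.get 18 (.var 42)) ;;
       setVar 42 (.succ (.var 42)) ;;
       setVar 44 (.get 14 (.var 45)))
      (setVar 47 (.get 12 (.var 41)) ;;
       setVar 41 (.succ (.var 41)) ;;
       ite (.le (.get 16 (.var 47)) (.const 0))
         (setArr 16 (.var 47) (.succ (.var 47)) ;;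
          setArr 17 (.var 47) (.var 47) ;;
          setArr 18 (.var 43) (.var 47) ;;
          setVar 43 (.succ (.var 43)) ;;
          setVar 46 (.var 47))
         skip))

/-- The search is not complete. -/
def bfsTest : Test :=
  .neg (.both (.both (.le (.var 44) (.const 0)) (.le (.var 43) (.var 42)))
    (.le (.var 20) (.var 41)))

open Cmd in
/-- One step of the initialization of the labels and lists. -/
def clearStep : Cmd :=
  setArr 16 (.get 12 (.var 40)) (.const 0) ;;
  setArr 14 (.get 12 (.var 40)) (.const 0) ;;
  setVar 40 (.succ (.var 40))

open Cmd in
/-- Adds the arc to the list of its initial node if it satisfies `b`. -/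
def linkStep (b : Test) : Cmd :=
  ite b
    (setArr 15 (.var 40) (.get 14 (.get 12 (.var 40))) ;;
     setArr 14 (.get 12 (.var 40)) (.succ (.var 40)))
    skip ;;
  setVar 40 (.succ (.var 40))

open Cmd in
/-- Computes the components of the graph formed by those arcs that satisfy `b`, beginning with the
component of the node in variable `22`. -/
def searchCmd (b : Test) : Cmd :=
  setVar 40 (.const 0) ;;
  loop (.lt (.var 40) (.var 20)) clearStep ;;
  (setArr 14 (.var 22) (.const 0) ;; setVar 40 (.const 0)) ;;
  loop (.lt (.var 40) (.var 20)) (linkStep b) ;;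
  (setArr 16 (.var 22) (.succ (.var 22)) ;; setArr 18 (.const 0) (.var 22) ;;
    setVar 41 (.const 0) ;; setVar 42 (.const 0) ;; setVar 43 (.const 1) ;;
    setVar 44 (.const 0) ;; setVar 46 (.var 22)) ;;
  loop bfsTest bfsStep

section

variable {P : Program} {O : Oracle}

/-- The linked lists of arcs are complete. -/
def Linked (M : ℕ) (F : ℕ → ℕ) (D : ℕ → Prop) (t : ℕ) (H X : ℕ → ℕ) : Prop :=
  (∀ x, (x = t ∨ ∃ a < M, F a = x) → H x = prevArc F D x M) ∧
    ∀ a < M, D a → X a = prevArc F D (F a) a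

/-- A step scans one arc of the current node, or takes the next node out of the queue, or, when the
queue is exhausted, tests the initial node of the next arc as the root of a new component. The lists
of arcs run downwards in the arc numbers, so a single bound `β` records what has been scanned. -/
theorem run_bfs {M t : ℕ} {F T : ℕ → ℕ} {D : ℕ → Prop} (hD : ArcSymm M F T D) (μ : Mem)
    (hM : μ.var 20 = M) (hF : μ.arr 12 = F) (hT : μ.arr 13 = T)
    (hL : Linked M F D t (μ.arr 14) (μ.arr 15))
    (hI : BfsInv M F T D t (μ.arr 16) (μ.arr 17) (μ.arr 18) 0 0 1 t M 0)
    (h41 : μ.var 41 = 0) (h42 : μ.var 42 = 0) (h43 : μ.var 43 = 1) (h44 : μ.var 44 = 0)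
    (h46 : μ.var 46 = t) :
    Run P O (.loop bfsTest bfsStep) μ ((bfsTest.cost + bfsStep.ub) * (4 * M + 1) + bfsTest.cost)
      fun μ' => ∃ m, SearchResult M F T D t (μ'.arr 16) (μ'.arr 17) (μ'.arr 18) m := by
  set A := bfsTest.cost + bfsStep.ub with hA
  -- The credit counts unscanned arcs and untested roots twice and waiting nodes once. Scanning an
  -- arc or testing a root may add a node to the queue, and still the credit drops by at least one
  -- step.
  set I : ℕ → Mem → Prop := fun n μ => ∃ β r,
    BfsInv M F T D t (μ.arr 16) (μ.arr 17) (μ.arr 18) (μ.var 41) (μ.var 42) (μ.var 43) (μ.var 46)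
      β r ∧ μ.arr 12 = F ∧ μ.arr 13 = T ∧ μ.var 20 = M ∧ Linked M F D t (μ.arr 14) (μ.arr 15) ∧
    (0 < μ.var 42 → μ.var 44 = prevArc F D (μ.arr 18 (μ.var 42 - 1)) β ∧
      μ.var 45 = μ.arr 18 (μ.var 42 - 1)) ∧
    (μ.var 44 ≠ 0 → r < μ.var 42) ∧
    n = A * (2 * BfsInv.todo M F (μ.arr 18) (μ.var 42) β + (μ.var 43 - μ.var 42) +
      2 * (M - μ.var 41)) with hIdef
  have h0 : I (A * (2 * BfsInv.todo M F (μ.arr 18) 0 M + 1 + 2 * M)) μ := by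
    refine ⟨M, 0, ?_, hF, hT, hM, hL, ?_, ?_, ?_⟩
    · rw [h41, h42, h43, h46]; exact hI
    · rw [h42]; simp
    · rw [h44]; simp
    · rw [h41, h42, h43]; simp
  have hle : BfsInv.todo M F (μ.arr 18) 0 M ≤ M := BfsInv.todo_le
  refine (Run.loop I ?_ h0).mono ?_ ?_
  · rintro n μ₁ ⟨β, r, hinv, hF, hT, hM, hL, hx, hr, rfl⟩ hb
    refine ⟨bfsStep.ub, Run.simple rfl ?_⟩
    have hle := hinv.qle
    by_cases hh : 1 ≤ μ₁.var 44
    · have hpos : 0 < μ₁.var 42 := by have := hr (by omega); omega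
      obtain ⟨hx1, hx2⟩ := hx hpos
      obtain ⟨b, hb'⟩ : ∃ b, μ₁.var 44 = b + 1 := ⟨_, (Nat.succ_pred_eq_of_pos hh).symm⟩
      rw [hb'] at hx1
      obtain ⟨p1, p2, p3, p4⟩ := prevArc_eq_succ hx1.symm
      have hbM : b < M := p1.trans_le hinv.β_le
      have hlab : μ₁.arr 16 (μ₁.arr 18 (μ₁.var 42 - 1)) = μ₁.var 46 + 1 :=
        hinv.label _ (by omega) (by have := hr (by omega); omega)
      obtain ⟨a', ha', hDa', hFa', hTa'⟩ := hD b hbM p2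
      have hrel : ArcRel M F T D (μ₁.arr 18 (μ₁.var 42 - 1)) (T b) := ⟨b, hbM, p2, p3, rfl⟩
      have hnext : μ₁.arr 15 b = prevArc F D (μ₁.arr 18 (μ₁.var 42 - 1)) b := by
        rw [hL.2 b hbM p2, p3]
      by_cases hC : μ₁.arr 16 (T b) ≤ 0
      · have hC0 : μ₁.arr 16 (T b) = 0 := by omega
        have hreach : Relation.ReflTransGen (ArcRel M F T D) (μ₁.var 46) (T b) := by
          obtain ⟨r', hr', hr''⟩ := hinv.reach (μ₁.var 42 - 1) (by omega)
          obtain rfl : r' = μ₁.var 46 := by omega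
          exact hr''.tail hrel
        have hpush := hinv.push (v := μ₁.var 45) (l' := μ₁.var 46) ⟨a', ha', hFa'⟩ hC0 hinv.rle
          hinv.closed hinv.label hreach
          (Or.inr ⟨_, by omega, hx2, hlab, hrel⟩)
        have hny := (hinv.zero_iff (T b) (Or.inr ⟨a', ha', hFa'⟩)).1 hC0
        have hQ : ∀ j < μ₁.var 42, Function.update (μ₁.arr 18) (μ₁.var 43) (T b) j =
          μ₁.arr 18 j := fun j hj => Function.update_of_ne (by omega) _ _
        have hscan := hpush.scan p1 hpos (fun a h h' hDa => by
          rw [hQ _ (by omega)]; exact p4 a h h' hDa) (by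
          rw [hQ _ (by omega), Function.update_self, Function.update_of_ne (hny _ (by omega)), hlab])
        have htodo := hinv.todo_scan hpos p1 p3 hQ
        have hmul := Nat.mul_le_mul_left A (show 1 + (2 * BfsInv.todo M F
          (Function.update (μ₁.arr 18) (μ₁.var 43) (T b)) (μ₁.var 42) b +
          (μ₁.var 43 + 1 - μ₁.var 42) + 2 * (M - μ₁.var 41)) ≤
          2 * BfsInv.todo M F (μ₁.arr 18) (μ₁.var 42) β + (μ₁.var 43 - μ₁.var 42) +
          2 * (M - μ₁.var 41) by omega)
        refine ⟨_, ⟨b, r, ?_, ?_, ?_, ?_, ?_, ?_, ?_, rfl⟩, ?_⟩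
        · simpa [bfsStep, hh, hb', hT, hC] using hscan
        · simpa [bfsStep, hh, hb', hT, hC] using hF
        · simp [bfsStep, hb', hT, hC]
        · simpa [bfsStep, hh, hb', hT, hC] using hM
        · simpa [bfsStep, hh, hb', hT, hC] using hL
        · have := hQ (μ₁.var 42 - 1) (by omega)
          simp [bfsStep, hb', hT, hC, this, hx2, hnext]
        · have := hr (by omega)
          simp [bfsStep, hb', hT, hC, this]
        · rw [mul_add, mul_one] at hmul
          rw [← hA]
          simpa [bfsStep, hh, hb', hT, hC] using hmul
      · have hCT : μ₁.arr 16 (T b) = μ₁.arr 16 (μ₁.arr 18 (μ₁.var 42 - 1)) := by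
          have hv : ∃ j < μ₁.var 43, μ₁.arr 18 j = T b := by
            by_contra hn
            push Not at hn
            have := (hinv.zero_iff (T b) (Or.inr ⟨a', ha', hFa'⟩)).2 hn
            omega
          obtain ⟨j, hj, hjT⟩ := hv
          by_cases hjr : r ≤ j
          · rw [← hjT, hinv.label j hj hjr, hlab]
          -- The end of the arc belongs to an earlier component, which is closed under arcs. The
          -- reverse arc therefore gives the current node the same label.
          · have := hinv.closed j (by omega) a' ha' hDa' (by rw [hFa', hjT])
            rw [hTa', p3, hjT] at this
            exact this.symm
        have hscan := hinv.scan p1 hpos p4 hCT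
        have htodo := hinv.todo_scan hpos p1 p3 (fun j _ => rfl)
        have hmul := Nat.mul_le_mul_left A (show 1 + (2 * BfsInv.todo M F
          (μ₁.arr 18) (μ₁.var 42) b +
          (μ₁.var 43 - μ₁.var 42) + 2 * (M - μ₁.var 41)) ≤
          2 * BfsInv.todo M F (μ₁.arr 18) (μ₁.var 42) β + (μ₁.var 43 - μ₁.var 42) +
          2 * (M - μ₁.var 41) by omega)
        have hC' : μ₁.arr 16 (T b) ≠ 0 := by omega
        refine ⟨_, ⟨b, r, ?_, ?_, ?_, ?_, ?_, ?_, ?_, rfl⟩, ?_⟩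
        · simpa [bfsStep, hh, hb', hT, hC'] using hscan
        · simpa [bfsStep, hh, hb', hT, hC'] using hF
        · simp [bfsStep, hb', hT, hC']
        · simpa [bfsStep, hh, hb', hT, hC'] using hM
        · simpa [bfsStep, hh, hb', hT, hC'] using hL
        · simp [bfsStep, hb', hT, hC', hx2, hnext]
        · have := hr (by omega)
          simp [bfsStep, hb', hT, hC', this]
        · rw [mul_add, mul_one] at hmul
          rw [← hA]
          simpa [bfsStep, hh, hb', hT, hC'] using hmul
    · have hh0 : μ₁.var 44 = 0 := by omega
      have hz : 0 < μ₁.var 42 → prevArc F D (μ₁.arr 18 (μ₁.var 42 - 1)) β = 0 := fun h => by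
        rw [← (hx h).1, hh0]
      by_cases hq : μ₁.var 42 < μ₁.var 43
      · have hq' : μ₁.var 42 + 1 ≤ μ₁.var 43 := hq
        have hnx := hinv.next hz hq
        have hhead : μ₁.arr 14 (μ₁.arr 18 (μ₁.var 42)) =
            prevArc F D (μ₁.arr 18 (μ₁.var 42)) M := hL.1 _ (hinv.touched _ hq)
        have htodo : BfsInv.todo M F (μ₁.arr 18) (μ₁.var 42 + 1) M ≤ _ :=
          BfsInv.todo_next (β := β)
        have hmul := Nat.mul_le_mul_left A (show 1 + (2 * BfsInv.todo M F
          (μ₁.arr 18) (μ₁.var 42 + 1) M +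
          (μ₁.var 43 - (μ₁.var 42 + 1)) + 2 * (M - μ₁.var 41)) ≤
          2 * BfsInv.todo M F (μ₁.arr 18) (μ₁.var 42) β + (μ₁.var 43 - μ₁.var 42) +
          2 * (M - μ₁.var 41) by omega)
        have hrle := hinv.rle
        refine ⟨_, ⟨M, r, ?_, ?_, ?_, ?_, ?_, ?_, ?_, rfl⟩, ?_⟩
        · simpa [bfsStep, hh0, hq'] using hnx
        · simpa [bfsStep, hh0, hq'] using hF
        · simpa [bfsStep, hh0, hq'] using hT
        · simpa [bfsStep, hh0, hq'] using hM
        · simpa [bfsStep, hh0, hq'] using hL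
        · simpa [bfsStep, hh0, hq'] using hhead
        · simp [bfsStep, hh0, hq']; omega
        · rw [mul_add, mul_one] at hmul
          rw [← hA]
          simpa [bfsStep, hh0, hq'] using hmul
      · have hq' : ¬ μ₁.var 42 + 1 ≤ μ₁.var 43 := by omega
        have hc : μ₁.var 41 < M := by
          simp [bfsTest, hh0, hM] at hb
          omega
        have hqe : μ₁.var 43 = μ₁.var 42 := by omega
        have hmul := fun x : ℕ → ℕ => Nat.mul_le_mul_left A (show 1 + (2 * x 0 +
          (μ₁.var 43 + 1 - μ₁.var 42) + 2 * (M - (μ₁.var 41 + 1))) ≤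
          2 * x 0 + (μ₁.var 43 - μ₁.var 42) +
          2 * (M - μ₁.var 41) by omega)
        by_cases hC : μ₁.arr 16 (F (μ₁.var 41)) ≤ 0
        · have hC0 : μ₁.arr 16 (F (μ₁.var 41)) = 0 := by omega
          -- The new component starts at the head of the queue; everything before it is completely
          -- scanned, hence closed under arcs.
          have hpush := hinv.push (v := F (μ₁.var 41)) (l' := F (μ₁.var 41))
            ⟨_, hc, rfl⟩ hC0 (le_refl (μ₁.var 42)) (hinv.scanned_all hz)
            (fun j hj hj' => by omega) .refl (Or.inl rfl)
          have hskip := hpush.skip hc (by simp)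
          have hQ : ∀ j < μ₁.var 42, Function.update (μ₁.arr 18) (μ₁.var 43) (F (μ₁.var 41)) j =
            μ₁.arr 18 j := fun j hj => Function.update_of_ne (by omega) _ _
          have htodo : BfsInv.todo M F (Function.update (μ₁.arr 18) (μ₁.var 43) (F (μ₁.var 41)))
              (μ₁.var 42) β = BfsInv.todo M F (μ₁.arr 18) (μ₁.var 42) β := by
            classical
            unfold BfsInv.todo
            congr 1
            refine Finset.filter_congr fun a _ => forall₂_congr fun j hj => ?_
            rw [hQ j hj]
          have hmul := hmul fun _ => BfsInv.todo M F (μ₁.arr 18) (μ₁.var 42) β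
          refine ⟨_, ⟨β, μ₁.var 42, ?_, ?_, ?_, ?_, ?_, ?_, ?_, rfl⟩, ?_⟩
          · simpa [bfsStep, hh0, hq', hF, hC] using hskip
          · simp [bfsStep, hh0, hq', hF, hC]
          · simpa [bfsStep, hh0, hq', hF, hC] using hT
          · simpa [bfsStep, hh0, hq', hF, hC] using hM
          · simpa [bfsStep, hh0, hq', hF, hC] using hL
          · intro hpos
            simp [bfsStep, hh0, hq', hF, hC] at hpos
            have := hQ (μ₁.var 42 - 1) (by omega)
            have hx := hx hpos
            rw [hh0] at hx
            simpa [bfsStep, hh0, hq', hF, hC, this] using hx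
          · simp [bfsStep, hh0, hq', hF, hC]
          · rw [mul_add, mul_one] at hmul
            rw [← hA]
            simpa [bfsStep, hh0, hq', hF, hC, htodo] using hmul
        · have hC' : μ₁.arr 16 (F (μ₁.var 41)) ≠ 0 := by omega
          have hskip := hinv.skip hc hC'
          have hmul := (hmul fun _ => BfsInv.todo M F (μ₁.arr 18) (μ₁.var 42) β).trans' <|
            Nat.mul_le_mul_left A (show 1 + (2 * BfsInv.todo M F (μ₁.arr 18) (μ₁.var 42) β +
              (μ₁.var 43 - μ₁.var 42) + 2 * (M - (μ₁.var 41 + 1))) ≤ _ by omega)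
          refine ⟨_, ⟨β, r, ?_, ?_, ?_, ?_, ?_, ?_, ?_, rfl⟩, ?_⟩
          · simpa [bfsStep, hh0, hq', hF, hC'] using hskip
          · simp [bfsStep, hh0, hq', hF, hC']
          · simpa [bfsStep, hh0, hq', hF, hC'] using hT
          · simpa [bfsStep, hh0, hq', hF, hC'] using hM
          · simpa [bfsStep, hh0, hq', hF, hC'] using hL
          · simpa [bfsStep, hh0, hq', hF, hC'] using hx
          · simp [bfsStep, hh0, hq', hF, hC']
          · rw [mul_add, mul_one] at hmul
            rw [← hA]
            simpa [bfsStep, hh0, hq', hF, hC'] using hmul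
  · refine Nat.add_le_add_right (Nat.mul_le_mul_left _ ?_) _
    omega
  · rintro μ₁ ⟨⟨n, β, r, hinv, hF, hT, hM, hL, hx, hr, -⟩, hb⟩
    simp only [bfsTest, Test.Holds, IExp.eval, not_not, hM] at hb
    have hz : 0 < μ₁.var 42 → prevArc F D (μ₁.arr 18 (μ₁.var 42 - 1)) β = 0 := fun h => by
      rw [← (hx h).1]; omega
    have hqe : μ₁.var 42 = μ₁.var 43 := le_antisymm hinv.qle hb.1.2
    have hvis : ∀ a < M, ∃ j < μ₁.var 43, μ₁.arr 18 j = F a := fun a ha =>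
      hinv.cand a (ha.trans_le hb.2)
    have hvis' : ∀ y, (y = t ∨ ∃ a < M, F a = y) → ∃ j < μ₁.var 43, μ₁.arr 18 j = y := by
      rintro y (rfl | ⟨a, ha, rfl⟩)
      · exact ⟨0, by have := hinv.rlt; omega, hinv.root.1⟩
      · exact hvis a ha
    refine ⟨μ₁.var 43, ?_, ?_, hvis', hinv.parent, hinv.inj, hinv.root.2, ?_⟩
    · intro a ha hDa
      obtain ⟨j, hj, e⟩ := hvis a ha
      rw [hinv.scanned_all hz j (by omega) a ha hDa e.symm, e]
    · intro y hy
      obtain ⟨j, hj, rfl⟩ := hvis' y hy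
      exact hinv.reach j hj
    · classical
      have : Finset.card ((Finset.range (μ₁.var 43)).image (μ₁.arr 18)) = μ₁.var 43 := by
        rw [Finset.card_image_of_injOn, Finset.card_range]
        intro i hi j hj
        exact hinv.inj i (by simpa using hi) j (by simpa using hj)
      rw [← this]
      calc _ ≤ (insert t ((Finset.range M).image F)).card := Finset.card_le_card fun y hy => by
            obtain ⟨j, hj, rfl⟩ := Finset.mem_image.1 hy
            simpa using hinv.touched j (by simpa using hj)
        _ ≤ _ := (Finset.card_insert_le _ _).trans
            (Nat.add_le_add_right (Finset.card_image_le.trans (by simp)) _)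

end

section

variable {P : Program} {O : Oracle}

/-- Only `t` and the initial nodes of arcs are cleared, so that the time is linear in the number of
arcs, however large the numbers of the nodes are. This matters after contractions. By the
reversibility of the arcs every end of an admissible arc is also an initial node. -/
theorem run_search (b : Test) : ∃ K, ∀ {O : Oracle}
    (μ : Mem) (M t : ℕ) (F T : ℕ → ℕ) (D : ℕ → Prop),
    μ.var 20 = M → μ.var 22 = t → μ.arr 12 = F → μ.arr 13 = T → ArcSymm M F T D →
    (∀ μ' : Mem, μ'.real = μ.real → (b.Holds μ' ↔ D (μ'.var 40))) →
    Run P O (searchCmd b) μ (K * (M + 1)) fun μ' =>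
      ∃ m, SearchResult M F T D t (μ'.arr 16) (μ'.arr 17) (μ'.arr 18) m := by
  refine ⟨clearStep.ub + (linkStep b).ub + 4 * (bfsTest.cost + bfsStep.ub) + bfsTest.cost + 100,
    fun {O} μ M t F T D hM ht hF hT hD hb => ?_⟩
  have h₁ : ∀ μ₁, μ₁.var 40 = 0 → μ₁.var 20 = M → μ₁.arr 12 = F →
      Run P O (.loop (.lt (.var 40) (.var 20)) clearStep) μ₁
        ((M - 0) * (5 + clearStep.ub) + 5)
        fun μ₂ => ∀ a < M, μ₂.arr 16 (F a) = 0 ∧ μ₂.arr 14 (F a) = 0 := by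
    intro μ₁ k1 k2 k3
    refine (Run.for_range (i := 0) (m := M) (t := clearStep.ub) (fun r μ₂ => μ₂.var 40 = r ∧
      μ₂.var 20 = M ∧ μ₂.arr 12 = F ∧ ∀ a < r, μ₂.arr 16 (F a) = 0 ∧ μ₂.arr 14 (F a) = 0)
      (Nat.zero_le _) ?_ ?_ ⟨k1, k2, k3, by simp⟩).mono le_rfl ?_
    · rintro r μ₂ - hr ⟨l1, l2, l3, l4⟩
      refine ⟨by simp [l1, l2]; omega, Run.simple rfl ?_⟩
      simp only [clearStep, Cmd.step, IExp.eval, Function.update_self, ne_eq,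
        Nat.reduceEqDiff, not_false_eq_true, Function.update_of_ne, l1, l2, l3, true_and]
      intro a ha
      rcases Nat.lt_succ_iff_lt_or_eq.1 ha with h | rfl
      · simp only [Function.update_apply]
        split_ifs <;> simp [l4 a h]
      · simp
    · rintro μ₂ ⟨l1, l2, -⟩
      simp [l1, l2]
    · rintro μ₂ ⟨-, -, -, l4⟩
      exact l4
  have h₂ : ∀ μ₁, μ₁.var 40 = 0 → μ₁.var 20 = M → μ₁.arr 12 = F → μ₁.real = μ.real →
      (∀ a < M, μ₁.arr 14 (F a) = 0) → μ₁.arr 14 t = 0 →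
      Run P O (.loop (.lt (.var 40) (.var 20)) (linkStep b)) μ₁
        ((M - 0) * (5 + (linkStep b).ub) + 5)
        fun μ₂ => Linked M F D t (μ₂.arr 14) (μ₂.arr 15) := by
    intro μ₁ k1 k2 k3 k4 k5 k6
    refine (Run.for_range (i := 0) (m := M) (t := (linkStep b).ub) (fun r μ₂ => μ₂.var 40 = r ∧
      μ₂.var 20 = M ∧ μ₂.arr 12 = F ∧ μ₂.real = μ.real ∧
      (∀ x, (x = t ∨ ∃ a < M, F a = x) → μ₂.arr 14 x = prevArc F D x r) ∧
      ∀ a < r, D a → μ₂.arr 15 a = prevArc F D (F a) a)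
      (Nat.zero_le _) ?_ ?_ ⟨k1, k2, k3, k4, ?_, by simp⟩).mono le_rfl ?_
    · rintro r μ₂ - hr ⟨l1, l2, l3, l4, l5, l6⟩
      refine ⟨by simp [l1, l2]; omega, Run.simple rfl ?_⟩
      have hbr := hb μ₂ l4
      rw [l1] at hbr
      by_cases hDr : D r
      · simp only [linkStep, Cmd.step, hbr, hDr, if_true, IExp.eval, Function.update_self, ne_eq,
          Nat.reduceEqDiff, not_false_eq_true, Function.update_of_ne, l1, l2, l3, true_and, l4]
        constructor
        · intro x hx
          rw [prevArc]
          by_cases hxr : F r = x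
          · subst hxr; simp [hDr]
          · rw [Function.update_of_ne (Ne.symm hxr), l5 x hx, if_neg fun h => hxr h.2]
        · intro a ha hDa
          rcases Nat.lt_succ_iff_lt_or_eq.1 ha with h | rfl
          · rw [Function.update_of_ne h.ne]; exact l6 a h hDa
          · rw [Function.update_self]; exact l5 _ (Or.inr ⟨_, hr, rfl⟩)
      · simp only [linkStep, Cmd.step, hbr, hDr, if_false, IExp.eval, Function.update_self, ne_eq,
          Nat.reduceEqDiff, not_false_eq_true, Function.update_of_ne, l1, l2, l3, true_and, l4]
        constructor
        · intro x hx
          rw [prevArc, if_neg fun h => hDr h.1]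
          exact l5 x hx
        · intro a ha hDa
          rcases Nat.lt_succ_iff_lt_or_eq.1 ha with h | rfl
          · exact l6 a h hDa
          · exact absurd hDa hDr
    · rintro μ₂ ⟨l1, l2, -⟩
      simp [l1, l2]
    · rintro x (rfl | ⟨a, ha, rfl⟩)
      exacts [k6, k5 a ha]
    · rintro μ₂ ⟨-, -, -, -, l5, l6⟩
      exact ⟨l5, l6⟩
  refine (Run.seq (Run.exact rfl) fun μ₁ g₁ => Run.seq ((h₁ μ₁ ?_ ?_ ?_).withFrame rfl
    fun μ₂ g f => And.intro g f) fun μ₂ g₂ => Run.seq (Run.exact rfl) fun μ₃ g₃ =>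
    Run.seq ((h₂ μ₃ ?_ ?_ ?_ ?_ ?_ ?_).withFrame rfl fun μ₄ g f => And.intro g f)
    fun μ₄ g₄ => Run.seq (Run.exact rfl) fun μ₅ g₅ =>
    run_bfs (F := F) (T := T) (t := t) hD μ₅ ?_ ?_ ?_ ?_ ?_ ?_ ?_ ?_ ?_ ?_).mono
      (t := _) ?_ fun _ => id
  · simp [g₁]
  · simp [g₁, hM]
  · simp [g₁, hF]
  rotate_right
  · generalize clearStep.ub = x
    generalize (linkStep b).ub = y
    generalize bfsTest.cost = z
    generalize bfsStep.ub = w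
    simp
    nlinarith
  all_goals obtain ⟨g₂, f₂⟩ := g₂
  all_goals
    have v20 := f₂.var 20 (by decide)
    have v22 := f₂.var 22 (by decide)
    have a12 := f₂.arr 12 (by decide)
    have a13 := f₂.arr 13 (by decide)
    have rl : μ₂.real = μ₁.real := funext fun R => f₂.real R (by simp [Cmd.wr, clearStep])
    simp [g₁] at v20 v22 a12 a13 rl
  · simp [g₃]
  · simp [g₃, v20, hM]
  · simp [g₃, a12, hF]
  · simp [g₃, rl]
  · intro a ha
    simp [g₃, Function.update_apply, (g₂ a ha).2]
  · simp [g₃, v22, ht]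
  all_goals obtain ⟨g₄, f₄⟩ := g₄
  all_goals
    have v20' := f₄.var 20 (by simp [Cmd.wv, linkStep])
    have v22' := f₄.var 22 (by simp [Cmd.wv, linkStep])
    have a12' := f₄.arr 12 (by simp [Cmd.wa, linkStep])
    have a13' := f₄.arr 13 (by simp [Cmd.wa, linkStep])
    have a16' := f₄.arr 16 (by simp [Cmd.wa, linkStep])
    simp [g₃, v20, v22, a12, a13, hM, ht, hF, hT] at v20' v22' a12' a13' a16'
  · simp [g₅, v20']
  · simp [g₅, a12']
  · simp [g₅, a13']
  · simpa [g₅] using g₄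
  · have c0 : ∀ y, (y = t ∨ ∃ a < M, F a = y) → y ≠ t → μ₅.arr 16 y = 0 := by
      rintro y (rfl | ⟨a, ha, rfl⟩) hy
      · exact absurd rfl hy
      · simp [g₅, v22', Function.update_of_ne hy, a16', (g₂ a ha).1]
    have q0 : μ₅.arr 18 0 = t := by simp [g₅, v22']
    have ct : μ₅.arr 16 t = t + 1 := by simp [g₅, v22']
    constructor
    · omega
    · omega
    · omega
    · omega
    · exact le_rfl
    · intro j hj
      obtain rfl : j = 0 := by omega
      exact Or.inl q0
    · intro y hy
      by_cases hyt : y = t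
      · subst hyt
        simp only [ct, Nat.add_eq_zero_iff, one_ne_zero, and_false, false_iff]
        exact fun hc => hc 0 (by omega) q0
      · simp only [c0 y hy hyt, true_iff]
        intro j hj
        obtain rfl : j = 0 := by omega
        rw [q0]; exact Ne.symm hyt
    · intro j hj
      obtain rfl : j = 0 := by omega
      rw [q0, ct]; exact ⟨t, rfl, .refl⟩
    · intro j hj
      obtain rfl : j = 0 := by omega
      rw [q0, ct]; exact Or.inl rfl
    · intro i hi j hj _; omega
    · intro j hj; omega
    · intro j hj; omega
    · intro j hj _
      obtain rfl : j = 0 := by omega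
      rw [q0, ct]
    · intro a ha; omega
    · exact ⟨q0, ct⟩
  · simp [g₅]
  · simp [g₅]
  · simp [g₅]
  · simp [g₅]
  · simp [g₅, v22']

end

/-! ## Bottleneck paths in linear time -/

/-- The set of the arcs with the numbers `a < M`, with their weights. -/
def arcSet (M : ℕ) (F T : ℕ → ℕ) (W : ℕ → ℝ) : Set (ℕ × ℕ × ℝ) :=
  {e | ∃ a < M, e = (F a, T a, W a)}

/-- A path of arcs from `S` with weights in `D` joins `u` and `v`. -/
def Conn (S : Set (ℕ × ℕ × ℝ)) (D : Set ℝ) : ℕ → ℕ → Prop :=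
  Relation.ReflTransGen fun u v => ∃ w ∈ D, (u, v, w) ∈ S

/-- Every arc of `S` has a reverse arc of the same weight. -/
def SymmArcs (S : Set (ℕ × ℕ × ℝ)) : Prop := ∀ u v w, (u, v, w) ∈ S → (v, u, w) ∈ S

theorem arcRel_iff {M : ℕ} {F T : ℕ → ℕ} {W : ℕ → ℝ} {D : Set ℝ} {u v : ℕ} :
    ArcRel M F T (fun a => W a ∈ D) u v ↔ ∃ w ∈ D, (u, v, w) ∈ arcSet M F T W := by
  constructor
  · rintro ⟨a, ha, hD, rfl, rfl⟩
    exact ⟨_, hD, a, ha, rfl⟩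
  · rintro ⟨w, hD, a, ha, e⟩
    simp only [Prod.mk.injEq] at e
    exact ⟨a, ha, by beta_reduce; rw [← e.2.2]; exact hD, e.1.symm, e.2.1.symm⟩

theorem arcRel_eq {M : ℕ} {F T : ℕ → ℕ} {W : ℕ → ℝ} {D : Set ℝ} :
    Relation.ReflTransGen (ArcRel M F T fun a => W a ∈ D) = Conn (arcSet M F T W) D := by
  unfold Conn
  congr 1
  ext u v
  exact arcRel_iff

theorem SymmArcs.arcSymm {M : ℕ} {F T : ℕ → ℕ} {W : ℕ → ℝ} (h : SymmArcs (arcSet M F T W))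
    (D : Set ℝ) : ArcSymm M F T fun a => W a ∈ D := by
  intro a ha hD
  obtain ⟨a', ha', e⟩ := h _ _ _ ⟨a, ha, rfl⟩
  simp only [Prod.mk.injEq] at e
  exact ⟨a', ha', by beta_reduce; rw [← e.2.2]; exact hD, e.1.symm, e.2.1.symm⟩

theorem Conn.symm {S : Set (ℕ × ℕ × ℝ)} (h : SymmArcs S) {D : Set ℝ} {u v : ℕ}
    (huv : Conn S D u v) : Conn S D v u := by
  induction huv with
  | refl => exact .refl
  | tail _ hbc ih =>
    obtain ⟨w, hw, hS⟩ := hbc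
    exact .head ⟨w, hw, h _ _ _ hS⟩ ih

theorem Conn.mono {S S' : Set (ℕ × ℕ × ℝ)} {D D' : Set ℝ} {u v : ℕ} (huv : Conn S D u v)
    (h : ∀ u v w, (u, v, w) ∈ S → w ∈ D → (u, v, w) ∈ S' ∧ w ∈ D') : Conn S' D' u v :=
  Relation.ReflTransGen.mono (fun _ _ ⟨w, hw, hS⟩ => ⟨w, (h _ _ _ hS hw).2, (h _ _ _ hS hw).1⟩) _ _ huv

/-- Contracting the components of the graph of the arcs of weight at most `p`. -/
theorem conn_contract {S S' : Set (ℕ × ℕ × ℝ)} (hS : SymmArcs S) {p : ℝ} {l : ℕ → ℕ}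
    (h₁ : ∀ u v w, (u, v, w) ∈ S → w ≤ p → l u = l v)
    (h₂ : ∀ u v w, (u, v, w) ∈ S → Conn S (Set.Iic p) (l u) u)
    (hS' : ∀ e, e ∈ S' ↔ ∃ u v w, (u, v, w) ∈ S ∧ p < w ∧ e = (l u, l v, w))
    {D : Set ℝ} (hD : Set.Iic p ⊆ D) {x y : ℕ} (hx : Conn S (Set.Iic p) (l x) x)
    (hy : Conn S (Set.Iic p) (l y) y) : Conn S D x y ↔ Conn S' D (l x) (l y) := by
  have up : ∀ {u v}, Conn S (Set.Iic p) u v → Conn S D u v := fun h =>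
    h.mono fun _ _ _ h h' => ⟨h, hD h'⟩
  constructor
  · intro h
    clear hy
    induction h with
    | refl => exact .refl
    | tail _ hbc ih =>
      obtain ⟨w, hw, hS''⟩ := hbc
      -- A light arc stays within one component and disappears; a heavy arc survives between the
      -- representatives.
      by_cases hwp : w ≤ p
      · rw [← h₁ _ _ _ hS'' hwp]; exact ih
      · exact ih.tail ⟨w, hw, (hS' _).2 ⟨_, _, _, hS'', not_le.1 hwp, rfl⟩⟩
  · intro h
    have key : ∀ u v, Conn S' D u v → Conn S D u v := by
      intro u v huv
      induction huv with
      | refl => exact .refl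
      | tail _ hbc ih =>
        obtain ⟨w, hw, hS''⟩ := hbc
        obtain ⟨u', v', w', hm, -, e⟩ := (hS' _).1 hS''
        simp only [Prod.mk.injEq] at e
        obtain ⟨rfl, rfl, rfl⟩ := e
        -- An arc of the contracted graph unfolds to a walk from the representative to the true
        -- initial node, along the original arc, and on to the representative of its end.
        exact ih.trans ((up (h₂ _ _ _ hm)).trans
          ((Relation.ReflTransGen.single ⟨w, hw, hm⟩).trans
            (Conn.symm hS (up (h₂ _ _ _ (hS _ _ _ hm))))))
    exact (Conn.symm hS (up hx)).trans ((key _ _ h).trans (up hy))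

/-! ### Compaction of the list of arcs -/

open Cmd in
/-- One step of `filterCmd`. -/
def filterStep (b : Test) (g : IExp → IExp) : Cmd :=
  ite b
    (setArr 12 (.var 49) (g (.get 12 (.var 40))) ;;
     setArr 13 (.var 49) (g (.get 13 (.var 40))) ;;
     setReal 12 (.var 49) (.get 12 (.var 40)) ;;
     setVar 49 (.succ (.var 49)))
    skip ;;
  setVar 40 (.succ (.var 40))

open Cmd in
/-- Keeps only those arcs that satisfy `b`, and replaces their ends by means of `g`. -/
def filterCmd (b : Test) (g : IExp → IExp) : Cmd :=
  (setVar 40 (.const 0) ;; setVar 49 (.const 0)) ;;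
  loop (.lt (.var 40) (.var 20)) (filterStep b g) ;;
  setVar 20 (.var 49)

section

variable {P : Program} {O : Oracle}

/-- The compaction works in place, as the writing position never overtakes the reading position. The
map `g` is the identity or the passage to component labels, and may depend on the memory only
through the array of labels. -/
theorem run_filter (b : Test) (g : IExp → IExp) : ∃ K, ∀ {O : Oracle}
    (μ : Mem) (M : ℕ) (F T : ℕ → ℕ)
    (W : ℕ → ℝ) (D : Set ℝ) (l : ℕ → ℕ), μ.var 20 = M → μ.arr 12 = F → μ.arr 13 = T →
    μ.real 12 = W →
    (∀ (μ' : Mem), μ'.real 7 = μ.real 7 → (b.Holds μ' ↔ μ'.real 12 (μ'.var 40) ∈ D)) →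
    (∀ (μ' : Mem) e, μ'.arr 16 = μ.arr 16 → (g e).eval μ' = l (e.eval μ')) →
    Run P O (filterCmd b g) μ (K * (M + 1)) fun μ' => μ'.var 20 = cntIn W D 0 M ∧
      ∀ e, e ∈ arcSet (μ'.var 20) (μ'.arr 12) (μ'.arr 13) (μ'.real 12) ↔
        ∃ u v w, (u, v, w) ∈ arcSet M F T W ∧ w ∈ D ∧ e = (l u, l v, w) := by
  refine ⟨(filterStep b g).ub + 100, fun {O} μ M F T W D l hM hF hT hW hb hg => ?_⟩
  set I : ℕ → Mem → Prop := fun i μ₁ => μ₁.var 40 = i ∧ μ₁.var 20 = M ∧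
    μ₁.var 49 = cntIn W D 0 i ∧ μ₁.real 7 = μ.real 7 ∧ μ₁.arr 16 = μ.arr 16 ∧
    (∀ a, i ≤ a → μ₁.arr 12 a = F a ∧ μ₁.arr 13 a = T a ∧ μ₁.real 12 a = W a) ∧
    (∀ o < μ₁.var 49, ∃ a < i, W a ∈ D ∧ μ₁.arr 12 o = l (F a) ∧ μ₁.arr 13 o = l (T a) ∧
      μ₁.real 12 o = W a) ∧
    ∀ a < i, W a ∈ D → ∃ o < μ₁.var 49, μ₁.arr 12 o = l (F a) ∧ μ₁.arr 13 o = l (T a) ∧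
      μ₁.real 12 o = W a with hI
  have h₁ : ∀ μ₁, I 0 μ₁ → Run P O (.loop (.lt (.var 40) (.var 20)) (filterStep b g)) μ₁
      ((M - 0) * (5 + (filterStep b g).ub) + 5) (I M) := by
    intro μ₁ h
    refine Run.for_range I (Nat.zero_le _) ?_ ?_ h
    · rintro i μ₂ - hi ⟨k1, k2, k3, k4, k5, k6, k7, k8⟩
      refine ⟨by simp [k1, k2]; omega, Run.simple rfl ?_⟩
      have hbi := hb μ₂ k4
      rw [k1, (k6 i le_rfl).2.2] at hbi
      have hsucc := cntIn_add (Z := W) (D := D) (a := 0) (b := i) (c := i + 1) (Nat.zero_le _)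
        (Nat.le_succ i)
      have hle := cntIn_le W D 0 i
      by_cases hDi : W i ∈ D
      · have h1 : cntIn W D i (i + 1) = i + 1 - i := cntIn_of_forall fun x hx hx' => by
          obtain rfl : x = i := by omega
          exact hDi
        have hoi : μ₂.var 49 ≤ i := by omega
        have hg1 := hg μ₂ (.get 12 (.var 40)) k5
        -- By the time the second end is read, an entry of array `12` has been overwritten; this
        -- does not affect `g`.
        have hg2 := hg { μ₂ with arr := (Function.update μ₂.arr 12
          (Function.update (μ₂.arr 12) (μ₂.var 49) (l (F i)))) } (.get 13 (.var 40)) (by simpa using k5)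
        simp [k1, (k6 i le_rfl).1] at hg1
        simp [k1, (k6 i le_rfl).2.1] at hg2
        simp only [hI, filterStep, Cmd.step, hbi, hDi, if_true, IExp.eval, RExp.eval, hg1, hg2,
          Function.update_self, ne_eq, Nat.reduceEqDiff, not_false_eq_true, Function.update_of_ne,
          k1, k2, true_and, k4, k5, (k6 i le_rfl).2.2]
        refine ⟨by omega, ?_, ?_, ?_⟩
        · intro a ha
          simp only [Function.update_of_ne (show a ≠ μ₂.var 49 by omega)]
          exact k6 a (by omega)
        · intro o ho
          rcases Nat.lt_succ_iff_lt_or_eq.1 ho with h | rfl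
          · simp only [Function.update_of_ne h.ne]
            obtain ⟨a, ha, h'⟩ := k7 o h
            exact ⟨a, by omega, h'⟩
          · simp only [Function.update_self]
            exact ⟨i, by omega, hDi, rfl, rfl, rfl⟩
        · intro a ha hDa
          rcases Nat.lt_succ_iff_lt_or_eq.1 ha with h | rfl
          · obtain ⟨o, ho, h'⟩ := k8 a h hDa
            refine ⟨o, by omega, ?_⟩
            simp only [Function.update_of_ne ho.ne]
            exact h'
          · refine ⟨μ₂.var 49, by omega, ?_⟩
            simp only [Function.update_self, true_and]
      · have h1 : cntIn W D i (i + 1) = 0 := cntIn_eq_zero fun x hx hx' => by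
          obtain rfl : x = i := by omega
          exact hDi
        simp only [hI, filterStep, Cmd.step, hbi, hDi, if_false, IExp.eval,
          Function.update_self, ne_eq, Nat.reduceEqDiff, not_false_eq_true, Function.update_of_ne,
          k1, k2, true_and, k4, k5]
        refine ⟨by omega, fun a ha => k6 a (by omega), fun o ho => ?_, fun a ha hDa => ?_⟩
        · obtain ⟨a, ha, h'⟩ := k7 o ho
          exact ⟨a, by omega, h'⟩
        · rcases Nat.lt_succ_iff_lt_or_eq.1 ha with h | rfl
          · exact k8 a h hDa
          · exact absurd hDa hDi
    · rintro μ₂ ⟨l1, l2, -⟩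
      simp [l1, l2]
  refine (Run.seq (Run.exact rfl) fun μ₁ g₁ => Run.seq (h₁ μ₁ ?_) fun μ₂ g₂ =>
    Run.simple rfl ?_).mono (t := _) ?_ fun _ => id
  · simp [hI, g₁, hM, hF, hT, hW]
    simp [cntIn]
  · obtain ⟨k1, k2, k3, k4, k5, k6, k7, k8⟩ := g₂
    simp only [Cmd.step, IExp.eval, Function.update_self]
    refine ⟨k3, fun e => ⟨?_, ?_⟩⟩
    · rintro ⟨o, ho, rfl⟩
      obtain ⟨a, ha, h1, h2, h3, h4⟩ := k7 o ho
      exact ⟨F a, T a, W a, ⟨a, ha, rfl⟩, h1, by rw [h2, h3, h4]⟩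
    · rintro ⟨u, v, w, ⟨a, ha, e'⟩, hw, rfl⟩
      simp only [Prod.mk.injEq] at e'
      obtain ⟨rfl, rfl, rfl⟩ := e'
      obtain ⟨o, ho, h1, h2, h3⟩ := k8 a ha hw
      exact ⟨o, ho, by rw [h1, h2, h3]⟩
  · generalize (filterStep b g).ub = x
    simp
    nlinarith

end

/-! ### Pruning and contraction -/

/-- The arc is lighter than the pivot. -/
def ltPivot : Test := .rlt (.get 12 (.var 40)) (.get 7 (.const 0))

/-- The arc is at most as heavy as the pivot. -/
def lePivot : Test := .rle (.get 12 (.var 40)) (.get 7 (.const 0))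

/-- The component of the node. -/
def labelExp (e : IExp) : IExp := .sub (.get 16 e) (.const 1)

/-- The nodes in the variables `21` and `22` have the same label. -/
def joinedTest : Test := .eq (.get 16 (.var 21)) (.get 16 (.var 22))

open Cmd in
/-- One round of `bottleneckCmd`. -/
def bottleneckStep : Cmd :=
  pivotCmd ;; searchCmd ltPivot ;;
  ite joinedTest
    (filterCmd ltPivot id)
    (searchCmd lePivot ;;
     ite joinedTest
       (setVar 24 (.const 1))
       (filterCmd (.neg lePivot) labelExp ;;
        setVar 21 (labelExp (.var 21)) ;; setVar 22 (labelExp (.var 22))))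

open Cmd in
/-- Computes the bottleneck value of the nodes in the variables `21` and `22`. -/
def bottleneckCmd : Cmd :=
  setVar 24 (.const 0) ;;
  loop (.le (.var 24) (.const 0)) bottleneckStep

namespace SearchResult

variable {M : ℕ} {F T : ℕ → ℕ} {W : ℕ → ℝ} {D : Set ℝ} {t : ℕ} {C R Q : ℕ → ℕ} {m : ℕ}

theorem conn (h : SearchResult M F T (fun a => W a ∈ D) t C R Q m) {y : ℕ}
    (hy : y = t ∨ ∃ a < M, F a = y) : C y ≠ 0 ∧ Conn (arcSet M F T W) D (C y - 1) y := by
  obtain ⟨r, hr, hc⟩ := h.label y hy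
  rw [arcRel_eq] at hc
  rw [hr]
  exact ⟨by omega, hc⟩

theorem label_eq (h : SearchResult M F T (fun a => W a ∈ D) t C R Q m) {u v : ℕ}
    (huv : Conn (arcSet M F T W) D u v) : C u = C v := by
  induction huv with
  | refl => rfl
  | tail _ hbc ih =>
    obtain ⟨w, hw, a, ha, e⟩ := hbc
    simp only [Prod.mk.injEq] at e
    obtain ⟨rfl, rfl, rfl⟩ := e
    rw [ih, h.arc a ha hw]

theorem joined_iff (h : SearchResult M F T (fun a => W a ∈ D) t C R Q m)
    (hS : SymmArcs (arcSet M F T W)) {y : ℕ} (hy : y = t ∨ ∃ a < M, F a = y) :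
    C y = C t ↔ Conn (arcSet M F T W) D y t := by
  refine ⟨fun e => ?_, h.label_eq⟩
  have h₁ := (h.conn hy).2
  have h₂ := (h.conn (Or.inl rfl)).2
  rw [e] at h₁
  exact (Conn.symm hS h₁).trans h₂

end SearchResult

/-- `B` is the bottleneck value of `s` and `t`. -/
def IsBottleneck (S : Set (ℕ × ℕ × ℝ)) (s t : ℕ) (B : ℝ) : Prop :=
  Conn S (Set.Iic B) s t ∧ ¬ Conn S (Set.Iio B) s t

/-- The arcs `S` with the nodes `u` and `v` have the same bottleneck value as `S₀` with `s`, `t`. -/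
structure BottleneckInv (S₀ : Set (ℕ × ℕ × ℝ)) (s t : ℕ) (S : Set (ℕ × ℕ × ℝ)) (u v : ℕ) :
    Prop where
  symm : SymmArcs S
  ne : u ≠ v
  conn : Conn S Set.univ u v
  iic : ∀ x y w, (x, y, w) ∈ S → (Conn S₀ (Set.Iic w) s t ↔ Conn S (Set.Iic w) u v)
  iio : ∀ x y w, (x, y, w) ∈ S → (Conn S₀ (Set.Iio w) s t ↔ Conn S (Set.Iio w) u v)

namespace BottleneckInv

variable {S₀ S S' : Set (ℕ × ℕ × ℝ)} {s t u v : ℕ}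

theorem exists_arc (h : BottleneckInv S₀ s t S u v) : ∃ y w, (u, y, w) ∈ S := by
  rcases Relation.ReflTransGen.cases_head h.conn with e | ⟨y, ⟨w, -, hw⟩, -⟩
  · exact absurd e h.ne
  · exact ⟨y, w, hw⟩

/-- The remaining weights are below `p`, and for a threshold below `p` the removed arcs play no
part. -/
theorem filter_lt (h : BottleneckInv S₀ s t S u v) {p : ℝ} (hp : Conn S (Set.Iio p) u v)
    (hS' : ∀ e, e ∈ S' ↔ e ∈ S ∧ e.2.2 < p) : BottleneckInv S₀ s t S' u v := by
  have key : ∀ D : Set ℝ, D ⊆ Set.Iio p → (Conn S D u v ↔ Conn S' D u v) := fun D hD =>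
    ⟨fun h => h.mono fun _ _ w h hw => ⟨(hS' _).2 ⟨h, hD hw⟩, hw⟩,
      fun h => h.mono fun _ _ w h hw => ⟨((hS' _).1 h).1, hw⟩⟩
  refine ⟨fun x y w hw => ?_, h.ne, ?_, fun x y w hw => ?_, fun x y w hw => ?_⟩
  · rw [hS'] at hw ⊢
    exact ⟨h.symm _ _ _ hw.1, hw.2⟩
  · exact ((key _ le_rfl).1 hp).mono fun _ _ _ h _ => ⟨h, trivial⟩
  · rw [hS'] at hw
    rw [h.iic x y w hw.1, key (Set.Iic w) fun z hz => lt_of_le_of_lt hz hw.2]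
  · rw [hS'] at hw
    rw [h.iio x y w hw.1, key (Set.Iio w) fun z hz => lt_trans hz hw.2]

/-- All remaining weights exceed `p`, so every threshold in question admits the contracted arcs,
which is what `conn_contract` requires. -/
theorem contract (h : BottleneckInv S₀ s t S u v) {p : ℝ} {l : ℕ → ℕ} (hne : l u ≠ l v)
    (h₁ : ∀ u v w, (u, v, w) ∈ S → w ≤ p → l u = l v)
    (h₂ : ∀ u v w, (u, v, w) ∈ S → Conn S (Set.Iic p) (l u) u)
    (hS' : ∀ e, e ∈ S' ↔ ∃ u v w, (u, v, w) ∈ S ∧ p < w ∧ e = (l u, l v, w))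
    (hv : Conn S (Set.Iic p) (l v) v) : BottleneckInv S₀ s t S' (l u) (l v) := by
  obtain ⟨y, w, hu⟩ := h.exists_arc
  have key : ∀ D : Set ℝ, Set.Iic p ⊆ D → (Conn S D u v ↔ Conn S' D (l u) (l v)) := fun D hD =>
    conn_contract h.symm h₁ h₂ hS' hD (h₂ _ _ _ hu) hv
  refine ⟨fun x y w hw => ?_, hne, (key _ (Set.subset_univ _)).1 h.conn, fun x y w hw => ?_,
    fun x y w hw => ?_⟩
  · rw [hS'] at hw ⊢
    obtain ⟨x', y', w', hm, hp, e⟩ := hw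
    simp only [Prod.mk.injEq] at e
    obtain ⟨rfl, rfl, rfl⟩ := e
    exact ⟨_, _, _, h.symm _ _ _ hm, hp, rfl⟩
  · obtain ⟨x', y', w', hm, hp, e⟩ := (hS' _).1 hw
    simp only [Prod.mk.injEq] at e
    obtain ⟨rfl, rfl, rfl⟩ := e
    rw [h.iic _ _ _ hm, key _ (Set.Iic_subset_Iic.2 hp.le)]
  · obtain ⟨x', y', w', hm, hp, e⟩ := (hS' _).1 hw
    simp only [Prod.mk.injEq] at e
    obtain ⟨rfl, rfl, rfl⟩ := e
    rw [h.iio _ _ _ hm, key (Set.Iio _) fun z hz => lt_of_le_of_lt hz hp]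

end BottleneckInv

section

variable {P : Program} {O : Oracle}

/-- The arcs in the memory. -/
def memArcs (μ : Mem) : Set (ℕ × ℕ × ℝ) :=
  arcSet (μ.var 20) (μ.arr 12) (μ.arr 13) (μ.real 12)

/-- The two nodes are joined by arcs lighter than the pivot, or by arcs at most as heavy as the
pivot but not by lighter ones, or not even by these. The second case gives the answer. In the other
two cases the pivot guarantees that at most `63 / 64` of the arcs survive. -/
theorem run_bottleneckStep : ∃ K, ∀ {O : Oracle} (μ : Mem) (S₀ : Set (ℕ × ℕ × ℝ)) (s t : ℕ),
    BottleneckInv S₀ s t (memArcs μ) (μ.var 21) (μ.var 22) → μ.var 24 = 0 →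
    Run P O bottleneckStep μ (K * μ.var 20) fun μ' =>
      (μ'.var 24 = 0 ∧ BottleneckInv S₀ s t (memArcs μ') (μ'.var 21) (μ'.var 22) ∧
        64 * μ'.var 20 ≤ 63 * μ.var 20) ∨
      (μ'.var 24 = 1 ∧ IsBottleneck S₀ s t (μ'.real 7 0)) := by
  obtain ⟨K₁, hK₁⟩ := run_pivot (P := P)
  obtain ⟨K₂, hK₂⟩ := run_search (P := P) ltPivot
  obtain ⟨K₃, hK₃⟩ := run_search (P := P) lePivot
  obtain ⟨K₄, hK₄⟩ := run_filter (P := P) ltPivot id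
  obtain ⟨K₅, hK₅⟩ := run_filter (P := P) (.neg lePivot) labelExp
  refine ⟨K₁ + 2 * K₂ + 2 * K₃ + 2 * K₄ + 2 * K₅ + 100, fun {O} μ S₀ s t hI h24 => ?_⟩
  obtain ⟨M, hM⟩ : ∃ M, M = μ.var 20 := ⟨_, rfl⟩
  obtain ⟨y₀, w₀, a₀, ha₀, e₀⟩ := hI.exists_arc
  simp only [Prod.mk.injEq] at e₀
  rw [← hM] at ha₀
  have hM0 : 0 < M := by omega
  have hp₁ := (hK₁ (O := O) μ M hM.symm hM0).withFrame (Q' := fun μ₁ => (∃ a < M, μ₁.real 7 0 = μ.real 12 a) ∧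
      64 * cntIn (μ.real 12) {x | x < μ₁.real 7 0} 0 M ≤ 63 * M ∧
      M ≤ 64 * cntIn (μ.real 12) {x | x ≤ μ₁.real 7 0} 0 M ∧ μ₁.var 20 = M ∧
      μ₁.var 21 = μ.var 21 ∧ μ₁.var 22 = μ.var 22 ∧ μ₁.var 24 = 0 ∧ μ₁.arr 12 = μ.arr 12 ∧
      μ₁.arr 13 = μ.arr 13 ∧ μ₁.real 12 = μ.real 12) rfl fun μ₁ h f =>
    ⟨h.1, h.2.1, h.2.2, by rw [f.var 20 (by decide), hM], f.var 21 (by decide),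
      f.var 22 (by decide), by rw [f.var 24 (by decide), h24], f.arr 12 (by decide),
      f.arr 13 (by decide), f.real 12 (by decide)⟩
  have harcs : memArcs μ = arcSet M (μ.arr 12) (μ.arr 13) (μ.real 12) := by rw [memArcs, hM]
  generalize μ.var 21 = u at *
  generalize μ.var 22 = v at *
  generalize μ.arr 12 = F at *
  generalize μ.arr 13 = T at *
  generalize μ.real 12 = W at *
  rw [harcs] at hI
  rw [← hM]
  have hu : u = v ∨ ∃ a < M, F a = u := Or.inr ⟨a₀, ha₀, e₀.1.symm⟩
  refine (hp₁.seq fun μ₁ ⟨⟨a₁, ha₁, hpa⟩, hlt, hle, v20, v21, v22, v24, a12, a13, r12⟩ => ?_).mono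
    (t := K₁ * M + (K₂ * (M + 1) + (joinedTest.cost + (K₃ * (M + 1) + (joinedTest.cost +
      (K₄ * (M + 1) + K₅ * (M + 1) + 50)))))) ?_ fun _ => id
  swap
  · simp [joinedTest]
    nlinarith
  obtain ⟨p, hp⟩ : ∃ p, p = μ₁.real 7 0 := ⟨_, rfl⟩
  rw [← hp] at hpa hlt hle
  -- The pivot is the weight of an arc, so the invariant, which compares the two graphs only at such
  -- thresholds, applies to it.
  have hpW : (F a₁, T a₁, p) ∈ arcSet M F T W := ⟨a₁, ha₁, by rw [hpa]⟩
  refine ((hK₂ μ₁ M v F T (fun a => W a ∈ Set.Iio p) v20 v22 a12 a13 (hI.symm.arcSymm _)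
    ?_).withFrame rfl fun μ₂ h f => And.intro h f).seq fun μ₂ ⟨⟨m, h₂⟩, f₂⟩ => ?_
  · intro μ' h
    simp [ltPivot, h, r12, hp]
  have v20' := (f₂.var 20 (by decide)).trans v20
  have v21' := (f₂.var 21 (by decide)).trans v21
  have v22' := (f₂.var 22 (by decide)).trans v22
  have v24' := (f₂.var 24 (by decide)).trans v24
  have a12' := (f₂.arr 12 (by decide)).trans a12
  have a13' := (f₂.arr 13 (by decide)).trans a13
  have rl : μ₂.real = μ₁.real := funext fun R => f₂.real R (by decide +revert)
  have r12' : μ₂.real 12 = W := by rw [rl, r12]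
  have hp' : p = μ₂.real 7 0 := by rw [rl, hp]
  have hj₂ := h₂.joined_iff hI.symm hu
  refine Run.ite (fun hj => ?_) fun hj => ?_
  · have hj : μ₂.arr 16 u = μ₂.arr 16 v := by
      simp [joinedTest, v21', v22'] at hj; omega
    refine ((hK₄ μ₂ M F T W (Set.Iio p) id v20' a12' a13' r12' ?_ ?_).withFrame rfl
      fun μ₃ h f => And.intro h f).mono (by omega) ?_
    · intro μ' h
      simp [ltPivot, h, hp']
    · intro μ' e _
      rfl
    · rintro μ₃ ⟨⟨h, hS⟩, f⟩
      refine Or.inl ⟨(f.var 24 (by decide)).trans v24', ?_, ?_⟩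
      · rw [(f.var 21 (by decide)).trans v21', (f.var 22 (by decide)).trans v22']
        refine hI.filter_lt (hj₂.1 hj) fun e => (hS e).trans ?_
        constructor
        · rintro ⟨u, v, w, h, hw, rfl⟩
          exact ⟨h, hw⟩
        · rintro ⟨h, hw⟩
          exact ⟨_, _, _, h, hw, rfl⟩
      · rw [h]; exact hlt
  · have hj : ¬ Conn (arcSet M F T W) (Set.Iio p) u v := by
      rw [← hj₂]
      intro e
      exact hj (by simp [joinedTest, v21', v22', e])
    refine ((hK₃ μ₂ M v F T (fun a => W a ∈ Set.Iic p) v20' v22' a12' a13' (hI.symm.arcSymm _)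
      ?_).withFrame rfl fun μ₂ h f => And.intro h f).seq fun μ₃ ⟨⟨m, h₃⟩, f₃⟩ => ?_
    · intro μ' h
      simp [lePivot, h, r12', ← hp']
    have v20'' := (f₃.var 20 (by decide)).trans v20'
    have v21'' := (f₃.var 21 (by decide)).trans v21'
    have v22'' := (f₃.var 22 (by decide)).trans v22'
    have v24'' := (f₃.var 24 (by decide)).trans v24'
    have a12'' := (f₃.arr 12 (by decide)).trans a12'
    have a13'' := (f₃.arr 13 (by decide)).trans a13'
    have rl' : μ₃.real = μ₂.real := funext fun R => f₃.real R (by decide +revert)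
    have r12'' : μ₃.real 12 = W := by rw [rl', r12']
    have hp'' : p = μ₃.real 7 0 := by rw [rl', hp']
    have hj₃ := h₃.joined_iff hI.symm hu
    refine Run.ite (fun hj' => ?_) fun hj' => ?_
    · have hj' : μ₃.arr 16 u = μ₃.arr 16 v := by
        simp [joinedTest, v21'', v22''] at hj'; omega
      refine (Run.simple rfl (Or.inr ⟨?_, ?_⟩)).mono (by simp) fun _ => id
      · simp
      · simp only [Cmd.step]
        rw [← hp'']
        exact ⟨(hI.iic _ _ _ hpW).2 (hj₃.1 hj'), fun h => hj ((hI.iio _ _ _ hpW).1 h)⟩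
    · have hj' : μ₃.arr 16 u ≠ μ₃.arr 16 v := fun e =>
        hj' (by simp [joinedTest, v21'', v22'', e])
      refine (((hK₅ μ₃ M F T W (Set.Ioi p) (fun x => μ₃.arr 16 x - 1) v20'' a12'' a13'' r12''
        ?_ ?_).withFrame rfl fun μ₃ h f => And.intro h f).seq fun μ₄ ⟨⟨h, hS⟩, f⟩ =>
        Run.simple rfl (Or.inl ⟨?_, ?_, ?_⟩)).mono (t := _) ?_ fun _ => id
      · intro μ' h
        simp [lePivot, h, hp'']
      · intro μ' e h
        simp [labelExp, h]
      · simp [labelExp]; omega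
      · simp [f.var 24 (by decide), v24'']
      · have e21 := (f.var 21 (by decide)).trans v21''
        have e22 := (f.var 22 (by decide)).trans v22''
        have e16 := f.arr 16 (by decide)
        have hc : ∀ x y w, (x, y, w) ∈ arcSet M F T W →
            μ₃.arr 16 x ≠ 0 ∧ Conn (arcSet M F T W) (Set.Iic p) (μ₃.arr 16 x - 1) x := by
          rintro x y w ⟨a, ha, e⟩
          simp only [Prod.mk.injEq] at e
          exact h₃.conn (Or.inr ⟨a, ha, e.1.symm⟩)
        have := hI.contract (p := p) (l := fun x => μ₃.arr 16 x - 1) (S' := memArcs μ₄) ?_ ?_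
          (fun x y w h => (hc x y w h).2) ?_ (h₃.conn (Or.inl rfl)).2
        · simpa [labelExp, e21, e22, e16, memArcs] using this
        · have h1 := (h₃.conn hu).1
          have h2 := (h₃.conn (Or.inl rfl)).1
          omega
        · rintro x y w hm hw
          have := h₃.label_eq (.single ⟨w, hw, hm⟩)
          simp only [this]
        · intro e
          exact hS e
      · simp only [Cmd.step, ne_eq, Nat.reduceEqDiff, not_false_eq_true, Function.update_of_ne]
        rw [h]
        have : cntIn W (Set.Iic p) 0 M + cntIn W (Set.Ioi p) 0 M = M := by
          classical
          rw [cntIn, cntIn, ← Finset.card_union_of_disjoint, ← Finset.filter_or]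
          · rw [Finset.filter_true_of_mem, Nat.card_Ico, Nat.sub_zero]
            exact fun x _ => le_or_gt (W x) p
          · exact Finset.disjoint_filter.2 fun x _ (h : W x ≤ p) (h' : p < W x) => not_lt.2 h h'
        have hle' : M ≤ 64 * cntIn W (Set.Iic p) 0 M := hle
        omega

theorem run_bottleneck : ∃ K, ∀ {O : Oracle} (μ : Mem), SymmArcs (memArcs μ) → μ.var 21 ≠ μ.var 22 →
    Conn (memArcs μ) Set.univ (μ.var 21) (μ.var 22) →
    Run P O bottleneckCmd μ (K * (μ.var 20 + 1)) fun μ' =>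
      IsBottleneck (memArcs μ) (μ.var 21) (μ.var 22) (μ'.real 7 0) := by
  obtain ⟨K, hK⟩ := run_bottleneckStep (P := P)
  refine ⟨64 * (K + 3) + 10, fun {O} μ hS hne hconn => ?_⟩
  set S₀ := memArcs μ
  set s := μ.var 21
  set t := μ.var 22
  -- An inconclusive round removes at least a `64`th part of the arcs, so the factor `64` in the
  -- credit pays for a round of cost linear in the current number of arcs.
  set I : ℕ → Mem → Prop := fun n μ₁ => (μ₁.var 24 = 0 ∧
    BottleneckInv S₀ s t (memArcs μ₁) (μ₁.var 21) (μ₁.var 22) ∧ n = 64 * (K + 3) * μ₁.var 20) ∨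
    (μ₁.var 24 = 1 ∧ IsBottleneck S₀ s t (μ₁.real 7 0) ∧ n = 0) with hI
  refine (Run.seq (Run.exact rfl) fun μ₁ g₁ => Run.loop I (n := 64 * (K + 3) * μ.var 20)
    ?_ ?_).mono (t := _) ?_ ?_
  · rintro n μ₂ h hb
    simp at hb
    rcases h with ⟨h24, hinv, rfl⟩ | ⟨h, -⟩
    · refine ⟨_, (hK μ₂ S₀ s t hinv h24).imp fun μ₃ h => ?_⟩
      obtain ⟨y, w, a, ha, -⟩ := hinv.exists_arc
      rcases h with ⟨h, h', hle⟩ | ⟨h, h'⟩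
      · refine ⟨_, Or.inl ⟨h, h', rfl⟩, ?_⟩
        simp
        nlinarith
      · refine ⟨_, Or.inr ⟨h, h', rfl⟩, ?_⟩
        simp
        nlinarith
    · omega
  · refine Or.inl ⟨by simp [g₁], ?_, by simp [g₁]⟩
    have e : memArcs μ₁ = S₀ := by simp [g₁, S₀, memArcs]
    have e1 : μ₁.var 21 = s := by simp [g₁, s]
    have e2 : μ₁.var 22 = t := by simp [g₁, t]
    rw [e, e1, e2]
    exact ⟨hS, hne, hconn, fun _ _ _ _ => Iff.rfl, fun _ _ _ _ => Iff.rfl⟩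
  · simp
    nlinarith
  · rintro μ₂ ⟨⟨n, h⟩, hb⟩
    simp at hb
    rcases h with ⟨h24, -⟩ | ⟨-, h, -⟩
    · omega
    · exact h

end

section

open Filter Topology Set

/-! ## Simplices -/

namespace GeoComplex

variable {d : ℕ} (C : GeoComplex d)

theorem nonempty_of_mem {Δ : Finset (Pt d)} (h : Δ ∈ C.faces) : Δ.Nonempty :=
  (C.isRelLowerSet_faces h).1

theorem mem_of_subset {Δ Ψ : Finset (Pt d)} (h : Δ ∈ C.faces) (hs : Ψ ⊆ Δ) (hn : Ψ.Nonempty) :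
    Ψ ∈ C.faces :=
  (C.isRelLowerSet_faces h).2 hs hn

end GeoComplex

theorem isClosed_realize {d : ℕ} (Δ : Finset (Pt d)) : IsClosed (realize Δ) :=
  Δ.finite_toSet.isClosed_convexHull ℝ

theorem convex_realize {d : ℕ} (Δ : Finset (Pt d)) : Convex ℝ (realize Δ) := convex_convexHull ℝ _

theorem realize_mono {d : ℕ} {Δ Ψ : Finset (Pt d)} (h : Δ ⊆ Ψ) : realize Δ ⊆ realize Ψ :=
  convexHull_mono (by exact_mod_cast h)

/-- The point `x` is a convex combination of the vertices of `Δ` with positive coefficients. -/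
def InRel {d : ℕ} (Δ : Finset (Pt d)) (x : Pt d) : Prop :=
  ∃ w : Pt d → ℝ, (∀ v ∈ Δ, 0 < w v) ∧ ∑ v ∈ Δ, w v = 1 ∧ ∑ v ∈ Δ, w v • v = x

namespace InRel

variable {d : ℕ} {Δ Ψ : Finset (Pt d)} {x y : Pt d}

theorem mem (h : InRel Δ x) : x ∈ realize Δ := by
  obtain ⟨w, h₁, h₂, h₃⟩ := h
  exact Finset.mem_convexHull'.2 ⟨w, fun v hv => (h₁ v hv).le, h₂, h₃⟩

theorem nonempty (h : InRel Δ x) : Δ.Nonempty := by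
  obtain ⟨w, h₁, h₂, h₃⟩ := h
  by_contra hc
  rw [Finset.not_nonempty_iff_eq_empty] at hc
  simp [hc] at h₂

/-- Discarding the vertices with coefficient zero leaves the carrier of `x`. -/
theorem exists_of_mem (h : x ∈ realize Δ) : ∃ F ⊆ Δ, InRel F x := by
  classical
  obtain ⟨w, h₁, h₂, h₃⟩ := Finset.mem_convexHull'.1 h
  refine ⟨Δ.filter fun v => w v ≠ 0, Finset.filter_subset _ _, w, fun v hv => ?_, ?_, ?_⟩
  · rw [Finset.mem_filter] at hv
    exact lt_of_le_of_ne (h₁ v hv.1) hv.2.symm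
  · rw [Finset.sum_filter_ne_zero]; exact h₂
  · rw [← h₃]
    refine Finset.sum_subset (Finset.filter_subset _ _) fun v hv hv' => ?_
    simp only [Finset.mem_filter, not_and, not_not] at hv'
    rw [hv' hv, zero_smul]

/-- A convex combination over the proper face, extended by zero, would differ from the positive one
at a missing vertex, against affine independence. -/
theorem notMem (h : InRel Δ x) (hΔ : AffineIndependent ℝ ((↑) : Δ → Pt d)) (hΨ : Ψ ⊂ Δ) :
    x ∉ realize Ψ := by
  classical
  intro hx
  obtain ⟨w, h₁, h₂, h₃⟩ := h
  obtain ⟨w', h₁', h₂', h₃'⟩ := Finset.mem_convexHull'.1 hx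
  obtain ⟨v, hv, hv'⟩ := Finset.exists_of_ssubset hΨ
  set z : Pt d → ℝ := fun u => w u - if u ∈ Ψ then w' u else 0
  have e : Ψ = Δ.filter (· ∈ Ψ) := by
    ext u; simp only [Finset.mem_filter]; exact ⟨fun h => ⟨hΨ.1 h, h⟩, fun h => h.2⟩
  have s₁ : ∑ u ∈ Δ, z u = 0 := by
    rw [Finset.sum_sub_distrib, h₂, ← Finset.sum_filter, ← e, h₂', sub_self]
  have s₂ : ∑ u ∈ Δ, z u • u = 0 := by
    simp only [z, sub_smul, ite_smul, zero_smul]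
    rw [Finset.sum_sub_distrib, h₃, ← Finset.sum_filter, ← e, h₃', sub_self]
  have key := affineIndependent_iff.1 hΔ Finset.univ (fun u => z u)
    (by rw [← s₁]; exact Finset.sum_coe_sort Δ z)
    (by rw [← s₂]; exact Finset.sum_coe_sort Δ fun u => z u • u) ⟨v, hv⟩ (Finset.mem_univ _)
  simp only [z, hv', if_false, sub_zero] at key
  exact (h₁ v hv).ne' key

/-- Mixing two positive combinations with positive weights leaves every vertex of either set with a
positive coefficient. No independence is needed, so this applies before the union is known to be a
simplex. -/
theorem lineMap [DecidableEq (Pt d)] (hx : InRel Δ x) (hy : InRel Ψ y) {a : ℝ} (h0 : 0 < a)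
    (h1 : a < 1) : InRel (Δ ∪ Ψ) (AffineMap.lineMap x y a) := by
  obtain ⟨w, h₁, h₂, h₃⟩ := hx
  obtain ⟨w', h₁', h₂', h₃'⟩ := hy
  have e₁ : (Δ ∪ Ψ).filter (· ∈ Δ) = Δ := by
    ext u; simp only [Finset.mem_filter, Finset.mem_union]; tauto
  have e₂ : (Δ ∪ Ψ).filter (· ∈ Ψ) = Ψ := by
    ext u; simp only [Finset.mem_filter, Finset.mem_union]; tauto
  refine ⟨fun u => (1 - a) * (if u ∈ Δ then w u else 0) + a * (if u ∈ Ψ then w' u else 0),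
    fun v hv => ?_, ?_, ?_⟩
  · have p₁ : 0 ≤ if v ∈ Δ then w v else 0 := by
      split_ifs with h
      exacts [(h₁ v h).le, le_rfl]
    have p₂ : 0 ≤ if v ∈ Ψ then w' v else 0 := by
      split_ifs with h
      exacts [(h₁' v h).le, le_rfl]
    rcases Finset.mem_union.1 hv with h | h
    · have : 0 < if v ∈ Δ then w v else 0 := by rw [if_pos h]; exact h₁ v h
      have := mul_pos (sub_pos.2 h1) this
      have := mul_nonneg h0.le p₂
      beta_reduce
      linarith
    · have : 0 < if v ∈ Ψ then w' v else 0 := by rw [if_pos h]; exact h₁' v h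
      have := mul_pos h0 this
      have := mul_nonneg (sub_pos.2 h1).le p₁
      beta_reduce
      linarith
  · rw [Finset.sum_add_distrib, ← Finset.mul_sum, ← Finset.mul_sum, ← Finset.sum_filter,
      ← Finset.sum_filter, e₁, e₂, h₂, h₂']
    ring
  · simp only [add_smul, mul_smul, ite_smul, zero_smul]
    rw [Finset.sum_add_distrib, ← Finset.smul_sum, ← Finset.smul_sum, ← Finset.sum_filter,
      ← Finset.sum_filter, e₁, e₂, h₃, h₃', AffineMap.lineMap_apply_module]

end InRel

/-! ## Simplicial paths are lower semicontinuous -/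

/-- A finite union of open intervals and points. -/
def IsTame (A : Set unitInterval) : Prop :=
  ∃ (S : Finset (unitInterval × unitInterval)) (Q : Finset unitInterval),
    A = (⋃ p ∈ S, Set.Ioo p.1 p.2) ∪ Q

namespace IsTame

theorem empty : IsTame ∅ := ⟨∅, ∅, by simp⟩

theorem Ioo (a b : unitInterval) : IsTame (Set.Ioo a b) := ⟨{(a, b)}, ∅, by simp⟩

theorem singleton (a : unitInterval) : IsTame {a} := ⟨∅, {a}, by simp⟩

theorem union {A B : Set unitInterval} (hA : IsTame A) (hB : IsTame B) : IsTame (A ∪ B) := by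
  classical
  obtain ⟨S, Q, rfl⟩ := hA
  obtain ⟨S', Q', rfl⟩ := hB
  refine ⟨S ∪ S', Q ∪ Q', ?_⟩
  rw [Finset.set_biUnion_union, Finset.coe_union]
  exact Set.union_union_union_comm _ _ _ _

theorem biUnion {ι : Type*} (s : Finset ι) (A : ι → Set unitInterval) (h : ∀ i ∈ s, IsTame (A i)) :
    IsTame (⋃ i ∈ s, A i) := by
  classical
  induction s using Finset.induction_on with
  | empty => simpa using empty
  | insert a s _ ih =>
    rw [Finset.set_biUnion_insert]
    exact (h a (by simp)).union (ih fun i hi => h i (by simp [hi]))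

/-- Immediately to the right of `t` lies either an initial part of one of the open intervals, or
nothing of the finitely many intervals and points. The left side is symmetric. -/
theorem eventually_right {A : Set unitInterval} (h : IsTame A) (t : unitInterval) :
    (∀ᶠ x in 𝓝[>] t, x ∈ A) ∨ ∀ᶠ x in 𝓝[>] t, x ∉ A := by
  obtain ⟨S, Q, rfl⟩ := h
  by_cases hS : ∃ p ∈ S, t ∈ Set.Ico p.1 p.2
  · obtain ⟨p, hp, h₁, h₂⟩ := hS
    left
    filter_upwards [Ioo_mem_nhdsGT h₂] with x hx
    exact Or.inl (Set.mem_biUnion hp ⟨h₁.trans_lt hx.1, hx.2⟩)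
  · right
    have e₁ : ∀ᶠ x in 𝓝[>] t, ∀ p ∈ S, x ∉ Set.Ioo p.1 p.2 := by
      rw [Finset.eventually_all]
      intro p hp
      by_cases h : t < p.1
      · filter_upwards [Ioo_mem_nhdsGT h] with x hx hx'
        exact absurd hx.2 (not_lt.2 hx'.1.le)
      · filter_upwards [self_mem_nhdsWithin] with x hx hx'
        exact hS ⟨p, hp, not_lt.1 h, lt_trans hx hx'.2⟩
    have e₂ : ∀ᶠ x in 𝓝[>] t, ∀ q ∈ Q, x ≠ q := by
      rw [Finset.eventually_all]
      intro q _
      by_cases h : t < q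
      · filter_upwards [Ioo_mem_nhdsGT h] with x hx
        exact hx.2.ne
      · filter_upwards [self_mem_nhdsWithin] with x hx
        exact ((not_lt.1 h).trans_lt hx).ne'
    filter_upwards [e₁, e₂] with x h₁ h₂ hx
    rcases hx with hx | hx
    · obtain ⟨p, hp, hx⟩ := Set.mem_iUnion₂.1 hx
      exact h₁ p hp hx
    · exact h₂ x hx rfl

theorem eventually_left {A : Set unitInterval} (h : IsTame A) (t : unitInterval) :
    (∀ᶠ x in 𝓝[<] t, x ∈ A) ∨ ∀ᶠ x in 𝓝[<] t, x ∉ A := by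
  obtain ⟨S, Q, rfl⟩ := h
  by_cases hS : ∃ p ∈ S, t ∈ Set.Ioc p.1 p.2
  · obtain ⟨p, hp, h₁, h₂⟩ := hS
    left
    filter_upwards [Ioo_mem_nhdsLT h₁] with x hx
    exact Or.inl (Set.mem_biUnion hp ⟨hx.1, hx.2.trans_le h₂⟩)
  · right
    have e₁ : ∀ᶠ x in 𝓝[<] t, ∀ p ∈ S, x ∉ Set.Ioo p.1 p.2 := by
      rw [Finset.eventually_all]
      intro p hp
      by_cases h : p.2 < t
      · filter_upwards [Ioo_mem_nhdsLT h] with x hx hx'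
        exact absurd hx.1 (not_lt.2 hx'.2.le)
      · filter_upwards [self_mem_nhdsWithin] with x hx hx'
        exact hS ⟨p, hp, lt_trans hx'.1 hx, not_lt.1 h⟩
    have e₂ : ∀ᶠ x in 𝓝[<] t, ∀ q ∈ Q, x ≠ q := by
      rw [Finset.eventually_all]
      intro q _
      by_cases h : q < t
      · filter_upwards [Ioo_mem_nhdsLT h] with x hx
        exact hx.1.ne'
      · filter_upwards [self_mem_nhdsWithin] with x hx
        exact (lt_of_lt_of_le hx (not_lt.1 h)).ne
    filter_upwards [e₁, e₂] with x h₁ h₂ hx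
    rcases hx with hx | hx
    · obtain ⟨p, hp, hx⟩ := Set.mem_iUnion₂.1 hx
      exact h₁ p hp hx
    · exact h₂ x hx rfl

end IsTame

namespace GeoComplex

variable {d : ℕ} {C : GeoComplex d} {p q : Pt d} {γ : Path p q} {φ : unitInterval → Finset (Pt d)}

/-- The finitely many simplices that miss the point `γ t` are closed, so points of the curve at
nearby times miss them as well; hence the simplices visited there contain `γ t`. -/
theorem Realizes.eventually_mem (h : C.Realizes γ φ) (t : unitInterval) :
    ∀ᶠ x in 𝓝 t, γ t ∈ realize (φ x) := by
  have key : ∀ᶠ x in 𝓝 t, ∀ Ψ ∈ C.faces, γ t ∉ realize Ψ → γ x ∉ realize Ψ := by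
    rw [eventually_all_finite C.finite_faces]
    intro Ψ _
    by_cases ht : γ t ∈ realize Ψ
    · exact Eventually.of_forall fun x hx => absurd ht hx
    · have := (γ.continuous.tendsto t).eventually ((isClosed_realize Ψ).isOpen_compl.mem_nhds ht)
      filter_upwards [this] with x hx _
      exact hx
  filter_upwards [key] with x hx
  by_contra hc
  exact hx _ (h.isSimplicialPath.mem x) hc (h.mem x)

/-- The simplex at time `x` contains `γ t`, so it is not a proper face of `φ t`; adjacency leaves
only the other inclusion. -/
theorem Realizes.subset_of_adj (h : C.Realizes γ φ) {t x : unitInterval}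
    (hadj : φ t = φ x ∨ SimplexAdj (φ t) (φ x)) (hx : γ t ∈ realize (φ x)) : φ t ⊆ φ x := by
  rcases hadj with h' | h' | h'
  · exact h'.subset
  · exact h'
  · by_cases he : φ x = φ t
    · exact he.symm.subset
    · exact absurd hx (h.lowest t _ (h.isSimplicialPath.mem x) (h'.ssubset_of_ne he))

/-- Close to the time `t` the simplicial path visits only cofaces of the simplex at time `t`. -/
theorem Realizes.eventually_subset (h : C.Realizes γ φ) (t : unitInterval) :
    ∀ᶠ x in 𝓝 t, φ t ⊆ φ x := by
  rw [← nhdsNE_sup_pure, ← nhdsLT_sup_nhdsGT, eventually_sup, eventually_sup]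
  refine ⟨⟨?_, ?_⟩, by simp⟩
  -- There are finitely many simplices with tame preimages, so `φ` is constant just before `t`. On a
  -- short interval ending at `t` it thus takes at most two values, and these are adjacent. The
  -- right side is symmetric.
  · by_cases hex : ∃ Ψ ∈ C.faces, ∀ᶠ x in 𝓝[<] t, φ x = Ψ
    · obtain ⟨Ψ, hΨ, hev⟩ := hex
      by_cases hb : ∃ b, b < t
      · obtain ⟨b, hb⟩ := hb
        obtain ⟨a, ha, hsub⟩ := (mem_nhdsLT_iff_exists_Ioo_subset' hb).1 hev
        filter_upwards [Ioo_mem_nhdsLT ha, nhdsWithin_le_nhds (h.eventually_mem t)] with x hx hm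
        refine h.subset_of_adj ?_ hm
        by_cases he : φ t = φ x
        · exact Or.inl he
        · refine Or.inr (h.isSimplicialPath.adj x t hx.2.le _ _ he ?_)
          ext Δ
          simp only [Set.mem_image, Set.mem_insert_iff, Set.mem_singleton_iff]
          constructor
          · rintro ⟨y, hy, rfl⟩
            rcases hy.2.eq_or_lt with rfl | hlt
            · exact Or.inl rfl
            · right
              rw [show φ y = Ψ from hsub ⟨hx.1.trans_le hy.1, hlt⟩, show φ x = Ψ from hsub hx]
          · rintro (rfl | rfl)
            · exact ⟨t, ⟨hx.2.le, le_rfl⟩, rfl⟩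
            · exact ⟨x, ⟨le_rfl, hx.2.le⟩, rfl⟩
      -- At the left end of the unit interval the filter is trivial.
      · have : Set.Iio t = ∅ := by
          ext x; simp only [Set.mem_Iio, Set.mem_empty_iff_false, iff_false]
          exact fun hx => hb ⟨x, hx⟩
        simp [this]
    · have : ∀ᶠ x in 𝓝[<] t, ∀ Ψ ∈ C.faces, φ x ≠ Ψ := by
        rw [eventually_all_finite C.finite_faces]
        intro Ψ hΨ
        rcases IsTame.eventually_left (h.isSimplicialPath.finite_union Ψ hΨ) t with h' | h'
        · exact absurd ⟨Ψ, hΨ, h'⟩ hex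
        · exact h'
      filter_upwards [this] with x hx
      exact absurd rfl (hx _ (h.isSimplicialPath.mem x))
  · by_cases hex : ∃ Ψ ∈ C.faces, ∀ᶠ x in 𝓝[>] t, φ x = Ψ
    · obtain ⟨Ψ, hΨ, hev⟩ := hex
      by_cases hb : ∃ b, t < b
      · obtain ⟨b, hb⟩ := hb
        obtain ⟨a, ha, hsub⟩ := (mem_nhdsGT_iff_exists_Ioo_subset' hb).1 hev
        filter_upwards [Ioo_mem_nhdsGT ha, nhdsWithin_le_nhds (h.eventually_mem t)] with x hx hm
        refine h.subset_of_adj ?_ hm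
        by_cases he : φ t = φ x
        · exact Or.inl he
        · refine Or.inr (h.isSimplicialPath.adj t x hx.1.le _ _ he ?_)
          ext Δ
          simp only [Set.mem_image, Set.mem_insert_iff, Set.mem_singleton_iff]
          constructor
          · rintro ⟨y, hy, rfl⟩
            rcases hy.1.eq_or_lt with rfl | hlt
            · exact Or.inl rfl
            · right
              rw [show φ y = Ψ from hsub ⟨hlt, hy.2.trans_lt hx.2⟩, show φ x = Ψ from hsub hx]
          · rintro (rfl | rfl)
            · exact ⟨t, ⟨le_rfl, hx.1.le⟩, rfl⟩
            · exact ⟨x, ⟨hx.1.le, le_rfl⟩, rfl⟩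
      · have : Set.Ioi t = ∅ := by
          ext x; simp only [Set.mem_Ioi, Set.mem_empty_iff_false, iff_false]
          exact fun hx => hb ⟨x, hx⟩
        simp [this]
    · have : ∀ᶠ x in 𝓝[>] t, ∀ Ψ ∈ C.faces, φ x ≠ Ψ := by
        rw [eventually_all_finite C.finite_faces]
        intro Ψ hΨ
        rcases IsTame.eventually_right (h.isSimplicialPath.finite_union Ψ hΨ) t with h' | h'
        · exact absurd ⟨Ψ, hΨ, h'⟩ hex
        · exact h'
      filter_upwards [this] with x hx
      exact absurd rfl (hx _ (h.isSimplicialPath.mem x))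

end GeoComplex

/-! ## Polygonal curves -/

/-- The polygonal curve with the vertices `q 0, …, q m`. -/
noncomputable def polygon {V : Type*} [AddCommGroup V] [Module ℝ V] (m : ℕ) (q : ℕ → V)
    (u : unitInterval) : V :=
  q 0 + ∑ j ∈ Finset.range m, (max 0 (min 1 (m * (u : ℝ) - j))) • (q (j + 1) - q j)

/-- At such a time the clamped coefficients are `1` before index `j` and `0` after it, so the sum
telescopes to `q j` plus a part of the next edge. -/
theorem polygon_apply {V : Type*} [AddCommGroup V] [Module ℝ V] {m : ℕ} (q : ℕ → V)
    {u : unitInterval} {j : ℕ} (hj : j < m) (h₁ : (j : ℝ) ≤ m * u) (h₂ : m * (u : ℝ) ≤ j + 1) :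
    polygon m q u = AffineMap.lineMap (q j) (q (j + 1)) (m * (u : ℝ) - j) := by
  obtain ⟨e, rfl⟩ := Nat.exists_eq_add_of_lt hj
  rw [polygon, show j + e + 1 = j + (1 + e) by ring, Finset.sum_range_add, Finset.sum_range_add,
    Finset.sum_range_one]
  have s₁ : ∑ i ∈ Finset.range j, (max 0 (min 1 (((j + (1 + e) : ℕ) : ℝ) * (u : ℝ) - i))) •
      (q (i + 1) - q i) = q j - q 0 := by
    rw [← Finset.sum_range_sub]
    refine Finset.sum_congr rfl fun i hi => ?_
    have : (i : ℝ) + 1 ≤ j := by exact_mod_cast Finset.mem_range.1 hi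
    have e : ((j + (1 + e) : ℕ) : ℝ) * (u : ℝ) - i ≥ 1 := by
      rw [show j + (1 + e) = j + e + 1 by ring]; linarith
    rw [min_eq_left e, max_eq_right zero_le_one, one_smul]
  have s₂ : ∑ i ∈ Finset.range e, (max 0 (min 1 (((j + (1 + e) : ℕ) : ℝ) * (u : ℝ) -
      ((j + (1 + i) : ℕ) : ℝ)))) • (q (j + (1 + i) + 1) - q (j + (1 + i))) = 0 := by
    refine Finset.sum_eq_zero fun i hi => ?_
    have : ((j + (1 + e) : ℕ) : ℝ) * (u : ℝ) - ((j + (1 + i) : ℕ) : ℝ) ≤ 0 := by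
      rw [show j + (1 + e) = j + e + 1 by ring]
      push_cast at h₂ ⊢
      have : (0 : ℝ) ≤ i := by positivity
      linarith
    rw [max_eq_left ((min_le_right _ _).trans this), zero_smul]
  rw [s₁, s₂, add_zero]
  have h₃ : ((j + (1 + e) : ℕ) : ℝ) * (u : ℝ) - j ≤ 1 := by
    rw [show j + (1 + e) = j + e + 1 by ring]; linarith
  have h₄ : 0 ≤ ((j + (1 + e) : ℕ) : ℝ) * (u : ℝ) - j := by
    rw [show j + (1 + e) = j + e + 1 by ring]; linarith
  rw [add_zero, min_eq_right h₃, max_eq_right h₄, AffineMap.lineMap_apply]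
  simp only [vsub_eq_sub, vadd_eq_add]
  abel

theorem isPolygonal_polygon {V : Type*} [AddCommGroup V] [Module ℝ V] {m : ℕ} (hm : 0 < m)
    (q : ℕ → V) : IsPolygonal (polygon m q) m q :=
  ⟨hm, fun _ hj _ h₁ h₂ => polygon_apply q hj h₁ h₂⟩

theorem polygon_vertex {V : Type*} [AddCommGroup V] [Module ℝ V] {m : ℕ} (hm : 0 < m)
    (q : ℕ → V) {j : ℕ} (hj : j ≤ m) {u : unitInterval} (hu : m * (u : ℝ) = j) :
    polygon m q u = q j := by
  rcases hj.eq_or_lt with rfl | hj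
  · obtain ⟨e, rfl⟩ : ∃ e, j = e + 1 := ⟨j - 1, by omega⟩
    push_cast at hu
    rw [polygon_apply (j := e) q (by omega) (by push_cast; linarith) (by push_cast; linarith)]
    push_cast
    rw [hu, add_sub_cancel_left, AffineMap.lineMap_apply_one]
  · rw [polygon_apply q hj hu.ge (by linarith), hu, sub_self, AffineMap.lineMap_apply_zero]

theorem continuous_polygon {d : ℕ} (m : ℕ) (q : ℕ → Pt d) : Continuous (polygon m q) := by
  unfold polygon
  fun_prop

/-- The polygonal curve as a path. -/
noncomputable def polygonPath {d m : ℕ} (hm : 0 < m) (q : ℕ → Pt d) {a b : Pt d} (ha : q 0 = a)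
    (hb : q m = b) : Path a b where
  toFun := polygon m q
  continuous_toFun := continuous_polygon m q
  source' := by rw [polygon_vertex hm q (Nat.zero_le _) (by simp), ha]
  target' := by rw [polygon_vertex hm q le_rfl (by simp), hb]

/-- Every time is a breakpoint or lies between two consecutive breakpoints. -/
theorem exists_piece {m : ℕ} (u : unitInterval) :
    (∃ j ≤ m, m * (u : ℝ) = j) ∨ ∃ j < m, (j : ℝ) < m * u ∧ m * (u : ℝ) < j + 1 := by
  have h0 : 0 ≤ m * (u : ℝ) := mul_nonneg (Nat.cast_nonneg _) u.2.1
  have h1 : m * (u : ℝ) ≤ m := by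
    have := mul_le_mul_of_nonneg_left u.2.2 (Nat.cast_nonneg (α := ℝ) m)
    simpa using this
  have f₁ := Nat.floor_le h0
  have f₂ := Nat.lt_floor_add_one (m * (u : ℝ))
  rcases f₁.eq_or_lt with h | h
  · exact Or.inl ⟨_, by exact_mod_cast h.le.trans h1, h.symm⟩
  · exact Or.inr ⟨_, by exact_mod_cast h.trans_le h1, h, f₂⟩

open Classical in
/-- A polygonal curve whose vertices have the carriers `F 0, …, F m` is a curve in `C`. -/
theorem GeoComplex.hasCurve_polygonPath {d : ℕ} (C : GeoComplex d) {m : ℕ} (hm : 0 < m)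
    (q : ℕ → Pt d) {a b : Pt d} (ha : q 0 = a) (hb : q m = b) (F : ℕ → Finset (Pt d))
    (hF : ∀ j ≤ m, InRel (F j) (q j)) (hC : ∀ j < m, F j ∪ F (j + 1) ∈ C.faces) :
    C.HasCurve (polygonPath hm q ha hb) := by
  -- Floor and ceiling agree exactly at the breakpoints, where `φ` is the carrier of a vertex; in
  -- between it is the union of the carriers of both ends.
  set φ : unitInterval → Finset (Pt d) := fun u => F ⌊m * (u : ℝ)⌋₊ ∪ F ⌈m * (u : ℝ)⌉₊ with hφ
  have φ₁ : ∀ {u : unitInterval} {j : ℕ}, m * (u : ℝ) = j → φ u = F j := by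
    intro u j h
    simp [hφ, h]
  have φ₂ : ∀ {u : unitInterval} {j : ℕ}, (j : ℝ) < m * u → m * (u : ℝ) < j + 1 →
      φ u = F j ∪ F (j + 1) := by
    intro u j h h'
    have e₁ : ⌊m * (u : ℝ)⌋₊ = j := (Nat.floor_eq_iff ((Nat.cast_nonneg _).trans h.le)).2 ⟨h.le, h'⟩
    have e₂ : ⌈m * (u : ℝ)⌉₊ = j + 1 := (Nat.ceil_eq_iff (by omega)).2 ⟨by simpa using h,
      by push_cast; exact h'.le⟩
    simp only [hφ, e₁, e₂]
  have hFC : ∀ j ≤ m, F j ∈ C.faces := by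
    intro j hj
    rcases hj.eq_or_lt with rfl | hj
    · obtain ⟨e, rfl⟩ : ∃ e, j = e + 1 := ⟨j - 1, by omega⟩
      exact C.mem_of_subset (hC e (by omega)) Finset.subset_union_right (hF _ le_rfl).nonempty
    · exact C.mem_of_subset (hC j hj) Finset.subset_union_left (hF j hj.le).nonempty
  have hmem : ∀ u, φ u ∈ C.faces := by
    intro u
    rcases exists_piece (m := m) u with ⟨j, hj, h⟩ | ⟨j, hj, h, h'⟩
    · rw [φ₁ h]; exact hFC j hj
    · rw [φ₂ h h']; exact hC j hj
  have hrel : ∀ u, InRel (φ u) (polygon m q u) := by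
    intro u
    rcases exists_piece (m := m) u with ⟨j, hj, h⟩ | ⟨j, hj, h, h'⟩
    · rw [φ₁ h, polygon_vertex hm q hj h]; exact hF j hj
    · rw [φ₂ h h', polygon_apply q hj h.le h'.le]
      exact (hF j hj.le).lineMap (hF (j + 1) hj) (by linarith) (by linarith)
  have hcont : Continuous fun x : unitInterval => m * (x : ℝ) := by fun_prop
  -- The simplex at a breakpoint is contained in those of both neighbouring pieces, and inside a
  -- piece `φ` is constant.
  have hsemi : ∀ u, ∀ᶠ x in 𝓝 u, φ u ⊆ φ x := by
    intro u
    have hc : Tendsto (fun x : unitInterval => m * (x : ℝ)) (𝓝 u) (𝓝 (m * (u : ℝ))) :=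
      hcont.tendsto u
    rcases exists_piece (m := m) u with ⟨j, hj, h⟩ | ⟨j, hj, h, h'⟩
    · filter_upwards [hc.eventually (lt_mem_nhds (show (j : ℝ) - 1 < m * u by linarith)),
        hc.eventually (gt_mem_nhds (show m * (u : ℝ) < j + 1 by linarith))] with x h₁ h₂
      rw [φ₁ h]
      rcases lt_trichotomy (m * (x : ℝ)) j with h₃ | h₃ | h₃
      · obtain ⟨e, rfl⟩ : ∃ e, j = e + 1 := by
          refine ⟨j - 1, (Nat.succ_pred_eq_of_pos ?_).symm⟩
          rw [Nat.pos_iff_ne_zero]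
          rintro rfl
          have : 0 ≤ m * (x : ℝ) := mul_nonneg (Nat.cast_nonneg _) x.2.1
          simp at h₃
          linarith
        push_cast at h₁ h₃
        rw [φ₂ (j := e) (by linarith) h₃]
        exact Finset.subset_union_right
      · rw [φ₁ h₃]
      · rw [φ₂ h₃ h₂]
        exact Finset.subset_union_left
    · filter_upwards [hc.eventually (lt_mem_nhds h), hc.eventually (gt_mem_nhds h')] with x h₁ h₂
      rw [φ₂ h h', φ₂ h₁ h₂]
  refine ⟨φ, ⟨hmem, fun Δ _ => ?_, fun x y hxy Δ Ψ hne him => ?_⟩, fun u => (hrel u).mem,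
    fun u Ψ _ hlt => (hrel u).notMem (C.affineIndependent _ (hmem u)) hlt⟩
  · have hm' : (0 : ℝ) < m := by exact_mod_cast hm
    have hb : ∀ j : ℕ, j ≤ m → ((j : ℝ) / m) ∈ unitInterval := fun j hj =>
      ⟨by positivity, by rw [div_le_one hm']; exact_mod_cast hj⟩
    -- The breakpoints as elements of the unit interval; the value `0` for `j > m` is never used.
    set b : ℕ → unitInterval := fun j => if h : j ≤ m then ⟨j / m, hb j h⟩ else 0 with hbdef
    have b_lt : ∀ j ≤ m, ∀ u : unitInterval, b j < u ↔ (j : ℝ) < m * u := by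
      intro j hj u
      simp only [hbdef, hj, dif_pos]
      rw [← Subtype.coe_lt_coe, div_lt_iff₀' hm']
    have lt_b : ∀ j ≤ m, ∀ u : unitInterval, u < b j ↔ m * (u : ℝ) < j := by
      intro j hj u
      simp only [hbdef, hj, dif_pos]
      rw [← Subtype.coe_lt_coe, lt_div_iff₀' hm']
    have eq_b : ∀ j ≤ m, ∀ u : unitInterval, u = b j ↔ m * (u : ℝ) = j := by
      intro j hj u
      simp only [hbdef, hj, dif_pos]
      rw [← Subtype.coe_inj, eq_div_iff hm'.ne', mul_comm]
    have : φ ⁻¹' {Δ} = (⋃ j ∈ (Finset.range m).filter fun j => F j ∪ F (j + 1) = Δ,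
        Set.Ioo (b j) (b (j + 1))) ∪ ⋃ j ∈ (Finset.range (m + 1)).filter fun j => F j = Δ,
        {b j} := by
      ext u
      simp only [Set.mem_preimage, Set.mem_singleton_iff, Set.mem_union, Set.mem_iUnion,
        Finset.mem_filter, Finset.mem_range, exists_prop, Set.mem_Ioo]
      constructor
      · intro hu
        rcases exists_piece (m := m) u with ⟨j, hj, h⟩ | ⟨j, hj, h, h'⟩
        · exact Or.inr ⟨j, ⟨by omega, by rw [← φ₁ h]; exact hu⟩, (eq_b j hj u).2 h⟩
        · exact Or.inl ⟨j, ⟨hj, by rw [← φ₂ h h']; exact hu⟩, (b_lt j hj.le u).2 h,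
            (lt_b (j + 1) hj u).2 (by push_cast; exact h')⟩
      · rintro (⟨j, ⟨hj, e⟩, h, h'⟩ | ⟨j, ⟨hj, e⟩, h⟩)
        · rw [b_lt j hj.le] at h
          rw [lt_b (j + 1) hj] at h'
          push_cast at h'
          rw [φ₂ h h', e]
        · rw [eq_b j (by omega)] at h
          rw [φ₁ h, e]
    rw [this]
    exact (IsTame.biUnion _ _ fun _ _ => IsTame.Ioo _ _).union
      (IsTame.biUnion _ _ fun _ _ => IsTame.singleton _)
  -- By semicontinuity the sets of times with `Δ ⊆ φ` and with `Ψ ⊆ φ` are open. They cover the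
  -- interval and both meet it, so by connectedness they have a common time there, and at this time
  -- one of the two simplices contains the other.
  · by_contra hadj
    rw [SimplexAdj, not_or] at hadj
    have hval : ∀ u ∈ Set.Icc x y, φ u = Δ ∨ φ u = Ψ := fun u hu => by
      have : φ u ∈ φ '' Set.Icc x y := ⟨u, hu, rfl⟩
      rw [him] at this
      exact this
    have hop : ∀ Θ : Finset (Pt d), IsOpen {u | Θ ⊆ φ u} := fun Θ => isOpen_iff_eventually.2
      fun u hu => (hsemi u).mono fun x hx => Finset.Subset.trans hu hx
    have hΔ : Δ ∈ φ '' Set.Icc x y := by rw [him]; simp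
    have hΨ : Ψ ∈ φ '' Set.Icc x y := by rw [him]; simp
    obtain ⟨u, hu, rfl⟩ := hΔ
    obtain ⟨v, hv, rfl⟩ := hΨ
    obtain ⟨z, hz, h₁, h₂⟩ := (isPreconnected_Icc (a := x) (b := y)) _ _ (hop (φ u)) (hop (φ v))
      (fun w hw => (hval w hw).imp (fun h => h.symm.subset) (fun h => h.symm.subset))
      ⟨u, hu, Finset.Subset.refl _⟩ ⟨v, hv, Finset.Subset.refl _⟩
    rcases hval z hz with h | h
    · exact hadj.2 (by rw [← h]; exact h₂)
    · exact hadj.1 (by rw [← h]; exact h₁)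

end

section

open Filter Topology Set

/-! ## Digits -/

/-- The digit number `i` of `x` to the base `n`. -/
def digit (n x i : ℕ) : ℕ := x / n ^ i % n

theorem exists_digit_eq (n : ℕ) (k : ℕ) (a : ℕ → ℕ) (h : ∀ i < k, a i < n) :
    ∃ x < n ^ k, ∀ i < k, digit n x i = a i := by
  induction k generalizing a with
  | zero => exact ⟨0, by simp, by simp⟩
  | succ k ih =>
    obtain ⟨y, hy, hy'⟩ := ih (fun i => a (i + 1)) fun i hi => h (i + 1) (by omega)
    have h0 := h 0 (by omega)
    refine ⟨a 0 + n * y, ?_, fun i hi => ?_⟩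
    · rw [pow_succ]
      nlinarith
    · rcases i with _ | i
      · simp [digit, Nat.mod_eq_of_lt h0]
      · rw [← hy' i (by omega), digit, digit, pow_succ', ← Nat.div_div_eq_div_mul,
          Nat.add_mul_div_left _ _ (by omega), Nat.div_eq_of_lt h0, zero_add]

theorem eq_of_digit_eq {n k : ℕ} {x y : ℕ} (hx : x < n ^ k) (hy : y < n ^ k)
    (h : ∀ i < k, digit n x i = digit n y i) : x = y := by
  induction k generalizing x y with
  | zero => simp at hx hy; omega
  | succ k ih =>
    have h0 := h 0 (by omega)
    simp only [digit, pow_zero, Nat.div_one] at h0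
    rw [← Nat.mod_add_div x n, ← Nat.mod_add_div y n, h0]
    rw [pow_succ] at hx hy
    congr 2
    refine ih (Nat.div_lt_of_lt_mul (by linarith)) (Nat.div_lt_of_lt_mul (by linarith))
      fun i hi => ?_
    have := h (i + 1) (by omega)
    rwa [digit, digit, pow_succ', ← Nat.div_div_eq_div_mul, ← Nat.div_div_eq_div_mul] at this

/-! ## The graph of the cells -/

/-- The product cell with the number `x`. -/
def cellOf {k d : ℕ} (num : Fin k → ℕ → Finset (Pt d)) (n x : ℕ) : Fin k → Finset (Pt d) :=
  fun i => num i (digit n x i)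

/-- The number `x` is the number of a product cell. -/
def IsNode {k d : ℕ} (C : Fin k → GeoComplex d) (n x : ℕ) : Prop :=
  x < n ^ k ∧ ∀ i : Fin k, digit n x i < (C i).size

/-- The minimum of `f` over `A` exists and is `w`. -/
def IsMinVal {V : Type*} (f : V → ℝ) (A : Set V) (w : ℝ) : Prop := ∃ x ∈ A, IsMinOn f A x ∧ f x = w

/-- The arcs of the graph, in one direction. Besides the cells there are the nodes `n ^ k` for the
point `s` and `n ^ k + 1` for the point `t`. -/
def CellArc {k d : ℕ} (C : Fin k → GeoComplex d) (s t : Fin k → Pt d)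
    (num : Fin k → ℕ → Finset (Pt d)) (f : (Fin k → Pt d) → ℝ) (n u v : ℕ) (w : ℝ) : Prop :=
  (IsNode C n u ∧ IsNode C n v ∧
    (∃ i, cellOf num n u i ⊂ cellOf num n v i ∧ ∀ j ≠ i, digit n u j = digit n v j) ∧
    IsMinVal f (realizeCell (cellOf num n u)) w) ∨
  (IsNode C n v ∧ ((u = n ^ k ∧ s ∈ realizeCell (cellOf num n v) ∧ w = f s) ∨
    (u = n ^ k + 1 ∧ t ∈ realizeCell (cellOf num n v) ∧ w = f t)))

/-- The arcs of the graph. -/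
def cellArcs {k d : ℕ} (C : Fin k → GeoComplex d) (s t : Fin k → Pt d)
    (num : Fin k → ℕ → Finset (Pt d)) (f : (Fin k → Pt d) → ℝ) (n : ℕ) : Set (ℕ × ℕ × ℝ) :=
  {e | CellArc C s t num f n e.1 e.2.1 e.2.2 ∨ CellArc C s t num f n e.2.1 e.1 e.2.2}

theorem realizeCell_mono {k d : ℕ} {Δ Ψ : Fin k → Finset (Pt d)} (h : ∀ i, Δ i ⊆ Ψ i) :
    realizeCell Δ ⊆ realizeCell Ψ :=
  Set.pi_mono fun i _ => realize_mono (h i)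

section

variable {k d : ℕ} {C : Fin k → GeoComplex d} {s t : Fin k → Pt d}
  {num : Fin k → ℕ → Finset (Pt d)} {f : (Fin k → Pt d) → ℝ} {n : ℕ}

theorem symmArcs_cellArcs : SymmArcs (cellArcs C s t num f n) := fun _ _ _ h => h.symm

theorem IsNode.isProductCell (hnum : ∀ i, IsNumbering (C i) (num i)) {x : ℕ} (hx : IsNode C n x) :
    IsProductCell C (cellOf num n x) :=
  fun i => (hnum i).mapsTo (hx.2 i)

theorem IsNode.lt {x : ℕ} (hx : IsNode C n x) : x < n ^ k := hx.1

theorem exists_node (hnum : ∀ i, IsNumbering (C i) (num i)) (hn : ∀ i, (C i).size ≤ n)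
    {Δ : Fin k → Finset (Pt d)} (hΔ : IsProductCell C Δ) :
    ∃ x, IsNode C n x ∧ cellOf num n x = Δ := by
  choose a ha ha' using fun i => (hnum i).surjOn (hΔ i)
  obtain ⟨x, hx, hx'⟩ := exists_digit_eq n k (fun i => if h : i < k then a ⟨i, h⟩ else 0)
    fun i hi => by
      simp only [hi, dif_pos]
      exact lt_of_lt_of_le (ha ⟨i, hi⟩) (hn _)
  have : ∀ i : Fin k, digit n x i = a i := fun i => by simp [hx' i i.2]
  exact ⟨x, ⟨hx, fun i => by rw [this]; exact ha i⟩, funext fun i => by rw [cellOf, this, ha']⟩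

/-- A cell that contains a point whose value is in the lower set `D` is joined in the graph of `D`
to all cells of which it is a face. -/
theorem conn_of_subset (hnum : ∀ i, IsNumbering (C i) (num i)) (hn : ∀ i, (C i).size ≤ n)
    (hmin : ∀ Δ, IsProductCell C Δ → ∃ w, IsMinVal f (realizeCell Δ) w) {D : Set ℝ}
    (hD : IsLowerSet D) {x y : ℕ} (hx : IsNode C n x) (hy : IsNode C n y)
    (hxy : ∀ i, cellOf num n x i ⊆ cellOf num n y i) {z : Fin k → Pt d}
    (hz : z ∈ realizeCell (cellOf num n x)) (hzD : f z ∈ D) :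
    Conn (cellArcs C s t num f n) D x y := by
  classical
  -- Arcs change a single component, so the components of `x` are enlarged to those of `y` one at a
  -- time; `T` holds those already enlarged.
  have key : ∀ (T : Finset (Fin k)) (y' : ℕ), IsNode C n y' →
      (∀ i, cellOf num n y' i = if i ∈ T then cellOf num n y i else cellOf num n x i) →
      Conn (cellArcs C s t num f n) D x y' := by
    intro T
    have hdig : ∀ {u v : ℕ} {i : Fin k}, IsNode C n u → IsNode C n v →
        cellOf num n u i = cellOf num n v i → digit n u i = digit n v i :=
      fun hu hv h => (hnum _).injOn (hu.2 _) (hv.2 _) h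
    induction T using Finset.induction_on with
    | empty =>
      intro y' hy' h
      have : x = y' := eq_of_digit_eq hx.1 hy'.1 fun i hi => hdig (i := ⟨i, hi⟩) hx hy'
        (by rw [h]; simp)
      rw [this]
      exact .refl
    | insert i T hi ih =>
      intro y' hy' h
      obtain ⟨y₁, hy₁, e⟩ := exists_node (n := n) hnum hn
        (Δ := fun i => if i ∈ T then cellOf num n y i else cellOf num n x i) fun i => by
          beta_reduce
          split_ifs
          exacts [hy.isProductCell hnum i, hx.isProductCell hnum i]
      have h₁ := ih y₁ hy₁ fun i => by rw [e]
      by_cases he : cellOf num n x i = cellOf num n y i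
      · have : y₁ = y' := eq_of_digit_eq hy₁.1 hy'.1 fun j hj => hdig (i := ⟨j, hj⟩) hy₁ hy' (by
          rw [e, h]
          by_cases hji : (⟨j, hj⟩ : Fin k) = i
          · simp [hji, hi, he]
          · simp [hji])
        rwa [← this]
      · obtain ⟨w, hw⟩ := hmin _ (hy₁.isProductCell hnum)
        refine h₁.tail ⟨w, ?_, Or.inl (Or.inl ⟨hy₁, hy', ⟨i, ?_, fun j hj => ?_⟩, hw⟩)⟩
        -- The smaller of the two cells contains the cell `x`, hence the point `z`, so the weight of
        -- the arc is at most `f z`.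
        · obtain ⟨p, hp, hp', rfl⟩ := hw
          refine hD (hp' (realizeCell_mono (fun j => ?_) hz)) hzD
          rw [e]
          beta_reduce
          split_ifs
          exacts [hxy j, subset_rfl]
        · rw [e, h]
          simpa [hi] using (hxy i).ssubset_of_ne he
        · refine hdig hy₁ hy' ?_
          rw [e, h]
          simp [hj]
  exact key Finset.univ y hy fun i => by simp

theorem realizeCell_nonempty (hnum : ∀ i, IsNumbering (C i) (num i)) {x : ℕ} (hx : IsNode C n x) :
    (realizeCell (cellOf num n x)).Nonempty := by
  choose p hp using fun i => (C i).nonempty_of_mem (hx.isProductCell hnum i)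
  exact ⟨p, fun i _ => subset_convexHull ℝ _ (hp i)⟩

/-- The two extra nodes of the graph are joined. -/
theorem conn_univ (hnum : ∀ i, IsNumbering (C i) (num i)) (hn : ∀ i, (C i).size ≤ n)
    (hmin : ∀ Δ, IsProductCell C Δ → ∃ w, IsMinVal f (realizeCell Δ) w)
    (hs : ∀ i, (C i).IsVertex (s i)) (ht : ∀ i, (C i).IsVertex (t i))
    (hst : ∀ i, (C i).SameComponent (s i) (t i)) :
    Conn (cellArcs C s t num f n) Set.univ (n ^ k) (n ^ k + 1) := by
  classical
  have up : ∀ {x y}, IsNode C n x → IsNode C n y → (∀ i, cellOf num n x i ⊆ cellOf num n y i) →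
      Conn (cellArcs C s t num f n) Set.univ x y := fun hx hy hxy => by
    obtain ⟨z, hz⟩ := realizeCell_nonempty hnum hx
    exact conn_of_subset hnum hn hmin isLowerSet_univ hx hy hxy hz trivial
  -- One component moves along its chain of adjacent simplices while the others rest. Moving all
  -- components one after the other then leads from `s` to `t`.
  have one : ∀ (i : Fin k) (p q : Finset (Pt d)),
      Relation.ReflTransGen (fun Δ Ψ => Δ ∈ (C i).faces ∧ Ψ ∈ (C i).faces ∧ SimplexAdj Δ Ψ) p q →
      ∀ x y, IsNode C n x → IsNode C n y → cellOf num n x i = p → cellOf num n y i = q →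
      (∀ j ≠ i, cellOf num n x j = cellOf num n y j) →
      Conn (cellArcs C s t num f n) Set.univ x y := by
    intro i p q h
    induction h with
    | refl =>
      intro x y hx hy h₁ h₂ h₃
      refine up hx hy fun j => ?_
      by_cases hj : j = i
      · rw [hj, h₁, h₂]
      · rw [h₃ j hj]
    | @tail b c _ hbc ih =>
      intro x y hx hy h₁ h₂ h₃
      obtain ⟨y₁, hy₁, e⟩ := exists_node (n := n) hnum hn
        (Δ := Function.update (cellOf num n x) i b) fun j => by
          by_cases hj : j = i
          · subst hj; simpa using hbc.1
          · simpa [hj] using hx.isProductCell hnum j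
      refine (ih x y₁ hx hy₁ h₁ (by simp [e]) fun j hj => by simp [e, hj]).trans ?_
      rcases hbc.2.2 with h | h
      · refine up hy₁ hy fun j => ?_
        by_cases hj : j = i
        · subst hj; simpa [e, h₂] using h
        · simp [e, hj, h₃ j hj]
      · refine Conn.symm symmArcs_cellArcs (up hy hy₁ fun j => ?_)
        by_cases hj : j = i
        · subst hj; simpa [e, h₂] using h
        · simp [e, hj, h₃ j hj]
  obtain ⟨x, hx, ex⟩ := exists_node (n := n) hnum hn (Δ := fun i => {s i}) hs
  have key : ∀ (T : Finset (Fin k)) (y : ℕ), IsNode C n y →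
      (∀ i, cellOf num n y i = if i ∈ T then {t i} else {s i}) →
      Conn (cellArcs C s t num f n) Set.univ x y := by
    intro T
    induction T using Finset.induction_on with
    | empty =>
      intro y hy h
      exact up hx hy fun i => by simp [h, ex]
    | insert i T hi ih =>
      intro y hy h
      obtain ⟨y₁, hy₁, e⟩ := exists_node (n := n) hnum hn
        (Δ := fun i => if i ∈ T then {t i} else {s i}) fun i => by
          beta_reduce
          split_ifs
          exacts [ht i, hs i]
      refine (ih y₁ hy₁ fun j => by rw [e]).trans
        (one i _ _ (hst i) y₁ y hy₁ hy (by simp [e, hi]) (by simp [h]) fun j hj => by simp [e, h, hj])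
  obtain ⟨y, hy, ey⟩ := exists_node (n := n) hnum hn (Δ := fun i => {t i}) ht
  refine .head ⟨f s, trivial, Or.inl (Or.inr ⟨hx, Or.inl ⟨rfl, ?_, rfl⟩⟩)⟩
    (.tail (key Finset.univ y hy fun i => by simp [ey])
      ⟨f t, trivial, Or.inr (Or.inr ⟨hy, Or.inr ⟨rfl, ?_, rfl⟩⟩)⟩)
  · rw [ex]; intro i _; simp [realize]
  · rw [ey]; intro i _; simp [realize]

/-! ### From curves to paths in the graph -/

/-- Curves along which `f` is smaller than `B` give a path of arcs lighter than `B`. -/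
theorem conn_of_curves (hnum : ∀ i, IsNumbering (C i) (num i)) (hn : ∀ i, (C i).size ≤ n)
    (hmin : ∀ Δ, IsProductCell C Δ → ∃ w, IsMinVal f (realizeCell Δ) w) {B : ℝ}
    (π : ∀ i, Path (s i) (t i)) (ρ : Fin k → Path (0 : unitInterval) 1)
    (hπ : ∀ i, (C i).HasCurve (π i)) (hB : ∀ u, f (fun i => π i (ρ i u)) < B) :
    Conn (cellArcs C s t num f n) (Set.Iio B) (n ^ k) (n ^ k + 1) := by
  choose φ hφ using hπ
  choose x hx ex using fun u : unitInterval => exists_node (n := n) hnum hn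
    (Δ := fun i => φ i (ρ i u)) fun i => (hφ i).isSimplicialPath.mem _
  have hmem : ∀ u, (fun i => π i (ρ i u)) ∈ realizeCell (cellOf num n (x u)) := fun u => by
    rw [ex]; exact fun i _ => (hφ i).mem _
  -- There are finitely many components, so near `u` all of them have moved to cofaces. The point at
  -- time `u` then witnesses that the connecting arcs are light.
  have hloc : ∀ u, ∀ᶠ v in 𝓝 u, Conn (cellArcs C s t num f n) (Set.Iio B) (x u) (x v) := by
    intro u
    have : ∀ᶠ v in 𝓝 u, ∀ i, φ i (ρ i u) ⊆ φ i (ρ i v) := eventually_all.2 fun i =>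
      ((ρ i).continuous.tendsto u).eventually ((hφ i).eventually_subset (ρ i u))
    filter_upwards [this] with v hv
    exact conn_of_subset hnum hn hmin (isLowerSet_Iio B) (hx u) (hx v)
      (fun i => by rw [ex, ex]; exact hv i) (hmem u) (hB u)
  have hclop : IsClopen {u | Conn (cellArcs C s t num f n) (Set.Iio B) (n ^ k) (x u)} := by
    refine ⟨⟨isOpen_iff_eventually.2 fun u hu => ?_⟩, isOpen_iff_eventually.2 fun u hu => ?_⟩
    · exact (hloc u).mono fun v hv h => hu (Relation.ReflTransGen.trans h
        (Conn.symm symmArcs_cellArcs hv))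
    · exact (hloc u).mono fun v hv => Relation.ReflTransGen.trans hu hv
  have h₀ : (fun i => π i (ρ i 0)) = s := by funext i; simp
  have h₁ : (fun i => π i (ρ i 1)) = t := by funext i; simp
  -- The cell at time `0` contains the point `s`, but it need not be the cell of the vertices `s i`.
  -- This is why the extra nodes are joined to all cells that contain their point.
  have hall := hclop.eq_univ ⟨0, .single ⟨f s, by rw [← h₀]; exact hB 0,
    Or.inl (Or.inr ⟨hx 0, Or.inl ⟨rfl, by rw [← h₀]; exact hmem 0, rfl⟩⟩)⟩⟩
  have h1 : (1 : unitInterval) ∈ {u | Conn (cellArcs C s t num f n) (Set.Iio B) (n ^ k) (x u)} := by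
    rw [hall]; trivial
  exact h1.tail ⟨f t, by rw [← h₁]; exact hB 1,
    Or.inr (Or.inr ⟨hx 1, Or.inr ⟨rfl, by rw [← h₁]; exact hmem 1, rfl⟩⟩)⟩

/-! ### From paths in the graph to curves -/

/-- The point `q` is the one that the algorithm assigns to the node `x`. -/
def IsNodePoint (C : Fin k → GeoComplex d) (s t : Fin k → Pt d)
    (num : Fin k → ℕ → Finset (Pt d)) (f : (Fin k → Pt d) → ℝ) (n x : ℕ) (q : Fin k → Pt d) :
    Prop :=
  (x = n ^ k ∧ q = s) ∨ (x = n ^ k + 1 ∧ q = t) ∨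
    (IsNode C n x ∧ q ∈ realizeCell (cellOf num n x) ∧
      IsMinOn f (realizeCell (cellOf num n x)) q)

theorem IsNodePoint.mem {x : ℕ} {q : Fin k → Pt d} (h : IsNodePoint C s t num f n x q)
    (hx : IsNode C n x) :
    q ∈ realizeCell (cellOf num n x) ∧ IsMinOn f (realizeCell (cellOf num n x)) q := by
  have := hx.lt
  rcases h with ⟨h, -⟩ | ⟨h, -⟩ | ⟨-, h⟩
  · omega
  · omega
  · exact h

/-- The arc leads to the larger cell, which therefore contains both points. The weight is the value
at the first point, and the second point minimizes `f` over the larger cell. -/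
theorem CellArc.point {u v : ℕ} {w : ℝ} (h : CellArc C s t num f n u v w) {q r : Fin k → Pt d}
    (hq : IsNodePoint C s t num f n u q) (hr : IsNodePoint C s t num f n v r) :
    IsNode C n v ∧ q ∈ realizeCell (cellOf num n v) ∧ r ∈ realizeCell (cellOf num n v) ∧
      f q ≤ w ∧ f r ≤ w ∧ (IsNode C n u → ∀ i, cellOf num n u i ⊆ cellOf num n v i) ∧
      (u = n ^ k ∨ u = n ^ k + 1 ∨ IsNode C n u) := by
  rcases h with ⟨hu, hv, ⟨i, hi, hj⟩, p, hp, hp', rfl⟩ | ⟨hv, h⟩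
  · have hq := hq.mem hu
    have hr := hr.mem hv
    have hsub : ∀ j, cellOf num n u j ⊆ cellOf num n v j := fun j => by
      by_cases h : j = i
      · rw [h]; exact hi.subset
      · simp only [cellOf, hj j h, subset_rfl]
    have hqv := realizeCell_mono hsub hq.1
    exact ⟨hv, hqv, hr.1, hq.2 hp, hr.2 (realizeCell_mono hsub hp), fun _ => hsub,
      Or.inr (Or.inr hu)⟩
  · have hr' := hr.mem hv
    rcases h with ⟨rfl, h, rfl⟩ | ⟨rfl, h, rfl⟩
    · have : q = s := by
        rcases hq with ⟨-, h⟩ | ⟨h, -⟩ | ⟨h, -⟩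
        · exact h
        · omega
        · exact absurd h.lt (lt_irrefl _)
      subst this
      exact ⟨hv, h, hr'.1, le_rfl, hr'.2 h, fun h => absurd h.lt (lt_irrefl _), Or.inl rfl⟩
    · have : q = t := by
        rcases hq with ⟨h, -⟩ | ⟨-, h⟩ | ⟨h, -⟩
        · omega
        · exact h
        · have := h.lt; omega
      subst this
      exact ⟨hv, h, hr'.1, le_rfl, hr'.2 h, fun h => by have := h.lt; omega, Or.inr (Or.inl rfl)⟩

/-- A path in the graph gives polygonal curves. -/
theorem exists_curves (hnum : ∀ i, IsNumbering (C i) (num i))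
    (hf : ∀ Δ, IsProductCell C Δ → ConvexOn ℝ (realizeCell Δ) f) {B : ℝ} {m : ℕ} {y : ℕ → ℕ}
    {q : ℕ → Fin k → Pt d} (hy0 : y 0 = n ^ k) (hym : y m = n ^ k + 1)
    (hinj : ∀ j, 0 < j → j < m → y j ≠ n ^ k ∧ y j ≠ n ^ k + 1)
    (harc : ∀ j < m, ∃ w ≤ B, (y j, y (j + 1), w) ∈ cellArcs C s t num f n)
    (hq : ∀ j ≤ m, IsNodePoint C s t num f n (y j) (q j)) :
    ∃ π : ∀ i, Path (s i) (t i), (∀ i, IsPolygonal (π i) m fun j => q j i) ∧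
      (∀ i, (C i).HasCurve (π i)) ∧
      ∃ u₀ : unitInterval, (∀ u, f (fun i => π i u) ≤ f (fun i => π i u₀)) ∧
        f (fun i => π i u₀) ≤ B := by
  classical
  have hm0 : m ≠ 0 := by
    rintro rfl
    omega
  have hN : ¬ IsNode C n (n ^ k) := fun h => absurd h.lt (lt_irrefl _)
  have hN' : ¬ IsNode C n (n ^ k + 1) := fun h => by have := h.lt; omega
  -- Here `v` is the larger of the two cells at the ends of the arc number `j`, or the only cell if
  -- the other end is an extra node.
  have hpt : ∀ j < m, ∃ v, IsNode C n v ∧ q j ∈ realizeCell (cellOf num n v) ∧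
      q (j + 1) ∈ realizeCell (cellOf num n v) ∧ f (q j) ≤ B ∧ f (q (j + 1)) ≤ B ∧
      ((v = y (j + 1) ∧ (y j = n ^ k ∨ y j = n ^ k + 1 ∨ IsNode C n (y j)) ∧
        (IsNode C n (y j) → ∀ i, cellOf num n (y j) i ⊆ cellOf num n v i)) ∨
      (v = y j ∧ (y (j + 1) = n ^ k ∨ y (j + 1) = n ^ k + 1 ∨ IsNode C n (y (j + 1))) ∧
        (IsNode C n (y (j + 1)) → ∀ i, cellOf num n (y (j + 1)) i ⊆ cellOf num n v i))) := by
    intro j hj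
    obtain ⟨w, hw, h | h⟩ := harc j hj
    · obtain ⟨h1, h2, h3, h4, h5, h6, h7⟩ := h.point (hq j hj.le) (hq (j + 1) hj)
      exact ⟨_, h1, h2, h3, h4.trans hw, h5.trans hw, Or.inl ⟨rfl, h7, h6⟩⟩
    · obtain ⟨h1, h2, h3, h4, h5, h6, h7⟩ := h.point (hq (j + 1) hj) (hq j hj.le)
      exact ⟨_, h1, h3, h2, h5.trans hw, h4.trans hw, Or.inr ⟨rfl, h7, h6⟩⟩
  have hnode : ∀ j, 0 < j → j < m → IsNode C n (y j) := by
    intro j hj hjm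
    obtain ⟨v, hv, -, -, -, -, ⟨-, h, -⟩ | ⟨rfl, -, -⟩⟩ := hpt j hjm
    · rcases h with h | h | h
      · exact absurd h (hinj j hj hjm).1
      · exact absurd h (hinj j hj hjm).2
      · exact h
    · exact hv
  -- The extra nodes are not directly joined, since every arc has a cell as one of its ends.
  have hm1 : m ≠ 1 := by
    rintro rfl
    obtain ⟨v, hv, -, -, -, -, ⟨rfl, -, -⟩ | ⟨rfl, -, -⟩⟩ := hpt 0 one_pos
    · rw [zero_add, hym] at hv
      exact hN' hv
    · rw [hy0] at hv
      exact hN hv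
  -- At both ends of the path the extra node is replaced by the neighbouring cell, which contains
  -- its point. Now every `q j` lies in a cell `z j`, and consecutive cells are faces of a common
  -- cell.
  set z : ℕ → ℕ := fun j => if j = 0 then y 1 else if j = m then y (m - 1) else y j with hz
  have hz0 : z 0 = y 1 := by simp [hz]
  have hzm : z m = y (m - 1) := by simp [hz, hm0]
  have hzj : ∀ j, 0 < j → j < m → z j = y j := fun j h h' => by simp [hz, h.ne', h'.ne]
  have hznode : ∀ j ≤ m, IsNode C n (z j) := by
    intro j hj
    rcases Nat.eq_zero_or_pos j with rfl | h0
    · rw [hz0]; exact hnode 1 one_pos (by omega)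
    · rcases hj.eq_or_lt with rfl | h
      · rw [hzm]; exact hnode _ (by omega) (by omega)
      · rw [hzj j h0 h]; exact hnode j h0 h
  have hzq : ∀ j ≤ m, q j ∈ realizeCell (cellOf num n (z j)) := by
    intro j hj
    rcases Nat.eq_zero_or_pos j with rfl | h0
    · rw [hz0]
      obtain ⟨v, hv, h1, h2, -, -, ⟨rfl, -, -⟩ | ⟨rfl, -, -⟩⟩ := hpt 0 (by omega)
      · exact h1
      · rw [hy0] at hv; exact absurd hv hN
    · rcases hj.eq_or_lt with rfl | h
      · rw [hzm]
        have e : j - 1 + 1 = j := by omega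
        obtain ⟨v, hv, h1, h2, -, -, ⟨rfl, -, -⟩ | ⟨rfl, -, -⟩⟩ := hpt (j - 1) (by omega)
        · rw [e, hym] at hv; exact absurd hv hN'
        · rwa [e] at h2
      · rw [hzj j h0 h]; exact ((hq j hj).mem (hnode j h0 h)).1
  have hadj : ∀ j < m, ∃ v, IsNode C n v ∧ (∀ i, cellOf num n (z j) i ⊆ cellOf num n v i) ∧
      ∀ i, cellOf num n (z (j + 1)) i ⊆ cellOf num n v i := by
    intro j hj
    rcases Nat.eq_zero_or_pos j with rfl | h0
    · exact ⟨y 1, hnode 1 one_pos (by omega), fun i => by rw [hz0], fun i => by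
        rw [zero_add, hzj 1 one_pos (by omega)]⟩
    · by_cases h : j + 1 = m
      · exact ⟨y j, hnode j h0 hj, fun i => by rw [hzj j h0 hj], fun i => by
          rw [h, hzm, ← h, Nat.add_sub_cancel]⟩
      · have h1 : j + 1 < m := by omega
        rw [hzj j h0 hj, hzj (j + 1) (by omega) h1]
        obtain ⟨v, hv, -, -, -, -, ⟨rfl, -, h⟩ | ⟨rfl, -, h⟩⟩ := hpt j hj
        · exact ⟨_, hv, h (hnode j h0 hj), fun i => subset_rfl⟩
        · exact ⟨_, hv, fun i => subset_rfl, h (hnode (j + 1) (by omega) h1)⟩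
  have hqB : ∀ j ≤ m, f (q j) ≤ B := by
    intro j hj
    rcases hj.eq_or_lt with rfl | h
    · obtain ⟨v, -, -, -, -, h, -⟩ := hpt (j - 1) (by omega)
      rwa [Nat.sub_add_cancel (by omega)] at h
    · obtain ⟨v, -, -, -, h, -⟩ := hpt j h
      exact h
  have hF : ∀ j i, ∃ F, j ≤ m → F ⊆ cellOf num n (z j) i ∧ InRel F (q j i) := by
    intro j i
    by_cases hj : j ≤ m
    · obtain ⟨F, h⟩ := InRel.exists_of_mem (hzq j hj i trivial)
      exact ⟨F, fun _ => h⟩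
    · exact ⟨∅, fun h => absurd h hj⟩
  choose F hF using hF
  have hm' : 0 < m := by omega
  have hs : ∀ i, q 0 i = s i := fun i => by
    rcases hq 0 (Nat.zero_le _) with ⟨-, h⟩ | ⟨h, -⟩ | ⟨h, -⟩
    · rw [h]
    · omega
    · rw [hy0] at h; exact absurd h hN
  have ht : ∀ i, q m i = t i := fun i => by
    rcases hq m le_rfl with ⟨h, -⟩ | ⟨-, h⟩ | ⟨h, -⟩
    · omega
    · rw [h]
    · rw [hym] at h; exact absurd h hN'
  -- On each segment `f` is bounded by its values at the ends, so the maximum is attained at one of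
  -- the finitely many vertices; continuity of `f` is not required.
  obtain ⟨j₀, hj₀, hmax⟩ := Finset.exists_max_image (Finset.range (m + 1)) (fun j => f (q j))
    ⟨0, by simp⟩
  have hmR : (0 : ℝ) < m := by exact_mod_cast hm'
  have hj₀' : j₀ ≤ m := by simpa [Nat.lt_succ_iff] using hj₀
  have hvert : ∀ {j : ℕ} {u : unitInterval}, j ≤ m → m * (u : ℝ) = j →
      (fun i => polygonPath hm' (fun j => q j i) (hs i) (ht i) u) = q j := fun hj hu =>
    funext fun i => polygon_vertex hm' (fun j => q j i) hj hu
  have h₀ := hvert (u := ⟨j₀ / m, by positivity, by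
    rw [div_le_one hmR]; exact_mod_cast hj₀'⟩) hj₀' (by simp; field_simp)
  refine ⟨fun i => polygonPath hm' (fun j => q j i) (hs i) (ht i),
    fun i => isPolygonal_polygon hm' fun j => q j i, fun i => ?_, ⟨j₀ / m, by positivity, by
    rw [div_le_one hmR]; exact_mod_cast hj₀'⟩, fun u => ?_, ?_⟩
  · refine (C i).hasCurve_polygonPath hm' _ _ _ (fun j => F j i) (fun j hj => (hF j i hj).2)
      fun j hj => ?_
    obtain ⟨v, hv, h1, h2⟩ := hadj j hj
    convert (C i).mem_of_subset (hv.isProductCell hnum i)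
      (Finset.union_subset ((hF j i hj.le).1.trans (h1 i)) ((hF (j + 1) i hj).1.trans (h2 i)))
      ((hF j i hj.le).2.nonempty.mono Finset.subset_union_left)
  · rw [h₀]
    rcases exists_piece (m := m) u with ⟨j, hj, h⟩ | ⟨j, hj, h, h'⟩
    · rw [hvert hj h]
      exact hmax j (by simpa [Nat.lt_succ_iff] using hj)
    · have e : (fun i => polygonPath hm' (fun j => q j i) (hs i) (ht i) u) =
          AffineMap.lineMap (q j) (q (j + 1)) (m * (u : ℝ) - j) := by
        funext i
        refine (polygon_apply (fun j => q j i) hj h.le h'.le).trans ?_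
        simp [AffineMap.lineMap_apply]
      rw [e]
      obtain ⟨v, hv, h1, h2, -⟩ := hpt j hj
      refine ((hf _ (hv.isProductCell hnum)).le_max_of_mem_segment h1 h2 ?_).trans
        (max_le (hmax j (by simp; omega)) (hmax (j + 1) (by simpa using hj)))
      rw [segment_eq_image_lineMap]
      exact ⟨_, ⟨by linarith, by linarith⟩, rfl⟩
  · rw [h₀]
    exact hqB _ hj₀'

end

end

section

/-! ## Orthogonalization with coefficients -/

/-- The coordinates of a point, followed by `1`. -/
noncomputable def hat {d : ℕ} (p : Pt d) (c : ℕ) : ℝ := if h : c < d then p ⟨c, h⟩ else 1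

/-- The row `z` is the vector in the columns `0, …, d`, followed by its coefficients with respect
to the vectors `o 0, …, o (d + 1)`; it belongs to `o r` and to combinations of its predecessors, and
it is orthogonal to the first `j` rows of `Z`. -/
structure IsOrthoRow (d : ℕ) (o Z : ℕ → ℕ → ℝ) (r : ℕ) (z : ℕ → ℝ) (j : ℕ) : Prop where
  comb : ∀ c ≤ d, z c = ∑ m ∈ Finset.range (d + 2), z (d + 1 + m) * o m c
  one : z (d + 1 + r) = 1
  zero : ∀ m, r < m → m < d + 2 → z (d + 1 + m) = 0
  orth : ∀ j' < j, ∑ c ∈ Finset.range (d + 1), z c * Z j' c = 0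

/-- The first `r` rows of `Z` arise from `o` by orthogonalization. -/
def IsOrtho (d : ℕ) (o Z : ℕ → ℕ → ℝ) (r : ℕ) : Prop := ∀ l < r, IsOrthoRow d o Z l (Z l) l

variable {d : ℕ} {o o' Z Z' : ℕ → ℕ → ℝ} {r : ℕ}

/-- One subtraction of the Gram-Schmidt process, applied simultaneously to the vector and to its
coefficients. Row `j` is supported on earlier vectors, so the leading coefficient `1` survives. -/
theorem IsOrthoRow.step {z z' : ℕ → ℝ} {j : ℕ} (hZ : IsOrtho d o Z r) (hz : IsOrthoRow d o Z r z j)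
    (hj : j < r) (hr : r < d + 2)
    (hz' : ∀ c < 2 * d + 3, z' c = z c - (∑ c ∈ Finset.range (d + 1), z c * Z j c) /
      (∑ c ∈ Finset.range (d + 1), Z j c * Z j c) * Z j c) : IsOrthoRow d o Z r z' (j + 1) := by
  have hj' := hZ j hj
  generalize hα : (∑ c ∈ Finset.range (d + 1), z c * Z j c) /
      (∑ c ∈ Finset.range (d + 1), Z j c * Z j c) = α at hz'
  refine ⟨fun c hc => ?_, ?_, fun m hm hm' => ?_, fun j' hj'' => ?_⟩
  · rw [hz' c (by omega), hz.comb c hc, hj'.comb c hc, Finset.mul_sum, ← Finset.sum_sub_distrib]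
    refine Finset.sum_congr rfl fun m hm => ?_
    rw [Finset.mem_range] at hm
    rw [hz' _ (by omega)]
    ring
  · rw [hz' _ (by omega), hz.one, hj'.zero r hj hr, mul_zero, sub_zero]
  · rw [hz' _ (by omega), hz.zero m hm hm', hj'.zero m (by omega) hm', mul_zero, sub_zero]
  · have e : ∑ c ∈ Finset.range (d + 1), z' c * Z j' c = ∑ c ∈ Finset.range (d + 1), z c * Z j' c -
        α * ∑ c ∈ Finset.range (d + 1), Z j c * Z j' c := by
      rw [Finset.mul_sum, ← Finset.sum_sub_distrib]
      refine Finset.sum_congr rfl fun c hc => ?_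
      rw [Finset.mem_range] at hc
      rw [hz' c (by omega)]
      ring
    rw [e]
    rcases Nat.lt_succ_iff_lt_or_eq.1 hj'' with h | rfl
    · rw [hz.orth j' h, hj'.orth j' h, mul_zero, sub_zero]
    · rw [← hα]
      -- If the earlier row is zero, the quotient has denominator `0`; this is harmless, since
      -- everything is orthogonal to this row.
      by_cases h0 : ∑ c ∈ Finset.range (d + 1), Z j' c * Z j' c = 0
      · have : ∀ c ∈ Finset.range (d + 1), Z j' c = 0 := fun c hc => by
          have := (Finset.sum_eq_zero_iff_of_nonneg fun c _ => mul_self_nonneg (Z j' c)).1 h0 c hc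
          simpa using this
        rw [h0, mul_zero, sub_zero]
        exact Finset.sum_eq_zero fun c hc => by rw [this c hc, mul_zero]
      · rw [div_mul_cancel₀ _ h0, sub_self]

/-- The coefficients of the first `r` rows with respect to later vectors vanish, so a new vector may
be prescribed at position `r` without affecting them. -/
theorem IsOrtho.congr (h : IsOrtho d o Z r) (hr : r < d + 2) (ho : ∀ m < r, o' m = o m)
    (hZ : ∀ l < r, ∀ c < 2 * d + 3, Z' l c = Z l c) : IsOrtho d o' Z' r := by
  intro l hl
  have h := h l hl
  refine ⟨fun c hc => ?_, ?_, fun m hm hm' => ?_, fun j hj => ?_⟩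
  · rw [hZ l hl c (by omega), h.comb c hc]
    refine Finset.sum_congr rfl fun m hm => ?_
    rw [Finset.mem_range] at hm
    rw [hZ l hl _ (by omega)]
    by_cases hmr : m < r
    · rw [ho m hmr]
    · rw [h.zero m (by omega) hm, zero_mul, zero_mul]
  · rw [hZ l hl _ (by omega), h.one]
  · rw [hZ l hl _ (by omega), h.zero m hm hm']
  · rw [← h.orth j hj]
    refine Finset.sum_congr rfl fun c hc => ?_
    rw [Finset.mem_range] at hc
    rw [hZ l hl _ (by omega), hZ j (by omega) _ (by omega)]

theorem IsOrtho.succ (h : IsOrtho d o Z r) (h' : IsOrthoRow d o Z r (Z r) r) :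
    IsOrtho d o Z (r + 1) := by
  intro l hl
  rcases Nat.lt_succ_iff_lt_or_eq.1 hl with hl | rfl
  · exact h l hl
  · exact h'

theorem IsOrthoRow.init {z : ℕ → ℝ} (hr : r < d + 2) (hz : ∀ c ≤ d, z c = o r c)
    (hz' : ∀ m < d + 2, z (d + 1 + m) = if m = r then 1 else 0) : IsOrthoRow d o Z r z 0 := by
  refine ⟨fun c hc => ?_, ?_, fun m hm hm' => ?_, fun j hj => absurd hj (Nat.not_lt_zero _)⟩
  · rw [hz c hc, Finset.sum_eq_single r]
    · simp [hz' r hr]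
    · intro m hm hmr
      rw [hz' m (Finset.mem_range.1 hm), if_neg hmr, zero_mul]
    · intro h
      exact absurd (Finset.mem_range.2 hr) h
  · rw [hz' r hr, if_pos rfl]
  · rw [hz' m hm', if_neg (by omega)]

theorem hat_sum {r : ℕ} {v : ℕ → Pt d} {l : ℕ → ℝ} {p : Pt d} (h1 : ∑ m ∈ Finset.range r, l m = 1)
    (h : ∑ m ∈ Finset.range r, l m • v m = p) (c : ℕ) :
    ∑ m ∈ Finset.range r, l m * hat (v m) c = hat p c := by
  unfold hat
  split_ifs with hc
  · rw [← h]
    simp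
  · simpa using h1

/-- The last row of the orthogonalization decides whether the point lies in the simplex. -/
theorem IsOrtho.mem_realize_iff {v : ℕ → Pt d} {p : Pt d} {Δ : Finset (Pt d)}
    (hΔ : AffineIndependent ℝ ((↑) : Δ → Pt d)) (hv : Set.BijOn v (Set.Iio r) Δ) (hr : r < d + 2)
    (ho : ∀ m < r, o m = hat (v m)) (hp : o r = hat p) (h : IsOrtho d o Z (r + 1)) :
    ((∀ c ≤ d, Z r c = 0) ∧ ∀ m < r, Z r (d + 1 + m) ≤ 0) ↔ p ∈ realize Δ := by
  classical
  have hrow : ∀ c ≤ d, Z r c = ∑ m ∈ Finset.range r, Z r (d + 1 + m) * hat (v m) c + hat p c := by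
    intro c hc
    have h' := h r (Nat.lt_succ_self r)
    rw [h'.comb c hc, ← Finset.sum_subset (Finset.range_subset_range.2 (show r + 1 ≤ d + 2 by omega)),
      Finset.sum_range_succ, h'.one, one_mul, hp]
    · congr 1
      refine Finset.sum_congr rfl fun m hm => ?_
      rw [ho m (Finset.mem_range.1 hm)]
    · intro m hm hm'
      simp only [Finset.mem_range, not_lt] at hm hm'
      rw [h'.zero m (by omega) hm, zero_mul]
  have hsum : ∀ {M : Type} [AddCommMonoid M] (g : Pt d → M),
      ∑ x ∈ Δ, g x = ∑ m ∈ Finset.range r, g (v m) := by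
    intro M _ g
    symm
    refine Finset.sum_bij (fun m _ => v m) (fun m hm => ?_) (fun m hm m' hm' e => ?_)
      (fun x hx => ?_) fun _ _ => rfl
    · exact hv.mapsTo (Finset.mem_range.1 hm)
    · exact hv.injOn (Finset.mem_range.1 hm) (Finset.mem_range.1 hm') e
    · obtain ⟨m, hm, rfl⟩ := hv.surjOn hx
      exact ⟨m, Finset.mem_range.2 hm, rfl⟩
  constructor
  · rintro ⟨h0, hneg⟩
    -- If the vector part vanishes, the row states a linear relation in which `hat p` has
    -- coefficient `1`. The negated remaining coefficients are then barycentric coordinates of `p`;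
    -- column `d`, where all vectors have the entry `1`, shows that their sum is `1`.
    refine (convex_realize Δ).sum_mem (t := Finset.range r) (w := fun m => - Z r (d + 1 + m))
      (z := v) (fun m hm => by linarith [hneg m (Finset.mem_range.1 hm)]) ?_
      (fun m hm => subset_convexHull ℝ _ (hv.mapsTo (Finset.mem_range.1 hm))) |> cast ?_
    · congr 1
      ext c
      have := hrow c c.2.le
      rw [h0 c c.2.le] at this
      simp only [hat, c.2, dif_pos] at this
      simp only [neg_smul, Finset.sum_neg_distrib, PiLp.neg_apply, WithLp.ofLp_sum,
        Finset.sum_apply, PiLp.smul_apply, smul_eq_mul]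
      linarith
    · have := hrow d le_rfl
      rw [h0 d le_rfl] at this
      simp only [hat, lt_irrefl, dif_neg, not_false_eq_true, mul_one] at this
      rw [Finset.sum_neg_distrib]
      linarith
  · intro hmem
    obtain ⟨w, hw, hw1, hwp⟩ := Finset.mem_convexHull'.1 hmem
    rw [hsum] at hw1 hwp
    have hhat : ∀ c, ∑ m ∈ Finset.range r, w (v m) * hat (v m) c = hat p c := hat_sum hw1 hwp
    -- Inductively, each vector of a vertex is a combination of the rows up to its own, and the last
    -- row is orthogonal to all of them.
    have horth : ∀ m < r, ∑ c ∈ Finset.range (d + 1), Z r c * hat (v m) c = 0 := by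
      intro m
      induction m using Nat.strong_induction_on with
      | _ m ih =>
        intro hm
        have hm' := h m (by omega)
        have e : ∀ c ≤ d, hat (v m) c =
            Z m c - ∑ l ∈ Finset.range m, Z m (d + 1 + l) * hat (v l) c := by
          intro c hc
          rw [hm'.comb c hc, ← Finset.sum_subset
            (Finset.range_subset_range.2 (show m + 1 ≤ d + 2 by omega)), Finset.sum_range_succ,
            hm'.one, one_mul, ho m hm]
          · rw [Finset.sum_congr rfl fun l hl => by rw [ho l ((Finset.mem_range.1 hl).trans hm)]]
            ring
          · intro l hl hl'
            simp only [Finset.mem_range, not_lt] at hl hl'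
            rw [hm'.zero l (by omega) hl, zero_mul]
        rw [Finset.sum_congr rfl fun c hc => by
          rw [e c (by simpa [Nat.lt_succ_iff] using hc), mul_sub, Finset.mul_sum]]
        rw [Finset.sum_sub_distrib, (h r (Nat.lt_succ_self r)).orth m hm, Finset.sum_comm, zero_sub,
          neg_eq_zero]
        refine Finset.sum_eq_zero fun l hl => ?_
        have hl := Finset.mem_range.1 hl
        rw [Finset.sum_congr rfl fun c _ => show Z r c * (Z m (d + 1 + l) * hat (v l) c) =
          Z m (d + 1 + l) * (Z r c * hat (v l) c) by ring, ← Finset.mul_sum,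
          ih l hl (hl.trans hm), mul_zero]
    -- As `p` is a combination of the vertices, the last row lies in the span of their vectors;
    -- being orthogonal to this span, it is zero.
    have hzero : ∑ c ∈ Finset.range (d + 1), Z r c * Z r c = 0 := by
      rw [Finset.sum_congr rfl fun c hc => show Z r c * Z r c =
        ∑ m ∈ Finset.range r, (Z r (d + 1 + m) + w (v m)) * (Z r c * hat (v m) c) by
          conv_lhs => rw [hrow c (by simpa [Nat.lt_succ_iff] using hc), ← hhat c,
            ← Finset.sum_add_distrib, Finset.sum_mul]
          rw [hrow c (by simpa [Nat.lt_succ_iff] using hc), ← hhat c,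
            ← Finset.sum_add_distrib]
          refine Finset.sum_congr rfl fun m _ => ?_
          ring]
      rw [Finset.sum_comm]
      refine Finset.sum_eq_zero fun m hm => ?_
      rw [← Finset.mul_sum, horth m (Finset.mem_range.1 hm), mul_zero]
    have hz : ∀ c ≤ d, Z r c = 0 := fun c hc => by
      have := (Finset.sum_eq_zero_iff_of_nonneg fun c _ => mul_self_nonneg (Z r c)).1 hzero c
        (by simp; omega)
      simpa using this
    refine ⟨hz, fun m hm => ?_⟩
    have hrel : ∀ c ≤ d, ∑ m ∈ Finset.range r, (Z r (d + 1 + m) + w (v m)) * hat (v m) c = 0 := by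
      intro c hc
      rw [← hz c hc, hrow c hc, ← hhat c, ← Finset.sum_add_distrib]
      exact Finset.sum_congr rfl fun m _ => by ring
    -- The coefficients are carried over from indices to points. By affine independence the row
    -- holds the negated barycentric coordinates of `p`, so its coefficients are not positive.
    set g : Pt d → ℝ := fun x => Z r (d + 1 + Function.invFunOn v (Set.Iio r) x) + w x
    have hg : ∀ m < r, g (v m) = Z r (d + 1 + m) + w (v m) := fun m hm => by
      simp only [g]
      rw [hv.injOn.leftInvOn_invFunOn (Set.mem_Iio.2 hm)]
    have hvm := hv.mapsTo (Set.mem_Iio.2 hm)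
    have key := affineIndependent_iff.1 hΔ Finset.univ (fun u => g u) ?_ ?_ ⟨v m, hvm⟩
      (Finset.mem_univ _)
    · have hk : g (v m) = 0 := key
      rw [hg m hm] at hk
      linarith [hw (v m) hvm]
    · rw [Finset.sum_coe_sort Δ g, hsum]
      have := hrel d le_rfl
      simp only [hat, lt_irrefl, dif_neg, not_false_eq_true, mul_one] at this
      rw [← this]
      exact Finset.sum_congr rfl fun m hm => hg m (Finset.mem_range.1 hm)
    · rw [Finset.sum_coe_sort Δ fun x => g x • x, hsum]
      ext c
      have := hrel c c.2.le
      simp only [hat, c.2, dif_pos] at this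
      simp only [WithLp.ofLp_sum, Finset.sum_apply, PiLp.smul_apply, smul_eq_mul, PiLp.zero_apply]
      rw [← this]
      exact Finset.sum_congr rfl fun m hm => by rw [hg m (Finset.mem_range.1 hm)]

end

/-! ## Initialization -/

theorem Cmd.Frame.refl (c : Cmd) (μ : Mem) : c.Frame μ μ :=
  ⟨fun _ _ => rfl, fun _ _ => rfl, fun _ _ => rfl⟩

theorem Cmd.Frame.trans {c : Cmd} {μ₁ μ₂ μ₃ : Mem} (h : c.Frame μ₁ μ₂) (h' : c.Frame μ₂ μ₃) :
    c.Frame μ₁ μ₃ :=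
  ⟨fun x hx => (h'.var x hx).trans (h.var x hx), fun x hx => (h'.arr x hx).trans (h.arr x hx),
    fun x hx => (h'.real x hx).trans (h.real x hx)⟩

/-- A loop with the rounds `0, …, m - 1`, controlled by the counter `x`. -/
theorem Run.for_var {P : Program} {O : Oracle} {c : Cmd} (I : ℕ → Mem → Prop) (x : ℕ) (e : IExp)
    (m t : ℕ) (hc : c.callFree = true) {Q : Mem → Prop}
    {μ : Mem} (hx : ∀ j μ', j ≤ m → I j μ' → c.Frame μ μ' → μ'.var x = j ∧ e.eval μ' = m)
    (hstep : ∀ j μ', j < m → I j μ' → c.Frame μ μ' → Run P O c μ' t (I (j + 1))) (h : I 0 μ)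
    (hQ : ∀ μ', I m μ' → c.Frame μ μ' → Q μ') :
    Run P O (.loop (.lt (.var x) e) c) μ (m * (e.cost + 4 + t) + e.cost + 4) Q := by
  refine (Run.for_range (fun j μ' => I j μ' ∧ c.Frame μ μ') (i := 0) (m := m) (t := t)
    (Nat.zero_le _) ?_ ?_ ⟨h, Cmd.Frame.refl c μ⟩).mono ?_ fun μ' h => hQ μ' h.1 h.2
  · rintro j μ' - hj ⟨h₁, h₂⟩
    obtain ⟨h₃, h₄⟩ := hx j μ' hj.le h₁ h₂
    refine ⟨?_, (hstep j μ' hj h₁ h₂).withFrame hc fun μ₂ h f => ⟨h, h₂.trans f⟩⟩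
    simp [h₃, h₄]
    omega
  · rintro μ' ⟨h₁, h₂⟩
    obtain ⟨h₃, h₄⟩ := hx m μ' le_rfl h₁ h₂
    simp [h₃, h₄]
  · simp
    have : 1 + 1 + 1 + e.cost + 1 + t = e.cost + 4 + t := by ring
    rw [this]
    omega

open Cmd in
/-- One round of `maxSizeCmd`. -/
def maxSizeStep : Cmd :=
  ite (.lt (.var 2) (.get 0 (.var 10))) (setVar 2 (.get 0 (.var 10))) skip ;;
  setVar 10 (.succ (.var 10))

open Cmd in
/-- Computes the number `n` of simplices of the largest complex. -/
def maxSizeCmd : Cmd :=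
  (setVar 2 (.const 0) ;; setVar 10 (.const 0)) ;; loop (.lt (.var 10) (.var 0)) maxSizeStep

open Cmd in
/-- Multiplies the variable `3` by `n`. -/
def powStep : Cmd :=
  (setVar 11 (.const 0) ;; setVar 12 (.const 0)) ;;
  loop (.lt (.var 12) (.var 2))
    (setVar 11 (.add (.var 11) (.var 3)) ;; setVar 12 (.succ (.var 12))) ;;
  (setVar 3 (.var 11) ;; setVar 4 (.add (.var 4) (.var 1)) ;; setVar 10 (.succ (.var 10)))

open Cmd in
/-- Computes `n ^ k` and `k * d`. -/
def powCmd : Cmd :=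
  (setVar 3 (.const 1) ;; setVar 4 (.const 0) ;; setVar 10 (.const 0)) ;;
  loop (.lt (.var 10) (.var 0)) powStep

open Cmd in
/-- One round of `tableCmd`. -/
def tableStep : Cmd :=
  setArr 7 (.var 10) (.var 11) ;; setArr 8 (.var 10) (.var 12) ;; setArr 9 (.var 10) (.var 13) ;;
  setVar 13 (.add (.var 13) (.var 2)) ;;
  ite (.le (.var 2) (.succ (.var 12)))
    (setVar 11 (.succ (.var 11)) ;; setVar 12 (.const 0))
    (setVar 12 (.succ (.var 12))) ;;
  setVar 10 (.succ (.var 10))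

open Cmd in
/-- Tabulates the quotients, remainders and products of the numbers below `n ^ k` with `n`. -/
def tableCmd : Cmd :=
  (setVar 10 (.const 0) ;; setVar 11 (.const 0) ;; setVar 12 (.const 0) ;; setVar 13 (.const 0)) ;;
  loop (.lt (.var 10) (.var 3)) tableStep

open Cmd in
/-- The initialization. -/
def initCmd : Cmd := maxSizeCmd ;; powCmd ;; tableCmd

/-- The memory after the initialization. -/
structure IsReady {k d : ℕ} (C : Fin k → GeoComplex d) (s t : Fin k → Pt d)
    (num : Fin k → ℕ → Finset (Pt d)) (n : ℕ) (μ : Mem) : Prop where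
  input : EncodesInput C s t num μ
  var_two : μ.var 2 = n
  var_three : μ.var 3 = n ^ k
  var_four : μ.var 4 = k * d
  quot : ∀ x < n ^ k, μ.arr 7 x = x / n
  rem : ∀ x < n ^ k, μ.arr 8 x = x % n
  prod : ∀ x < n ^ k, μ.arr 9 x = x * n

section

variable {k d : ℕ} {C : Fin k → GeoComplex d} {s t : Fin k → Pt d}
  {num : Fin k → ℕ → Finset (Pt d)} {f : (Fin k → Pt d) → ℝ} {n : ℕ}

theorem EncodesInput.congr {μ μ' : Mem} (h : EncodesInput C s t num μ) (h0 : μ'.var 0 = μ.var 0)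
    (h1 : μ'.var 1 = μ.var 1) (ha : ∀ A < 6, μ'.arr A = μ.arr A) :
    EncodesInput C s t num μ' := by
  have a0 := ha 0 (by norm_num)
  have a1 := ha 1 (by norm_num)
  have a2 := ha 2 (by norm_num)
  have a3 := ha 3 (by norm_num)
  have a4 := ha 4 (by norm_num)
  have a5 := ha 5 (by norm_num)
  obtain ⟨h1, h2, h3, h4, h5, h6, h7, h8⟩ := h
  constructor <;> simp only [*, implies_true]
  exact h8

/-- The command does not destroy what the initialization computed. -/
def Cmd.keepsReady (c : Cmd) : Bool :=
  [0, 1, 2, 3, 4].all (fun x => !c.wv.contains x) &&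
  [0, 1, 2, 3, 4, 5, 7, 8, 9].all fun x => !c.wa.contains x

/-- The side condition is a Boolean computation on the command, which `rfl` settles in each
application. -/
theorem IsReady.of_frame {μ μ' : Mem} (h : IsReady C s t num n μ) {c : Cmd} (f : c.Frame μ μ')
    (hc : c.keepsReady = true) : IsReady C s t num n μ' := by
  simp only [Cmd.keepsReady, List.all_cons, List.all_nil, Bool.and_true, Bool.and_eq_true,
    Bool.not_eq_true', List.contains_eq_mem, decide_eq_false_iff_not] at hc
  obtain ⟨⟨v0, v1, v2, v3, v4⟩, a0, a1, a2, a3, a4, a5, a7, a8, a9⟩ := hc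
  refine ⟨h.input.congr (f.var 0 v0) (f.var 1 v1) fun A hA => ?_, ?_, ?_, ?_, ?_, ?_, ?_⟩
  · interval_cases A
    exacts [f.arr 0 a0, f.arr 1 a1, f.arr 2 a2, f.arr 3 a3, f.arr 4 a4, f.arr 5 a5]
  · rw [f.var 2 v2, h.var_two]
  · rw [f.var 3 v3, h.var_three]
  · rw [f.var 4 v4, h.var_four]
  · rw [f.arr 7 a7]; exact h.quot
  · rw [f.arr 8 a8]; exact h.rem
  · rw [f.arr 9 a9]; exact h.prod

variable {P : Program} {O : Oracle}

theorem run_maxSize (k : ℕ) : ∃ K, ∀ {O : Oracle} (μ : Mem) (a : Fin k → ℕ), μ.var 0 = k →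
    (∀ i : Fin k, μ.arr 0 i = a i) →
    Run P O maxSizeCmd μ K fun μ' => μ'.var 2 = Finset.univ.sup a := by
  refine ⟨maxSizeStep.ub * k + 10 * k + 20, fun {O} μ a h0 ha => ?_⟩
  refine (Run.seq (Run.exact rfl) fun μ₁ g₁ =>
    (Run.for_var (fun j μ' => μ'.var 10 = j ∧ μ'.var 0 = k ∧ μ'.arr 0 = μ.arr 0 ∧
      μ'.var 2 = (Finset.univ.filter fun i : Fin k => (i : ℕ) < j).sup a) 10 (.var 0) k
      maxSizeStep.ub rfl ?_ ?_ ?_ ?_)).mono (t := _) ?_ fun _ => id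
  · rintro j μ' - ⟨h1, h2, -⟩ -
    exact ⟨h1, h2⟩
  · rintro j μ' hj ⟨h1, h2, h3, h4⟩ -
    refine Run.simple rfl ?_
    have e : (Finset.univ.filter fun i : Fin k => (i : ℕ) < j + 1) =
        insert ⟨j, hj⟩ (Finset.univ.filter fun i : Fin k => (i : ℕ) < j) := by
      ext i
      simp [Fin.ext_iff]
      omega
    rw [e, Finset.sup_insert, ← h4, ← ha ⟨j, hj⟩]
    have e' : max (μ.arr 0 j) (μ'.var 2) =
        if μ'.var 2 + 1 ≤ μ.arr 0 j then μ.arr 0 j else μ'.var 2 := by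
      split_ifs <;> omega
    by_cases hlt : μ'.var 2 + 1 ≤ μ.arr 0 j
    · simp [maxSizeStep, h1, h2, h3, hlt]; omega
    · simp [maxSizeStep, h1, h2, h3, hlt]; omega
  · simp [g₁, h0]
  · rintro μ' ⟨-, -, -, h⟩ -
    rw [h]
    congr 1
    ext i
    simp
  · generalize maxSizeStep.ub = x
    simp
    nlinarith

/-- The machine cannot multiply integers, so each of the `k` multiplications by `n` consists of `n`
additions. -/
theorem run_pow (k : ℕ) : ∃ K, ∀ {O : Oracle}
    (μ : Mem) (n d : ℕ), μ.var 0 = k → μ.var 1 = d → μ.var 2 = n →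
    Run P O powCmd μ (K * (n + 1)) fun μ' => μ'.var 3 = n ^ k ∧ μ'.var 4 = k * d := by
  refine ⟨40 * k + 40, fun {O} μ n d h0 h1 h2 => ?_⟩
  refine (Run.seq (Run.exact rfl) fun μ₁ g₁ =>
    (Run.for_var (fun j μ' => μ'.var 10 = j ∧ μ'.var 0 = k ∧ μ'.var 1 = d ∧ μ'.var 2 = n ∧
      μ'.var 3 = n ^ j ∧ μ'.var 4 = j * d) 10 (.var 0) k
      (n * 15 + 25) rfl ?_ ?_ ?_ ?_)).mono (t := _) ?_ fun _ => id
  · rintro j μ' - ⟨h1, h2, -⟩ -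
    exact ⟨h1, h2⟩
  · rintro j μ' hj ⟨h1, h2, h3, h4, h5, h6⟩ -
    refine (Run.seq (Run.exact rfl) fun μ₁ g₁ => Run.seq (Run.for_var (fun i μ' => μ'.var 12 = i ∧
      μ'.var 2 = n ∧ μ'.var 3 = n ^ j ∧ μ'.var 11 = i * n ^ j) 12 (.var 2) n 10 rfl ?_ ?_ ?_
        fun μ' h f => And.intro h f)
      fun μ₂ g₂ => Run.simple rfl ?_).mono (t := _) ?_ fun _ => id
    · rintro j μ' - ⟨h1, h2, -⟩ -
      exact ⟨h1, h2⟩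
    · rintro i μ' hi ⟨h1, h2, h3, h4⟩ -
      refine (Run.simple rfl ?_).mono (t := _) (by simp) fun _ => id
      simp [h1, h2, h3, h4, Nat.add_mul]
    · simp [g₁, h4, h5]
    · obtain ⟨⟨k1, k2, k3, k4⟩, f⟩ := g₂
      have e10 := f.var 10 (by decide)
      have e0 := f.var 0 (by decide)
      have e1 := f.var 1 (by decide)
      have e4 := f.var 4 (by decide)
      simp [g₁] at e10 e0 e1 e4
      simp [k2, k4, e10, e0, e1, e4, h1, h2, h3, h6, pow_succ, mul_comm]
      ring
    · simp
      omega
  · simp [g₁, h0, h1, h2]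
  · rintro μ' ⟨-, -, -, -, h⟩ -
    exact h
  · simp
    nlinarith

/-- A counter with carry produces quotient and remainder of successive numbers in constant time
each, and a running sum produces the products. Later, division and multiplication by `n` are table
lookups. -/
theorem run_table : ∃ K, ∀ {O : Oracle} (μ : Mem) (n N : ℕ), 0 < n → μ.var 2 = n → μ.var 3 = N →
    Run P O tableCmd μ (K * (N + 1)) fun μ' => (∀ x < N, μ'.arr 7 x = x / n) ∧
      (∀ x < N, μ'.arr 8 x = x % n) ∧ ∀ x < N, μ'.arr 9 x = x * n := by
  refine ⟨tableStep.ub + 20, fun {O} μ n N hn h2 h3 => ?_⟩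
  refine (Run.seq (Run.exact rfl) fun μ₁ g₁ =>
    (Run.for_var (fun j μ' => (μ'.var 10 = j ∧ μ'.var 3 = N ∧ μ'.var 2 = n ∧
      μ'.var 11 = j / n ∧ μ'.var 12 = j % n ∧ μ'.var 13 = j * n) ∧
      (∀ x < j, μ'.arr 7 x = x / n) ∧ (∀ x < j, μ'.arr 8 x = x % n) ∧
        ∀ x < j, μ'.arr 9 x = x * n) 10 (.var 3) N
      tableStep.ub rfl ?_ ?_ ?_ ?_)).mono (t := _) ?_ fun _ => id
  · rintro j μ' - ⟨⟨h1, h2, -⟩, -⟩ -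
    exact ⟨h1, h2⟩
  · rintro j μ' hj ⟨⟨h1, h2, h3, h4, h5, h6⟩, h7, h8, h9⟩ -
    refine Run.simple rfl ?_
    have hmod := Nat.mod_lt j hn
    refine ⟨?_, ?_, ?_, ?_⟩
    · by_cases hc : n ≤ j % n + 1
      · have e : (j + 1) % n = 0 ∧ (j + 1) / n = j / n + 1 := by
          have := Nat.mod_add_div j n
          have e : j + 1 = n * (j / n + 1) := by rw [Nat.mul_add]; omega
          rw [e]
          exact ⟨Nat.mul_mod_right _ _, Nat.mul_div_cancel_left _ hn⟩
        simp [tableStep, h1, h2, h3, h4, h5, h6, hc, e, Nat.add_mul]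
      · have e : (j + 1) % n = j % n + 1 ∧ (j + 1) / n = j / n := by
          have := Nat.mod_add_div j n
          have e : j + 1 = (j % n + 1) + n * (j / n) := by omega
          rw [e, Nat.add_mul_mod_self_left, Nat.add_mul_div_left _ _ hn,
            Nat.mod_eq_of_lt (by omega), Nat.div_eq_of_lt (by omega)]
          simp
        simp [tableStep, h1, h2, h3, h4, h5, h6, hc, e, Nat.add_mul]
    all_goals
      intro x hx
      have hite : ∀ (c : Prop) [Decidable c] (a b : Mem) (A : ℕ),
          (if c then a else b).arr A = if c then a.arr A else b.arr A := by
        intro c _ a b A; split_ifs <;> rfl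
      rcases Nat.lt_succ_iff_lt_or_eq.1 hx with hx | rfl
      · by_cases hc : n ≤ j % n + 1 <;>
        simp [tableStep, h1, h3, h5, hc, hx.ne, h7 x hx, h8 x hx, h9 x hx]
      · by_cases hc : n ≤ x % n + 1 <;>
        simp [tableStep, h1, h3, h4, h5, h6, hc]
  · simp [g₁, h2, h3]
  · rintro μ' ⟨-, h⟩ -
    exact h
  · generalize tableStep.ub = x
    simp
    nlinarith

theorem size_le_sup (i : Fin k) : (C i).size ≤ Finset.univ.sup fun i => (C i).size :=
  Finset.le_sup (f := fun i => (C i).size) (Finset.mem_univ i)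

theorem run_init (k d : ℕ) (hk : 0 < k) : ∃ K, ∀ {O : Oracle}
    (C : Fin k → GeoComplex d) (s t : Fin k → Pt d)
    (num : Fin k → ℕ → Finset (Pt d)) (μ : Mem), EncodesInput C s t num μ →
    Run P O initCmd μ (K * (Finset.univ.sup fun i => (C i).size) ^ k)
      (IsReady C s t num (Finset.univ.sup fun i => (C i).size)) := by
  obtain ⟨K₁, h₁⟩ := run_maxSize (P := P) k
  obtain ⟨K₂, h₂⟩ := run_pow (P := P) k
  obtain ⟨K₃, h₃⟩ := run_table (P := P)
  refine ⟨K₁ + 2 * K₂ + 2 * K₃, fun {O} C s t num μ h => ?_⟩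
  obtain ⟨n, hn⟩ : ∃ n, n = Finset.univ.sup fun i => (C i).size := ⟨_, rfl⟩
  have hn0 : 0 < n := by
    have := h.start_lt ⟨0, hk⟩
    have := size_le_sup (C := C) ⟨0, hk⟩
    omega
  -- For `k ≥ 1` the cost `O(n)` of computing the power is absorbed by `O(n ^ k)`.
  have hnk : n ≤ n ^ k := Nat.le_self_pow hk.ne' n
  rw [← hn]
  refine (Run.seq ((h₁ μ (fun i => (C i).size) h.var_zero h.size).withFrame rfl
    fun μ₁ g f => And.intro g f) fun μ₁ ⟨g₁, f₁⟩ => Run.seq ((h₂ μ₁ n d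
      ((f₁.var 0 (by decide)).trans h.var_zero) ((f₁.var 1 (by decide)).trans h.var_one)
      (g₁.trans hn.symm)).withFrame rfl fun μ₁ g f => And.intro g f) fun μ₂ ⟨g₂, f₂⟩ =>
      ((h₃ μ₂ n (n ^ k) hn0 ((f₂.var 2 (by decide)).trans (g₁.trans hn.symm)) g₂.1).withFrame rfl
        fun μ₃ g₃ f₃ => ?_)).mono (t := _) ?_ fun _ => id
  · refine ⟨((h.congr (f₁.var 0 (by decide)) (f₁.var 1 (by decide)) fun A hA => ?_).congr
      (f₂.var 0 (by decide)) (f₂.var 1 (by decide)) fun A hA => ?_).congr (f₃.var 0 (by decide))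
      (f₃.var 1 (by decide)) fun A hA => ?_, ?_, ?_, ?_, g₃.1, g₃.2.1, g₃.2.2⟩
    · interval_cases A <;> exact f₁.arr _ (by decide)
    · interval_cases A <;> exact f₂.arr _ (by decide)
    · interval_cases A <;> exact f₃.arr _ (by decide)
    · rw [f₃.var 2 (by decide), f₂.var 2 (by decide), g₁, hn]
    · rw [f₃.var 3 (by decide), g₂.1]
    · rw [f₃.var 4 (by decide), g₂.2]
  · have : 1 ≤ n ^ k := Nat.one_le_pow _ _ hn0
    nlinarith

end

/-! ## Numbers of cells -/

open Cmd in
/-- One round of `decodeCmd`. -/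
def decodeStep : Cmd :=
  setArr 6 (.var 10) (.get 8 (.var 51)) ;;
  ite (.le (.get 0 (.var 10)) (.get 8 (.var 51))) (setVar 52 (.const 0)) skip ;;
  setVar 51 (.get 7 (.var 51)) ;;
  setVar 10 (.succ (.var 10))

open Cmd in
/-- Writes the digits of the variable `50` into the array `6`; the variable `52` tells whether it is
the number of a cell. -/
def decodeCmd : Cmd :=
  (setVar 51 (.var 50) ;; setVar 52 (.const 1) ;; setVar 10 (.const 0)) ;;
  loop (.lt (.var 10) (.var 0)) decodeStep

open Cmd in
/-- One round of `encodeCmd`. -/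
def encodeStep : Cmd :=
  setVar 53 (.add (.get 9 (.var 53)) (.get 6 (.sub (.var 0) (.succ (.var 10))))) ;;
  setVar 10 (.succ (.var 10))

open Cmd in
/-- Computes the number of the cell in the array `6`. -/
def encodeCmd : Cmd :=
  (setVar 53 (.const 0) ;; setVar 10 (.const 0)) ;;
  loop (.lt (.var 10) (.var 0)) encodeStep

open Cmd in
/-- Appends the arc from `u` to `v` and its reverse to the list of the arcs; their weight is the
function value that the oracle has returned. -/
def emitCmd (u v : ℕ) : Cmd :=
  setArr 10 (.var 23) (.var u) ;; setArr 11 (.var 23) (.var v) ;;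
  setReal 10 (.var 23) (.get 4 (.var 4)) ;; setVar 23 (.succ (.var 23)) ;;
  setArr 10 (.var 23) (.var v) ;; setArr 11 (.var 23) (.var u) ;;
  setReal 10 (.var 23) (.get 4 (.var 4)) ;; setVar 23 (.succ (.var 23))

theorem digit_add_mul {n a y : ℕ} (h : a < n) (i : ℕ) :
    digit n (y * n + a) (i + 1) = digit n y i := by
  rw [digit, digit, pow_succ', ← Nat.div_div_eq_div_mul, mul_comm, Nat.mul_add_div (by omega),
    Nat.div_eq_of_lt h, add_zero]

theorem digit_add_mul_zero {n a y : ℕ} (h : a < n) : digit n (y * n + a) 0 = a := by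
  simp [digit, mul_comm y, Nat.mod_eq_of_lt h]

/-! ### Lists of arcs and numbers of cells -/

/-- The symmetric list of arcs in the memory consists of the arcs in `S` and their reverses. -/
def HasArcs (μ : Mem) (S : Set (ℕ × ℕ × ℝ)) : Prop :=
  arcSet (μ.var 23) (μ.arr 10) (μ.arr 11) (μ.real 10) = {e | e ∈ S ∨ (e.2.1, e.1, e.2.2) ∈ S}

theorem HasArcs.congr {μ μ' : Mem} {S : Set (ℕ × ℕ × ℝ)} (h : HasArcs μ S)
    (h1 : μ'.var 23 = μ.var 23) (h2 : μ'.arr 10 = μ.arr 10) (h3 : μ'.arr 11 = μ.arr 11)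
    (h4 : μ'.real 10 = μ.real 10) : HasArcs μ' S := by
  rwa [HasArcs, h1, h2, h3, h4]

/-- The command does not change the list of the arcs. -/
def Cmd.keepsArcs (c : Cmd) : Bool :=
  !c.wv.contains 23 && !c.wa.contains 10 && !c.wa.contains 11 && !c.wr.contains 10

theorem HasArcs.of_frame {μ μ' : Mem} {S : Set (ℕ × ℕ × ℝ)} (h : HasArcs μ S) {c : Cmd}
    (f : c.Frame μ μ') (hc : c.keepsArcs = true) :
    HasArcs μ' S ∧ μ'.var 23 = μ.var 23 := by
  simp only [Cmd.keepsArcs, Bool.and_eq_true, Bool.not_eq_true', List.contains_eq_mem,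
    decide_eq_false_iff_not] at hc
  obtain ⟨⟨⟨h1, h2⟩, h3⟩, h4⟩ := hc
  exact ⟨h.congr (f.var _ h1) (f.arr _ h2) (f.arr _ h3) (f.real _ h4), f.var _ h1⟩

theorem arcSet_succ (M : ℕ) (F T : ℕ → ℕ) (W : ℕ → ℝ) :
    arcSet (M + 1) F T W = insert (F M, T M, W M) (arcSet M F T W) := by
  ext e
  simp only [arcSet, Set.mem_ofPred_eq, Set.mem_insert_iff]
  constructor
  · rintro ⟨a, ha, rfl⟩
    rcases Nat.lt_succ_iff_lt_or_eq.1 ha with h | rfl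
    · exact Or.inr ⟨a, h, rfl⟩
    · exact Or.inl rfl
  · rintro (rfl | ⟨a, ha, rfl⟩)
    · exact ⟨M, Nat.lt_succ_self M, rfl⟩
    · exact ⟨a, by omega, rfl⟩

theorem arcSet_congr {M : ℕ} {F F' T T' : ℕ → ℕ} {W W' : ℕ → ℝ} (hF : ∀ a < M, F' a = F a)
    (hT : ∀ a < M, T' a = T a) (hW : ∀ a < M, W' a = W a) :
    arcSet M F' T' W' = arcSet M F T W := by
  ext e
  simp only [arcSet, Set.mem_ofPred_eq]
  refine exists_congr fun a => and_congr_right fun ha => ?_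
  rw [hF a ha, hT a ha, hW a ha]

section

variable {k d : ℕ} {C : Fin k → GeoComplex d} {s t : Fin k → Pt d}
  {num : Fin k → ℕ → Finset (Pt d)} {f : (Fin k → Pt d) → ℝ} {n : ℕ} {P : Program} {O : Oracle}

theorem run_emit {u v : ℕ} (hu : u ≠ 23) (hv : v ≠ 23) {μ : Mem} {S : Set (ℕ × ℕ × ℝ)}
    (h : HasArcs μ S) :
    Run P O (emitCmd u v) μ 31 fun μ' =>
      HasArcs μ' (insert (μ.var u, μ.var v, μ.real 4 (μ.var 4)) S) ∧
        μ'.var 23 = μ.var 23 + 2 := by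
  refine (Run.simple rfl ⟨?_, ?_⟩).mono (by simp [emitCmd]) fun _ => id
  · unfold HasArcs
    have e23 : ((emitCmd u v).step O μ).var 23 = μ.var 23 + 1 + 1 := by simp [emitCmd]
    rw [e23, arcSet_succ, arcSet_succ, arcSet_congr (F := μ.arr 10) (T := μ.arr 11)
      (W := μ.real 10), show arcSet (μ.var 23) (μ.arr 10) (μ.arr 11) (μ.real 10) = _ from h]
    · ext ⟨x, y, w⟩
      simp [emitCmd, hu, hv]
      tauto
    · intro a ha
      simp [emitCmd, ha.ne, (ha.trans (Nat.lt_succ_self _)).ne]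
    · intro a ha
      simp [emitCmd, ha.ne, (ha.trans (Nat.lt_succ_self _)).ne]
    · intro a ha
      simp [emitCmd, ha.ne, (ha.trans (Nat.lt_succ_self _)).ne]
  · simp [emitCmd]

theorem IsReady.digits_size {μ : Mem} (h : IsReady C s t num n μ) {j : ℕ} (hj : j < k) :
    μ.arr 0 j = (C ⟨j, hj⟩).size := h.input.size ⟨j, hj⟩

/-- All components use the same base `n`, so a number below `n ^ k` may have a digit that exceeds
the size of a smaller complex; such numbers are recognized and later skipped. -/
theorem run_decode (k : ℕ) : ∃ K, ∀ {O : Oracle}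
    {d : ℕ} {C : Fin k → GeoComplex d} {s t : Fin k → Pt d}
    {num : Fin k → ℕ → Finset (Pt d)} {n : ℕ} (μ : Mem), IsReady C s t num n μ →
    μ.var 50 < n ^ k →
    Run P O decodeCmd μ K fun μ' => (∀ i < k, μ'.arr 6 i = digit n (μ.var 50) i) ∧
      (μ'.var 52 = 1 ↔ IsNode C n (μ.var 50)) := by
  refine ⟨k * (decodeStep.ub + 20) + 20, fun {O} {d C s t num n} μ h hx => ?_⟩
  obtain ⟨x, hxe⟩ : ∃ x, x = μ.var 50 := ⟨_, rfl⟩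
  rw [← hxe] at hx ⊢
  refine (Run.seq (Run.exact rfl) fun μ₁ g₁ => Run.for_var (fun j μ' => μ'.var 10 = j ∧
      μ'.var 51 = x / n ^ j ∧ (∀ i < j, μ'.arr 6 i = digit n x i) ∧
      (μ'.var 52 = 1 ↔ ∀ i : Fin k, (i : ℕ) < j → digit n x i < (C i).size) ∧
        IsReady C s t num n μ') 10 (.var 0) k decodeStep.ub rfl ?_ ?_ ?_ ?_).mono (t := _)
      ?_ fun _ => id
  · rintro j μ' - ⟨h1, h2, h3, h4, h5⟩ -
    exact ⟨h1, h5.input.var_zero⟩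
  · rintro j μ' hj ⟨h1, h2, h3, h4, h5⟩ -
    refine (Run.exact rfl).withFrame rfl fun μ₂ g₂ f₂ => ?_
    have hlt : x / n ^ j < n ^ k := (Nat.div_le_self _ _).trans_lt hx
    have e8 := h5.rem _ hlt
    have e7 := h5.quot _ hlt
    have e0 := h5.digits_size hj
    have hiff : (∀ i : Fin k, (i : ℕ) < j + 1 → digit n x i < (C i).size) ↔
        (∀ i : Fin k, (i : ℕ) < j → digit n x i < (C i).size) ∧
          digit n x j < (C ⟨j, hj⟩).size := by
      constructor
      · exact fun h => ⟨fun i hi => h i (by omega), h ⟨j, hj⟩ (Nat.lt_succ_self j)⟩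
      · rintro ⟨h, h'⟩ i hi
        rcases Nat.lt_succ_iff_lt_or_eq.1 hi with hi | hi
        · exact h i hi
        · obtain rfl : i = ⟨j, hj⟩ := Fin.ext hi
          exact h'
    have hready := h5.of_frame f₂ rfl
    have hd : x / n ^ j % n = digit n x j := rfl
    rw [hd] at e8
    rw [hiff, ← h4]
    refine ⟨?_, ?_, ?_, ?_, hready⟩
    · by_cases hc : (C ⟨j, hj⟩).size ≤ digit n x j <;>
        simp [g₂, decodeStep, h1, h2, e0, e8, e7, hc]
    · by_cases hc : (C ⟨j, hj⟩).size ≤ digit n x j <;>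
        simp [g₂, decodeStep, h1, h2, e0, e8, e7, hc, Nat.div_div_eq_div_mul, pow_succ]
    · intro i hi
      rcases Nat.lt_succ_iff_lt_or_eq.1 hi with hi | rfl
      · by_cases hc : (C ⟨j, hj⟩).size ≤ digit n x j <;>
          simp [g₂, decodeStep, h1, h2, e0, e8, e7, hc, hi.ne, h3 i hi]
      · by_cases hc : (C ⟨i, hj⟩).size ≤ digit n x i <;>
          simp [g₂, decodeStep, h1, h2, e0, e8, e7, hc]
    · by_cases hc : (C ⟨j, hj⟩).size ≤ digit n x j
      · simp [g₂, decodeStep, h1, h2, e0, e8, e7, hc, not_lt.2 hc]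
      · simp [g₂, decodeStep, h1, h2, e0, e8, e7, hc, not_le.1 hc]
  · refine ⟨by simp [g₁], by simp [g₁, hxe], fun i hi => absurd hi (Nat.not_lt_zero _), by simp [g₁],
      ?_⟩
    refine h.of_frame (c := decodeCmd) ?_ rfl
    rw [g₁]
    exact ⟨fun x hx => by simp [decodeCmd, Cmd.wv] at hx; simp [hx], fun _ _ => rfl, fun _ _ => rfl⟩
  · rintro μ' ⟨h1, h2, h3, h4, h5⟩ -
    exact ⟨h3, h4.trans ⟨fun h => ⟨hx, fun i => h i i.2⟩, fun h i _ => h.2 i⟩⟩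
  · generalize decodeStep.ub = x
    simp
    nlinarith

/-- Horner's scheme, beginning with the most significant digit: after `j` rounds the variable holds
the number formed by the last `j` entries. It is below `n ^ j`, so its multiple can be read from the
table. -/
theorem run_encode (k : ℕ) : ∃ K, ∀ {O : Oracle}
    {d : ℕ} {C : Fin k → GeoComplex d} {s t : Fin k → Pt d}
    {num : Fin k → ℕ → Finset (Pt d)} {n : ℕ} (μ : Mem), IsReady C s t num n μ →
    (∀ i < k, μ.arr 6 i < n) →
    Run P O encodeCmd μ K fun μ' => μ'.var 53 < n ^ k ∧
      ∀ i < k, digit n (μ'.var 53) i = μ.arr 6 i := by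
  refine ⟨k * (encodeStep.ub + 20) + 20, fun {O} {d C s t num n} μ h hx => ?_⟩
  refine (Run.seq (Run.exact rfl) fun μ₁ g₁ => Run.for_var (fun j μ' => μ'.var 10 = j ∧
      μ'.var 53 < n ^ j ∧ (∀ i < j, digit n (μ'.var 53) i = μ.arr 6 (k - j + i)) ∧
        μ'.arr 6 = μ.arr 6 ∧ IsReady C s t num n μ') 10 (.var 0) k encodeStep.ub rfl ?_ ?_ ?_ ?_).mono
      (t := _) ?_ fun _ => id
  · rintro j μ' - ⟨h1, h2, h3, h4, h5⟩ -
    exact ⟨h1, h5.input.var_zero⟩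
  · rintro j μ' hj ⟨h1, h2, h3, h4, h5⟩ -
    refine (Run.exact rfl).withFrame rfl fun μ₂ g₂ f₂ => ?_
    have ha := hx (k - (j + 1)) (by omega)
    have hn : 0 < n := by omega
    have hlt : μ'.var 53 < n ^ k := h2.trans_le (Nat.pow_le_pow_right hn hj.le)
    have e9 := h5.prod _ hlt
    have e53 : μ₂.var 53 = μ'.var 53 * n + μ.arr 6 (k - (j + 1)) := by
      simp [g₂, encodeStep, h1, h4, e9, h5.input.var_zero]
    rw [e53]
    refine ⟨by simp [g₂, encodeStep, h1], ?_, fun i hi => ?_,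
      (f₂.arr 6 (by decide)).trans h4, h5.of_frame f₂ rfl⟩
    · rw [pow_succ]
      nlinarith
    · rcases i with _ | i
      · rw [digit_add_mul_zero ha, add_zero]
      · rw [digit_add_mul ha, h3 i (by omega)]
        congr 1
        omega
  · refine ⟨by simp [g₁], by simp [g₁], fun i hi => absurd hi (Nat.not_lt_zero _), by simp [g₁],
      ?_⟩
    refine h.of_frame (c := encodeCmd) ?_ rfl
    rw [g₁]
    exact ⟨fun x hx => by simp [encodeCmd, Cmd.wv] at hx; simp [hx], fun _ _ => rfl, fun _ _ => rfl⟩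
  · rintro μ' ⟨h1, h2, h3, h4, h5⟩ -
    exact ⟨h2, fun i hi => by simpa using h3 i hi⟩
  · generalize encodeStep.ub = x
    simp
    nlinarith

end

/-! ## Orthogonalization in the machine -/

open Cmd in
/-- One round of `rowInitCmd`. -/
def rowInitStep (R : ℕ) : Cmd :=
  ite (.lt (.var 64) (.var 1))
    (setReal 5 (.add (.var 63) (.var 64)) (.get R (.add (.var 60) (.var 64))))
    (ite (.eq (.var 64) (.var 1))
      (setReal 5 (.add (.var 63) (.var 64)) (.const 1))
      (ite (.eq (.var 64) (.add (.succ (.var 1)) (.var 62)))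
        (setReal 5 (.add (.var 63) (.var 64)) (.const 1))
        (setReal 5 (.add (.var 63) (.var 64)) (.const 0)))) ;;
  setVar 64 (.succ (.var 64))

open Cmd in
/-- Writes a point from the real array `R`, with its coefficients, into the next row. -/
def rowInitCmd (R : ℕ) : Cmd :=
  setVar 64 (.const 0) ;; loop (.lt (.var 64) (.var 61)) (rowInitStep R)

open Cmd in
/-- One round of `dotCmd`. -/
def dotStep : Cmd :=
  setReal 7 (.const 2) (.add (.get 7 (.const 2))
    (.mul (.get 5 (.add (.var 63) (.var 64))) (.get 5 (.add (.var 66) (.var 64))))) ;;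
  setReal 7 (.const 3) (.add (.get 7 (.const 3))
    (.mul (.get 5 (.add (.var 66) (.var 64))) (.get 5 (.add (.var 66) (.var 64))))) ;;
  setVar 64 (.succ (.var 64))

open Cmd in
/-- Computes the inner products of the last row and of an earlier row with this earlier row. -/
def dotCmd : Cmd :=
  (setReal 7 (.const 2) (.const 0) ;; setReal 7 (.const 3) (.const 0) ;; setVar 64 (.const 0)) ;;
  loop (.lt (.var 64) (.succ (.var 1))) dotStep

open Cmd in
/-- One round of `subtractCmd`. -/
def subtractStep : Cmd :=
  setReal 5 (.add (.var 63) (.var 64)) (.sub (.get 5 (.add (.var 63) (.var 64)))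
    (.mul (.get 7 (.const 4)) (.get 5 (.add (.var 66) (.var 64))))) ;;
  setVar 64 (.succ (.var 64))

open Cmd in
/-- Subtracts a multiple of an earlier row from the last row. -/
def subtractCmd : Cmd :=
  (setReal 7 (.const 4) (.div (.get 7 (.const 2)) (.get 7 (.const 3))) ;;
    setVar 64 (.const 0)) ;;
  loop (.lt (.var 64) (.var 61)) subtractStep

open Cmd in
/-- Makes the last row orthogonal to an earlier row. -/
def reduceStep : Cmd :=
  dotCmd ;; subtractCmd ;;
  (setVar 65 (.succ (.var 65)) ;; setVar 66 (.add (.var 66) (.var 61)))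

open Cmd in
/-- Appends a point from the real array `R` to the orthogonal rows. -/
def pushCmd (R : ℕ) : Cmd :=
  rowInitCmd R ;; (setVar 65 (.const 0) ;; setVar 66 (.const 0)) ;;
  loop (.lt (.var 65) (.var 62)) reduceStep ;;
  (setVar 62 (.succ (.var 62)) ;; setVar 63 (.add (.var 63) (.var 61)))

/-- The rows of the matrix in the real array `5`. -/
def rowsOf (d : ℕ) (μ : Mem) (l c : ℕ) : ℝ := μ.real 5 (l * (2 * d + 3) + c)

/-- The variables that describe the matrix of orthogonal rows. -/
structure RowVars (d : ℕ) (μ : Mem) (r : ℕ) : Prop where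
  dim : μ.var 1 = d
  width : μ.var 61 = 2 * d + 3
  rows : μ.var 62 = r
  offset : μ.var 63 = r * (2 * d + 3)

section

variable {P : Program} {O : Oracle}

theorem run_rowInit (d R : ℕ) (hR : R ≠ 5) (μ : Mem) (r : ℕ) (h : RowVars d μ r) :
    Run P O (rowInitCmd R) μ ((2 * d + 3) * 60 + 10) fun μ' => RowVars d μ' r ∧
      (∀ l < r, ∀ c < 2 * d + 3, rowsOf d μ' l c = rowsOf d μ l c) ∧
      ∀ c < 2 * d + 3, rowsOf d μ' r c = if c < d then μ.real R (μ.var 60 + c) else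
        if c = d then 1 else if c = d + 1 + r then 1 else 0 := by
  refine (Run.seq (Run.exact rfl) fun μ₁ g₁ => Run.for_var (fun j μ' => μ'.var 64 = j ∧
      RowVars d μ' r ∧ μ'.var 60 = μ.var 60 ∧ μ'.real R = μ.real R ∧
      (∀ i < r * (2 * d + 3), μ'.real 5 i = μ.real 5 i) ∧
      ∀ c < j, rowsOf d μ' r c = if c < d then μ.real R (μ.var 60 + c) else
        if c = d then 1 else if c = d + 1 + r then 1 else 0) 64 (.var 61) (2 * d + 3)
      (rowInitStep R).ub rfl ?_ ?_ ?_ ?_).mono (t := _) ?_ fun _ => id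
  · rintro j μ' - ⟨h1, h2, -⟩ -
    exact ⟨h1, h2.width⟩
  · rintro j μ' hj ⟨h1, ⟨h2, h3, h4, h5⟩, h6, h7, h8, h9⟩ -
    refine Run.simple rfl ?_
    have key : (rowInitStep R).step O μ' =
        { μ' with
          real := Function.update μ'.real 5 (Function.update (μ'.real 5) (r * (2 * d + 3) + j)
            (if j < d then μ.real R (μ.var 60 + j) else
              if j = d then 1 else if j = d + 1 + r then 1 else 0))
          var := Function.update μ'.var 64 (j + 1) } := by
      by_cases c1 : j < d
      · simp [rowInitStep, h1, h2, h5, h6, h7, c1]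
      · by_cases c2 : j = d
        · simp [rowInitStep, h1, h2, h5, c2]
        · have : ¬ (j ≤ d ∧ d ≤ j) := by omega
          by_cases c3 : j = d + 1 + r
          · have hd : ¬ d + 1 + r ≤ d := by omega
            have hd' : ¬ d + 1 + r < d := by omega
            simp [rowInitStep, h1, h2, h4, h5, c3, hd, hd']
          · have : ¬ (j ≤ d + 1 + r ∧ d + 1 + r ≤ j) := by omega
            simp [rowInitStep, *]
    rw [key]
    refine ⟨by simp, ⟨by simp [h2], by simp [h3], by simp [h4], by simp [h5]⟩, by simp [h6],
      by simp [hR, h7], fun i hi => ?_, fun c hc => ?_⟩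
    · have : i ≠ r * (2 * d + 3) + j := by omega
      simp [this, h8 i hi]
    · rcases Nat.lt_succ_iff_lt_or_eq.1 hc with hc | rfl
      · rw [← h9 c hc]
        simp [rowsOf, hc.ne]
      · simp [rowsOf]
  · obtain ⟨h2, h3, h4, h5⟩ := h
    refine ⟨by simp [g₁], ⟨by simp [g₁, h2], by simp [g₁, h3], by simp [g₁, h4], by simp [g₁, h5]⟩,
      by simp [g₁], by simp [g₁], by simp [g₁], fun i hi => absurd hi (Nat.not_lt_zero _)⟩
  · rintro μ' ⟨-, h2, -, -, h5, h6⟩ -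
    refine ⟨h2, fun l hl c hc => h5 _ ?_, h6⟩
    nlinarith
  · simp [rowInitStep]
    nlinarith

theorem run_dot (d : ℕ) (μ : Mem) (r j : ℕ) (h : RowVars d μ r)
    (h66 : μ.var 66 = j * (2 * d + 3)) :
    Run P O dotCmd μ ((d + 1) * 60 + 30) fun μ' => RowVars d μ' r ∧
      μ'.real 7 2 = ∑ c ∈ Finset.range (d + 1), rowsOf d μ r c * rowsOf d μ j c ∧
      μ'.real 7 3 = ∑ c ∈ Finset.range (d + 1), rowsOf d μ j c * rowsOf d μ j c := by
  refine (Run.seq (Run.exact rfl) fun μ₁ g₁ => Run.for_var (fun i μ' => μ'.var 64 = i ∧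
      RowVars d μ' r ∧ μ'.var 66 = j * (2 * d + 3) ∧ μ'.real 5 = μ.real 5 ∧
      μ'.real 7 2 = ∑ c ∈ Finset.range i, rowsOf d μ r c * rowsOf d μ j c ∧
      μ'.real 7 3 = ∑ c ∈ Finset.range i, rowsOf d μ j c * rowsOf d μ j c)
      64 (.succ (.var 1)) (d + 1) dotStep.ub rfl ?_ ?_ ?_ ?_).mono (t := _) ?_ fun _ => id
  · rintro j μ' - ⟨h1, h2, -⟩ -
    exact ⟨h1, by simp [h2.dim]⟩
  · rintro i μ' hj ⟨h1, ⟨h2, h3, h4, h5⟩, h6, h7, h8, h9⟩ -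
    refine Run.simple rfl ?_
    refine ⟨by simp [dotStep, h1], ⟨by simp [dotStep, h2], by simp [dotStep, h3],
      by simp [dotStep, h4], by simp [dotStep, h5]⟩, by simp [dotStep, h6], by simp [dotStep, h7],
      ?_, ?_⟩
    · rw [Finset.sum_range_succ, ← h8]
      simp [dotStep, h1, h5, h6, h7, rowsOf]
    · rw [Finset.sum_range_succ, ← h9]
      simp [dotStep, h1, h6, h7, rowsOf]
  · obtain ⟨h2, h3, h4, h5⟩ := h
    exact ⟨by simp [g₁], ⟨by simp [g₁, h2], by simp [g₁, h3], by simp [g₁, h4], by simp [g₁, h5]⟩,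
      by simp [g₁, h66], by simp [g₁], by simp [g₁], by simp [g₁]⟩
  · rintro μ' ⟨-, h2, -, -, h5, h6⟩ -
    exact ⟨h2, h5, h6⟩
  · simp [dotStep]
    nlinarith

theorem run_subtract (d : ℕ) (μ : Mem) (r j : ℕ) (h : RowVars d μ r) (hj : j < r)
    (h66 : μ.var 66 = j * (2 * d + 3)) :
    Run P O subtractCmd μ ((2 * d + 3) * 60 + 30) fun μ' => RowVars d μ' r ∧
      (∀ l < r, ∀ c < 2 * d + 3, rowsOf d μ' l c = rowsOf d μ l c) ∧
      ∀ c < 2 * d + 3, rowsOf d μ' r c = rowsOf d μ r c - μ.real 7 2 / μ.real 7 3 * rowsOf d μ j c := by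
  have hjr : j * (2 * d + 3) + (2 * d + 3) ≤ r * (2 * d + 3) := by nlinarith
  refine (Run.seq (Run.exact rfl) fun μ₁ g₁ => Run.for_var (fun i μ' => μ'.var 64 = i ∧
      RowVars d μ' r ∧ μ'.var 66 = j * (2 * d + 3) ∧ μ'.real 7 4 = μ.real 7 2 / μ.real 7 3 ∧
      (∀ i < r * (2 * d + 3), μ'.real 5 i = μ.real 5 i) ∧
      (∀ c < 2 * d + 3, i ≤ c → rowsOf d μ' r c = rowsOf d μ r c) ∧
      ∀ c < i, rowsOf d μ' r c = rowsOf d μ r c - μ.real 7 2 / μ.real 7 3 * rowsOf d μ j c)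
      64 (.var 61) (2 * d + 3) subtractStep.ub rfl ?_ ?_ ?_ ?_).mono (t := _) ?_ fun _ => id
  · rintro j μ' - ⟨h1, h2, -⟩ -
    exact ⟨h1, h2.width⟩
  · rintro i μ' hi ⟨h1, ⟨h2, h3, h4, h5⟩, h6, h7, h8, h9, h10⟩ -
    refine Run.simple rfl ?_
    refine ⟨by simp [subtractStep, h1], ⟨by simp [subtractStep, h2], by simp [subtractStep, h3],
      by simp [subtractStep, h4], by simp [subtractStep, h5]⟩, by simp [subtractStep, h6],
      by simp [subtractStep, h7], fun i' hi' => ?_, fun c hc hc' => ?_, fun c hc => ?_⟩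
    · rw [← h8 i' hi']
      have : i' ≠ r * (2 * d + 3) + i := by omega
      simp [subtractStep, h1, h5, this]
    · rw [← h9 c hc (by omega)]
      have : c ≠ i := by omega
      simp [subtractStep, h1, h5, rowsOf, this]
    · rcases Nat.lt_succ_iff_lt_or_eq.1 hc with hc | rfl
      · rw [← h10 c hc]
        simp [subtractStep, h1, h5, rowsOf, hc.ne]
      · have e1 := h9 c hi le_rfl
        have e2 := h8 (j * (2 * d + 3) + c) (by omega)
        simp only [rowsOf] at e1
        simp [subtractStep, h1, h5, h6, h7, rowsOf, e1, e2]
  · obtain ⟨h2, h3, h4, h5⟩ := h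
    exact ⟨by simp [g₁], ⟨by simp [g₁, h2], by simp [g₁, h3], by simp [g₁, h4], by simp [g₁, h5]⟩,
      by simp [g₁, h66], by simp [g₁], by simp [g₁], by simp [g₁, rowsOf],
      fun c hc => absurd hc (Nat.not_lt_zero _)⟩
  · rintro μ' ⟨-, h2, -, -, h5, -, h6⟩ -
    refine ⟨h2, fun l hl c hc => h5 _ ?_, h6⟩
    nlinarith
  · simp [subtractStep]
    nlinarith

theorem run_push (d R : ℕ) (hR : R ≠ 5) : ∃ K, ∀ {O : Oracle} (μ : Mem) (r : ℕ) (o : ℕ → ℕ → ℝ),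
    RowVars d μ r → r < d + 2 → IsOrtho d o (rowsOf d μ) r →
    (∀ c < d, μ.real R (μ.var 60 + c) = o r c) → o r d = 1 →
    Run P O (pushCmd R) μ K fun μ' => RowVars d μ' (r + 1) ∧ IsOrtho d o (rowsOf d μ') (r + 1) := by
  refine ⟨((2 * d + 3) * 60 + 10) + ((d + 2) * ((d + 1) * 60 + (2 * d + 3) * 60 + 100) + 100),
    fun {O} μ r o h hr ho hp hp1 => ?_⟩
  refine (Run.seq (run_rowInit d R hR μ r h) fun μ₁ ⟨g1, g2, g3⟩ => Run.seq (Run.exact rfl)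
    fun μ₂ g₂ => Run.seq (Run.for_var (fun j μ' => μ'.var 65 = j ∧ μ'.var 66 = j * (2 * d + 3) ∧
      RowVars d μ' r ∧ IsOrtho d o (rowsOf d μ') r ∧
      IsOrthoRow d o (rowsOf d μ') r (rowsOf d μ' r) j) 65 (.var 62) r
      (((d + 1) * 60 + 30) + (((2 * d + 3) * 60 + 30) + 20)) rfl ?_ ?_ ?_
      fun μ' h f => h) fun μ₃ g₃ => Run.simple rfl ?_).mono (t := _) ?_ fun _ => id
  · rintro j μ' - ⟨h1, -, h2, -⟩ -
    exact ⟨h1, h2.rows⟩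
  · rintro j μ' hj ⟨h1, h2, h3, h4, h5⟩ -
    refine (Run.seq ((run_dot d μ' r j h3 h2).withFrame rfl fun _ g f => And.intro g f)
      fun μ₃ ⟨⟨k1, k2, k3⟩, f₃⟩ => Run.seq ((run_subtract d μ₃ r j k1 hj
        ((f₃.var 66 (by decide)).trans h2)).withFrame rfl fun _ g f => And.intro g f)
        fun μ₄ ⟨⟨l1, l2, l3⟩, f₄⟩ => Run.simple rfl ?_).mono (t := _) ?_ fun _ => id
    · have e5 : μ₃.real 5 = μ'.real 5 := f₃.real 5 (by decide)
      have eR : rowsOf d μ₃ = rowsOf d μ' := by funext l c; simp [rowsOf, e5]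
      have e65 := (f₄.var 65 (by decide)).trans ((f₃.var 65 (by decide)).trans h1)
      have e66 := (f₄.var 66 (by decide)).trans ((f₃.var 66 (by decide)).trans h2)
      rw [eR] at l2 l3
      rw [k2, k3] at l3
      have o1 := h4.congr (o' := o) (Z' := rowsOf d μ₄) hr (fun _ _ => rfl) l2
      have o2 := h5.step (z' := rowsOf d μ₄ r) h4 hj hr l3
      obtain ⟨m1, m2, m3, m4⟩ := l1
      refine ⟨by simp [e65], by simp [e66, m2, Nat.add_mul],
        ⟨by simp [m1], by simp [m2], by simp [m3], by simp [m4]⟩, o1, ?_⟩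
      refine ⟨o2.comb, o2.one, o2.zero, fun j' hj' => ?_⟩
      rw [← o2.orth j' hj']
      refine Finset.sum_congr rfl fun c hc => ?_
      rw [Finset.mem_range] at hc
      have : rowsOf d μ₄ j' c = rowsOf d μ' j' c := l2 j' (by omega) c (by omega)
      rw [← this]
      rfl
    · simp
  · obtain ⟨h2, h3, h4, h5⟩ := g1
    have e : rowsOf d μ₂ = rowsOf d μ₁ := by funext l c; simp [rowsOf, g₂]
    refine ⟨by simp [g₂], by simp [g₂], ⟨by simp [g₂, h2], by simp [g₂, h3], by simp [g₂, h4],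
      by simp [g₂, h5]⟩, ?_, ?_⟩
    · rw [e]
      exact ho.congr hr (fun _ _ => rfl) g2
    · rw [e]
      refine .init hr (fun c hc => ?_) fun m hm => ?_
      · rw [g3 c (by omega)]
        rcases hc.lt_or_eq with hc | rfl
        · rw [if_pos hc, hp c hc]
        · rw [if_neg (lt_irrefl _), if_pos rfl, hp1]
      · rw [g3 _ (by omega), if_neg (by omega), if_neg (by omega)]
        simp
  · obtain ⟨-, -, ⟨h2, h3, h4, h5⟩, h6, h7⟩ := g₃
    exact ⟨⟨by simp [h2], by simp [h3], by simp [h4], by simp [h3, h5, Nat.add_mul]⟩, h6.succ h7⟩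
  · simp
    nlinarith [Nat.zero_le (d * d)]

end

/-! ## The test whether a point lies in a cell -/

open Cmd in
/-- Appends the current face to the rows if it is a vertex. -/
def vertexStep : Cmd :=
  ite (.lt (.var 57) (.var 56))
    (setVar 67 (.get 5 (.add (.succ (.var 55)) (.var 57))))
    (setVar 67 (.var 58)) ;;
  ite (.le (.get 5 (.get 4 (.add (.get 3 (.var 54)) (.var 67)))) (.const 0))
    (setArr 6 (.var 54) (.var 67) ;; query 6 4 ;; pushCmd 4)
    skip ;;
  setVar 57 (.succ (.var 57))

open Cmd in
/-- Loads the list of the faces of the simplex in the component number `54` of the array `6`. -/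
def facesCmd : Cmd :=
  setVar 58 (.get 6 (.var 54)) ;;
  setVar 55 (.get 4 (.add (.get 3 (.var 54)) (.var 58))) ;;
  setVar 56 (.get 5 (.var 55)) ;;
  setVar 57 (.const 0)

open Cmd in
/-- Refutes the membership if the vector in the last row is not zero. -/
def checkZeroCmd : Cmd :=
  setVar 64 (.const 0) ;;
  loop (.lt (.var 64) (.succ (.var 1)))
    (ite (.both (.rle (.get 5 (.add (.var 68) (.var 64))) (.const 0))
        (.rle (.const 0) (.get 5 (.add (.var 68) (.var 64))))) skip (setVar 59 (.const 0)) ;;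
      setVar 64 (.succ (.var 64)))

open Cmd in
/-- Refutes the membership if a coefficient in the last row is positive. -/
def checkSignCmd : Cmd :=
  setVar 65 (.const 0) ;;
  loop (.lt (.var 65) (.var 69))
    (ite (.rle (.get 5 (.add (.var 68) (.add (.succ (.var 1)) (.var 65)))) (.const 0)) skip
        (setVar 59 (.const 0)) ;;
      setVar 65 (.succ (.var 65)))

open Cmd in
/-- The membership test in one component. -/
def componentTest : Cmd :=
  (facesCmd ;; setVar 62 (.const 0) ;; setVar 63 (.const 0)) ;;
  loop (.lt (.var 57) (.succ (.var 56))) vertexStep ;;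
  (setArr 6 (.var 54) (.var 58) ;; setVar 68 (.var 63) ;; setVar 69 (.var 62)) ;;
  pushCmd 8 ;; checkZeroCmd ;; checkSignCmd ;;
  (setVar 54 (.succ (.var 54)) ;; setVar 60 (.add (.var 60) (.var 1)))

open Cmd in
/-- Sets the variable `59` to `1` if the point in the real array `8` lies in the cell given by the
array `6`, and to `0` otherwise. -/
def insideCmd : Cmd :=
  (setVar 59 (.const 1) ;; setVar 54 (.const 0) ;; setVar 60 (.const 0) ;;
    setVar 61 (.add (.add (.var 1) (.var 1)) (.const 3))) ;;
  loop (.lt (.var 54) (.var 0)) componentTest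

/-- The faces of the simplex number `a` in the component `i`, the simplex itself being the last. -/
def faceNum (μ : Mem) (i a j : ℕ) : ℕ :=
  if j < μ.arr 5 (μ.arr 4 (μ.arr 3 i + a)) then μ.arr 5 (μ.arr 4 (μ.arr 3 i + a) + 1 + j) else a

section

variable {k d : ℕ} {C : Fin k → GeoComplex d} {s t : Fin k → Pt d}
  {num : Fin k → ℕ → Finset (Pt d)} {f : (Fin k → Pt d) → ℝ} {n : ℕ} {P : Program} {O : Oracle}

/-- The given list contains proper faces only. The simplex itself is appended because it may be a
vertex, and then it has to be found among its own faces. -/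
theorem EncodesInput.faceNum {μ : Mem} (h : EncodesInput C s t num μ)
    (hnum : ∀ i, IsNumbering (C i) (num i)) (i : Fin k) {a : ℕ} (ha : a < (C i).size) :
    Set.BijOn (faceNum μ i a) (Set.Iio (μ.arr 5 (μ.arr 4 (μ.arr 3 i + a)) + 1))
      {b | b < (C i).size ∧ num i b ⊆ num i a} := by
  obtain ⟨h1, h2, h3⟩ := h.faces i a ha
  generalize hL : μ.arr 5 (μ.arr 4 (μ.arr 3 i + a)) = L at *
  have e1 : ∀ j < L, _root_.faceNum μ i a j = μ.arr 5 (μ.arr 4 (μ.arr 3 i + a) + 1 + j) :=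
    fun j hj => by rw [_root_.faceNum, hL, if_pos hj]
  have e2 : _root_.faceNum μ i a L = a := by rw [_root_.faceNum, hL, if_neg (lt_irrefl _)]
  refine ⟨fun j hj => ?_, fun j hj j' hj' e => ?_, fun b hb => ?_⟩
  · rcases Nat.lt_succ_iff_lt_or_eq.1 hj with hj | rfl
    · rw [e1 j hj]
      have := h1 hj
      exact ⟨this.1, this.2.subset⟩
    · rw [e2]
      exact ⟨ha, subset_rfl⟩
  · rcases Nat.lt_succ_iff_lt_or_eq.1 hj with hj | rfl <;>
    rcases Nat.lt_succ_iff_lt_or_eq.1 hj' with hj' | rfl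
    · rw [e1 j hj, e1 j' hj'] at e
      exact h2 hj hj' e
    · rw [e1 j hj, e2] at e
      have h := (h1 hj).2
      beta_reduce at h
      rw [e] at h
      exact absurd h (ssubset_irrefl _)
    · rw [e1 j' hj', e2] at e
      have h := (h1 hj').2
      beta_reduce at h
      rw [← e] at h
      exact absurd h (ssubset_irrefl _)
    · rfl
  · by_cases hba : num i b = num i a
    · have : b = a := (hnum i).injOn hb.1 ha hba
      exact ⟨L, Nat.lt_succ_self L, by rw [e2, this]⟩
    · obtain ⟨j, hj, hj'⟩ := h3 (show b ∈ {b | b < (C i).size ∧ num i b ⊂ num i a} from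
        ⟨hb.1, hb.2.ssubset_of_ne hba⟩)
      exact ⟨j, Nat.lt_succ_of_lt hj, by rw [e1 j hj]; exact hj'⟩

theorem GeoComplex.card_le {C : GeoComplex d} {Δ : Finset (Pt d)} (h : Δ ∈ C.faces) :
    Δ.card ≤ d + 1 := by
  have := (C.affineIndependent Δ h).card_le_finrank_succ
  rw [Fintype.card_coe] at this
  refine this.trans (Nat.succ_le_succ ?_)
  exact (Submodule.finrank_le _).trans (by simp)

/-- The listed faces are distinct subsets of a set of at most `d + 1` affinely independent points.
This makes the work per cell independent of `n`. -/
theorem EncodesInput.length_le {μ : Mem} (h : EncodesInput C s t num μ)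
    (hnum : ∀ i, IsNumbering (C i) (num i)) (i : Fin k) {a : ℕ} (ha : a < (C i).size) :
    μ.arr 5 (μ.arr 4 (μ.arr 3 i + a)) ≤ 2 ^ (d + 1) := by
  have h1 := h.faces i a ha
  have hin : Set.InjOn (num i ∘ fun j => μ.arr 5 (μ.arr 4 (μ.arr 3 i + a) + 1 + j))
      (Finset.range (μ.arr 5 (μ.arr 4 (μ.arr 3 i + a)))) := by
    rw [Finset.coe_range]
    exact (hnum i).injOn.comp h1.injOn fun j hj => (h1.mapsTo hj).1
  have := Finset.card_le_card_of_injOn (t := (num i a).powerset) _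
    (fun j hj => by
      rw [Finset.mem_coe, Finset.mem_powerset]
      exact (h1.mapsTo (Finset.mem_range.1 hj)).2.subset) hin
  rw [Finset.card_range, Finset.card_powerset] at this
  exact this.trans (Nat.pow_le_pow_right (by norm_num)
    (GeoComplex.card_le ((hnum i).mapsTo ha)))

/-- A vertex has no nonempty proper subset, and any larger simplex has its vertices as proper faces.
Vertices are thus recognized from the combinatorial data alone. -/
theorem EncodesInput.length_eq_zero_iff {μ : Mem} (h : EncodesInput C s t num μ)
    (hnum : ∀ i, IsNumbering (C i) (num i)) (i : Fin k) {a : ℕ} (ha : a < (C i).size) :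
    μ.arr 5 (μ.arr 4 (μ.arr 3 i + a)) = 0 ↔ ∃ x, num i a = {x} := by
  have h1 := h.faces i a ha
  have hmem := (hnum i).mapsTo ha
  constructor
  · intro h0
    obtain ⟨x, hx⟩ := (C i).nonempty_of_mem hmem
    refine ⟨x, ?_⟩
    by_contra hne
    have hsub : {x} ⊂ num i a :=
      (Finset.singleton_subset_iff.2 hx).ssubset_of_ne (fun e => hne e.symm)
    obtain ⟨b, hb, hb'⟩ := (hnum i).surjOn
      ((C i).mem_of_subset hmem hsub.subset (Finset.singleton_nonempty x))
    obtain ⟨j, hj, -⟩ := h1.surjOn (show b ∈ {b | b < (C i).size ∧ num i b ⊂ num i a} from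
      ⟨hb, by rw [hb']; exact hsub⟩)
    rw [h0] at hj
    exact absurd hj (Nat.not_lt_zero _)
  · rintro ⟨x, hx⟩
    by_contra h0
    obtain ⟨h2, h3⟩ := h1.mapsTo (Nat.pos_of_ne_zero h0)
    rw [hx, Finset.ssubset_singleton_iff] at h3
    exact ((C i).nonempty_of_mem ((hnum i).mapsTo h2)).ne_empty h3

theorem run_checkZero (d : ℕ) (μ : Mem) (r : ℕ) (h1 : μ.var 1 = d)
    (h2 : μ.var 68 = r * (2 * d + 3)) :
    Run P O checkZeroCmd μ ((d + 1) * 50 + 30) fun μ' =>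
      (μ'.var 59 = 1 ↔ μ.var 59 = 1 ∧ ∀ c ≤ d, rowsOf d μ r c = 0) := by
  refine (Run.seq (Run.exact rfl) fun μ₁ g₁ => Run.for_var (fun i μ' => (μ'.var 64 = i ∧
      μ'.var 1 = d ∧ μ'.var 68 = r * (2 * d + 3) ∧ μ'.real 5 = μ.real 5) ∧
      (μ'.var 59 = 1 ↔ μ.var 59 = 1 ∧ ∀ c < i, rowsOf d μ r c = 0))
      64 (.succ (.var 1)) (d + 1) 30 rfl ?_ ?_ ?_ ?_).mono (t := _) ?_ fun _ => id
  · rintro j μ' - ⟨⟨h1, h2, -⟩, -⟩ -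
    exact ⟨h1, by simp [h2]⟩
  · rintro i μ' hi ⟨⟨h1, h2, h3, h4⟩, h5⟩ -
    refine (Run.simple rfl ?_).mono (t := _) (by simp) fun _ => id
    have hiff : (∀ c < i + 1, rowsOf d μ r c = 0) ↔
        (∀ c < i, rowsOf d μ r c = 0) ∧ rowsOf d μ r i = 0 := by
      simp only [Nat.lt_succ_iff_lt_or_eq, or_imp, forall_and, forall_eq]
    have hR : rowsOf d μ r i = μ.real 5 (r * (2 * d + 3) + i) := rfl
    have hiff' : (μ.var 59 = 1 ∧ ∀ c < i + 1, rowsOf d μ r c = 0) ↔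
        μ'.var 59 = 1 ∧ μ.real 5 (r * (2 * d + 3) + i) = 0 := by
      rw [hiff, ← and_assoc, ← h5, hR]
    rw [hiff']
    by_cases hc : μ.real 5 (r * (2 * d + 3) + i) = 0
    · simp [h1, h2, h3, h4, hc]
    · have hc' : ¬ (μ.real 5 (r * (2 * d + 3) + i) ≤ 0 ∧ 0 ≤ μ.real 5 (r * (2 * d + 3) + i)) :=
        fun h => hc (le_antisymm h.1 h.2)
      simp [h1, h2, h3, h4, hc, hc']
  · simp [g₁, h1, h2]
  · rintro μ' ⟨-, h⟩ -
    simp only [Nat.lt_succ_iff] at h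
    exact h
  · simp
    omega

theorem run_checkSign (d : ℕ) (μ : Mem) (r : ℕ) (hr : r < d + 2) (h1 : μ.var 1 = d)
    (h2 : μ.var 68 = r * (2 * d + 3)) (h3 : μ.var 69 = r) :
    Run P O checkSignCmd μ ((d + 1) * 50 + 30) fun μ' =>
      (μ'.var 59 = 1 ↔ μ.var 59 = 1 ∧ ∀ m < r, rowsOf d μ r (d + 1 + m) ≤ 0) := by
  refine (Run.seq (Run.exact rfl) fun μ₁ g₁ => Run.for_var (fun i μ' => (μ'.var 65 = i ∧
      μ'.var 1 = d ∧ μ'.var 68 = r * (2 * d + 3) ∧ μ'.var 69 = r ∧ μ'.real 5 = μ.real 5) ∧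
      (μ'.var 59 = 1 ↔ μ.var 59 = 1 ∧ ∀ c < i, rowsOf d μ r (d + 1 + c) ≤ 0))
      65 (.var 69) r 30 rfl ?_ ?_ ?_ ?_).mono (t := _) ?_ fun _ => id
  · rintro j μ' - ⟨⟨h1, h2, h3, h4, -⟩, -⟩ -
    exact ⟨h1, h4⟩
  · rintro i μ' hi ⟨⟨h1, h2, h3, h6, h4⟩, h5⟩ -
    refine (Run.simple rfl ?_).mono (t := _) (by simp) fun _ => id
    have hiff : (∀ c < i + 1, rowsOf d μ r (d + 1 + c) ≤ 0) ↔
        (∀ c < i, rowsOf d μ r (d + 1 + c) ≤ 0) ∧ rowsOf d μ r (d + 1 + i) ≤ 0 := by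
      simp only [Nat.lt_succ_iff_lt_or_eq, or_imp, forall_and, forall_eq]
    have hR : rowsOf d μ r (d + 1 + i) = μ.real 5 (r * (2 * d + 3) + (d + 1 + i)) := rfl
    have hiff' : (μ.var 59 = 1 ∧ ∀ c < i + 1, rowsOf d μ r (d + 1 + c) ≤ 0) ↔
        μ'.var 59 = 1 ∧ μ.real 5 (r * (2 * d + 3) + (d + 1 + i)) ≤ 0 := by
      rw [hiff, ← and_assoc, ← h5, hR]
    rw [hiff']
    by_cases hc : μ.real 5 (r * (2 * d + 3) + (d + 1 + i)) ≤ 0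
    · simp [h1, h2, h3, h4, h6, hc]
    · simp [h1, h2, h3, h4, h6, hc]
  · simp [g₁, h1, h2, h3]
  · rintro μ' ⟨-, h⟩ -
    exact h
  · simp
    nlinarith

/-- The rows belong to the vertices among the first `j` faces of the simplex number `a`. -/
def HasVertexRows (num : ℕ → Finset (Pt d)) (b : ℕ → ℕ) (j : ℕ) (μ : Mem) : Prop :=
  ∃ (r : ℕ) (v : ℕ → Pt d), RowVars d μ r ∧ IsOrtho d (fun m => hat (v m)) (rowsOf d μ) r ∧
    Set.BijOn v (Set.Iio r) {x | ∃ j' < j, num (b j') = {x}}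

theorem HasVertexRows.congr {num : ℕ → Finset (Pt d)} {b : ℕ → ℕ} {j : ℕ} {μ μ' : Mem}
    (h : HasVertexRows num b j μ) (h1 : μ'.var 1 = μ.var 1) (h61 : μ'.var 61 = μ.var 61)
    (h62 : μ'.var 62 = μ.var 62) (h63 : μ'.var 63 = μ.var 63) (h5 : μ'.real 5 = μ.real 5) :
    HasVertexRows num b j μ' := by
  obtain ⟨r, v, ⟨k1, k2, k3, k4⟩, k5, k6⟩ := h
  refine ⟨r, v, ⟨h1.trans k1, h61.trans k2, h62.trans k3, h63.trans k4⟩, ?_, k6⟩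
  have : rowsOf d μ' = rowsOf d μ := by funext l c; simp [rowsOf, h5]
  rwa [this]

/-- The state after the first `j` faces of the simplex number `a` of the component `i` have been
treated. -/
def VertexInv (C : Fin k → GeoComplex d) (s t : Fin k → Pt d) (num : Fin k → ℕ → Finset (Pt d))
    (n : ℕ) (μ₀ : Mem) (i : Fin k) (a : ℕ) (j : ℕ) (μ : Mem) : Prop :=
  (μ.var 57 = j ∧ IsReady C s t num n μ ∧ ∀ l ≠ (i : ℕ), μ.arr 6 l = μ₀.arr 6 l) ∧
    HasVertexRows (num i) (faceNum μ₀ i a) j μ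

/-- The collected vertices belong to one simplex, so there are at most `d + 1` of them, and the row
of the tested point still fits into the `d + 2` columns of coefficients. -/
theorem VertexInv.card_le (hnum : ∀ i, IsNumbering (C i) (num i)) {μ₀ : Mem}
    (h₀ : EncodesInput C s t num μ₀) {i : Fin k} {a : ℕ} (ha : a < (C i).size)
    {j : ℕ} (hj : j ≤ μ₀.arr 5 (μ₀.arr 4 (μ₀.arr 3 i + a)) + 1) {r : ℕ} {v : ℕ → Pt d}
    (hv : Set.BijOn v (Set.Iio r) {x | ∃ j' < j, num i (faceNum μ₀ i a j') = {x}}) :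
    r < d + 2 := by
  have : r ≤ (num i a).card := by
    rw [← Finset.card_range r]
    refine Finset.card_le_card_of_injOn v (fun m hm => ?_) (by simpa using hv.injOn)
    obtain ⟨j', hj', e⟩ := hv.mapsTo (Finset.mem_range.1 hm)
    have h := ((h₀.faceNum hnum i ha).mapsTo (Set.mem_Iio.2 (hj'.trans_le hj))).2
    rw [e, Finset.singleton_subset_iff] at h
    exact h
  have := this.trans (GeoComplex.card_le ((hnum i).mapsTo ha))
  omega

theorem vertices_eq (hnum : ∀ i, IsNumbering (C i) (num i)) {μ₀ : Mem}
    (h₀ : EncodesInput C s t num μ₀) {i : Fin k} {a : ℕ} (ha : a < (C i).size) :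
    {x | ∃ j' < μ₀.arr 5 (μ₀.arr 4 (μ₀.arr 3 i + a)) + 1, num i (faceNum μ₀ i a j') = {x}} =
      (num i a : Set (Pt d)) := by
  have hb := h₀.faceNum hnum i ha
  ext x
  constructor
  · rintro ⟨j', hj', e⟩
    have h := (hb.mapsTo (Set.mem_Iio.2 hj')).2
    rw [e, Finset.singleton_subset_iff] at h
    exact h
  · intro hx
    have hsub := Finset.singleton_subset_iff.2 hx
    obtain ⟨b, hb', e⟩ := (hnum i).surjOn
      ((C i).mem_of_subset ((hnum i).mapsTo ha) hsub (Finset.singleton_nonempty x))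
    obtain ⟨j, hj, e'⟩ := hb.surjOn (show b ∈ {b | b < (C i).size ∧ num i b ⊆ num i a} from
      ⟨hb', by rw [e]; exact hsub⟩)
    exact ⟨j, hj, by rw [e', e]⟩

/-- The input contains no coordinates. Those of a vertex are obtained from the oracle, by a query
about a cell that has this vertex as its component `i` and arbitrary simplices as the other
components. -/
theorem run_vertexStep (k d : ℕ) : ∃ K, ∀ {O : Oracle}
    (C : Fin k → GeoComplex d) (s t : Fin k → Pt d)
    (num : Fin k → ℕ → Finset (Pt d)) (n : ℕ) (f : (Fin k → Pt d) → ℝ),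
    (∀ i, IsNumbering (C i) (num i)) → IsMinOracle C f num O →
    ∀ (μ₀ : Mem) (i : Fin k) (a j : ℕ) (μ : Mem), IsReady C s t num n μ₀ → a < (C i).size →
    (∀ l : Fin k, μ₀.arr 6 l < (C l).size) →
    j < μ₀.arr 5 (μ₀.arr 4 (μ₀.arr 3 i + a)) + 1 →
    (∀ A < 6, μ.arr A = μ₀.arr A) →
    μ.var 54 = i → μ.var 60 = i * d → μ.var 58 = a → μ.var 55 = μ₀.arr 4 (μ₀.arr 3 i + a) →
    μ.var 56 = μ₀.arr 5 (μ₀.arr 4 (μ₀.arr 3 i + a)) → VertexInv C s t num n μ₀ i a j μ →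
    Run P O vertexStep μ K (VertexInv C s t num n μ₀ i a (j + 1)) := by
  obtain ⟨K, hK⟩ := run_push (P := P) d 4 (by decide)
  refine ⟨K + 100, fun {O} C s t num n f hnum hO μ₀ i a j μ h₀ ha hsize hj hA v54 v60 v58 v55 v56
    ⟨⟨h1, h2, h3⟩, r, v, h4, h5, h6⟩ => ?_⟩
  have hb := h₀.input.faceNum hnum i ha
  have hr : r < d + 2 := VertexInv.card_le hnum h₀.input ha hj.le h6
  obtain ⟨b, hbe⟩ : ∃ b, b = faceNum μ₀ i a j := ⟨_, rfl⟩
  obtain ⟨hb1, hb2⟩ := hb.mapsTo (Set.mem_Iio.2 hj)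
  rw [← hbe] at hb1 hb2
  have a3 := hA 3 (by norm_num)
  have a4 := hA 4 (by norm_num)
  have a5 := hA 5 (by norm_num)
  have hfirst : Run P O (.ite (.lt (.var 57) (.var 56))
      (.setVar 67 (.get 5 (.add (.succ (.var 55)) (.var 57)))) (.setVar 67 (.var 58))) μ 20
      fun μ' => μ' = { μ with var := Function.update μ.var 67 b } := by
    refine (Run.exact rfl).mono (by simp) ?_
    rintro μ' rfl
    rw [hbe, faceNum]
    by_cases hc : j < μ₀.arr 5 (μ₀.arr 4 (μ₀.arr 3 i + a))
    · simp [h1, v56, v55, a5, hc]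
    · simp [h1, v56, v58, hc]
  have hzero := h₀.input.length_eq_zero_iff hnum i hb1
  have hset : ∀ {S : Set (Pt d)}, (∀ x, x ∈ S ↔ num i b = {x}) →
      {x | ∃ j' < j + 1, num i (faceNum μ₀ i a j') = {x}} =
        {x | ∃ j' < j, num i (faceNum μ₀ i a j') = {x}} ∪ S := by
    intro S hS
    ext x
    simp only [Nat.lt_succ_iff_lt_or_eq, or_and_right, exists_or, exists_eq_left, ← hbe,
      Set.mem_union, hS, Set.mem_ofPred_eq]
  refine (Run.seq hfirst fun μ₁ g₁ => Run.seq (Q := fun μ₂ => μ₂.var 57 = j ∧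
    (∀ l ≠ (i : ℕ), μ₂.arr 6 l = μ₀.arr 6 l) ∧ HasVertexRows (num i) (faceNum μ₀ i a) (j + 1) μ₂)
    (Run.ite (t := 20 + K) (fun hc => ?_) fun hc => ?_)
    fun μ₃ g₃ => Run.simple (Q := fun μ₂ => μ₂.var 57 = j + 1 ∧
      (∀ l ≠ (i : ℕ), μ₂.arr 6 l = μ₀.arr 6 l) ∧
      HasVertexRows (num i) (faceNum μ₀ i a) (j + 1) μ₂) rfl ?_).withFrame
    (Q' := VertexInv C s t num n μ₀ i a (j + 1)) rfl ?_ |>.mono ?_ fun _ => id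
  · have hc : ∃ x, num i b = {x} := by
      rw [← hzero]
      simp [g₁, v54, a3, a4, a5] at hc
      exact hc
    obtain ⟨x, hx⟩ := hc
    have hmem : x ∉ {x | ∃ j' < j, num i (faceNum μ₀ i a j') = {x}} := by
      rintro ⟨j', hj', e⟩
      have hb' := hb.mapsTo (Set.mem_Iio.2 (hj'.trans hj))
      have := (hnum i).injOn hb'.1 hb1 (by rw [e, hx])
      rw [hbe] at this
      exact hj'.ne (hb.injOn (Set.mem_Iio.2 (hj'.trans hj)) (Set.mem_Iio.2 hj) this)
    have harr : ∀ l : Fin k, Function.update (μ.arr 6) (i : ℕ) b l < (C l).size := by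
      intro l
      by_cases hl : l = i
      · subst hl; simpa using hb1
      · have : (l : ℕ) ≠ i := fun e => hl (Fin.ext e)
        simp only [ne_eq, this, not_false_eq_true, Function.update_of_ne, h3]
        exact hsize l
    -- Wherever the minimum over the cell is attained, its component `i` can only be the vertex.
    obtain ⟨z, hz, -, hz', -⟩ := hO _ harr
    have hzx : z i = x := by
      have := hz i trivial
      simpa [hx, realize] using this
    refine (Run.seq (Run.exact rfl) fun μ₂ g₂ => Run.seq (Run.exact rfl) fun μ₃ g₃ =>
      (hK μ₃ r (fun m => hat (Function.update v r x m)) ?_ hr ?_ ?_ ?_).withFrame rfl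
        fun μ₄ g f => ?_).mono (t := _) ?_ fun _ => id
    · obtain ⟨k1, k2, k3, k4⟩ := h4
      exact ⟨by simp [g₃, g₂, g₁, k1], by simp [g₃, g₂, g₁, k2], by simp [g₃, g₂, g₁, k3],
        by simp [g₃, g₂, g₁, k4]⟩
    · refine h5.congr hr (fun m hm => by simp [hm.ne]) fun l hl c hc => ?_
      simp [rowsOf, g₃, g₂, g₁]
    · intro c hc
      have := hz' i ⟨c, hc⟩
      simp only [Function.update_self, hat, hc, dif_pos]
      rw [← hzx, ← this]
      simp [g₃, g₂, g₁, v54, v60]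
    · simp [hat]
    · obtain ⟨g4, g5⟩ := g
      refine ⟨?_, fun l hl => ?_, r + 1, Function.update v r x, g4, g5, ?_⟩
      · rw [f.var 57 (by decide)]
        simp [g₃, g₂, g₁, h1]
      · rw [f.arr 6 (by decide)]
        simp [g₃, g₂, g₁, v54, hl, h3 l hl]
      · rw [hset (S := {x}) fun y => by rw [hx, Finset.singleton_inj, Set.mem_singleton_iff,
          eq_comm]]
        have hI : Set.Iio (r + 1) = Set.Iio r ∪ {r} := by
          ext m; simp
        rw [hI]
        refine Set.BijOn.union (h6.congr fun m hm => ?_) (by simp) ?_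
        · have : m ≠ r := (Set.mem_Iio.1 hm).ne
          simp [this]
        · have h6' : Set.BijOn (Function.update v r x) (Set.Iio r)
              {x | ∃ j' < j, num i (faceNum μ₀ i a j') = {x}} := h6.congr fun m hm => by
            have : m ≠ r := (Set.mem_Iio.1 hm).ne
            simp [this]
          rw [Set.injOn_union (by simp)]
          refine ⟨h6'.injOn, by simp, ?_⟩
          rintro m hm m' rfl e
          refine hmem ?_
          have := h6'.mapsTo hm
          rw [e] at this
          simpa using this
    · simp
      omega
  · have hc : ¬ ∃ x, num i b = {x} := by
      rw [← hzero]
      simp [g₁, v54, a3, a4, a5] at hc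
      exact hc
    refine (Run.simple rfl ⟨?_, ?_, r, v, ?_, ?_, ?_⟩).mono (by simp; omega) fun _ => id
    · simp [g₁, h1]
    · simpa [g₁] using h3
    · obtain ⟨k1, k2, k3, k4⟩ := h4
      exact ⟨by simp [g₁, k1], by simp [g₁, k2], by simp [g₁, k3], by simp [g₁, k4]⟩
    · refine h5.congr hr (fun m hm => rfl) fun l hl c hc => ?_
      simp [rowsOf, g₁]
    · rw [hset (S := ∅) fun y => ⟨fun h => absurd h id, fun h => absurd ⟨y, h⟩ hc⟩, Set.union_empty]
      exact h6
  · obtain ⟨k1, k2, k3⟩ := g₃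
    exact ⟨by simp [k1], by simpa using k2, k3.congr (by simp) (by simp) (by simp) (by simp)
      (by simp)⟩
  · rintro μ₄ ⟨k1, k2, k3⟩ f
    exact ⟨⟨k1, h2.of_frame f rfl, k2⟩, k3⟩
  · simp
    omega

/-- Once all faces have been treated, the rows belong to all vertices of the simplex, and the point
is appended as the last row. Checking this row is the criterion of `IsOrtho.mem_realize_iff`. -/
theorem run_componentTest (k d : ℕ) : ∃ K, ∀ {O : Oracle}
    (C : Fin k → GeoComplex d) (s t : Fin k → Pt d)
    (num : Fin k → ℕ → Finset (Pt d)) (n : ℕ) (f : (Fin k → Pt d) → ℝ),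
    (∀ i, IsNumbering (C i) (num i)) → IsMinOracle C f num O →
    ∀ (i : Fin k) (p : Pt d) (μ : Mem), IsReady C s t num n μ →
    (∀ l : Fin k, μ.arr 6 l < (C l).size) → μ.var 54 = i → μ.var 60 = i * d →
    μ.var 61 = 2 * d + 3 → (∀ c : Fin d, μ.real 8 (i * d + c) = p c) →
    Run P O componentTest μ K fun μ' =>
      (μ'.var 54 = i + 1 ∧ μ'.var 60 = (i + 1) * d ∧ μ'.var 61 = 2 * d + 3) ∧
      (μ'.var 59 = 1 ↔ μ.var 59 = 1 ∧ p ∈ realize (num i (μ.arr 6 i))) ∧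
      μ'.arr 6 = μ.arr 6 := by
  obtain ⟨K₁, h₁⟩ := run_vertexStep (P := P) k d
  obtain ⟨K₂, h₂⟩ := run_push (P := P) d 8 (by decide)
  refine ⟨(2 ^ (d + 1) + 1) * (K₁ + 20) + K₂ + 200 * d + 500,
    fun {O} C s t num n f hnum hO i p μ h hsize v54 v60 v61 hp => ?_⟩
  obtain ⟨a, ha⟩ : ∃ a, a = μ.arr 6 i := ⟨_, rfl⟩
  have hai : a < (C i).size := ha ▸ hsize i
  obtain ⟨L, hL⟩ : ∃ L, L = μ.arr 5 (μ.arr 4 (μ.arr 3 i + a)) := ⟨_, rfl⟩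
  have hL' : L ≤ 2 ^ (d + 1) := by
    rw [hL]; exact h.input.length_le hnum i hai
  have h1 := h.input.var_one
  refine (Run.seq (Run.exact rfl) fun μ₁ g₁ => Run.seq (Run.for_var
    (VertexInv C s t num n μ i a) 57 (.succ (.var 56)) (L + 1) K₁ rfl ?_ ?_ ?_
    fun μ' g f => And.intro g f) fun μ₂ ⟨⟨⟨g1, g2, g3⟩, r, v, g4, g5, g6⟩, f₂⟩ => ?_).mono
      (t := (facesCmd ;; Cmd.setVar 62 (.const 0) ;; Cmd.setVar 63 (.const 0)).ub +
        (((L + 1) * (3 + 4 + K₁) + 3 + 4) + (K₂ + 100 * d + 300))) ?_ fun _ => id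
  · rintro j μ' - ⟨⟨k1, k2⟩, k3⟩ f
    refine ⟨k1, ?_⟩
    simp [f.var 56 (by decide), g₁, facesCmd, v54, ← ha, hL]
  · rintro j μ' hj hI f
    refine h₁ C s t num n _ hnum hO μ i a j μ' h hai hsize (by rw [← hL]; exact hj) ?_
      ?_ ?_ ?_ ?_ ?_ hI
    · intro A hA
      interval_cases A <;> rw [f.arr _ (by decide)] <;> simp [g₁, facesCmd]
    · simp [f.var 54 (by decide), g₁, facesCmd, v54]
    · simp [f.var 60 (by decide), g₁, facesCmd, v60]
    · simp [f.var 58 (by decide), g₁, facesCmd, v54, ha]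
    · simp [f.var 55 (by decide), g₁, facesCmd, v54, ha]
    · simp [f.var 56 (by decide), g₁, facesCmd, v54, ha]
  · refine ⟨⟨by simp [g₁, facesCmd], ?_, by simp [g₁, facesCmd]⟩, 0, fun _ => 0,
      ⟨by simp [g₁, facesCmd, h1], by simp [g₁, facesCmd, v61], by simp [g₁, facesCmd],
        by simp [g₁, facesCmd]⟩, fun l hl => absurd hl (Nat.not_lt_zero _), ?_⟩
    · refine h.of_frame (c := facesCmd ;; Cmd.setVar 62 (.const 0) ;;
        Cmd.setVar 63 (.const 0)) ⟨fun x hx => ?_, fun _ _ => ?_, fun _ _ => ?_⟩ rfl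
      · simp [facesCmd, Cmd.wv] at hx
        simp [g₁, facesCmd, hx]
      · simp [g₁, facesCmd]
      · simp [g₁, facesCmd]
    · have e₁ : Set.Iio 0 = (∅ : Set ℕ) := by ext; simp
      rw [e₁]
      simp
  · simp [facesCmd]
    nlinarith
  · have hr : r < d + 2 := VertexInv.card_le hnum h.input hai (by rw [← hL]) g6
    rw [hL, vertices_eq hnum h.input hai] at g6
    obtain ⟨k1, k2, k3, k4⟩ := g4
    have w54 : μ₂.var 54 = i := by rw [f₂.var 54 (by decide)]; simp [g₁, facesCmd, v54]
    have w58 : μ₂.var 58 = a := by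
      rw [f₂.var 58 (by decide)]; simp [g₁, facesCmd, v54, ha]
    have w59 : μ₂.var 59 = μ.var 59 := by rw [f₂.var 59 (by decide)]; simp [g₁, facesCmd]
    have w60 : μ₂.var 60 = i * d := by rw [f₂.var 60 (by decide)]; simp [g₁, facesCmd, v60]
    have w8 : μ₂.real 8 = μ.real 8 := by rw [f₂.real 8 (by decide)]; simp [g₁, facesCmd]
    have w6 : Function.update (μ₂.arr 6) (i : ℕ) a = μ.arr 6 := by
      funext l
      by_cases hl : l = i
      · subst hl; simp [ha]
      · simp [hl, g3 l hl]
    refine (Run.seq (Run.exact rfl) fun μ₃ g₃ => Run.seq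
      ((h₂ μ₃ r (fun m => hat (Function.update v r p m)) ?_ hr ?_ ?_ ?_).withFrame rfl
        fun _ g f => And.intro g f) fun μ₄ ⟨⟨g4', g5'⟩, f₄⟩ => Run.seq
        ((run_checkZero d μ₄ r g4'.dim ?_).withFrame rfl fun _ g f => And.intro g f)
        fun μ₅ ⟨g₅, f₅⟩ => Run.seq ((run_checkSign d μ₅ r hr ?_ ?_ ?_).withFrame rfl
        fun _ g f => And.intro g f) fun μ₆ ⟨g₆, f₆⟩ => Run.simple rfl ?_).mono (t := _) ?_ fun _ => id
    · exact ⟨by simp [g₃, k1], by simp [g₃, k2], by simp [g₃, k3], by simp [g₃, k4]⟩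
    · refine g5.congr hr (fun m hm => by simp [hm.ne]) fun l hl c hc => ?_
      simp [rowsOf, g₃]
    · intro c hc
      have := hp ⟨c, hc⟩
      simp only [Function.update_self, hat, hc, dif_pos]
      rw [← this]
      simp [g₃, w60, w8]
    · simp [hat]
    · rw [f₄.var 68 (by decide)]; simp [g₃, k4]
    · rw [f₅.var 1 (by decide), g4'.dim]
    · rw [f₅.var 68 (by decide), f₄.var 68 (by decide)]; simp [g₃, k4]
    · rw [f₅.var 69 (by decide), f₄.var 69 (by decide)]; simp [g₃, k3]
    · have key := g5'.mem_realize_iff (p := p)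
        ((C i).affineIndependent _ ((hnum i).mapsTo hai)) g6 hr
        (v := v) (fun m hm => by simp [hm.ne]) (by simp)
      have e5 : rowsOf d μ₅ = rowsOf d μ₄ := by
        funext l c; simp [rowsOf, f₅.real 5 (by decide)]
      have e59 : μ₄.var 59 = μ.var 59 := by
        rw [f₄.var 59 (by decide)]; simp [g₃, w59]
      have x54 : μ₆.var 54 = i := by
        rw [f₆.var 54 (by decide), f₅.var 54 (by decide), f₄.var 54 (by decide)]; simp [g₃, w54]
      have x60 : μ₆.var 60 = i * d := by
        rw [f₆.var 60 (by decide), f₅.var 60 (by decide), f₄.var 60 (by decide)]; simp [g₃, w60]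
      have x61 : μ₆.var 61 = 2 * d + 3 := by
        rw [f₆.var 61 (by decide), f₅.var 61 (by decide), g4'.width]
      have x1 : μ₆.var 1 = d := by
        rw [f₆.var 1 (by decide), f₅.var 1 (by decide), g4'.dim]
      rw [g₅, e5, and_assoc, key, e59] at g₆
      refine ⟨⟨by simp [x54], by simp [x60, x1, Nat.add_mul], by simp [x61]⟩, ?_, ?_⟩
      · rw [← ha, ← g₆]
        simp
      · simp only [Cmd.step]
        rw [f₆.arr 6 (by decide), f₅.arr 6 (by decide), f₄.arr 6 (by decide)]
        simp [g₃, w54, w58, w6]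
    · simp
      omega

theorem run_inside (k d : ℕ) : ∃ K, ∀ {O : Oracle} (C : Fin k → GeoComplex d) (s t : Fin k → Pt d)
    (num : Fin k → ℕ → Finset (Pt d)) (n : ℕ) (f : (Fin k → Pt d) → ℝ),
    (∀ i, IsNumbering (C i) (num i)) → IsMinOracle C f num O →
    ∀ (p : Fin k → Pt d) (μ : Mem), IsReady C s t num n μ →
    (∀ l : Fin k, μ.arr 6 l < (C l).size) →
    (∀ (i : Fin k) (c : Fin d), μ.real 8 (i * d + c) = p i c) →
    Run P O insideCmd μ K fun μ' =>
      (μ'.var 59 = 1 ↔ p ∈ realizeCell fun i => num i (μ.arr 6 i)) ∧ μ'.arr 6 = μ.arr 6 := by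
  obtain ⟨K, hK⟩ := run_componentTest (P := P) k d
  refine ⟨k * (K + 10) + 100, fun {O} C s t num n f hnum hO p μ h hsize hp => ?_⟩
  refine (Run.seq ((Run.exact rfl).withFrame rfl fun _ g f => And.intro g f) fun μ₁ ⟨g₁, f₁⟩ =>
    Run.for_var (fun j μ' => (μ'.var 54 = j ∧ μ'.var 60 = j * d ∧ μ'.var 61 = 2 * d + 3) ∧
      (μ'.var 59 = 1 ↔ ∀ i : Fin k, (i : ℕ) < j → p i ∈ realize (num i (μ.arr 6 i))) ∧
      μ'.arr 6 = μ.arr 6) 54 (.var 0) k K rfl ?_ ?_ ?_ ?_).mono (t := _) ?_ fun _ => id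
  · simp
    nlinarith
  · rintro j μ' - ⟨⟨h1, -⟩, -⟩ f
    exact ⟨h1, (h.of_frame f₁ rfl |>.of_frame f rfl).input.var_zero⟩
  · rintro j μ' hj ⟨⟨h1, h2, h3⟩, h4, h5⟩ f
    refine (hK C s t num n _ hnum hO ⟨j, hj⟩ (p ⟨j, hj⟩) μ'
      (h.of_frame f₁ rfl |>.of_frame f rfl) (by rw [h5]; exact hsize) h1 h2 h3 ?_).imp ?_
    · intro c
      rw [f.real 8 (by decide), f₁.real 8 (by decide)]
      exact hp ⟨j, hj⟩ c
    · rintro μ₂ ⟨k1, k2, k3⟩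
      refine ⟨k1, ?_, k3.trans h5⟩
      rw [k2, h4, h5]
      constructor
      · rintro ⟨k4, k5⟩ i hi
        rcases Nat.lt_succ_iff_lt_or_eq.1 hi with hi | hi
        · exact k4 i hi
        · obtain rfl : i = ⟨j, hj⟩ := Fin.ext hi
          exact k5
      · exact fun k4 => ⟨fun i hi => k4 i (by omega), k4 ⟨j, hj⟩ (Nat.lt_succ_self j)⟩
  · have := h.input.var_one
    simp [g₁, this]
    ring
  · rintro μ' ⟨-, h1, h2⟩ -
    refine ⟨h1.trans ?_, h2⟩
    simp only [Fin.is_lt, forall_const]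
    exact ⟨fun h i _ => h i, fun h i => h i trivial⟩

end

/-! ## The construction of the graph -/

open Cmd in
/-- Emits the arc from a face. -/
def faceStep : Cmd :=
  setArr 6 (.var 54) (.get 5 (.add (.succ (.var 55)) (.var 57))) ;; encodeCmd ;; query 6 4 ;;
  emitCmd 53 50 ;; setVar 57 (.succ (.var 57))

open Cmd in
/-- Emits the arcs from the faces in one component. -/
def componentArcs : Cmd :=
  facesCmd ;; loop (.lt (.var 57) (.var 56)) faceStep ;;
  (setArr 6 (.var 54) (.var 58) ;; setVar 54 (.succ (.var 54)))

open Cmd in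
/-- Emits the arc from the node `u` for the vertices in the array `A` if they lie in the cell. -/
def pointArcs (A u : ℕ) : Cmd :=
  query A 8 ;; insideCmd ;;
  ite (.eq (.var 59) (.const 1)) (query A 4 ;; emitCmd u 50) skip

open Cmd in
/-- Emits the arcs to a cell. -/
def cellStep : Cmd :=
  decodeCmd ;;
  ite (.eq (.var 52) (.const 1))
    (setVar 54 (.const 0) ;; loop (.lt (.var 54) (.var 0)) componentArcs ;;
      pointArcs 1 3 ;; pointArcs 2 70)
    skip ;;
  setVar 50 (.succ (.var 50))

open Cmd in
/-- Constructs the graph. -/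
def cellsCmd : Cmd :=
  (setVar 23 (.const 0) ;; setVar 50 (.const 0) ;; setVar 70 (.succ (.var 3))) ;;
  loop (.lt (.var 50) (.var 3)) cellStep

theorem IsMinVal.unique {V : Type*} {f : V → ℝ} {A : Set V} {w w' : ℝ} (h : IsMinVal f A w)
    (h' : IsMinVal f A w') : w = w' := by
  obtain ⟨x, hx, hx', rfl⟩ := h
  obtain ⟨y, hy, hy', rfl⟩ := h'
  exact le_antisymm (hx' hy) (hy' hx)

/-- The arc `e` leads from a face of the cell `x` that differs from `x` in the component `i`, where
it has the number `b`. -/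
def FaceArc {k d : ℕ} (C : Fin k → GeoComplex d) (num : Fin k → ℕ → Finset (Pt d))
    (f : (Fin k → Pt d) → ℝ) (n x : ℕ) (i : Fin k) (b : ℕ) (e : ℕ × ℕ × ℝ) : Prop :=
  e.2.1 = x ∧ IsNode C n e.1 ∧ digit n e.1 i = b ∧ num i b ⊂ num i (digit n x i) ∧
    (∀ j ≠ i, digit n e.1 j = digit n x j) ∧ IsMinVal f (realizeCell (cellOf num n e.1)) e.2.2

section

variable {k d : ℕ} {C : Fin k → GeoComplex d} {s t : Fin k → Pt d}
  {num : Fin k → ℕ → Finset (Pt d)} {f : (Fin k → Pt d) → ℝ} {n : ℕ} {P : Program} {O : Oracle}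

/-- The arcs into `x` are sorted by the changed component and the number of the face there, followed
by those from the two extra nodes. This matches the order in which they are emitted. -/
theorem cellArc_iff {x : ℕ} (hx : IsNode C n x) (e : ℕ × ℕ × ℝ) :
    e.2.1 = x ∧ CellArc C s t num f n e.1 e.2.1 e.2.2 ↔ (∃ i b, FaceArc C num f n x i b e) ∨
      (s ∈ realizeCell (cellOf num n x) ∧ e = (n ^ k, x, f s)) ∨
      (t ∈ realizeCell (cellOf num n x) ∧ e = (n ^ k + 1, x, f t)) := by
  obtain ⟨u, v, w⟩ := e
  constructor
  · rintro ⟨rfl, ⟨hu, -, ⟨i, hi, hj⟩, hw⟩ | ⟨-, ⟨rfl, h, rfl⟩ | ⟨rfl, h, rfl⟩⟩⟩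
    · exact Or.inl ⟨i, _, rfl, hu, rfl, hi, hj, hw⟩
    · exact Or.inr (Or.inl ⟨h, rfl⟩)
    · exact Or.inr (Or.inr ⟨h, rfl⟩)
  · rintro (⟨i, b, rfl, hu, rfl, hi, hj, hw⟩ | ⟨h, e⟩ | ⟨h, e⟩)
    · exact ⟨rfl, Or.inl ⟨hu, hx, ⟨i, hi, hj⟩, hw⟩⟩
    · simp only [Prod.mk.injEq] at e
      obtain ⟨rfl, rfl, rfl⟩ := e
      exact ⟨rfl, Or.inr ⟨hx, Or.inl ⟨rfl, h, rfl⟩⟩⟩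
    · simp only [Prod.mk.injEq] at e
      obtain ⟨rfl, rfl, rfl⟩ := e
      exact ⟨rfl, Or.inr ⟨hx, Or.inr ⟨rfl, h, rfl⟩⟩⟩

theorem IsMinOracle.point (hO : IsMinOracle C f num O) {a : ℕ → ℕ} {p : Fin k → Pt d}
    (ha : ∀ i : Fin k, a i < (C i).size) (hp : ∀ i : Fin k, num i (a i) = {p i}) :
    (∀ (i : Fin k) (c : Fin d), O a (i * d + c) = p i c) ∧ O a (k * d) = f p := by
  obtain ⟨z, hz, -, h1, h2⟩ := hO a ha
  have : z = p := by
    funext i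
    have := hz i trivial
    simpa [hp, realize] using this
  subst this
  exact ⟨h1, h2⟩

/-- The digits of `x` stand in the array `6`, possibly except in the component `i`. -/
def HasDigits (k n x : ℕ) (i : ℕ) (μ : Mem) : Prop := ∀ l < k, l ≠ i → μ.arr 6 l = digit n x l

/-- The face differs from `x` in the digit `i` alone, so it is determined by `b`, and exactly one
arc with its reverse is emitted. The entry `i` of the array is restored only after all faces, hence
the weak condition `HasDigits`. -/
theorem run_faceStep (k d : ℕ) : ∃ K, ∀ {O : Oracle} (C : Fin k → GeoComplex d) (s t : Fin k → Pt d)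
    (num : Fin k → ℕ → Finset (Pt d)) (n : ℕ) (f : (Fin k → Pt d) → ℝ),
    (∀ i, (C i).size ≤ n) → IsMinOracle C f num O →
    ∀ (i : Fin k) (b x : ℕ) (S : Set (ℕ × ℕ × ℝ)) (μ : Mem), IsReady C s t num n μ →
    IsNode C n x → b < (C i).size → num i b ⊂ num i (digit n x i) → HasDigits k n x i μ →
    μ.var 50 = x → μ.var 54 = i → μ.arr 5 (μ.var 55 + 1 + μ.var 57) = b → HasArcs μ S →
    Run P O faceStep μ K fun μ' => μ'.var 57 = μ.var 57 + 1 ∧ HasDigits k n x i μ' ∧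
      HasArcs μ' (S ∪ {e | FaceArc C num f n x i b e}) ∧ μ'.var 23 = μ.var 23 + 2 := by
  obtain ⟨K, hK⟩ := run_encode (P := P) k
  refine ⟨K + 100, fun {O} C s t num n f hn hO i b x S μ h hx hb hbx hdig v50 v54 hface hS => ?_⟩
  refine (Run.seq ((Run.exact rfl).withFrame rfl fun _ g f => And.intro g f) fun μ₁ ⟨g₁, f₁⟩ =>
    Run.seq ((hK μ₁ (h.of_frame f₁ rfl) ?_).withFrame rfl fun _ g f => And.intro g f)
      fun μ₂ ⟨⟨g₂, g₂'⟩, f₂⟩ => Run.seq ((Run.exact rfl).withFrame rfl fun _ g f => And.intro g f)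
      fun μ₃ ⟨g₃, f₃⟩ => Run.seq ((run_emit (S := S) (by decide) (by decide) ?_).withFrame rfl
        fun _ g f => And.intro g f) fun μ₄ ⟨⟨g₄, g₄'⟩, f₄⟩ => Run.simple rfl ?_).mono
      (t := _) ?_ fun _ => id
  · simp
    omega
  · intro l hl
    by_cases hli : l = i
    · have := hn i
      simp [g₁, v54, hface, hli]
      omega
    · simp [g₁, v54, hli, hdig l hl hli]
      exact (hx.2 ⟨l, hl⟩).trans_le (hn _)
  · exact (hS.of_frame f₁ rfl).1.of_frame f₂ rfl |>.1.of_frame f₃ rfl |>.1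
  · have w6 : ∀ l < k, l ≠ i → μ₁.arr 6 l = digit n x l := fun l hl hli => by
      simp [g₁, v54, hli, hdig l hl hli]
    have w6i : μ₁.arr 6 i = b := by simp [g₁, v54, hface]
    have hsize : ∀ l : Fin k, μ₁.arr 6 l < (C l).size := by
      intro l
      by_cases hli : l = i
      · rw [hli, w6i]; exact hb
      · rw [w6 l l.2 fun e => hli (Fin.ext e)]
        exact hx.2 l
    have hnode : IsNode C n (μ₂.var 53) := ⟨g₂, fun l => by rw [g₂' l l.2]; exact hsize l⟩
    have hcell : cellOf num n (μ₂.var 53) = fun l => num l (μ₁.arr 6 l) :=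
      funext fun l => by rw [cellOf, g₂' l l.2]
    obtain ⟨z, hz, hz', -, hval⟩ := hO _ hsize
    have hmin : IsMinVal f (realizeCell (cellOf num n (μ₂.var 53))) (O (μ₁.arr 6) (k * d)) := by
      rw [hcell]
      exact ⟨z, hz, hz', hval.symm⟩
    have w50 : μ₃.var 50 = x := by
      rw [f₃.var 50 (by decide), f₂.var 50 (by decide), f₁.var 50 (by decide), v50]
    have w53 : μ₃.var 53 = μ₂.var 53 := f₃.var 53 (by decide)
    have w4 : μ₃.var 4 = k * d := by
      rw [f₃.var 4 (by decide), f₂.var 4 (by decide), f₁.var 4 (by decide), h.var_four]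
    have wr : μ₃.real 4 = O (μ₁.arr 6) := by
      rw [← f₂.arr 6 (by decide)]
      simp [g₃]
    rw [w50, w53, w4, wr] at g₄
    have hset : S ∪ {e | FaceArc C num f n x i b e} =
        insert (μ₂.var 53, x, O (μ₁.arr 6) (k * d)) S := by
      rw [Set.union_comm, Set.insert_eq]
      congr 1
      ext ⟨u, v, w⟩
      simp only [Set.mem_ofPred_eq, Set.mem_singleton_iff, Prod.mk.injEq, FaceArc]
      constructor
      · rintro ⟨rfl, hu, hb', -, hj, hw⟩
        have : u = μ₂.var 53 := eq_of_digit_eq hu.1 g₂ fun l hl => by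
          rw [g₂' l hl]
          by_cases hli : l = i
          · rw [hli, w6i, hb']
          · rw [w6 l hl hli]
            exact hj ⟨l, hl⟩ fun e => hli (by rw [← e])
        subst this
        exact ⟨rfl, rfl, hw.unique hmin⟩
      · rintro ⟨rfl, rfl, rfl⟩
        refine ⟨rfl, hnode, ?_, hbx, fun j hj => ?_, hmin⟩
        · rw [g₂' i i.2, w6i]
        · rw [g₂' j j.2, w6 j j.2 fun e => hj (Fin.ext e)]
    rw [hset]
    refine ⟨?_, fun l hl hli => ?_, g₄.congr (by simp) (by simp) (by simp) (by simp), ?_⟩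
    · have : μ₄.var 57 = μ.var 57 := by
        rw [f₄.var 57 (by decide), f₃.var 57 (by decide), f₂.var 57 (by decide),
          f₁.var 57 (by decide)]
      simp [this]
    · have : μ₄.arr 6 = μ₁.arr 6 := by
        rw [f₄.arr 6 (by decide), f₃.arr 6 (by decide), f₂.arr 6 (by decide)]
      simp [this, w6 l hl hli]
    · have : μ₃.var 23 = μ.var 23 := by
        rw [f₃.var 23 (by decide), f₂.var 23 (by decide), f₁.var 23 (by decide)]
      simp [g₄', this]

theorem run_componentArcs (k d : ℕ) : ∃ K, ∀ {O : Oracle}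
    (C : Fin k → GeoComplex d) (s t : Fin k → Pt d)
    (num : Fin k → ℕ → Finset (Pt d)) (n : ℕ) (f : (Fin k → Pt d) → ℝ),
    (∀ i, IsNumbering (C i) (num i)) → (∀ i, (C i).size ≤ n) → IsMinOracle C f num O →
    ∀ (i : Fin k) (x : ℕ) (S : Set (ℕ × ℕ × ℝ)) (μ : Mem), IsReady C s t num n μ →
    IsNode C n x → (∀ l < k, μ.arr 6 l = digit n x l) → μ.var 50 = x → μ.var 54 = i →
    HasArcs μ S →
    Run P O componentArcs μ K fun μ' => μ'.var 54 = i + 1 ∧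
      (∀ l < k, μ'.arr 6 l = digit n x l) ∧
      HasArcs μ' (S ∪ {e | ∃ b, FaceArc C num f n x i b e}) ∧
      μ'.var 23 ≤ μ.var 23 + 2 * 2 ^ (d + 1) := by
  obtain ⟨K, hK⟩ := run_faceStep (P := P) k d
  refine ⟨2 ^ (d + 1) * (K + 10) + 100, fun {O} C s t num n f hnum hn hO i x S μ h hx hdig v50 v54 hS
    => ?_⟩
  obtain ⟨a, ha⟩ : ∃ a, a = digit n x i := ⟨_, rfl⟩
  have hai : a < (C i).size := ha ▸ hx.2 i
  have w6 : μ.arr 6 i = a := by rw [hdig i i.2, ha]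
  obtain ⟨L, hL⟩ : ∃ L, L = μ.arr 5 (μ.arr 4 (μ.arr 3 i + a)) := ⟨_, rfl⟩
  have hL' : L ≤ 2 ^ (d + 1) := by
    rw [hL]; exact h.input.length_le hnum i hai
  have hbij := h.input.faces i a hai
  rw [← hL] at hbij
  refine (Run.seq ((Run.exact rfl).withFrame rfl fun _ g f => And.intro g f) fun μ₁ ⟨g₁, f₁⟩ =>
    Run.seq (Run.for_var (fun j μ' => μ'.var 57 = j ∧ HasDigits k n x i μ' ∧
      HasArcs μ' (S ∪ {e | ∃ j' < j,
        FaceArc C num f n x i (μ.arr 5 (μ.arr 4 (μ.arr 3 i + a) + 1 + j')) e}) ∧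
      μ'.var 23 = μ.var 23 + 2 * j) 57 (.var 56) L K rfl ?_ ?_ ?_ fun _ h f => And.intro h f)
      fun μ₂ ⟨⟨g1, g2, g3, g4⟩, f₂⟩ => Run.simple rfl ?_).mono (t := _) ?_ fun _ => id
  · simp [facesCmd]
    nlinarith
  · rintro j μ' hj ⟨h1, -⟩ f
    refine ⟨h1, ?_⟩
    simp [f.var 56 (by decide), g₁, facesCmd, v54, w6, hL]
  · rintro j μ' hj ⟨h1, h2, h3, h4⟩ f
    obtain ⟨hb, hb'⟩ := hbij.mapsTo (Set.mem_Iio.2 hj)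
    beta_reduce at hb hb'
    nth_rewrite 2 [ha] at hb'
    have w55 : μ'.var 55 = μ.arr 4 (μ.arr 3 i + a) := by
      simp [f.var 55 (by decide), g₁, facesCmd, v54, w6]
    have w5 : μ'.arr 5 = μ.arr 5 := (f.arr 5 (by decide)).trans (f₁.arr 5 (by decide))
    refine (hK C s t num n _ hn hO i _ x _ μ' (h.of_frame f₁ rfl |>.of_frame f rfl) hx hb hb' h2
      ?_ ?_ ?_ h3).imp ?_
    · rw [f.var 50 (by decide), f₁.var 50 (by decide), v50]
    · rw [f.var 54 (by decide), f₁.var 54 (by decide), v54]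
    · rw [h1, w55, w5]
    · rintro μ'' ⟨k1, k2, k3, k4⟩
      refine ⟨by rw [k1, h1], k2, ?_, by rw [k4, h4]; ring⟩
      convert k3 using 1
      rw [Set.union_assoc]
      congr 1
      ext e
      simp only [Set.mem_ofPred_eq, Set.mem_union, Nat.lt_succ_iff_lt_or_eq, or_and_right,
        exists_or, exists_eq_left]
  · refine ⟨by simp [g₁, facesCmd], fun l hl hli => ?_, ?_, ?_⟩
    · rw [f₁.arr 6 (by decide), hdig l hl]
    · simpa using (hS.of_frame f₁ rfl).1
    · rw [f₁.var 23 (by decide)]; rfl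
  · have x54 : μ₂.var 54 = i := by rw [f₂.var 54 (by decide), f₁.var 54 (by decide), v54]
    have x58 : μ₂.var 58 = a := by
      simp [f₂.var 58 (by decide), g₁, facesCmd, v54, w6]
    refine ⟨by simp [x54], fun l hl => ?_, ?_, ?_⟩
    · by_cases hli : l = i
      · subst hli
        simp [x54, x58, ha]
      · simp [x54, hli, g2 l hl hli]
    · refine HasArcs.congr (μ := μ₂) ?_ (by simp) (by simp) (by simp) (by simp)
      convert g3 using 1
      congr 1
      ext e
      constructor
      · rintro ⟨b, hb⟩
        obtain ⟨-, hb1, hb2, hb3, -⟩ := id hb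
        obtain ⟨j, hj, hj'⟩ := hbij.surjOn (show b ∈ {b | b < (C i).size ∧ num i b ⊂ num i a} from
          ⟨hb2 ▸ hb1.2 i, ha ▸ hb3⟩)
        refine ⟨j, hj, ?_⟩
        beta_reduce at hj'
        rwa [hj']
      · rintro ⟨j, -, hj⟩
        exact ⟨_, hj⟩
    · simp [g4]
      omega

/-- A query about a cell of vertices has only one possible answer, so it provides the coordinates of
the point `p` as well as the value `F p`. -/
theorem run_pointArcs (k d : ℕ) : ∃ K, ∀ {O : Oracle}
    (C : Fin k → GeoComplex d) (s t : Fin k → Pt d)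
    (num : Fin k → ℕ → Finset (Pt d)) (n : ℕ) (F : (Fin k → Pt d) → ℝ),
    (∀ i, IsNumbering (C i) (num i)) → IsMinOracle C F num O →
    ∀ (A u : ℕ) (p : Fin k → Pt d) (x : ℕ) (S : Set (ℕ × ℕ × ℝ)) (μ : Mem), A ∉ insideCmd.wa →
    u ∉ insideCmd.wv → u ≠ 23 → IsReady C s t num n μ → (∀ i : Fin k, μ.arr A i < (C i).size) →
    (∀ i : Fin k, num i (μ.arr A i) = {p i}) →
    IsNode C n x → (∀ l < k, μ.arr 6 l = digit n x l) → μ.var 50 = x → HasArcs μ S →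
    Run P O (pointArcs A u) μ K fun μ' => (∀ l < k, μ'.arr 6 l = digit n x l) ∧
      HasArcs μ' (S ∪ {e | p ∈ realizeCell (cellOf num n x) ∧ e = (μ.var u, x, F p)}) ∧
      μ'.var 23 ≤ μ.var 23 + 2 := by
  obtain ⟨K, hK⟩ := run_inside (P := P) k d
  refine ⟨K + 100, fun {O} C s t num n F hnum hO A u p x S μ hA hu hu' h hAs hAp hx hdig v50 hS => ?_⟩
  obtain ⟨hO1, hO2⟩ := hO.point hAs hAp
  have hcell : cellOf num n x = fun i : Fin k => num i (μ.arr 6 i) :=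
    funext fun l => by rw [cellOf, hdig l l.2]
  refine (Run.seq ((Run.exact rfl).withFrame rfl fun _ g f => And.intro g f) fun μ₁ ⟨g₁, f₁⟩ =>
    Run.seq ((hK C s t num n F hnum hO p μ₁ (h.of_frame f₁ rfl) ?_ ?_).withFrame rfl
    fun _ g f => And.intro g f) fun μ₂ ⟨⟨g₂, g₂'⟩, f₂⟩ => Run.ite (t := 50) (fun hc => ?_)
    fun hc => ?_).mono (t := _) ?_ fun _ => id
  · simp
    omega
  · intro l
    rw [f₁.arr 6 (by simp [Cmd.wa]), hdig l l.2]
    exact hx.2 l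
  · intro i c
    simp [g₁, hO1]
  all_goals
    have e6 : μ₁.arr 6 = μ.arr 6 := f₁.arr 6 (by simp [Cmd.wa])
    rw [e6, ← hcell] at g₂
    have hS₂ := (hS.of_frame f₁ rfl).1.of_frame f₂ rfl
    rw [f₁.var 23 (by simp [Cmd.wv])] at hS₂
  · have hc : p ∈ realizeCell (cellOf num n x) := by
      rw [← g₂]
      simp at hc
      omega
    have wA : μ₂.arr A = μ.arr A := by rw [f₂.arr A hA]; simp [g₁]
    have wu : μ₂.var u = μ.var u := by rw [f₂.var u hu]; simp [g₁]
    have w50 : μ₂.var 50 = x := by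
      rw [f₂.var 50 (by decide), f₁.var 50 (by simp [Cmd.wv]), v50]
    have w4 : μ₂.var 4 = k * d := by
      rw [f₂.var 4 (by decide), f₁.var 4 (by simp [Cmd.wv]), h.var_four]
    refine (Run.seq ((Run.exact rfl).withFrame rfl fun _ g f => And.intro g f) fun μ₃ ⟨g₃, f₃⟩ =>
      (run_emit (S := S) hu' (by decide) ?_).withFrame rfl fun μ₄ g f => ?_).mono (t := _) ?_
        fun _ => id
    · simp
    · exact (hS₂.1.of_frame f₃ rfl).1
    · refine ⟨fun l hl => ?_, ?_, ?_⟩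
      · rw [f.arr 6 (by simp [Cmd.wa, emitCmd]),
          f₃.arr 6 (by simp [Cmd.wa]), g₂', e6, hdig l hl]
      · convert g.1 using 1
        rw [Set.union_comm, Set.insert_eq]
        congr 1
        ext e
        have e1 : μ₃.real 4 (μ₃.var 4) = F p := by simp [g₃, w4, wA, hO2]
        have e2 : μ₃.var u = μ.var u := by simp [g₃, wu]
        have e3 : μ₃.var 50 = x := by simp [g₃, w50]
        simp only [Set.mem_ofPred_eq, hc, true_and, Set.mem_singleton_iff, e1, e2, e3]
      · rw [g.2, f₃.var 23 (by simp [Cmd.wv]), hS₂.2]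
  · have hc : p ∉ realizeCell (cellOf num n x) := by
      rw [← g₂]
      intro e
      simp [e] at hc
    refine (Run.simple rfl ⟨fun l hl => ?_, ?_, ?_⟩).mono (by simp) fun _ => id
    · simp [g₂', e6, hdig l hl]
    · simpa [hc] using hS₂.1
    · simp [hS₂.2]

/-- Each of the `k` components contributes at most `2 ^ (d + 1)` faces, and each of the two points
at most one arc; every arc is stored with its reverse. -/
theorem run_cellStep (k d : ℕ) : ∃ K, ∀ {O : Oracle} (C : Fin k → GeoComplex d) (s t : Fin k → Pt d)
    (num : Fin k → ℕ → Finset (Pt d)) (n : ℕ) (F : (Fin k → Pt d) → ℝ),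
    (∀ i, IsNumbering (C i) (num i)) → (∀ i, (C i).size ≤ n) → IsMinOracle C F num O →
    ∀ (x : ℕ) (S : Set (ℕ × ℕ × ℝ)) (μ : Mem), IsReady C s t num n μ → x < n ^ k →
    μ.var 50 = x → μ.var 70 = n ^ k + 1 → HasArcs μ S →
    Run P O cellStep μ K fun μ' => μ'.var 50 = x + 1 ∧
      HasArcs μ' (S ∪ {e | e.2.1 = x ∧ CellArc C s t num F n e.1 e.2.1 e.2.2}) ∧
      μ'.var 23 ≤ μ.var 23 + (k * (2 * 2 ^ (d + 1)) + 4) := by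
  obtain ⟨K₁, h₁⟩ := run_decode (P := P) k
  obtain ⟨K₂, h₂⟩ := run_componentArcs (P := P) k d
  obtain ⟨K₃, h₃⟩ := run_pointArcs (P := P) k d
  refine ⟨K₁ + k * (K₂ + 10) + 2 * K₃ + 100, fun {O} C s t num n F hnum hn hO x S μ h hx v50 v70 hS
    => ?_⟩
  refine (Run.seq ((h₁ μ h (by rw [v50]; exact hx)).withFrame rfl fun _ g f => And.intro g f)
    fun μ₁ ⟨⟨g₁, g₁'⟩, f₁⟩ => Run.seq (Q := fun μ' => μ'.var 50 = x ∧
      HasArcs μ' (S ∪ {e | e.2.1 = x ∧ CellArc C s t num F n e.1 e.2.1 e.2.2}) ∧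
      μ'.var 23 ≤ μ.var 23 + (k * (2 * 2 ^ (d + 1)) + 4))
      (Run.ite (t := 10 + (k * (K₂ + 10) + 20 + (K₃ + K₃))) (fun hc => ?_) fun hc => ?_)
      fun μ₂ g₂ => Run.simple rfl ?_).mono (t := _) ?_ fun _ => id
  all_goals try rw [v50] at g₁ g₁'
  · have hnode : IsNode C n x := by
      rw [← g₁']
      simp at hc
      omega
    have r₁ := h.of_frame f₁ rfl
    obtain ⟨hS₁, hM₁⟩ := hS.of_frame f₁ rfl
    refine (Run.seq ((Run.exact rfl).withFrame rfl fun _ g f => And.intro g f) fun μ₂ ⟨g₂, f₂⟩ =>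
      Run.seq (Run.for_var (fun j μ' => μ'.var 54 = j ∧ (∀ l < k, μ'.arr 6 l = digit n x l) ∧
        HasArcs μ' (S ∪ {e | ∃ i : Fin k, (i : ℕ) < j ∧ ∃ b, FaceArc C num F n x i b e}) ∧
        μ'.var 23 ≤ μ.var 23 + j * (2 * 2 ^ (d + 1))) 54 (.var 0) k K₂ rfl ?_ ?_ ?_
        fun _ h f => And.intro h f) fun μ₃ ⟨⟨g1, g2, g3, g4⟩, f₃⟩ =>
      Run.seq ((h₃ C s t num n F hnum hO 1 3 s x _ μ₃ (by decide) (by decide) (by decide)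
        ((r₁.of_frame f₂ (by rfl)).of_frame f₃ (by rfl)) ?_ ?_ hnode g2 ?_ g3).withFrame rfl
        fun _ g f => And.intro g f) fun μ₄ ⟨⟨k1, k2, k3⟩, f₄⟩ =>
      (h₃ C s t num n F hnum hO 2 70 t x _ μ₄ (by decide) (by decide) (by decide)
        (((r₁.of_frame f₂ (by rfl)).of_frame f₃ (by rfl)).of_frame f₄ (by rfl)) ?_ ?_ hnode k1 ?_ k2).withFrame
        rfl fun μ₅ g₅ f₅ => ?_).mono (t := _) ?_ fun _ => id
    · simp
      nlinarith
    · rintro j μ' hj ⟨l1, -⟩ f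
      exact ⟨l1, (r₁.of_frame f₂ rfl |>.of_frame f rfl).input.var_zero⟩
    · rintro j μ' hj ⟨l1, l2, l3, l4⟩ f
      refine (h₂ C s t num n F hnum hn hO ⟨j, hj⟩ x _ μ' (r₁.of_frame f₂ rfl |>.of_frame f rfl)
        hnode l2 ?_ l1 l3).imp ?_
      · rw [f.var 50 (by decide), f₂.var 50 (by decide), f₁.var 50 (by decide), v50]
      · rintro μ'' ⟨m1, m2, m3, m4⟩
        refine ⟨m1, m2, ?_, by rw [Nat.add_mul]; omega⟩
        convert m3 using 1
        rw [Set.union_assoc]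
        congr 1
        ext e
        simp only [Set.mem_ofPred_eq, Set.mem_union]
        constructor
        · rintro ⟨i, hi, he⟩
          rcases Nat.lt_succ_iff_lt_or_eq.1 hi with hi | hi
          · exact Or.inl ⟨i, hi, he⟩
          · obtain rfl : i = ⟨j, hj⟩ := Fin.ext hi
            exact Or.inr he
        · rintro (⟨i, hi, he⟩ | he)
          · exact ⟨i, by omega, he⟩
          · exact ⟨⟨j, hj⟩, Nat.lt_succ_self j, he⟩
    · refine ⟨by simp [g₂], fun l hl => by simp [g₂, g₁ l hl], ?_, ?_⟩
      · simpa using (hS₁.of_frame f₂ rfl).1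
      · rw [f₂.var 23 (by decide), hM₁]
        omega
    · exact fun i => (r₁.of_frame f₂ rfl |>.of_frame f₃ rfl).input.start_lt i
    · exact fun i => (r₁.of_frame f₂ rfl |>.of_frame f₃ rfl).input.start i
    · rw [f₃.var 50 (by decide), f₂.var 50 (by decide), f₁.var 50 (by decide), v50]
    · exact fun i => (r₁.of_frame f₂ rfl |>.of_frame f₃ rfl |>.of_frame f₄ rfl).input.end_lt i
    · exact fun i => (r₁.of_frame f₂ rfl |>.of_frame f₃ rfl |>.of_frame f₄ rfl).input.ends i
    · rw [f₄.var 50 (by decide), f₃.var 50 (by decide), f₂.var 50 (by decide),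
        f₁.var 50 (by decide), v50]
    · refine ⟨?_, ?_, ?_⟩
      · rw [f₅.var 50 (by decide), f₄.var 50 (by decide), f₃.var 50 (by decide),
          f₂.var 50 (by decide), f₁.var 50 (by decide), v50]
      · convert g₅.2.1 using 1
        rw [Set.union_assoc, Set.union_assoc]
        congr 1
        ext e
        have e3 : μ₃.var 3 = n ^ k := (r₁.of_frame f₂ rfl |>.of_frame f₃ rfl).var_three
        have e70 : μ₄.var 70 = n ^ k + 1 := by
          rw [f₄.var 70 (by decide), f₃.var 70 (by decide), f₂.var 70 (by decide),
            f₁.var 70 (by decide), v70]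
        simp only [Set.mem_ofPred_eq, Set.mem_union, cellArc_iff hnode, e3, e70, Fin.is_lt,
          true_and]
      · have := g₅.2.2
        omega
  · have hnode : ¬ IsNode C n x := by
      rw [← g₁']
      intro e
      simp [e] at hc
    obtain ⟨hS₁, hM₁⟩ := hS.of_frame f₁ rfl
    refine (Run.simple rfl ⟨?_, ?_, ?_⟩).mono (by simp; omega) fun _ => id
    · simp [f₁.var 50 (by decide), v50]
    · have : {e : ℕ × ℕ × ℝ | e.2.1 = x ∧ CellArc C s t num F n e.1 e.2.1 e.2.2} = ∅ := by
        ext ⟨u, v, w⟩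
        simp only [Set.mem_ofPred_eq, Set.mem_empty_iff_false, iff_false, not_and]
        rintro rfl (⟨-, h, -⟩ | ⟨h, -⟩) <;> exact hnode h
      rw [this, Set.union_empty]
      exact hS₁
    · simp [hM₁]
  · exact ⟨by simp [g₂.1], g₂.2.1.congr (by simp) (by simp) (by simp) (by simp),
      by simpa using g₂.2.2⟩
  · simp
    omega

theorem run_cells (k d : ℕ) : ∃ K, ∀ {O : Oracle} (C : Fin k → GeoComplex d) (s t : Fin k → Pt d)
    (num : Fin k → ℕ → Finset (Pt d)) (n : ℕ) (F : (Fin k → Pt d) → ℝ),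
    (∀ i, IsNumbering (C i) (num i)) → (∀ i, (C i).size ≤ n) → IsMinOracle C F num O →
    ∀ (μ : Mem), IsReady C s t num n μ →
    Run P O cellsCmd μ (K * (n ^ k + 1)) fun μ' =>
      arcSet (μ'.var 23) (μ'.arr 10) (μ'.arr 11) (μ'.real 10) = cellArcs C s t num F n ∧
      μ'.var 23 ≤ K * n ^ k := by
  obtain ⟨K, hK⟩ := run_cellStep (P := P) k d
  refine ⟨K + k * (2 * 2 ^ (d + 1)) + 100, fun {O} C s t num n F hnum hn hO μ h => ?_⟩
  refine (Run.seq ((Run.exact rfl).withFrame rfl fun _ g f => And.intro g f) fun μ₁ ⟨g₁, f₁⟩ =>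
    Run.for_var (fun j μ' => μ'.var 50 = j ∧
      HasArcs μ' {e | e.2.1 < j ∧ CellArc C s t num F n e.1 e.2.1 e.2.2} ∧
      μ'.var 23 ≤ (k * (2 * 2 ^ (d + 1)) + 4) * j) 50 (.var 3) (n ^ k) K rfl ?_ ?_ ?_ ?_).mono
      (t := _) ?_ fun _ => id
  · generalize 2 * 2 ^ (d + 1) = y
    simp
    generalize n ^ k = N
    generalize k * y = z
    nlinarith [Nat.zero_le (z * N)]
  · rintro j μ' - ⟨h1, -⟩ f
    exact ⟨h1, (h.of_frame f₁ rfl |>.of_frame f rfl).var_three⟩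
  · rintro j μ' hj ⟨h1, h2, h3⟩ f
    refine (hK C s t num n F hnum hn hO j _ μ' (h.of_frame f₁ rfl |>.of_frame f rfl) hj h1 ?_
      h2).imp ?_
    · rw [f.var 70 (by decide)]
      simp [g₁, h.var_three]
    · rintro μ'' ⟨k1, k2, k3⟩
      refine ⟨k1, ?_, by rw [Nat.mul_add]; omega⟩
      convert k2 using 1
      ext e
      simp only [Set.mem_ofPred_eq, Set.mem_union, Nat.lt_succ_iff_lt_or_eq, or_and_right]
  · refine ⟨by simp [g₁], ?_, by simp [g₁]⟩
    simp [HasArcs, g₁, arcSet]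
  · rintro μ' ⟨-, h1, h2⟩ -
    refine ⟨h1.trans ?_, h2.trans (Nat.mul_le_mul_right _ (by omega))⟩
    -- Before reversal every arc leads to a cell, so the rounds for the numbers below `n ^ k`
    -- produce all of them.
    have : ∀ u v w, v < n ^ k ∧ CellArc C s t num F n u v w ↔ CellArc C s t num F n u v w :=
      fun u v w => and_iff_right_of_imp fun h => h.elim (fun h => h.2.1.lt) fun h => h.1.lt
    ext ⟨u, v, w⟩
    simp only [Set.mem_ofPred_eq, this, cellArcs]

end

/-! ## The output -/

open Cmd in
/-- Copies an arc. -/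
def loadStep : Cmd :=
  setArr 12 (.var 10) (.get 10 (.var 10)) ;; setArr 13 (.var 10) (.get 11 (.var 10)) ;;
  setReal 12 (.var 10) (.get 10 (.var 10)) ;; setVar 10 (.succ (.var 10))

open Cmd in
/-- Loads the graph for a bottleneck computation or a search. -/
def loadCmd : Cmd :=
  (setVar 20 (.var 23) ;; setVar 21 (.var 3) ;; setVar 22 (.succ (.var 3)) ;;
    setVar 10 (.const 0)) ;;
  loop (.lt (.var 10) (.var 23)) loadStep

open Cmd in
/-- Asks for the point of the node in the variable `71`. -/
def pointCmd : Cmd :=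
  ite (.lt (.var 71) (.var 3))
    (setVar 50 (.var 71) ;; decodeCmd ;; query 6 4)
    (ite (.le (.var 71) (.var 3)) (query 1 4) (query 2 4))

open Cmd in
/-- Copies a coordinate. -/
def copyStep : Cmd :=
  setReal 0 (.var 73) (.get 4 (.var 74)) ;; setVar 73 (.succ (.var 73)) ;;
  setVar 74 (.succ (.var 74))

open Cmd in
/-- Appends the point of the node in the variable `71` to the output. -/
def writeCmd : Cmd :=
  pointCmd ;; setVar 74 (.const 0) ;; loop (.lt (.var 74) (.var 4)) copyStep

open Cmd in
/-- Proceeds to the parent of the node. -/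
def pathStep : Cmd :=
  (setVar 71 (.get 17 (.var 71)) ;; setVar 72 (.succ (.var 72)) ;;
    setReal 7 (.const 6) (.add (.get 7 (.const 6)) (.const 1))) ;; writeCmd

open Cmd in
/-- Writes the points of the nodes of a path. -/
def pathCmd : Cmd :=
  (setVar 71 (.var 3) ;; setVar 72 (.const 0) ;; setVar 73 (.const 0) ;;
    setReal 7 (.const 6) (.const 0)) ;;
  writeCmd ;; loop (.lt (.var 71) (.var 22)) pathStep

open Cmd in
/-- Writes one time. -/
def timeStep : Cmd :=
  setReal 1 (.var 76) (.div (.get 7 (.const 5)) (.get 7 (.const 6))) ;;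
  setVar 76 (.succ (.var 76)) ;; setVar 74 (.succ (.var 74))

open Cmd in
/-- Writes the times of one point. -/
def timesStep : Cmd :=
  setVar 74 (.const 0) ;; loop (.lt (.var 74) (.var 0)) timeStep ;;
  (setVar 75 (.succ (.var 75)) ;;
    setReal 7 (.const 5) (.add (.get 7 (.const 5)) (.const 1)))

open Cmd in
/-- Writes the values of the reparameterizations. -/
def timesCmd : Cmd :=
  (setVar 75 (.const 0) ;; setVar 76 (.const 0) ;; setReal 7 (.const 5) (.const 0)) ;;
  loop (.lt (.var 75) (.succ (.var 72))) timesStep ;; setVar 0 (.var 72)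

/-- The pointers of a search lead from every node of the component of `t` to `t`. -/
theorem SearchResult.exists_path {M : ℕ} {F T : ℕ → ℕ} {D : ℕ → Prop} {t : ℕ} {C R Q : ℕ → ℕ}
    {m : ℕ} (h : SearchResult M F T D t C R Q m) {y : ℕ} (hy : C y = t + 1)
    (hv : ∃ j < m, Q j = y) :
    ∃ c < m, R^[c] y = t ∧ (∀ j < c, ArcRel M F T D (R^[j + 1] y) (R^[j] y)) ∧
      (∀ j, 0 < j → j ≤ c → R^[j] y ≠ y) ∧ ∀ j < c, R^[j] y ≠ t := by
  -- A parent stands earlier in the queue than its child. The positions along the chain of parents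
  -- thus decrease strictly, so it stops, and it can stop only at the root of the component.
  have key : ∀ r < m, C (Q r) = t + 1 → ∃ c ≤ r, R^[c] (Q r) = t ∧
      (∀ j < c, ArcRel M F T D (R^[j + 1] (Q r)) (R^[j] (Q r))) ∧
      (∀ j, 0 < j → j ≤ c → ∃ r' < r, R^[j] (Q r) = Q r') ∧ ∀ j < c, R^[j] (Q r) ≠ t := by
    intro r
    induction r using Nat.strong_induction_on with
    | _ r ih =>
      intro hr hC
      by_cases ht : Q r = t
      · exact ⟨0, Nat.zero_le _, ht, by simp, fun j h h' => by omega, by simp⟩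
      · rcases h.parent r hr with h' | ⟨r', hr', hR, hC', harc⟩
        · omega
        · obtain ⟨c, hc, h1, h2, h3, h4⟩ := ih r' hr' (hr'.trans hr) (hC' ▸ hC)
          have e : ∀ j, R^[j + 1] (Q r) = R^[j] (Q r') := fun j => by
            rw [Function.iterate_succ_apply, hR]
          refine ⟨c + 1, by omega, (e c).trans h1, fun j hj => ?_, fun j hj hj' => ?_,
            fun j hj => ?_⟩ <;> rcases j with _ | j
          · simpa [hR] using harc
          · rw [e, e]
            exact h2 j (by omega)
          · omega
          · rw [e]
            rcases j with _ | j
            · exact ⟨r', hr', rfl⟩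
            · obtain ⟨r'', h, h'⟩ := h3 (j + 1) (by omega) (by omega)
              exact ⟨r'', h.trans hr', h'⟩
          · exact ht
          · rw [e]
            exact h4 j (by omega)
  obtain ⟨r, hr, rfl⟩ := hv
  obtain ⟨c, hc, h1, h2, h3, h4⟩ := key r hr hy
  refine ⟨c, by omega, h1, h2, fun j hj hj' e => ?_, h4⟩
  obtain ⟨r', hr', e'⟩ := h3 j hj hj'
  have := h.inj r' (hr'.trans hr) r hr (e'.symm.trans e)
  omega

section

variable {k d : ℕ} {C : Fin k → GeoComplex d} {s t : Fin k → Pt d}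
  {num : Fin k → ℕ → Finset (Pt d)} {n : ℕ} {P : Program} {O : Oracle}

theorem run_load (μ : Mem) : Run P O loadCmd μ (40 * (μ.var 23 + 1)) fun μ' =>
    memArcs μ' = arcSet (μ.var 23) (μ.arr 10) (μ.arr 11) (μ.real 10) ∧ μ'.var 20 = μ.var 23 ∧
      μ'.var 21 = μ.var 3 ∧ μ'.var 22 = μ.var 3 + 1 := by
  refine (Run.seq (Run.exact rfl) fun μ₁ g₁ =>
    (Run.for_var (fun j μ' => μ'.var 10 = j ∧ μ'.var 23 = μ.var 23 ∧ μ'.var 20 = μ.var 23 ∧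
      μ'.var 21 = μ.var 3 ∧ μ'.var 22 = μ.var 3 + 1 ∧ μ'.arr 10 = μ.arr 10 ∧
      μ'.arr 11 = μ.arr 11 ∧ μ'.real 10 = μ.real 10 ∧ (∀ a < j, μ'.arr 12 a = μ.arr 10 a) ∧
      (∀ a < j, μ'.arr 13 a = μ.arr 11 a) ∧ ∀ a < j, μ'.real 12 a = μ.real 10 a)
      10 (.var 23) (μ.var 23) loadStep.ub rfl ?_ ?_ ?_ ?_)).mono (t := _) ?_ fun _ => id
  · rintro j μ' - ⟨h1, h2, -⟩ -
    exact ⟨h1, h2⟩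
  · rintro j μ' hj ⟨h1, h2, h3, h4, h5, h6, h7, h8, h9, h10, h11⟩ -
    refine Run.simple rfl ?_
    have key : ∀ a < j + 1, a ≠ j → a < j := fun a h h' => by omega
    refine ⟨by simp [loadStep, h1], by simp [loadStep, h2], by simp [loadStep, h3],
      by simp [loadStep, h4], by simp [loadStep, h5], by simp [loadStep, h6],
      by simp [loadStep, h7], by simp [loadStep, h8], ?_, ?_, ?_⟩ <;>
    · intro a ha
      by_cases e : a = j
      · simp [loadStep, h1, h6, h7, h8, e]
      · have := key a ha e
        simp [loadStep, h1, e, h9 a, h10 a, h11 a, this]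
  · simp [g₁]
  · rintro μ' ⟨h1, h2, h3, h4, h5, h6, h7, h8, h9, h10, h11⟩ -
    exact ⟨by rw [memArcs, h3]; exact arcSet_congr h9 h10 h11, h3, h4, h5⟩
  · simp [loadStep]
    omega

theorem coord_lt {i c : ℕ} (hi : i < k) (hc : c < d) : i * d + c < k * d := by
  have : (i + 1) * d ≤ k * d := Nat.mul_le_mul_right d hi
  rw [Nat.add_mul] at this
  omega

theorem run_point (k d : ℕ) : ∃ K, ∀ {O : Oracle} (C : Fin k → GeoComplex d) (s t : Fin k → Pt d)
    (num : Fin k → ℕ → Finset (Pt d)) (n : ℕ) (F : (Fin k → Pt d) → ℝ), IsMinOracle C F num O →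
    ∀ μ : Mem, IsReady C s t num n μ →
    (μ.var 71 = n ^ k ∨ μ.var 71 = n ^ k + 1 ∨ IsNode C n (μ.var 71)) →
    Run P O pointCmd μ K fun μ' => ∃ p, IsNodePoint C s t num F n (μ.var 71) p ∧
      ∀ (i : Fin k) (c : Fin d), μ'.real 4 (i * d + c) = p i c := by
  obtain ⟨K, hK⟩ := run_decode (P := P) k
  refine ⟨K + 20, fun {O} C s t num n F hO μ h hx => ?_⟩
  refine (Run.ite (t := K + 15) (fun hc => ?_) fun hc => ?_).mono (by simp; omega) fun _ => id
  · have hx : IsNode C n (μ.var 71) := by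
      simp [h.var_three] at hc
      rcases hx with e | e | e
      · omega
      · omega
      · exact e
    refine (Run.seq ((Run.exact rfl).withFrame rfl fun _ g f => And.intro g f) fun μ₁ ⟨g₁, f₁⟩ =>
      Run.seq (hK μ₁ (h.of_frame f₁ rfl) ?_) fun μ₂ ⟨g₂, _⟩ => Run.simple rfl ?_).mono (t := _)
      ?_ fun _ => id
    · simp
      omega
    · simp [g₁, hx.lt]
    · have e50 : μ₁.var 50 = μ.var 71 := by simp [g₁]
      rw [e50] at g₂
      obtain ⟨p, h1, h2, h3, -⟩ := hO (μ₂.arr 6) fun i => by rw [g₂ i i.2]; exact hx.2 i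
      have e : (fun i : Fin k => num i (μ₂.arr 6 i)) = cellOf num n (μ.var 71) :=
        funext fun i => by rw [g₂ i i.2, cellOf]
      rw [e] at h1 h2
      exact ⟨p, Or.inr (Or.inr ⟨hx, h1, h2⟩), fun i c => by simp [h3]⟩
  · simp only [Test.Holds, IExp.eval, h.var_three] at hc
    refine (Run.ite (t := 1) (fun hc' => Run.simple rfl ⟨s, Or.inl ⟨?_, rfl⟩, fun i c => ?_⟩)
      fun hc' => Run.simple rfl ⟨t, Or.inr (Or.inl ⟨?_, rfl⟩), fun i c => ?_⟩).mono (by simp)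
      fun _ => id
    · simp [h.var_three] at hc'
      omega
    · simp [(hO.point h.input.start_lt h.input.start).1]
    · simp [h.var_three] at hc'
      rcases hx with e | e | e
      · omega
      · exact e
      · have := e.lt
        omega
    · simp [(hO.point h.input.end_lt h.input.ends).1]

theorem run_write (k d : ℕ) : ∃ K, ∀ {O : Oracle} (C : Fin k → GeoComplex d) (s t : Fin k → Pt d)
    (num : Fin k → ℕ → Finset (Pt d)) (n : ℕ) (F : (Fin k → Pt d) → ℝ), IsMinOracle C F num O →
    ∀ μ : Mem, IsReady C s t num n μ →
    (μ.var 71 = n ^ k ∨ μ.var 71 = n ^ k + 1 ∨ IsNode C n (μ.var 71)) →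
    Run P O writeCmd μ K fun μ' => μ'.var 73 = μ.var 73 + k * d ∧
      (∀ a < μ.var 73, μ'.real 0 a = μ.real 0 a) ∧
      ∃ p, IsNodePoint C s t num F n (μ.var 71) p ∧
      ∀ (i : Fin k) (c : Fin d), μ'.real 0 (μ.var 73 + (i * d + c)) = p i c := by
  obtain ⟨K, hK⟩ := run_point (P := P) k d
  refine ⟨K + k * d * 40 + 20, fun {O} C s t num n F hO μ h hx => ?_⟩
  refine (Run.seq ((hK C s t num n F hO μ h hx).withFrame rfl fun _ g f => And.intro g f)
    fun μ₁ ⟨⟨p, hp, hp'⟩, f₁⟩ => Run.seq (Run.exact rfl) fun μ₂ g₂ =>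
    Run.for_var (fun j μ' => μ'.var 74 = j ∧ μ'.var 4 = k * d ∧ μ'.var 73 = μ.var 73 + j ∧
      μ'.real 4 = μ₁.real 4 ∧ (∀ a < μ.var 73, μ'.real 0 a = μ.real 0 a) ∧
      ∀ a < j, μ'.real 0 (μ.var 73 + a) = μ₁.real 4 a) 74 (.var 4) (k * d) copyStep.ub rfl
      ?_ ?_ ?_ ?_).mono (t := _) ?_ fun _ => id
  · rintro j μ' - ⟨h1, h2, -⟩ -
    exact ⟨h1, h2⟩
  · rintro j μ' hj ⟨h1, h2, h3, h4, h5, h6⟩ -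
    refine Run.simple rfl ⟨by simp [copyStep, h1], by simp [copyStep, h2],
      by simp [copyStep, h3]; omega, by simp [copyStep, h4], fun a ha => ?_, fun a ha => ?_⟩
    · have : a ≠ μ.var 73 + j := by omega
      simp [copyStep, h3, this, h5 a ha]
    · by_cases e : a = j
      · simp [copyStep, h3, e, h1, h4]
      · simp [copyStep, h3, e, h6 a (by omega)]
  · have e4 := (h.of_frame f₁ rfl).var_four
    have e73 := f₁.var 73 (by decide)
    have e0 := f₁.real 0 (by decide)
    simp [g₂, e4, e73, e0]
  · rintro μ' ⟨-, -, h3, -, h5, h6⟩ -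
    exact ⟨h3, h5, p, hp, fun i c => by rw [h6 _ (coord_lt i.2 c.2), hp']⟩
  · simp [copyStep]
    generalize k * d = x
    omega

/-- The points are written while following the parents. The length of the path is counted once as an
integer and once as a real, because integers cannot be converted to reals. -/
theorem run_path (k d : ℕ) : ∃ K, ∀ {O : Oracle} (C : Fin k → GeoComplex d) (s t : Fin k → Pt d)
    (num : Fin k → ℕ → Finset (Pt d)) (n : ℕ) (F : (Fin k → Pt d) → ℝ), IsMinOracle C F num O →
    ∀ (μ : Mem) (c : ℕ) (y : ℕ → ℕ), IsReady C s t num n μ → μ.var 22 = n ^ k + 1 →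
    y 0 = n ^ k → (∀ j < c, y (j + 1) = μ.arr 17 (y j)) → y c = n ^ k + 1 →
    (∀ j < c, y j = n ^ k ∨ IsNode C n (y j)) →
    Run P O pathCmd μ (K * (c + 1)) fun μ' => μ'.var 72 = c ∧ μ'.real 7 6 = c ∧ ∀ j ≤ c,
      IsNodePoint C s t num F n (y j)
        fun i => WithLp.toLp 2 fun a : Fin d => μ'.real 0 (j * (k * d) + (i * d + a)) := by
  obtain ⟨K, hK⟩ := run_write (P := P) k d
  refine ⟨K + 50, fun {O} C s t num n F hO μ c y h h22 hy0 hy hyc hnode => ?_⟩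
  set I : ℕ → Mem → Prop := fun j μ' => μ'.var 71 = y j ∧ μ'.var 72 = j ∧
      μ'.var 73 = (j + 1) * (k * d) ∧ μ'.var 22 = n ^ k + 1 ∧ μ'.arr 17 = μ.arr 17 ∧
      IsReady C s t num n μ' ∧ μ'.real 7 6 = j ∧ ∀ l ≤ j, IsNodePoint C s t num F n (y l)
        fun i => WithLp.toLp 2 fun a : Fin d => μ'.real 0 (l * (k * d) + (i * d + a)) with hI
  have hnode' : ∀ j ≤ c, y j = n ^ k ∨ y j = n ^ k + 1 ∨ IsNode C n (y j) := fun j hj => by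
    rcases hj.lt_or_eq with hj | rfl
    · exact (hnode j hj).imp_right Or.inr
    · exact Or.inr (Or.inl hyc)
  refine (Run.seq ((Run.exact rfl).withFrame rfl fun _ g f => And.intro g f) fun μ₁ ⟨g₁, f₁⟩ =>
    Run.seq ((hK C s t num n F hO μ₁ (h.of_frame f₁ rfl) ?_).withFrame rfl
      fun _ g f => And.intro g f) fun μ₂ ⟨⟨g1, _, p, hp, hp'⟩, f₂⟩ =>
    Run.for_range I (i := 0) (m := c) (t := K + 20) (Nat.zero_le _) ?_ ?_ ?_).mono (t := _) ?_ ?_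
  · simp
    nlinarith
  · rintro μ' ⟨-, h2, -, -, -, -, h7, h8⟩
    exact ⟨h2, h7, h8⟩
  · left
    simp [g₁, h.var_three]
  · rintro j μ' - hj ⟨h1, h2, h3, h4, h5, h6, h7, h8⟩
    refine ⟨?_, ?_⟩
    -- The node of `t` has the largest number of all nodes, so a smaller number means that the end
    -- is not yet reached.
    · simp only [Test.Holds, IExp.eval, h1, h4]
      rcases hnode j hj with e | e
      · omega
      · have := e.lt
        omega
    refine (Run.seq ((Run.exact rfl).withFrame rfl fun _ g f => And.intro g f) fun μ₁ ⟨g₁, f₁⟩ =>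
      ((hK C s t num n F hO μ₁ (h6.of_frame f₁ rfl) ?_).withFrame rfl
      fun μ₂ ⟨g1, g2, p, hp, hp'⟩ f₂ => ?_)).mono (t := _) ?_ fun _ => id
    · simp
      omega
    all_goals have e71 : μ₁.var 71 = y (j + 1) := by simp [g₁, h1, h5, hy j hj]
    · rw [e71]
      exact hnode' _ hj
    · have e73 : μ₁.var 73 = (j + 1) * (k * d) := by simp [g₁, h3]
      have e0 : μ₁.real 0 = μ'.real 0 := by simp [g₁]
      have e72 : μ₁.var 72 = j + 1 := by simp [g₁, h2]
      have e7 : μ₁.real 7 6 = j + 1 := by simp [g₁, h7]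
      rw [e71] at hp
      rw [e73] at g1 g2 hp'
      refine ⟨by rw [f₂.var 71 (by decide), e71], by rw [f₂.var 72 (by decide), e72],
        by rw [g1]; ring, by rw [f₂.var 22 (by decide), f₁.var 22 (by decide), h4],
        by rw [f₂.arr 17 (by decide), f₁.arr 17 (by decide), h5],
        (h6.of_frame f₁ rfl).of_frame f₂ rfl, by rw [f₂.real 7 (by decide), e7]; simp, ?_⟩
      intro l hl
      rcases hl.lt_or_eq with hl | rfl
      · have hl' : l ≤ j := by omega
        convert h8 l hl' using 2 with i
        ext a
        refine (g2 _ ?_).trans (by rw [e0])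
        have h1 := coord_lt i.2 a.2
        have h2 : (l + 1) * (k * d) ≤ (j + 1) * (k * d) := Nat.mul_le_mul_right _ hl
        rw [Nat.add_mul l] at h2
        omega
      · convert hp using 2 with i
        ext a
        exact hp' i a
  · rintro μ' ⟨h1, h2, h3, h4, -⟩
    simp [h1, h4, hyc]
  · have e71 : μ₁.var 71 = y 0 := by simp [g₁, h.var_three, hy0]
    have e73 : μ₁.var 73 = 0 := by simp [g₁]
    have e72 : μ₁.var 72 = 0 := by simp [g₁]
    have e7 : μ₁.real 7 6 = 0 := by simp [g₁]
    rw [e71] at hp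
    rw [e73] at g1 hp'
    refine ⟨by rw [f₂.var 71 (by decide), e71], by rw [f₂.var 72 (by decide), e72],
        by rw [g1]; ring, by rw [f₂.var 22 (by decide), f₁.var 22 (by decide), h22],
        by rw [f₂.arr 17 (by decide), f₁.arr 17 (by decide)],
        (h.of_frame f₁ rfl).of_frame f₂ rfl, by rw [f₂.real 7 (by decide), e7]; simp, ?_⟩
    intro l hl
    obtain rfl : l = 0 := by omega
    convert hp using 2 with i
    ext a
    simpa using hp' i a

/-- All reparameterizations are the identity, so the values `j / c` are written `k` times each; `j`
is also counted as a real. -/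
theorem run_times (k : ℕ) : ∃ K, ∀ {O : Oracle} (μ : Mem) (c : ℕ), μ.var 0 = k → μ.var 72 = c →
    μ.real 7 6 = c → Run P O timesCmd μ (K * (c + 1)) fun μ' => μ'.var 0 = c ∧
      ∀ j ≤ c, ∀ i < k, μ'.real 1 (j * k + i) = j / c := by
  refine ⟨k * 40 + 100, fun {O} μ c h0 h72 h7 => ?_⟩
  refine (Run.seq (Run.exact rfl) fun μ₁ g₁ => Run.seq
    (Run.for_var (fun j μ' => μ'.var 75 = j ∧ μ'.var 0 = k ∧ μ'.var 72 = c ∧ μ'.var 76 = j * k ∧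
      μ'.real 7 5 = j ∧ μ'.real 7 6 = c ∧ ∀ l < j, ∀ i < k, μ'.real 1 (l * k + i) = l / c)
      75 (.succ (.var 72)) (c + 1) (k * 30 + 40) rfl ?_ ?_ ?_ fun μ' h f => h)
      fun μ₂ ⟨_, _, g1, _, _, _, g2⟩ => Run.simple rfl ⟨?_, ?_⟩).mono (t := _) ?_ fun _ => id
  · rintro j μ' - ⟨h1, h2, h3, -⟩ -
    exact ⟨h1, by simp [h3]⟩
  · rintro j μ' hj ⟨h1, h2, h3, h4, h5, h6, h8⟩ -
    refine (Run.seq (Run.exact rfl) fun μ₁ g₁ => Run.seq (Run.for_var (fun i μ' =>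
      μ'.var 74 = i ∧ μ'.var 75 = j ∧ μ'.var 0 = k ∧ μ'.var 72 = c ∧ μ'.var 76 = j * k + i ∧
      μ'.real 7 5 = j ∧ μ'.real 7 6 = c ∧ (∀ l < j, ∀ i < k, μ'.real 1 (l * k + i) = l / c) ∧
      ∀ l < i, μ'.real 1 (j * k + l) = j / c) 74 (.var 0) k timeStep.ub rfl ?_ ?_ ?_
        fun μ' h f => h)
      fun μ₂ ⟨g1, g2, g3, g4, g5, g6, g7, g8, g9⟩ => Run.simple rfl ?_).mono (t := _) ?_
        fun _ => id
    · rintro i μ' - ⟨h1, -, h2, -⟩ -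
      exact ⟨h1, h2⟩
    · rintro i μ' hi ⟨h1, h2, h3, h4, h5, h6, h7, h8, h9⟩ -
      refine Run.simple rfl ⟨by simp [timeStep, h1], by simp [timeStep, h2],
        by simp [timeStep, h3], by simp [timeStep, h4], by simp [timeStep, h5]; omega,
        by simp [timeStep, h6], by simp [timeStep, h7], fun l hl i' hi' => ?_, fun l hl => ?_⟩
      · have := coord_lt hl hi'
        have : l * k + i' ≠ j * k + i := by omega
        simp [timeStep, h5, this, h8 l hl i' hi']
      · by_cases e : l = i
        · simp [timeStep, h5, h6, h7, e]
        · simp [timeStep, h5, e, h9 l (by omega)]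
    · simp [g₁, h1, h2, h3, h4, h5, h6]
      exact h8
    · refine ⟨by simp [g2], by simp [g3], by simp [g4], by simp [g5, Nat.add_mul], by simp [g6],
        by simp [g7], fun l hl i hi => ?_⟩
      rcases Nat.lt_succ_iff_lt_or_eq.1 hl with hl | rfl
      · simp [g8 l hl i hi]
      · simp [g9 i hi]
    · simp [timeStep]
      omega
  · simp [g₁, h0, h72, h7]
  · simp
    nlinarith
  · simp [g1]
  · intro j hj i hi
    simp [g2 j (by omega) i hi]

end

/-! ## The program -/

open Cmd in
/-- The main command. -/
def mainCmd : Cmd :=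
  initCmd ;; cellsCmd ;; loadCmd ;; bottleneckCmd ;; loadCmd ;; searchCmd lePivot ;; pathCmd ;;
  timesCmd

section

open Cmd

variable {k d : ℕ} {C : Fin k → GeoComplex d} {s t : Fin k → Pt d}
  {num : Fin k → ℕ → Finset (Pt d)} {f : (Fin k → Pt d) → ℝ} {n : ℕ} {P : Program} {O : Oracle}

theorem cellArcs_left {u v : ℕ} {w : ℝ} (h : (u, v, w) ∈ cellArcs C s t num f n) :
    u = n ^ k ∨ u = n ^ k + 1 ∨ IsNode C n u := by
  rcases h with (h | h) | (h | h)
  · exact Or.inr (Or.inr h.1)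
  · rcases h.2 with h | h
    · exact Or.inl h.1
    · exact Or.inr (Or.inl h.1)
  · exact Or.inr (Or.inr h.2.1)
  · exact Or.inr (Or.inr h.1)

/-- The memory holds a path in the graph from `s` to `t`, the bottleneck of which is minimal. -/
def HoldsPath (C : Fin k → GeoComplex d) (s t : Fin k → Pt d)
    (num : Fin k → ℕ → Finset (Pt d)) (f : (Fin k → Pt d) → ℝ) (n : ℕ) (μ : Mem) : Prop :=
  ∃ (B : ℝ) (y : ℕ → ℕ), IsBottleneck (cellArcs C s t num f n) (n ^ k) (n ^ k + 1) B ∧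
    y 0 = n ^ k ∧ y (μ.var 0) = n ^ k + 1 ∧
    (∀ j, 0 < j → j < μ.var 0 → y j ≠ n ^ k ∧ y j ≠ n ^ k + 1) ∧
    (∀ j < μ.var 0, ∃ w ≤ B, (y j, y (j + 1), w) ∈ cellArcs C s t num f n) ∧
    (∀ j ≤ μ.var 0, IsNodePoint C s t num f n (y j)
      fun i => WithLp.toLp 2 fun c : Fin d => μ.real 0 (j * (k * d) + (i * d + c))) ∧
    ∀ j ≤ μ.var 0, ∀ i < k, μ.real 1 (j * k + i) = j / μ.var 0

/-- The search starts at the node of `t`, so following parents from the node of `s` lists a path in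
the right direction. It returns to neither extra node, hence all inner nodes are cells. -/
theorem SearchResult.exists_nodes {M : ℕ} {F T : ℕ → ℕ} {W : ℕ → ℝ} {B : ℝ} {Z R Q : ℕ → ℕ}
    {m : ℕ} (h : SearchResult M F T (fun a => W a ∈ Set.Iic B) (n ^ k + 1) Z R Q m)
    (hS : arcSet M F T W = cellArcs C s t num f n)
    (hB : Conn (cellArcs C s t num f n) (Set.Iic B) (n ^ k) (n ^ k + 1)) :
    ∃ c < m, ∃ y : ℕ → ℕ, y 0 = n ^ k ∧ (∀ j, y (j + 1) = R (y j)) ∧ y c = n ^ k + 1 ∧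
      (∀ j < c, y j = n ^ k ∨ IsNode C n (y j)) ∧
      (∀ j, 0 < j → j < c → y j ≠ n ^ k ∧ y j ≠ n ^ k + 1) ∧
      ∀ j < c, ∃ w ≤ B, (y j, y (j + 1), w) ∈ cellArcs C s t num f n := by
  have hy : n ^ k = n ^ k + 1 ∨ ∃ a < M, F a = n ^ k := by
    rcases Relation.ReflTransGen.cases_head hB with e | ⟨v, ⟨w, -, hw⟩, -⟩
    · exact Or.inl e
    · rw [← hS] at hw
      obtain ⟨a, ha, e⟩ := hw
      simp only [Prod.mk.injEq] at e
      exact Or.inr ⟨a, ha, e.1.symm⟩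
  have hsymm : SymmArcs (arcSet M F T W) := hS ▸ symmArcs_cellArcs
  obtain ⟨c, hc, h1, h2, h3, h4⟩ := h.exists_path
    (((h.joined_iff hsymm hy).2 (hS ▸ hB)).trans h.root) (h.visited _ hy)
  have harc : ∀ j < c, ∃ w ≤ B, (R^[j] (n ^ k), R^[j + 1] (n ^ k), w) ∈
      cellArcs C s t num f n := fun j hj => by
    obtain ⟨w, hw, h⟩ := arcRel_iff.1 (h2 j hj)
    rw [hS] at h
    exact ⟨w, hw, symmArcs_cellArcs _ _ _ h⟩
  refine ⟨c, hc, fun j => R^[j] (n ^ k), rfl, fun j => Function.iterate_succ_apply' R j _, h1,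
    fun j hj => ?_, fun j hj hj' => ⟨h3 j hj hj'.le, h4 j hj'⟩, harc⟩
  obtain ⟨w, -, hw⟩ := harc j hj
  exact (cellArcs_left hw).imp_right fun h => h.resolve_left (h4 j hj)

theorem IsMinOracle.exists_isMinVal (hO : IsMinOracle C f num O)
    (hnum : ∀ i, IsNumbering (C i) (num i)) {Δ : Fin k → Finset (Pt d)} (hΔ : IsProductCell C Δ) :
    ∃ w, IsMinVal f (realizeCell Δ) w := by
  choose a ha ha' using fun i => (hnum i).surjOn (hΔ i)
  obtain ⟨x, h1, h2, -⟩ := hO (fun i => if h : i < k then a ⟨i, h⟩ else 0) fun i => by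
    simpa using ha i
  have : (fun i : Fin k => num i (if h : (i : ℕ) < k then a ⟨i, h⟩ else 0)) = Δ :=
    funext fun i => by simpa using ha' i
  rw [this] at h1 h2
  exact ⟨f x, x, h1, h2, rfl⟩

theorem run_solution (k d : ℕ) : ∃ K, ∀ {O : Oracle} (C : Fin k → GeoComplex d)
    (s t : Fin k → Pt d) (num : Fin k → ℕ → Finset (Pt d)) (n : ℕ) (F : (Fin k → Pt d) → ℝ),
    IsMinOracle C F num O → ∀ μ : Mem, IsReady C s t num n μ →
    memArcs μ = cellArcs C s t num F n → μ.var 22 = n ^ k + 1 →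
    IsBottleneck (cellArcs C s t num F n) (n ^ k) (n ^ k + 1) (μ.real 7 0) →
    Run P O (searchCmd lePivot ;; pathCmd ;; timesCmd) μ (K * (μ.var 20 + 1))
      (HoldsPath C s t num F n) := by
  obtain ⟨K₁, h₁⟩ := run_search (P := P) lePivot
  obtain ⟨K₂, h₂⟩ := run_path (P := P) k d
  obtain ⟨K₃, h₃⟩ := run_times (P := P) k
  refine ⟨K₁ + 2 * K₂ + 2 * K₃, fun {O} C s t num n F hO μ r hS h22 hB => ?_⟩
  obtain ⟨B, hBe⟩ : ∃ B, B = μ.real 7 0 := ⟨_, rfl⟩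
  rw [← hBe] at hB
  have hsymm : SymmArcs (memArcs μ) := hS ▸ symmArcs_cellArcs
  refine (Run.seq (t₂ := K₂ * (μ.var 20 + 2) + K₃ * (μ.var 20 + 2)) ((h₁ (O := O) μ _ (n ^ k + 1)
    _ _ (fun a => μ.real 12 a ∈ Set.Iic B) rfl h22 rfl rfl (hsymm.arcSymm _) ?_).withFrame rfl
      fun _ g f => And.intro g f) fun μ₁ ⟨⟨m, hm⟩, f₁⟩ => ?_).mono (t := _) ?_ fun _ => id
  · intro μ' hμ'
    simp [lePivot, hμ', hBe]
  · obtain ⟨c, hc, y, hy0, hy, hyc, hnode, hinj, harc⟩ := hm.exists_nodes hS hB.1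
    have hcM : c + 1 ≤ μ.var 20 + 2 := by
      have := hm.le
      omega
    have r₁ := r.of_frame f₁ (by rfl)
    refine (Run.seq ((h₂ C s t num n F hO μ₁ c y r₁ ((f₁.var 22 (by decide)).trans h22) hy0
      (fun j _ => hy j) hyc hnode).withFrame rfl fun _ g f => And.intro g f)
      fun μ₂ ⟨⟨g1, g2, g3⟩, f₂⟩ => (h₃ μ₂ c ?_ g1 g2).withFrame rfl
        fun μ₃ ⟨k1, k2⟩ f₃ => ?_).mono (t := _) ?_ fun _ => id
    · rw [f₂.var 0 (by decide), r₁.input.var_zero]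
    · exact add_le_add (Nat.mul_le_mul_left _ hcM) (Nat.mul_le_mul_left _ hcM)
    · subst k1
      exact ⟨B, y, hB, hy0, hyc, hinj, harc, by rw [f₃.real 0 (by decide)]; exact g3, k2⟩
  · generalize μ.var 20 = M
    nlinarith

/-- The bottleneck computation destroys its copy of the graph by deletions and contractions, so the
graph is loaded again before the search with the threshold `B`. Both searches use the pivot entry,
which now holds `B`. -/
theorem run_graph (k d : ℕ) : ∃ K, ∀ {O : Oracle} (C : Fin k → GeoComplex d)
    (s t : Fin k → Pt d) (num : Fin k → ℕ → Finset (Pt d)) (n : ℕ) (F : (Fin k → Pt d) → ℝ),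
    IsMinOracle C F num O → ∀ μ : Mem, IsReady C s t num n μ →
    arcSet (μ.var 23) (μ.arr 10) (μ.arr 11) (μ.real 10) = cellArcs C s t num F n →
    Conn (cellArcs C s t num F n) Set.univ (n ^ k) (n ^ k + 1) →
    Run P O (loadCmd ;; bottleneckCmd ;; loadCmd ;; searchCmd lePivot ;; pathCmd ;; timesCmd) μ
      (K * (μ.var 23 + 1)) (HoldsPath C s t num F n) := by
  obtain ⟨K₁, h₁⟩ := run_bottleneck (P := P)
  obtain ⟨K₂, h₂⟩ := run_solution (P := P) k d
  refine ⟨80 + K₁ + K₂, fun {O} C s t num n F hO μ r hS hconn => ?_⟩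
  refine (Run.seq (t₂ := K₁ * (μ.var 23 + 1) + (40 * (μ.var 23 + 1) + K₂ * (μ.var 23 + 1)))
    ((run_load μ).withFrame rfl fun _ g f => And.intro g f)
      fun μ₁ ⟨⟨a₁, b₁, c₁, d₁⟩, f₁⟩ => ?_).mono (t := _) ?_ fun _ => id
  · have r₁ := r.of_frame f₁ rfl
    rw [r.var_three] at c₁ d₁
    rw [hS] at a₁
    have hb := h₁ (O := O) μ₁ (a₁ ▸ symmArcs_cellArcs) (by omega) (by rw [a₁, c₁, d₁]; exact hconn)
    rw [a₁, b₁, c₁, d₁] at hb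
    refine Run.seq (hb.withFrame rfl fun _ g f => And.intro g f) fun μ₂ ⟨g₂, f₂⟩ => ?_
    have r₂ := r₁.of_frame f₂ rfl
    have e23 : μ₂.var 23 = μ.var 23 := (f₂.var 23 (by decide)).trans (f₁.var 23 (by decide))
    have hl := run_load (P := P) (O := O) μ₂
    rw [r₂.var_three, e23, (f₂.arr 10 (by decide)).trans (f₁.arr 10 (by decide)),
      (f₂.arr 11 (by decide)).trans (f₁.arr 11 (by decide)),
      (f₂.real 10 (by decide)).trans (f₁.real 10 (by decide)), hS] at hl
    refine Run.seq (hl.withFrame rfl fun _ g f => And.intro g f)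
      fun μ₃ ⟨⟨a₃, b₃, _, d₃⟩, f₃⟩ => ?_
    rw [← b₃]
    refine h₂ C s t num n F hO μ₃ (r₂.of_frame f₃ rfl) a₃ d₃ ?_
    rw [f₃.real 7 (by decide)]
    exact g₂
  · generalize μ.var 23 = M
    nlinarith

theorem run_main (k d : ℕ) (hk : 0 < k) : ∃ K, ∀ {O : Oracle} (C : Fin k → GeoComplex d)
    (s t : Fin k → Pt d) (num : Fin k → ℕ → Finset (Pt d)) (F : (Fin k → Pt d) → ℝ),
    (∀ i, (C i).IsVertex (s i)) → (∀ i, (C i).IsVertex (t i)) →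
    (∀ i, (C i).SameComponent (s i) (t i)) →
    (∀ i, IsNumbering (C i) (num i)) → IsMinOracle C F num O →
    ∀ μ : Mem, EncodesInput C s t num μ →
    Run P O mainCmd μ (K * (Finset.univ.sup fun i => (C i).size) ^ k)
      (HoldsPath C s t num F (Finset.univ.sup fun i => (C i).size)) := by
  obtain ⟨K₁, h₁⟩ := run_init (P := P) k d hk
  obtain ⟨K₂, h₂⟩ := run_cells (P := P) k d
  obtain ⟨K₃, h₃⟩ := run_graph (P := P) k d
  refine ⟨K₁ + 2 * K₂ + K₃ * (K₂ + 1), fun {O} C s t num F hs ht hst hnum hO μ hμ => ?_⟩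
  have hn : ∀ i, (C i).size ≤ Finset.univ.sup fun i => (C i).size := size_le_sup
  have hn0 : 1 ≤ Finset.univ.sup fun i => (C i).size := by
    have := hμ.start_lt ⟨0, hk⟩
    have := hn ⟨0, hk⟩
    omega
  have hmain := h₁ (O := O) C s t num μ hμ
  generalize (Finset.univ.sup fun i => (C i).size) = n at *
  have hN : 1 ≤ n ^ k := Nat.one_le_pow _ _ hn0
  refine (Run.seq hmain fun μ₁ r₁ =>
    Run.seq (t₂ := K₃ * (K₂ * n ^ k + 1)) ((h₂ C s t num n F hnum hn hO μ₁ r₁).withFrame rfl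
      fun _ g f => And.intro g f) fun μ₂ ⟨⟨gS, gM⟩, f₂⟩ =>
      (h₃ C s t num n F hO μ₂ (r₁.of_frame f₂ rfl) gS
        (conn_univ hnum hn (fun Δ hΔ => hO.exists_isMinVal hnum hΔ) hs ht hst)).mono
        (Nat.mul_le_mul_left _ (Nat.add_le_add_right gM 1)) fun _ => id).mono (t := _) ?_
      fun _ => id
  generalize n ^ k = N at *
  nlinarith

theorem isPolygonal_id {c : ℕ} (hc : 0 < c) {q : ℕ → ℝ} (hq : ∀ j ≤ c, q j = j / c) :
    IsPolygonal (fun u : unitInterval => (u : ℝ)) c q := by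
  refine ⟨hc, fun j hj u _ _ => ?_⟩
  have : (c : ℝ) ≠ 0 := by positivity
  rw [hq j hj.le, hq (j + 1) hj, AffineMap.lineMap_apply]
  simp only [vsub_eq_sub, vadd_eq_add, smul_eq_mul]
  push_cast
  field_simp
  ring

end

theorem mainTheorem2 :
    ∃ P : Program, ∀ k d : ℕ, 0 < k → ∃ K : ℕ,
      ∀ (C : Fin k → GeoComplex d) (s t : Fin k → Pt d),
        (∀ i, (C i).IsVertex (s i)) → (∀ i, (C i).IsVertex (t i)) →
        (∀ i, (C i).SameComponent (s i) (t i)) →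
      ∀ f : (Fin k → Pt d) → ℝ,
        (∀ Δ, IsProductCell C Δ → ConvexOn ℝ (realizeCell Δ) f) →
      ∀ num : Fin k → ℕ → Finset (Pt d), (∀ i, IsNumbering (C i) (num i)) →
      ∀ O : Oracle, IsMinOracle C f num O →
      ∀ μ : Mem, EncodesInput C s t num μ →
        ∃ (μ' : Mem) (T : ℕ),
          P.Runs O μ μ' T ∧
          T ≤ K * (Finset.univ.sup fun i => (C i).size) ^ k ∧
          ∃ (π : ∀ i, Path (s i) (t i)) (ρ : Fin k → Path (0 : unitInterval) 1),
            EncodesOutput μ' π ρ ∧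
            (∀ i, (C i).HasCurve (π i)) ∧
            (∀ i, Function.Injective (ρ i)) ∧
            ∃ u₀ : unitInterval,
              (∀ u, f (fun i => π i (ρ i u)) ≤ f (fun i => π i (ρ i u₀))) ∧
              ∀ (π' : ∀ i, Path (s i) (t i)) (ρ' : Fin k → Path (0 : unitInterval) 1),
                (∀ i, (C i).HasCurve (π' i)) →
                ∃ u, f (fun i => π i (ρ i u₀)) ≤ f (fun i => π' i (ρ' i u)) := by
  refine ⟨[mainCmd], fun k d hk => ?_⟩
  obtain ⟨K, hK⟩ := run_main (P := [mainCmd]) k d hk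
  refine ⟨K, fun C s t hs ht hst f hf num hnum O hO μ hμ => ?_⟩
  obtain ⟨μ', T, hrun, hT, B, y, hB, hy0, hyc, hinj, harc, hq, hρ⟩ :=
    hK (O := O) C s t num f hs ht hst hnum hO μ hμ
  obtain ⟨π, hπ, hcurve, u₀, hmax, hle⟩ := exists_curves hnum hf hy0 hyc hinj harc hq
  -- The polygons share their breakpoints in time, so the identity serves as every
  -- reparameterization.
  refine ⟨μ', T, hrun, hT, π, fun _ => ⟨⟨id, continuous_id⟩, rfl, rfl⟩,
    fun i => ⟨hπ i, isPolygonal_id (hπ i).1 fun j hj => hρ j hj i i.2⟩, hcurve,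
    fun i => Function.injective_id, u₀, hmax, fun π' ρ' hπ' => ?_⟩
  by_contra! hlt
  -- Curves that stay below the computed maximum, which is at most `B`, would join the extra nodes
  -- by arcs lighter than `B`.
  exact hB.2 (conn_of_curves hnum size_le_sup
    (fun Δ hΔ => hO.exists_isMinVal hnum hΔ) π' ρ' hπ' fun u => (hlt u).trans_le hle)
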